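/- Let $\mathbb K$ be a field of characteristic $p>0$. For a finite group $G$ let ${}_G\mathcal V$ be the category of finite-dimensional $\mathbb K[G]$-modules, and $\mathcal V={}_1\mathcal V$. For $M\in{}_G\mathcal V$ let $h_M=\mathrm{Hom}_G(M,-):{}_G\mathcal V\to\mathcal V$. A $\mathbb K$-linear functor $f:{}_G\mathcal V\to\mathcal V$ is *coherent* if there is an exact sequence $h_N\to h_M\to f\to 0$ with $M,N\in{}_G\mathcal V$. Let $\mathcal C(G)$ be the category of coherent functors, and $\mathcal C_n=\mathcal C(\mathfrak S_n)$. We view $\mathfrak S_m\times\mathfrak S_n\subseteq\mathfrak S_{m+n}$ and set $\mathrm{Ind}(f)=f\circ\mathrm{Res}$ for a linear functor $f$ on ${}_{\mathfrak S_m\times\mathfrak S_n}\mathcal V$; this sends coherent functors to coherent functors. For $M\in{}_{\mathfrak S_m}\mathcal V$, $N\in{}_{\mathfrak S_n}\mathcal V$ let $M\boxtimes N$ be their external tensor product over $\mathbb K$ and $M\otimes N\in{}_{\mathfrak S_{m+n}}\mathcal V$ the module induced from $M\boxtimes N$. For $f\in\mathcal C(G)$, $g\in\mathcal C(H)$ let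 $(f\odot g)(X)=f(g(\mathrm{Res}_{H}X))$, where $G$ acts on $g(\mathrm{Res}_HX)$ by functoriality, and for $f\in\mathcal C_m$, $g\in\mathcal C_n$ let $f\cdot g=\mathrm{Ind}(f\odot g)$. Let $\boxtimes_\ell:\mathcal C(G)\times\mathcal C(H)\to\mathcal C(G\times H)$ denote the bifunctor (unique up to isomorphism) that is right exact in each argument and satisfies $h_M\boxtimes_\ell h_N\cong h_{M\boxtimes N}$ naturally in $M$ and $N$, and let $f\otimes_\ell g=\mathrm{Ind}(f\boxtimes_\ell g)$, a bifunctor $\mathcal C_m\times\mathcal C_n\to\mathcal C_{m+n}$. Let $\Gamma^n\mathcal V$ be the category of finite-dimensional vector spaces with morphisms $V\to W$ the elements of $\Gamma^n(\mathrm{Hom}(V,W))=(\mathrm{Hom}(V,W)^{\otimes n})^{\mathfrak S_n}$, and let $\mathcal P_n$ be the category of homogeneous strict polynomial functors of degree $n$, that is, of $\mathbb K$-linear functors $\Gamma^n\mathcal V\to\mathcal V$. For $F\in\mathcal P_m$, $G\in\mathcal P_n$ let $F\otimes G\in\mathcal P_{m+n}$ be given by $(F\otimes G)(V)=F(V)\otimes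 G(V)$, where $\Gamma^{m+n}$ acts through $\Gamma^{m+n}\subseteq\Gamma^m\otimes\Gamma^n$. For a linear functor $f$ on ${}_{\mathfrak S_n}\mathcal V$ let $j^*(f)\in\mathcal P_n$ be given by $j^*(f)(V)=f(V^{\otimes n})$. **Theorem.** The bifunctors $\boxtimes_\ell:\mathcal C_m\times\mathcal C_n\to\mathcal C(\mathfrak S_m\times\mathfrak S_n)$ exist for all $m,n\ge0$, and $\otimes_\ell=\mathrm{Ind}(-\boxtimes_\ell-)$ has the following properties. 1. For all $M\in{}_{\mathfrak S_m}\mathcal V$ and $N\in{}_{\mathfrak S_n}\mathcal V$ there are isomorphisms $h_M\otimes_\ell h_N\cong h_{M\otimes N}\cong h_M\cdot h_N$, natural in $M$ and $N$. 2. For all $f\in\mathcal C_m$ and $g\in\mathcal C_n$ the functor $f\cdot g$ is coherent, and there is a morphism $f\otimes_\ell g\to f\cdot g$, natural in $f$ and $g$, which is an isomorphism when $g$ is projective in $\mathcal C_n$. 3. The bifunctors $\otimes_\ell$ equip the category $\bigoplus_{d\ge0}\mathcal C_d$ with a symmetric monoidal structure: there is one whose tensor product is biadditive and is given on the summands $\mathcal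 C_m$ and $\mathcal C_n$ by $\otimes_\ell:\mathcal C_m\times\mathcal C_n\to\mathcal C_{m+n}$, up to natural isomorphism. 4. The bifunctor $\otimes_\ell:\mathcal C_m\times\mathcal C_n\to\mathcal C_{m+n}$ is right exact in each argument and balanced: $f\otimes_\ell-$ is exact when $f$ is projective, and $-\otimes_\ell g$ is exact when $g$ is projective. 5. For $f\in\mathcal C_m$ and $g\in\mathcal C_n$ there are isomorphisms $j^*(f)\otimes j^*(g)\cong j^*(f\otimes_\ell g)\cong j^*(f\cdot g)$, natural in $f$ and $g$. 6. For each $n$ the functor $j^*$, from linear functors on ${}_{\mathfrak S_n}\mathcal V$ to $\mathcal P_n$, has a left adjoint $j_!$ with values in $\mathcal C_n$, and for $F\in\mathcal P_m$ and $G\in\mathcal P_n$ there is an isomorphism $j_!(F)\otimes_\ell j_!(G)\cong j_!(F\otimes G)$, natural in $F$ and $G$. -/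

import Mathlib

open CategoryTheory CategoryTheory.Limits
open scoped TensorProduct

universe u

namespace CoherentFunctors

noncomputable section

/-! ### Linear functors on finite-dimensional representations -/

/-- `K`-linear functors from finite-dimensional `K[G]`-modules to finite-dimensional
vector spaces. -/
def IsLinear (K : Type u) [Field K] {E : Type*} [Category E] [Preadditive E]
    [CategoryTheory.Linear K E] : ObjectProperty (E ⥤ FGModuleCat.{u} K) :=
  fun f => f.Additive ∧ f.Linear K

/-- The category of `K`-linear functors from finite-dimensional representations of `G` over `K`
to finite-dimensional vector spaces. -/
abbrev LinFun (K : Type u) [Field K] (G : Type) [Group G] :=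
  (IsLinear K (E := FDRep.{u} K G)).FullSubcategory

variable (K : Type u) [Field K]

section Reps
variable {G H : Type} [Group G] [Group H]

/-- The functor `Hom_G(M, -)`, without its linearity. -/
def homFunctor (M : FDRep.{u} K G) : FDRep.{u} K G ⥤ FGModuleCat.{u} K where
  obj X := FGModuleCat.of K (M ⟶ X)
  map f := FGModuleCat.ofHom (CategoryTheory.Linear.rightComp K M f)

variable (G) in
/-- The contravariant functor `M ↦ h_M = Hom_G(M, -)`. -/
def hLin : (FDRep.{u} K G)ᵒᵖ ⥤ LinFun K G where
  obj M := ⟨homFunctor K M.unop,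
    ⟨fun {X Y f g} => by ext (x : M.unop ⟶ X); exact Preadditive.comp_add _ _ _ x f g⟩,
    ⟨fun {X Y} f r => by ext (x : M.unop ⟶ X); exact CategoryTheory.Linear.comp_smul _ _ _ x r f⟩⟩
  map {M N} a := ObjectProperty.homMk
    { app := fun X => FGModuleCat.ofHom (CategoryTheory.Linear.leftComp K X a.unop)
      naturality := fun X Y f => by
        ext (x : M.unop ⟶ X); exact (Category.assoc a.unop x f).symm }
  map_id M := by
    ext X (x : M.unop ⟶ X); exact Category.id_comp x
  map_comp {L M N} a b := by
    ext X (x : L.unop ⟶ X); exact Category.assoc b.unop a.unop x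

/-- A linear functor `f` is coherent if there is an exact sequence `h_N → h_M → f → 0`. Exactness
in the abelian category of linear functors is pointwise. -/
def IsCoherent : ObjectProperty (LinFun K G) := fun f =>
  ∃ (N M : FDRep.{u} K G) (a : (hLin K G).obj (.op N) ⟶ (hLin K G).obj (.op M))
    (q : (hLin K G).obj (.op M) ⟶ f), ∀ X : FDRep.{u} K G,
      Function.Exact (a.hom.app X).hom.hom (q.hom.app X).hom.hom ∧
      Function.Surjective (q.hom.app X).hom.hom

variable (G) in
/-- The category of coherent functors. -/
abbrev Coh := (IsCoherent K (G := G)).FullSubcategory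

variable (G) in
/-- The inclusion of coherent functors into linear functors. -/
abbrev Coh.incl : Coh K G ⥤ LinFun K G := ObjectProperty.ι _

/-- Representable functors are coherent. -/
lemma isCoherent_h (M : (FDRep.{u} K G)ᵒᵖ) : IsCoherent K ((hLin K G).obj M) :=
  ⟨M.unop, M.unop, 0, 𝟙 _, fun X => ⟨fun x => by
    constructor
    · intro h; exact ⟨0, h.symm⟩
    · rintro ⟨y, rfl⟩; rfl, fun x => ⟨x, rfl⟩⟩⟩

variable (G) in
/-- The contravariant functor `M ↦ h_M` with values in coherent functors. -/
def hFun : (FDRep.{u} K G)ᵒᵖ ⥤ Coh K G :=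
  ObjectProperty.lift _ (hLin K G) (isCoherent_h K)

/-- Restriction of representations along a group homomorphism. -/
abbrev resRep (φ : H →* G) : FDRep.{u} K G ⥤ FDRep.{u} K H := Action.res _ φ

/-- Precomposition of linear functors with restriction along `φ : H → G`:
the functor `g ↦ g ∘ Res`, from linear functors on `H`-modules to
linear functors on `G`-modules. -/
def indLin (φ : H →* G) : LinFun K H ⥤ LinFun K G where
  obj f := ⟨resRep K φ ⋙ f.obj,
    haveI := f.property.1; haveI := f.property.2; ⟨inferInstance, inferInstance⟩⟩
  map t := ObjectProperty.homMk (Functor.whiskerLeft (resRep K φ) t.hom)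

instance [Finite G] (φ : H →* G) (V : FDRep.{u} K H) :
    Module.Finite K (Representation.IndV φ V.ρ) := by
  unfold Representation.IndV Representation.Coinvariants
  have : Module.Finite K (MonoidAlgebra K G) :=
    Module.Finite.equiv (MonoidAlgebra.coeffLinearEquiv K).symm
  have : Module.Finite K (MonoidAlgebra K G ⊗[K] V.V) := Module.Finite.tensorProduct K _ _
  exact Module.Finite.quotient K _

/-- Induction of finite-dimensional representations along `φ : H → G`, with `G` finite:
`K[G] ⊗_{K[H]} -`. -/
def indRep [Finite G] (φ : H →* G) : FDRep.{u} K H ⥤ FDRep.{u} K G where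
  obj V := FDRep.of (Representation.ind φ V.ρ)
  map {V W} f :=
    { hom := FGModuleCat.ofHom (Representation.Coinvariants.map _ _
        ⟨f.hom.hom.hom.lTensor (MonoidAlgebra K G), fun g => by
          have e : f.hom.hom.hom ∘ₗ V.ρ g = W.ρ g ∘ₗ f.hom.hom.hom :=
            congrArg (fun t => t.hom.hom) (f.comm g)
          simp [LinearMap.lTensor_comp_map, e, LinearMap.map_comp_lTensor]⟩)
      comm := fun g => by
        ext : 1
        apply Representation.IndV.hom_ext
        intro k
        ext x
        rfl }
  map_id V := by
    ext : 2
    apply Representation.IndV.hom_ext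
    intro k
    ext x
    rfl
  map_comp f g := by 
    ext : 2
    apply Representation.IndV.hom_ext
    intro k
    ext x
    rfl

/-- Frobenius reciprocity for finite-dimensional representations. -/
def frobenius [Finite G] (φ : H →* G) (N : FDRep.{u} K H) (X : FDRep.{u} K G) :
    ((indRep K φ).obj N ⟶ X) ≃ₗ[K] (N ⟶ (resRep K φ).obj X) :=
  (FDRep.forget₂HomLinearEquiv ((indRep K φ).obj N) X).symm ≪≫ₗ
    (Rep.indResHomEquiv.{u} φ ((forget₂ (FDRep K H) (Rep K H)).obj N)
      ((forget₂ (FDRep K G) (Rep K G)).obj X)) ≪≫ₗ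
    FDRep.forget₂HomLinearEquiv N ((resRep K φ).obj X)

lemma frobenius_comp [Finite G] (φ : H →* G) (N : FDRep.{u} K H) {X Y : FDRep.{u} K G}
    (a : (indRep K φ).obj N ⟶ X) (f : X ⟶ Y) :
    frobenius K φ N Y (a ≫ f) = frobenius K φ N X a ≫ (resRep K φ).map f := rfl

/-- `h_N ∘ Res ≅ h_{Ind N}`. -/
def indLinH [Finite G] (φ : H →* G) (N : FDRep.{u} K H) :
    (hLin K G).obj (.op ((indRep K φ).obj N)) ≅ (indLin K φ).obj ((hLin K H).obj (.op N)) :=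
  ObjectProperty.isoMk _ (NatIso.ofComponents
    (fun X => (frobenius K φ N X).toFGModuleCatIso)
    (fun {X Y} f => by
      ext (a : (indRep K φ).obj N ⟶ X)
      exact frobenius_comp K φ N a f))

lemma isCoherent_indLin [Finite G] (φ : H →* G) (f : LinFun K H) (hf : IsCoherent K f) :
    IsCoherent K ((indLin K φ).obj f) := by
  obtain ⟨N, M, a, q, hq⟩ := hf
  refine ⟨_, _, (indLinH K φ N).hom ≫ (indLin K φ).map a ≫ (indLinH K φ M).inv,
    (indLinH K φ M).hom ≫ (indLin K φ).map q, fun X => ⟨?_, ?_⟩⟩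
  · intro y
    refine ((hq ((resRep K φ).obj X)).1 (frobenius K φ M X y)).trans ⟨?_, ?_⟩
    · rintro ⟨z, hz⟩
      refine ⟨(frobenius K φ N X).symm z, ?_⟩
      exact (LinearEquiv.symm_apply_eq _).mpr ((congrArg (a.hom.app _).hom.hom
        ((frobenius K φ N X).apply_symm_apply z)).trans hz)
    · rintro ⟨z, hz⟩
      exact ⟨frobenius K φ N X z, (LinearEquiv.symm_apply_eq (frobenius K φ M X)).mp hz⟩
  · exact (hq ((resRep K φ).obj X)).2.comp (frobenius K φ M X).surjective

/-- Induction of coherent functors along a homomorphism `φ : H → G` to a finite group: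
`g ↦ g ∘ Res`. -/
def indCoh [Finite G] (φ : H →* G) : Coh K H ⥤ Coh K G :=
  ObjectProperty.lift _ (Coh.incl K H ⋙ indLin K φ) fun f => isCoherent_indLin K φ _ f.property

/-! ### External products -/

variable (G H) in
/-- The external tensor product `M ⊠ N` of representations of `G` and `H`: the tensor product
over `K`, on which `G × H` acts factorwise. -/
def boxRep : FDRep.{u} K G ⥤ FDRep.{u} K H ⥤ FDRep.{u} K (G × H) :=
  resRep K (MonoidHom.fst G H) ⋙ MonoidalCategory.curriedTensor _ ⋙
    (Functor.whiskeringLeft _ _ _).obj (resRep K (MonoidHom.snd G H))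

variable (G H) in
/-- The bifunctor `(M, N) ↦ h_{M ⊠ N}`. -/
def hBox : (FDRep.{u} K G)ᵒᵖ ⥤ (FDRep.{u} K H)ᵒᵖ ⥤ Coh K (G × H) :=
  (boxRep K G H).op ⋙ Functor.opHom _ _ ⋙ (Functor.whiskeringRight _ _ _).obj (hFun K (G × H))

/-- For a representation `X` of `G × H` and `a ∈ G`, the action of `(a, 1)` as an endomorphism of
the restriction of `X` to `H`. -/
def actLeft (X : FDRep.{u} K (G × H)) (a : G) :
    (resRep K (MonoidHom.inr G H)).obj X ⟶ (resRep K (MonoidHom.inr G H)).obj X where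
  hom := Action.ρ X (a, 1)
  comm b := by
    change Action.ρ X (a, 1) * Action.ρ X (1, b) = Action.ρ X (1, b) * Action.ρ X (a, 1)
    simp only [← map_mul, Prod.mk_mul_mk, mul_one, one_mul]

variable (G) in
/-- For a linear functor `g` on representations of `H` and a representation `X` of `G × H`, the
vector space `g(Res X)` with the action of `G` by functoriality. -/
def evalRight (g : LinFun K H) : FDRep.{u} K (G × H) ⥤ FDRep.{u} K G where
  obj X :=
    { V := g.obj.obj ((resRep K (MonoidHom.inr G H)).obj X)
      ρ :=
        { toFun a := g.obj.map (actLeft K X a)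
          map_one' := by
            have : actLeft K X (1 : G) = 𝟙 _ := by
              ext : 1
              exact map_one (Action.ρ X)
            rw [this, CategoryTheory.Functor.map_id]; rfl
          map_mul' a b := by
            have : actLeft K X (a * b) = actLeft K X b ≫ actLeft K X a := by
              ext : 1
              change Action.ρ X (a * b, 1) = Action.ρ X (a, 1) * Action.ρ X (b, 1)
              simp only [← map_mul, Prod.mk_mul_mk, mul_one]
            rw [this, Functor.map_comp]; rfl } }
  map {X Y} f :=
    { hom := g.obj.map ((resRep K (MonoidHom.inr G H)).map f)
      comm := fun a => by
        change g.obj.map _ ≫ g.obj.map _ = g.obj.map _ ≫ g.obj.map _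
        rw [← Functor.map_comp, ← Functor.map_comp]
        congr 1
        ext : 1
        exact f.comm (a, 1) }
  map_id X := by
    ext : 1
    exact (congrArg _ ((resRep K (MonoidHom.inr G H)).map_id X)).trans (g.obj.map_id _)
  map_comp {X Y Z} f f' := by
    ext : 1
    exact (congrArg _ ((resRep K (MonoidHom.inr G H)).map_comp f f')).trans (g.obj.map_comp _ _)

lemma evalRight_map_add (g : LinFun K H) {X Y : FDRep.{u} K (G × H)} (f f' : X ⟶ Y) :
    (evalRight K G g).map (f + f') = (evalRight K G g).map f + (evalRight K G g).map f' := by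
  have := g.property.1
  ext : 1
  change g.obj.map ((resRep K (MonoidHom.inr G H)).map (f + f')) = _
  rw [Functor.map_add, Functor.map_add]; rfl

lemma evalRight_map_smul (g : LinFun K H) {X Y : FDRep.{u} K (G × H)} (r : K) (f : X ⟶ Y) :
    (evalRight K G g).map (r • f) = r • (evalRight K G g).map f := by
  have := g.property.2
  ext : 1
  change g.obj.map ((resRep K (MonoidHom.inr G H)).map (r • f)) = _
  rw [Functor.map_smul, Functor.map_smul]; rfl

/-- Naturality of `g(Res X)` in `g`. -/
def evalRightMap {g g' : LinFun K H} (t : g ⟶ g') : evalRight K G g ⟶ evalRight K G g' where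
  app X :=
    { hom := t.hom.app _
      comm := fun a => t.hom.naturality _ }
  naturality X Y f := by
    ext : 1
    exact t.hom.naturality _

variable (G H) in
/-- The product `(f ⊙ g)(X) = f(g(Res X))` of linear functors. -/
def odot : LinFun K G ⥤ LinFun K H ⥤ LinFun K (G × H) where
  obj f :=
    { obj := fun g => ⟨evalRight K G g ⋙ f.obj, by
        have h₁ := f.property.1
        have h₂ := f.property.2
        refine ⟨⟨fun {X Y a b} => ?_⟩, ⟨fun {X Y} a r => ?_⟩⟩
        · change f.obj.map ((evalRight K G g).map (a + b)) = _
          rw [evalRight_map_add, Functor.map_add]; rfl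
        · change f.obj.map ((evalRight K G g).map (r • a)) = _
          rw [evalRight_map_smul, Functor.map_smul]; rfl⟩
      map := fun t => ObjectProperty.homMk (Functor.whiskerRight (evalRightMap K t) f.obj)
      map_id := fun g => by
        ext X : 3
        exact f.obj.map_id _
      map_comp := fun s t => by
        ext X : 3
        exact f.obj.map_comp ((evalRightMap K s).app X) ((evalRightMap K t).app X) }
  map s :=
    { app := fun g => ObjectProperty.homMk (Functor.whiskerLeft (evalRight K G g) s.hom)
      naturality := fun g g' t => by
        ext X : 3
        exact s.hom.naturality _ }
  map_id f := by
    ext g X : 5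
    rfl
  map_comp s t := by
    ext g X : 5
    rfl

end Reps
/-! ### Divided powers and strict polynomial functors -/

/-- The symmetric group on `n` letters. -/
abbrev SymGp (n : ℕ) : Type := Equiv.Perm (Fin n)

section TensorPowers

variable {X Y Z W : Type u} [AddCommGroup X] [Module K X] [AddCommGroup Y] [Module K Y]
  [AddCommGroup Z] [Module K Z] [AddCommGroup W] [Module K W]

variable (X) in
/-- The action of the symmetric group on `X^{⊗ n}` by permutation of the factors. -/
def permAct (n : ℕ) : Representation K (SymGp n) (⨂[K]^n X) where
  toFun σ := (PiTensorProduct.reindex K (fun _ => X) σ).toLinearMap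
  map_one' := by
    ext v
    simp only [LinearMap.compMultilinearMap_apply, LinearEquiv.coe_coe,
      PiTensorProduct.reindex_tprod]
    rfl
  map_mul' σ τ := by
    ext v
    simp only [LinearMap.compMultilinearMap_apply, LinearEquiv.coe_coe, Module.End.mul_apply,
      PiTensorProduct.reindex_tprod]
    rfl

lemma permAct_tprod (n : ℕ) (σ : SymGp n) (v : Fin n → X) :
    permAct K X n σ (PiTensorProduct.tprod K v) = PiTensorProduct.tprod K (fun i => v (σ⁻¹ i)) :=
  PiTensorProduct.reindex_tprod _ _

variable (X) in
/-- The divided power `Γ^n(X) = (X^{⊗ n})^{S_n}`. -/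
def Gam (n : ℕ) : Submodule K (⨂[K]^n X) := (permAct K X n).invariants

/-- The factorwise application `(a₁ ⊗ ⋯ ⊗ aₙ, b₁ ⊗ ⋯ ⊗ bₙ) ↦ β(a₁,b₁) ⊗ ⋯ ⊗ β(aₙ,bₙ)` of a
bilinear map. -/
def powBil (n : ℕ) (β : X →ₗ[K] Y →ₗ[K] Z) : ⨂[K]^n X →ₗ[K] ⨂[K]^n Y →ₗ[K] ⨂[K]^n Z :=
  PiTensorProduct.map₂ fun _ => β

lemma powBil_tprod (n : ℕ) (β : X →ₗ[K] Y →ₗ[K] Z) (x : Fin n → X) (y : Fin n → Y) :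
    powBil K n β (PiTensorProduct.tprod K x) (PiTensorProduct.tprod K y) =
      PiTensorProduct.tprod K (fun i => β (x i) (y i)) :=
  PiTensorProduct.map₂_tprod_tprod _ _ _

/-- Induction principle: two linear maps on a tensor power agree if they do on pure tensors. -/
lemma powExt {n : ℕ} {f g : ⨂[K]^n X →ₗ[K] W}
    (e : ∀ x : Fin n → X, f (PiTensorProduct.tprod K x) = g (PiTensorProduct.tprod K x)) : f = g :=
  PiTensorProduct.ext (MultilinearMap.ext e)

lemma permAct_powBil (n : ℕ) (β : X →ₗ[K] Y →ₗ[K] Z) (σ : SymGp n) (a : ⨂[K]^n X) (b : ⨂[K]^n Y) :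
    permAct K Z n σ (powBil K n β a b) = powBil K n β (permAct K X n σ a) (permAct K Y n σ b) := by
  have e : (powBil K n β).compr₂ (permAct K Z n σ) =
      (powBil K n β).compl₁₂ (permAct K X n σ) (permAct K Y n σ) := by
    refine powExt K fun x => powExt K fun y => ?_
    simp only [LinearMap.compr₂_apply, LinearMap.compl₁₂_apply, powBil_tprod, permAct_tprod]
  exact LinearMap.congr_fun₂ e a b

/-- The restriction `Γ^n(X) × Γ^n(Y) → Γ^n(Z)` of `powBil`. -/
def gamBil (n : ℕ) (β : X →ₗ[K] Y →ₗ[K] Z) :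
    Gam K X n →ₗ[K] Gam K Y n →ₗ[K] Gam K Z n :=
  LinearMap.mk₂ K (fun a b => ⟨powBil K n β a b, fun σ => by
      rw [permAct_powBil, a.2 σ, b.2 σ]⟩)
    (fun _ _ _ => Subtype.ext (by simp)) (fun _ _ _ => Subtype.ext (by simp))
    (fun _ _ _ => Subtype.ext (by simp)) (fun _ _ _ => Subtype.ext (by simp))

lemma gamBil_coe (n : ℕ) (β : X →ₗ[K] Y →ₗ[K] Z) (a : Gam K X n) (b : Gam K Y n) :
    (gamBil K n β a b : ⨂[K]^n Z) = powBil K n β a b := rfl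

variable {K} in
/-- The element `x ⊗ ⋯ ⊗ x` of `Γ^n(X)`. -/
def gam (n : ℕ) (x : X) : Gam K X n :=
  ⟨PiTensorProduct.tprod K fun _ => x, fun σ => permAct_tprod K n σ _⟩

end TensorPowers

lemma powBil_gam_left {X Y : Type u} [AddCommGroup X] [Module K X] [AddCommGroup Y] [Module K Y]
    (n : ℕ) (β : X →ₗ[K] Y →ₗ[K] Y) (x : X) (hβ : ∀ y, β x y = y) (b : ⨂[K]^n Y) :
    powBil K n β (gam n x : Gam K X n).1 b = b := by
  have e : powBil K n β (gam n x : Gam K X n).1 = LinearMap.id := powExt K fun y => by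
    simp only [gam, powBil_tprod, hβ, LinearMap.id_apply]
  exact LinearMap.congr_fun e b

lemma powBil_gam_right {X Y : Type u} [AddCommGroup X] [Module K X] [AddCommGroup Y] [Module K Y]
    (n : ℕ) (β : Y →ₗ[K] X →ₗ[K] Y) (x : X) (hβ : ∀ y, β y x = y) (b : ⨂[K]^n Y) :
    powBil K n β b (gam n x : Gam K X n).1 = b := by
  have e : (powBil K n β).flip (gam n x : Gam K X n).1 = LinearMap.id := powExt K fun y => by
    simp only [gam, LinearMap.flip_apply, powBil_tprod, hβ, LinearMap.id_apply]
  exact LinearMap.congr_fun e b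

lemma powBil_assoc {A B C D E F : Type u} [AddCommGroup A] [Module K A] [AddCommGroup B]
    [Module K B] [AddCommGroup C] [Module K C] [AddCommGroup D] [Module K D] [AddCommGroup E]
    [Module K E] [AddCommGroup F] [Module K F] (n : ℕ)
    (β₁ : A →ₗ[K] D →ₗ[K] E) (β₂ : B →ₗ[K] C →ₗ[K] D) (β₃ : F →ₗ[K] C →ₗ[K] E)
    (β₄ : A →ₗ[K] B →ₗ[K] F) (hβ : ∀ a b c, β₁ a (β₂ b c) = β₃ (β₄ a b) c)
    (a : ⨂[K]^n A) (b : ⨂[K]^n B) (c : ⨂[K]^n C) :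
    powBil K n β₁ a (powBil K n β₂ b c) = powBil K n β₃ (powBil K n β₄ a b) c := by
  induction a using PiTensorProduct.induction_on with
  | add a a' ha ha' => simp only [map_add, LinearMap.add_apply, ha, ha']
  | smul_tprod r a =>
    induction b using PiTensorProduct.induction_on with
    | add b b' hb hb' => simp only [map_add, LinearMap.add_apply, hb, hb']
    | smul_tprod s b =>
      induction c using PiTensorProduct.induction_on with
      | add c c' hc hc' => simp only [map_add, hc, hc']
      | smul_tprod t c =>
        simp only [map_smul, LinearMap.smul_apply, powBil_tprod, hβ]

/-- The category `Γ^n 𝒱`: its objects are the finite-dimensional vector spaces, its morphisms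
`V ⟶ W` are the elements of `Γ^n(Hom(V, W))`. -/
structure GamCat (n : ℕ) where
  /-- the underlying finite-dimensional vector space -/
  space : FGModuleCat.{u} K

/-- The composition `Γ^n(Hom(V, W)) × Γ^n(Hom(U, V)) → Γ^n(Hom(U, W))`. -/
def gamComp (n : ℕ) (U V W : FGModuleCat.{u} K) :
    Gam K (V →ₗ[K] W) n →ₗ[K] Gam K (U →ₗ[K] V) n →ₗ[K] Gam K (U →ₗ[K] W) n :=
  gamBil K n (LinearMap.llcomp K U V W)

instance (n : ℕ) : Category.{u} (GamCat K n) where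
  Hom V W := Gam K (V.space →ₗ[K] W.space) n
  id V := gam n LinearMap.id
  comp {U V W} a b := gamComp K n U.space V.space W.space b a
  id_comp {V W} a := Subtype.ext (powBil_gam_right K n
    (LinearMap.llcomp K V.space V.space W.space) LinearMap.id (fun _ => rfl) a.1)
  comp_id {_ W} a := Subtype.ext (powBil_gam_left K n
    (LinearMap.llcomp K _ W.space W.space) LinearMap.id (fun _ => rfl) a.1)
  assoc {U V W Z} a b c := Subtype.ext (powBil_assoc K n
    (LinearMap.llcomp K U.space W.space Z.space) (LinearMap.llcomp K U.space V.space W.space)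
    (LinearMap.llcomp K U.space V.space Z.space) (LinearMap.llcomp K V.space W.space Z.space)
    (fun _ _ _ => rfl) c.1 b.1 a.1)

lemma gamComp_add_left (n : ℕ) (U V W : FGModuleCat.{u} K) (b b' : Gam K (V →ₗ[K] W) n)
    (a : Gam K (U →ₗ[K] V) n) :
    gamComp K n U V W (b + b') a = gamComp K n U V W b a + gamComp K n U V W b' a := by
  rw [map_add, LinearMap.add_apply]

lemma gamComp_add_right (n : ℕ) (U V W : FGModuleCat.{u} K) (b : Gam K (V →ₗ[K] W) n)
    (a a' : Gam K (U →ₗ[K] V) n) :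
    gamComp K n U V W b (a + a') = gamComp K n U V W b a + gamComp K n U V W b a' :=
  map_add _ _ _

lemma gamComp_smul_left (n : ℕ) (U V W : FGModuleCat.{u} K) (r : K) (b : Gam K (V →ₗ[K] W) n)
    (a : Gam K (U →ₗ[K] V) n) :
    gamComp K n U V W (r • b) a = r • gamComp K n U V W b a := by
  rw [map_smul, LinearMap.smul_apply]

lemma gamComp_smul_right (n : ℕ) (U V W : FGModuleCat.{u} K) (r : K) (b : Gam K (V →ₗ[K] W) n)
    (a : Gam K (U →ₗ[K] V) n) :
    gamComp K n U V W b (r • a) = r • gamComp K n U V W b a :=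
  map_smul _ _ _

instance (n : ℕ) : Preadditive (GamCat K n) where
  homGroup V W := inferInstanceAs (AddCommGroup (Gam K (V.space →ₗ[K] W.space) n))
  add_comp _ _ _ a a' b := gamComp_add_right K n _ _ _ b a a'
  comp_add _ _ _ a b b' := gamComp_add_left K n _ _ _ b b' a

instance (n : ℕ) : CategoryTheory.Linear K (GamCat K n) where
  homModule V W := inferInstanceAs (Module K (Gam K (V.space →ₗ[K] W.space) n))
  smul_comp _ _ _ r a b := gamComp_smul_right K n _ _ _ r b a
  comp_smul _ _ _ a r b := gamComp_smul_left K n _ _ _ r b a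

/-- The category of homogeneous strict polynomial functors of degree `n`. -/
abbrev Pol (n : ℕ) := (IsLinear K (E := GamCat K n)).FullSubcategory

/-- The functor `Γ^n 𝒱 ⥤ _{S_n}𝒱`, `V ↦ V^{⊗ n}`. A morphism, an element of `Hom(V, W)^{⊗ n}`,
acts through the canonical map `Hom(V, W)^{⊗ n} → Hom(V^{⊗ n}, W^{⊗ n})`. -/
def iFun (n : ℕ) : GamCat K n ⥤ FDRep.{u} K (SymGp n) where
  obj V := FDRep.of (permAct K V.space n)
  map {V W} a :=
    { hom := FGModuleCat.ofHom (powBil K n LinearMap.id a.1)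
      comm := fun σ => by
        apply FGModuleCat.hom_ext
        refine LinearMap.ext fun (x : ⨂[K]^n V.space) => ?_
        change powBil K n LinearMap.id a.1 (permAct K V.space n σ x) =
          permAct K W.space n σ (powBil K n LinearMap.id a.1 x)
        rw [permAct_powBil, a.2 σ] }
  map_id V := by
    apply Action.Hom.ext
    apply FGModuleCat.hom_ext
    refine LinearMap.ext fun (x : ⨂[K]^n V.space) => ?_
    exact powBil_gam_left K n LinearMap.id LinearMap.id (fun _ => rfl) x
  map_comp {U V W} a b := by
    apply Action.Hom.ext
    apply FGModuleCat.hom_ext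
    refine LinearMap.ext fun (x : ⨂[K]^n U.space) => ?_
    exact (powBil_assoc K n LinearMap.id LinearMap.id LinearMap.id
      (LinearMap.llcomp K U.space V.space W.space) (fun _ _ _ => rfl) b.1 a.1 x).symm

instance (n : ℕ) : (iFun K n).Additive where
  map_add {V W a b} := by
    apply Action.Hom.ext
    apply FGModuleCat.hom_ext
    refine LinearMap.ext fun (x : ⨂[K]^n V.space) => ?_
    exact LinearMap.map_add₂ (powBil K n LinearMap.id) a.1 b.1 x

instance (n : ℕ) : (iFun K n).Linear K where
  map_smul {V W} a r := by
    apply Action.Hom.ext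
    apply FGModuleCat.hom_ext
    refine LinearMap.ext fun (x : ⨂[K]^n V.space) => ?_
    exact LinearMap.map_smul₂ (powBil K n LinearMap.id) r a.1 x

/-- The functor `j^* : f ↦ (V ↦ f(V^{⊗ n}))` from linear functors on representations of `S_n`
to strict polynomial functors. -/
def jLin (n : ℕ) : LinFun K (SymGp n) ⥤ Pol K n where
  obj f := ⟨iFun K n ⋙ f.obj,
    have := f.property.1; have := f.property.2; ⟨inferInstance, inferInstance⟩⟩
  map t := ObjectProperty.homMk (Functor.whiskerLeft (iFun K n) t.hom)

/-- The functor `j^*` on coherent functors. -/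
def jCoh (n : ℕ) : Coh K (SymGp n) ⥤ Pol K n := Coh.incl K (SymGp n) ⋙ jLin K n

/-! ### The tensor product of strict polynomial functors -/

/-- The Young embedding `S_m × S_n → S_{m+n}`. -/
def young (m n : ℕ) : SymGp m × SymGp n →* SymGp (m + n) :=
  finSumFinEquiv.permCongrHom.toMonoidHom.comp (Equiv.Perm.sumCongrHom (Fin m) (Fin n))

section Split

lemma range_of_invariant_right {K : Type*} [Field K] {A B H : Type*} [AddCommGroup A] [Module K A]
    [AddCommGroup B] [Module K B] [Group H] (ρ : Representation K H B) (y : A ⊗[K] B)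
    (hy : ∀ g, (ρ g).lTensor A y = y) :
    y ∈ LinearMap.range (ρ.invariants.subtype.lTensor A) := by
  classical
  let b := Module.Basis.ofVectorSpace K A
  have nat : ∀ (g : H) (z : A ⊗[K] B) (i), TensorProduct.equivFinsuppOfBasisLeft b ((ρ g).lTensor A z) i =
      ρ g (TensorProduct.equivFinsuppOfBasisLeft b z i) := by
    intro g z i
    induction z with
    | zero => simp
    | add z z' hz hz' => simp only [map_add, Finsupp.add_apply, hz, hz']
    | tmul a c => simp
  rw [← (TensorProduct.equivFinsuppOfBasisLeft b).symm_apply_apply y,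
    TensorProduct.equivFinsuppOfBasisLeft_symm_apply]
  refine Submodule.sum_mem _ fun i _ => ?_
  refine ⟨b i ⊗ₜ ⟨TensorProduct.equivFinsuppOfBasisLeft b y i, fun g => ?_⟩, rfl⟩
  rw [← nat, hy]

lemma range_of_invariant_left {K : Type*} [Field K] {A B H : Type*} [AddCommGroup A] [Module K A]
    [AddCommGroup B] [Module K B] [Group H] (ρ : Representation K H A) (y : A ⊗[K] B)
    (hy : ∀ g, (ρ g).rTensor B y = y) :
    y ∈ LinearMap.range (ρ.invariants.subtype.rTensor B) := by
  obtain ⟨z, hz⟩ := range_of_invariant_right ρ (TensorProduct.comm K A B y) fun g => by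
    rw [← LinearMap.comm_comp_rTensor_comp_comm_eq]; simp [hy]
  refine ⟨TensorProduct.comm K _ _ z, ?_⟩
  rw [← LinearMap.comm_comp_lTensor_comp_comm_eq]
  simp [hz]

lemma range_of_invariant {K : Type*} [Field K] {A B G H : Type*} [AddCommGroup A] [Module K A]
    [AddCommGroup B] [Module K B] [Group G] [Group H] (ρ : Representation K G A)
    (ρ' : Representation K H B) (y : A ⊗[K] B) (hy : ∀ g, (ρ g).rTensor B y = y)
    (hy' : ∀ g, (ρ' g).lTensor A y = y) :
    y ∈ LinearMap.range (TensorProduct.map ρ.invariants.subtype ρ'.invariants.subtype) := by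
  obtain ⟨z, rfl⟩ := range_of_invariant_left ρ y hy
  obtain ⟨w, rfl⟩ := range_of_invariant_right ρ' z fun g => by
    apply Module.Flat.rTensor_preserves_injective_linearMap (M := B) _
      (Submodule.injective_subtype ρ.invariants)
    refine Eq.trans ?_ (hy' g)
    rw [← LinearMap.comp_apply, ← LinearMap.comp_apply, LinearMap.rTensor_comp_lTensor,
      LinearMap.lTensor_comp_rTensor]
  exact ⟨w, by rw [← LinearMap.comp_apply, LinearMap.rTensor_comp_lTensor]⟩

variable (X : Type u) [AddCommGroup X] [Module K X]

/-- The map `Γ^m(X) ⊗ Γ^n(X) → X^{⊗ (m + n)}` given by concatenation of tensors. -/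
def gamMul (m n : ℕ) : Gam K X m ⊗[K] Gam K X n →ₗ[K] ⨂[K]^(m + n) X :=
  TensorPower.mulEquiv.toLinearMap ∘ₗ TensorProduct.map (Gam K X m).subtype (Gam K X n).subtype

lemma gamMul_injective (m n : ℕ) : Function.Injective (gamMul K X m n) := by
  refine TensorPower.mulEquiv.injective.comp ?_
  exact TensorProduct.map_injective_of_flat_flat _ _ Subtype.val_injective Subtype.val_injective

variable {X} in
lemma mulEquiv_tprod {m n : ℕ} (a : Fin m → X) (b : Fin n → X) :
    TensorPower.mulEquiv (PiTensorProduct.tprod K a ⊗ₜ[K] PiTensorProduct.tprod K b) =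
      PiTensorProduct.tprod K (fun i => Sum.elim a b (finSumFinEquiv.symm i)) := by
  simp only [TensorPower.mulEquiv, LinearEquiv.trans_apply, PiTensorProduct.tmulEquiv_apply]
  exact PiTensorProduct.reindex_tprod _ _

variable {X} in
/-- Two linear maps on a product of tensor powers agree if they do on pure tensors. -/
lemma powExt₂ {Y W : Type u} [AddCommGroup Y] [Module K Y] [AddCommGroup W] [Module K W]
    {m n : ℕ} {f g : (⨂[K]^m X) ⊗[K] (⨂[K]^n Y) →ₗ[K] W}
    (e : ∀ (x : Fin m → X) (y : Fin n → Y),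
      f (PiTensorProduct.tprod K x ⊗ₜ PiTensorProduct.tprod K y) =
      g (PiTensorProduct.tprod K x ⊗ₜ PiTensorProduct.tprod K y)) : f = g :=
  TensorProduct.ext (powExt K fun x => powExt K fun y => e x y)

lemma permAct_young (m n : ℕ) (σ : SymGp m) (τ : SymGp n) (y : (⨂[K]^m X) ⊗[K] (⨂[K]^n X)) :
    permAct K X (m + n) (young m n (σ, τ)) (TensorPower.mulEquiv y) =
      TensorPower.mulEquiv (TensorProduct.map (permAct K X m σ) (permAct K X n τ) y) := by
  have e : permAct K X (m + n) (young m n (σ, τ)) ∘ₗ TensorPower.mulEquiv.toLinearMap =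
      TensorPower.mulEquiv.toLinearMap ∘ₗ
        TensorProduct.map (permAct K X m σ) (permAct K X n τ) := by
    refine powExt₂ K fun a b => ?_
    simp only [LinearMap.comp_apply, LinearEquiv.coe_coe, TensorProduct.map_tmul, permAct_tprod,
      mulEquiv_tprod]
    congr 1
    funext i
    obtain ⟨i, rfl⟩ := finSumFinEquiv.surjective i
    rw [← map_inv]
    simp only [young, MonoidHom.comp_apply, Equiv.symm_apply_apply]
    change Sum.elim a b (finSumFinEquiv.symm (finSumFinEquiv (Equiv.Perm.sumCongr σ⁻¹ τ⁻¹
      (finSumFinEquiv.symm (finSumFinEquiv i))))) = _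
    simp only [Equiv.symm_apply_apply]
    cases i <;> rfl
  exact LinearMap.congr_fun e y

lemma gam_le_range (m n : ℕ) : Gam K X (m + n) ≤ LinearMap.range (gamMul K X m n) := by
  intro x hx
  obtain ⟨y, rfl⟩ := TensorPower.mulEquiv.surjective x
  have key : ∀ σ τ, TensorProduct.map (permAct K X m σ) (permAct K X n τ) y = y := fun σ τ =>
    TensorPower.mulEquiv.injective (by rw [← permAct_young, hx])
  obtain ⟨z, hz⟩ := range_of_invariant (permAct K X m) (permAct K X n) y
    (fun σ => by simpa [LinearMap.rTensor, Module.End.one_eq_id] using key σ 1)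
    (fun τ => by simpa [LinearMap.lTensor, Module.End.one_eq_id] using key 1 τ)
  exact ⟨z, congrArg TensorPower.mulEquiv hz⟩

/-- The inclusion `Γ^{m+n}(X) ⊆ Γ^m(X) ⊗ Γ^n(X)` inside `X^{⊗ (m + n)}`. -/
def gamSplit (m n : ℕ) : Gam K X (m + n) →ₗ[K] Gam K X m ⊗[K] Gam K X n :=
  (LinearEquiv.ofInjective _ (gamMul_injective K X m n)).symm.toLinearMap ∘ₗ
    Submodule.inclusion (gam_le_range K X m n)

lemma gamMul_gamSplit (m n : ℕ) (a : Gam K X (m + n)) :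
    gamMul K X m n (gamSplit K X m n a) = a :=
  congrArg Subtype.val ((LinearEquiv.ofInjective _ (gamMul_injective K X m n)).apply_symm_apply
    (Submodule.inclusion (gam_le_range K X m n) a))

lemma gamSplit_unique (m n : ℕ) (a : Gam K X (m + n)) (z : Gam K X m ⊗[K] Gam K X n)
    (hz : gamMul K X m n z = a) : gamSplit K X m n a = z :=
  gamMul_injective K X m n ((gamMul_gamSplit K X m n a).trans hz.symm)

variable {X} in
lemma powBil_mulEquiv {Y Z : Type u} [AddCommGroup Y] [Module K Y] [AddCommGroup Z] [Module K Z]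
    (m n : ℕ) (β : X →ₗ[K] Y →ₗ[K] Z) (a : (⨂[K]^m X) ⊗[K] (⨂[K]^n X))
    (b : (⨂[K]^m Y) ⊗[K] (⨂[K]^n Y)) :
    powBil K (m + n) β (TensorPower.mulEquiv a) (TensorPower.mulEquiv b) =
      TensorPower.mulEquiv (TensorProduct.map₂ (powBil K m β) (powBil K n β) a b) := by
  have e : (powBil K (m + n) β).compl₁₂ TensorPower.mulEquiv.toLinearMap
        TensorPower.mulEquiv.toLinearMap =
      (TensorProduct.map₂ (powBil K m β) (powBil K n β)).compr₂
        TensorPower.mulEquiv.toLinearMap := by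
    refine powExt₂ K fun x x' => powExt₂ K fun y y' => ?_
    simp only [LinearMap.compl₁₂_apply, LinearMap.compr₂_apply, LinearEquiv.coe_coe,
      TensorProduct.map₂_apply_tmul, TensorProduct.map_tmul, mulEquiv_tprod, powBil_tprod]
    congr 1
    funext i
    obtain ⟨i, rfl⟩ := finSumFinEquiv.surjective i
    simp only [Equiv.symm_apply_apply]
    cases i <;> rfl
  exact LinearMap.congr_fun₂ e a b

variable {X} in
lemma gamMul_map₂ {Y Z : Type u} [AddCommGroup Y] [Module K Y] [AddCommGroup Z] [Module K Z]
    (m n : ℕ) (β : X →ₗ[K] Y →ₗ[K] Z) (a : Gam K X m ⊗[K] Gam K X n)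
    (b : Gam K Y m ⊗[K] Gam K Y n) :
    gamMul K Z m n (TensorProduct.map₂ (gamBil K m β) (gamBil K n β) a b) =
      powBil K (m + n) β (gamMul K X m n a) (gamMul K Y m n b) := by
  rw [gamMul, gamMul, gamMul, LinearMap.comp_apply, LinearMap.comp_apply, LinearMap.comp_apply]
  refine Eq.trans (congrArg _ ?_) (powBil_mulEquiv K m n β _ _).symm
  have e : (TensorProduct.map₂ (gamBil K m β) (gamBil K n β)).compr₂
        (TensorProduct.map (Gam K Z m).subtype (Gam K Z n).subtype) =
      (TensorProduct.map₂ (powBil K m β) (powBil K n β)).compl₁₂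
        (TensorProduct.map (Gam K X m).subtype (Gam K X n).subtype)
        (TensorProduct.map (Gam K Y m).subtype (Gam K Y n).subtype) := by
    refine TensorProduct.ext' fun x x' => TensorProduct.ext' fun y y' => ?_
    simp only [LinearMap.compl₁₂_apply, LinearMap.compr₂_apply, TensorProduct.map₂_apply_tmul,
      TensorProduct.map_tmul]
    rfl
  exact LinearMap.congr_fun₂ e a b

end Split

/-- The linear map `Γ^n(Hom(V, W)) → Hom(F(V), F(W))` of a strict polynomial functor. -/
def Pol.act {n : ℕ} (F : Pol K n) (V W : FGModuleCat.{u} K) :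
    Gam K (V →ₗ[K] W) n →ₗ[K] (F.obj.obj ⟨V⟩ →ₗ[K] F.obj.obj ⟨W⟩) where
  toFun a := (F.obj.map (show (⟨V⟩ : GamCat K n) ⟶ ⟨W⟩ from a)).hom.hom
  map_add' a b := by
    have := F.property.1
    exact congrArg (fun t => t.hom.hom)
      (F.obj.map_add (f := (show (⟨V⟩ : GamCat K n) ⟶ ⟨W⟩ from a))
        (g := (show (⟨V⟩ : GamCat K n) ⟶ ⟨W⟩ from b)))
  map_smul' r a := by
    have := F.property.2
    exact congrArg (fun t => t.hom.hom)
      (F.obj.map_smul r (show (⟨V⟩ : GamCat K n) ⟶ ⟨W⟩ from a))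

lemma Pol.act_id {n : ℕ} (F : Pol K n) (V : FGModuleCat.{u} K) :
    F.act K V V (gam n LinearMap.id) = LinearMap.id :=
  congrArg (fun t => t.hom.hom) (F.obj.map_id ⟨V⟩)

lemma Pol.act_comp {n : ℕ} (F : Pol K n) (U V W : FGModuleCat.{u} K)
    (b : Gam K (V →ₗ[K] W) n) (a : Gam K (U →ₗ[K] V) n) :
    F.act K U W (gamComp K n U V W b a) = F.act K V W b ∘ₗ F.act K U V a :=
  congrArg (fun t => t.hom.hom) (F.obj.map_comp
    (show (⟨U⟩ : GamCat K n) ⟶ ⟨V⟩ from a) (show (⟨V⟩ : GamCat K n) ⟶ ⟨W⟩ from b))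

lemma Pol.act_naturality {n : ℕ} {F F' : Pol K n} (t : F ⟶ F') (V W : FGModuleCat.{u} K)
    (a : Gam K (V →ₗ[K] W) n) :
    (t.hom.app ⟨W⟩).hom.hom ∘ₗ F.act K V W a = F'.act K V W a ∘ₗ (t.hom.app ⟨V⟩).hom.hom :=
  congrArg (fun t => t.hom.hom) (t.hom.naturality (show (⟨V⟩ : GamCat K n) ⟶ ⟨W⟩ from a))

section PolTensor
variable {m n : ℕ}

/-- The map `Γ^m(Hom(V, W)) ⊗ Γ^n(Hom(V, W)) → Hom(F(V) ⊗ G(V), F(W) ⊗ G(W))`. -/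
def tensAct (F : Pol K m) (G : Pol K n) (V W : FGModuleCat.{u} K) :
    Gam K (V →ₗ[K] W) m ⊗[K] Gam K (V →ₗ[K] W) n →ₗ[K]
      (F.obj.obj ⟨V⟩ ⊗[K] G.obj.obj ⟨V⟩ →ₗ[K] F.obj.obj ⟨W⟩ ⊗[K] G.obj.obj ⟨W⟩) :=
  TensorProduct.homTensorHomMap (RingHom.id K) _ _ _ _ ∘ₗ TensorProduct.map (F.act K V W) (G.act K V W)

lemma tensAct_tmul (F : Pol K m) (G : Pol K n) (V W : FGModuleCat.{u} K)
    (a : Gam K (V →ₗ[K] W) m) (b : Gam K (V →ₗ[K] W) n) :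
    tensAct K F G V W (a ⊗ₜ b) = TensorProduct.map (F.act K V W a) (G.act K V W b) := rfl

lemma tensAct_comp (F : Pol K m) (G : Pol K n) (U V W : FGModuleCat.{u} K)
    (b : Gam K (V →ₗ[K] W) m ⊗[K] Gam K (V →ₗ[K] W) n)
    (a : Gam K (U →ₗ[K] V) m ⊗[K] Gam K (U →ₗ[K] V) n) :
    tensAct K F G U W (TensorProduct.map₂ (gamComp K m U V W) (gamComp K n U V W) b a) =
      tensAct K F G V W b ∘ₗ tensAct K F G U V a := by
  have e : (TensorProduct.map₂ (gamComp K m U V W) (gamComp K n U V W)).compr₂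
        (tensAct K F G U W) =
      (LinearMap.llcomp K _ _ _).compl₁₂ (tensAct K F G V W) (tensAct K F G U V) := by
    refine TensorProduct.ext' fun x x' => TensorProduct.ext' fun y y' => ?_
    simp only [LinearMap.compl₁₂_apply, LinearMap.compr₂_apply, TensorProduct.map₂_apply_tmul,
      TensorProduct.map_tmul, tensAct_tmul, Pol.act_comp, TensorProduct.map_comp]
    rfl
  exact LinearMap.congr_fun₂ e b a

lemma gamSplit_id (m n : ℕ) (V : FGModuleCat.{u} K) :
    gamSplit K (V →ₗ[K] V) m n (gam (m + n) LinearMap.id) =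
      gam m LinearMap.id ⊗ₜ gam n LinearMap.id := by
  refine gamSplit_unique K _ m n _ _ ((mulEquiv_tprod K _ _).trans ?_)
  change PiTensorProduct.tprod K _ = PiTensorProduct.tprod K _
  congr 1
  funext i
  cases finSumFinEquiv.symm i <;> rfl

lemma gamSplit_comp (m n : ℕ) (U V W : FGModuleCat.{u} K) (b : Gam K (V →ₗ[K] W) (m + n))
    (a : Gam K (U →ₗ[K] V) (m + n)) :
    gamSplit K _ m n (gamComp K (m + n) U V W b a) =
      TensorProduct.map₂ (gamComp K m U V W) (gamComp K n U V W)
        (gamSplit K _ m n b) (gamSplit K _ m n a) := by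
  refine gamSplit_unique K _ m n _ _ ((gamMul_map₂ K m n _ _ _).trans ?_)
  rw [gamMul_gamSplit, gamMul_gamSplit]
  rfl

/-- The tensor product `(F ⊗ G)(V) = F(V) ⊗ G(V)` of strict polynomial functors. The morphisms
`Γ^{m+n}(Hom(V, W))` act through `Γ^{m+n} ⊆ Γ^m ⊗ Γ^n`. -/
def Pol.tensorObj (F : Pol K m) (G : Pol K n) : Pol K (m + n) where
  obj :=
    { obj := fun V => FGModuleCat.of K (F.obj.obj ⟨V.space⟩ ⊗[K] G.obj.obj ⟨V.space⟩)
      map := fun {V W} a => FGModuleCat.ofHom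
        (tensAct K F G V.space W.space (gamSplit K (V.space →ₗ[K] W.space) m n a))
      map_id := fun V => by
        apply FGModuleCat.hom_ext
        change tensAct K F G V.space V.space (gamSplit K _ m n (gam (m + n) LinearMap.id)) =
          LinearMap.id
        rw [gamSplit_id, tensAct_tmul, Pol.act_id, Pol.act_id, TensorProduct.map_id]
      map_comp := fun {U V W} a b => by
        apply FGModuleCat.hom_ext
        change tensAct K F G U.space W.space (gamSplit K _ m n
          (gamComp K (m + n) U.space V.space W.space b a)) = _
        rw [gamSplit_comp, tensAct_comp]
        rfl }
  property := by
    refine ⟨⟨fun {V W a b} => ?_⟩, ⟨fun {V W} a r => ?_⟩⟩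
    · apply FGModuleCat.hom_ext
      exact (tensAct K F G V.space W.space ∘ₗ
        gamSplit K (V.space →ₗ[K] W.space) m n).map_add a b
    · apply FGModuleCat.hom_ext
      exact (tensAct K F G V.space W.space ∘ₗ
        gamSplit K (V.space →ₗ[K] W.space) m n).map_smul r a

lemma tensAct_naturality {F F' : Pol K m} {G G' : Pol K n} (s : F ⟶ F') (t : G ⟶ G')
    (V W : FGModuleCat.{u} K) (a : Gam K (V →ₗ[K] W) m ⊗[K] Gam K (V →ₗ[K] W) n) :
    TensorProduct.map (s.hom.app ⟨W⟩).hom.hom (t.hom.app ⟨W⟩).hom.hom ∘ₗ tensAct K F G V W a =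
      tensAct K F' G' V W a ∘ₗ
        TensorProduct.map (s.hom.app ⟨V⟩).hom.hom (t.hom.app ⟨V⟩).hom.hom := by
  induction a with
  | zero => simp only [map_zero, LinearMap.comp_zero, LinearMap.zero_comp]
  | add a b ha hb => simp only [map_add, LinearMap.comp_add, LinearMap.add_comp, ha, hb]
  | tmul a b =>
    rw [tensAct_tmul, tensAct_tmul, ← TensorProduct.map_comp, ← TensorProduct.map_comp,
      Pol.act_naturality, Pol.act_naturality]

/-- Functoriality of the tensor product of strict polynomial functors. -/
def Pol.tensorMap {F F' : Pol K m} {G G' : Pol K n} (s : F ⟶ F') (t : G ⟶ G') :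
    Pol.tensorObj K F G ⟶ Pol.tensorObj K F' G' :=
  ObjectProperty.homMk
    { app := fun V => FGModuleCat.ofHom
        (TensorProduct.map (s.hom.app ⟨V.space⟩).hom.hom (t.hom.app ⟨V.space⟩).hom.hom)
      naturality := fun V W a => by
        apply FGModuleCat.hom_ext
        exact tensAct_naturality K s t V.space W.space _ }

variable (m n) in
/-- The bifunctor `⊗ : 𝒫_m × 𝒫_n → 𝒫_{m+n}`. -/
def Pol.tensor : Pol K m ⥤ Pol K n ⥤ Pol K (m + n) where
  obj F :=
    { obj := fun G => Pol.tensorObj K F G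
      map := fun t => Pol.tensorMap K (𝟙 F) t
      map_id := fun G => by
        ext V : 3
        apply FGModuleCat.hom_ext
        exact TensorProduct.map_id
      map_comp := fun s t => by
        ext V : 3
        apply FGModuleCat.hom_ext
        exact TensorProduct.map_comp LinearMap.id _ LinearMap.id _ }
  map s :=
    { app := fun G => Pol.tensorMap K s (𝟙 G)
      naturality := fun G G' t => by
        ext V : 3
        apply FGModuleCat.hom_ext
        change TensorProduct.map _ _ ∘ₗ TensorProduct.map _ _ =
          TensorProduct.map _ _ ∘ₗ TensorProduct.map _ _
        rw [← TensorProduct.map_comp, ← TensorProduct.map_comp]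
        rfl }
  map_id F := by
    ext G V : 5
    apply FGModuleCat.hom_ext
    exact TensorProduct.map_id
  map_comp s t := by
    ext G V : 5
    apply FGModuleCat.hom_ext
    exact TensorProduct.map_comp _ LinearMap.id _ LinearMap.id

end PolTensor

/-! ### Right exact and balanced bifunctors -/

/-- A bifunctor is right exact in each argument. -/
def IsRightExact₂ {𝒜 ℬ 𝒞 : Type*} [Category 𝒜] [Category ℬ] [Category 𝒞]
    (B : 𝒜 ⥤ ℬ ⥤ 𝒞) : Prop :=
  (∀ f, PreservesFiniteColimits (B.obj f)) ∧ (∀ g, PreservesFiniteColimits (B.flip.obj g))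

/-- A functor is exact. -/
def IsExact {𝒜 ℬ : Type*} [Category 𝒜] [Category ℬ] (F : 𝒜 ⥤ ℬ) : Prop :=
  PreservesFiniteLimits F ∧ PreservesFiniteColimits F

/-- A bifunctor, right exact in each argument, is balanced if it becomes exact in one argument
when a projective object is put in the other. -/
def IsBalanced {𝒜 ℬ 𝒞 : Type*} [Category 𝒜] [Category ℬ] [Category 𝒞]
    (B : 𝒜 ⥤ ℬ ⥤ 𝒞) : Prop :=
  (∀ f, Projective f → IsExact (B.obj f)) ∧ (∀ g, Projective g → IsExact (B.flip.obj g))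

/-! ### Tensor products of coherent functors -/

/-- `B` is the external tensor product `⊠_ℓ` of coherent functors: the bifunctor, unique up to
isomorphism, that is right exact in each argument and satisfies `h_M ⊠_ℓ h_N ≅ h_{M ⊠ N}`
naturally in `M` and `N`. -/
structure IsLeftExternalTensor {G H : Type} [Group G] [Group H]
    (B : Coh K G ⥤ Coh K H ⥤ Coh K (G × H)) : Prop where
  /-- right exactness in each argument -/
  rightExact : IsRightExact₂ B
  /-- the value on representable functors -/
  onRepresentables :
    Nonempty (hFun K G ⋙ B ⋙ (Functor.whiskeringLeft _ _ _).obj (hFun K H) ≅ hBox K G H)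

section Tensor
variable (m n : ℕ)

/-- The tensor product `M ⊗ N = Ind (M ⊠ N)` of representations of `S_m` and `S_n`. -/
def tensRep : FDRep.{u} K (SymGp m) ⥤ FDRep.{u} K (SymGp n) ⥤ FDRep.{u} K (SymGp (m + n)) :=
  boxRep K (SymGp m) (SymGp n) ⋙ (Functor.whiskeringRight _ _ _).obj (indRep K (young m n))

/-- The bifunctor `(M, N) ↦ h_{M ⊗ N}`. -/
def hTens : (FDRep.{u} K (SymGp m))ᵒᵖ ⥤ (FDRep.{u} K (SymGp n))ᵒᵖ ⥤ Coh K (SymGp (m + n)) :=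
  (tensRep K m n).op ⋙ Functor.opHom _ _ ⋙ (Functor.whiskeringRight _ _ _).obj (hFun K (SymGp (m + n)))

variable {m n} in
/-- The bifunctor `(f, g) ↦ Ind (B(f, g))`; for `B = ⊠_ℓ` it is `f ⊗_ℓ g`. -/
def indTensor (B : Coh K (SymGp m) ⥤ Coh K (SymGp n) ⥤ Coh K (SymGp m × SymGp n)) :
    Coh K (SymGp m) ⥤ Coh K (SymGp n) ⥤ Coh K (SymGp (m + n)) :=
  B ⋙ (Functor.whiskeringRight _ _ _).obj (indCoh K (young m n))

/-- The bifunctor `f · g = Ind (f ⊙ g)` on coherent functors, with values regarded as linear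
functors. -/
def dot : Coh K (SymGp m) ⥤ Coh K (SymGp n) ⥤ LinFun K (SymGp (m + n)) :=
  Coh.incl K (SymGp m) ⋙ odot K (SymGp m) (SymGp n) ⋙ (Functor.whiskeringLeft _ _ _).obj (Coh.incl K (SymGp n)) ⋙
    (Functor.whiskeringRight _ _ _).obj (indLin K (young m n))

end Tensor

/-! ### The direct sum of the categories of coherent functors -/

/-- Finitely supported families of objects. -/
def IsFinSupp : ObjectProperty (∀ d : ℕ, Coh K (SymGp d)) :=
  fun F => {d | ¬ IsZero (F d)}.Finite

/-- The category `⨁_{d ≥ 0} 𝒞_d`. -/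
abbrev CohSum := (IsFinSupp K).FullSubcategory

instance : Preadditive (∀ d : ℕ, Coh K (SymGp d)) where
  homGroup F F' := inferInstanceAs (AddCommGroup (∀ d, F d ⟶ F' d))
  add_comp _ _ _ f f' g := funext fun d => Preadditive.add_comp _ _ _ (f d) (f' d) (g d)
  comp_add _ _ _ f g g' := funext fun d => Preadditive.comp_add _ _ _ (f d) (g d) (g' d)

open ZeroObject in
instance (G : Type) [Group G] : HasZeroObject (Coh K G) := by
  have : HasZeroObject (FDRep.{u} K G) := hasZeroObject_of_hasTerminal_object
  refine ⟨(hFun K G).obj (.op 0), ?_⟩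
  rw [IsZero.iff_id_eq_zero]
  ext X (x : (0 : FDRep.{u} K G) ⟶ X)
  exact (isZero_zero _).eq_of_src _ _

open Classical in
open ZeroObject in
/-- The family of functors defining the inclusion of the `m`-th summand: the identity in degree
`m` and zero in the other degrees. -/
def singleFamily (m d : ℕ) : Coh K (SymGp m) ⥤ Coh K (SymGp d) :=
  if e : m = d then e ▸ 𝟭 (Coh K (SymGp m)) else (Functor.const _).obj 0

/-- The inclusion of the `m`-th summand of `⨁_{d ≥ 0} 𝒞_d`. -/
def single (m : ℕ) : Coh K (SymGp m) ⥤ CohSum K :=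
  ObjectProperty.lift _ (Functor.pi' (singleFamily K m)) fun f => by
    refine (Set.finite_singleton m).subset fun d hd => ?_
    by_contra hne
    refine hd ?_
    have e : singleFamily K m d = _ := dif_neg (fun e => hne e.symm)
    change IsZero ((singleFamily K m d).obj f)
    rw [e]
    exact isZero_zero _

/-- A family of bifunctors `T m n : 𝒞_m × 𝒞_n → 𝒞_{m+n}` equips `⨁_{d ≥ 0} 𝒞_d` with a symmetric
monoidal structure: there is one whose tensor product is biadditive and is given by `T m n` on the
summands of degrees `m` and `n`. -/
def IsSymmetricMonoidal
    (T : ∀ m n : ℕ, Coh K (SymGp m) ⥤ Coh K (SymGp n) ⥤ Coh K (SymGp (m + n))) : Prop :=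
  ∃ (_ : MonoidalCategory (CohSum K)) (_ : SymmetricCategory (CohSum K)),
    MonoidalPreadditive (CohSum K) ∧ ∀ m n,
      Nonempty (single K m ⋙ MonoidalCategory.curriedTensor (CohSum K) ⋙
          (Functor.whiskeringLeft _ _ _).obj (single K n) ≅
        T m n ⋙ (Functor.whiskeringRight _ _ _).obj (single K (m + n)))

end
end CoherentFunctors

open CoherentFunctors

/-!
The proof treats all functors by their elements. A coherent functor is a functor `f` with an element
`e ∈ f(M)` that generates it and a morphism `a : M ⟶ N` such that `φ : M ⟶ X` annihilates `e` if and
only if `φ` factors through `a` (`IsPres`). Natural transformations `f ⟶ k` are then the elements of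
`k(M)` annihilated by `a`.

*The product `⊠_ℓ`.* It represents the natural bilinear maps `f(X) × g(Y) → k(X ⊠ Y)`
(`Bil.IsUniv`, `IsTensor`). For presented functors a representing object is the cokernel of
`h_{N ⊠ M'} ⊕ h_{M ⊠ N'} → h_{M ⊠ M'}` (`Bil.IsPres₂.isUniv`). The universal property gives the values
on representable functors and right exactness in each argument, and it determines the product up to
isomorphism, so that it also yields all comparison isomorphisms below (`IsTensor.exists_iso`).

*The product `⊙`.* An element `x ∈ f(X)` and an element `y ∈ g(Y)` define an element of
`f(g(Res (X ⊠ Y)))`: the map `X → g(Res (X ⊠ Y))` sending `v` to the image of `y` under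
`w ↦ v ⊗ w` is equivariant, and `f` is applied to it. The resulting bilinear map induces
`f ⊠_ℓ g ⟶ f ⊙ g`. It is universal if `g` is representable (`odotBil_isUniv`), since then
`g(Res X) = Hom_H(N, X)` is right adjoint to `- ⊠ N`; as projective coherent functors are retracts of
representable ones (`exists_retract`), the morphism is an isomorphism for projective `g`. In this case
`- ⊠_ℓ g` is exact because `f ⊙ g` is visibly exact in `f`; exchanging the two groups gives the other
half of balancedness. For the coherence of `f ⊙ g` see `isCoherent_odot`.

*Strict polynomial functors.* The restriction of `V^{⊗ (m + n)}` to the Young subgroup is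
`V^{⊗ m} ⊠ V^{⊗ n}`, and the universal map `f(X) ⊗ g(Y) → (f ⊠_ℓ g)(X ⊠ Y)` is bijective
(`Bil.IsUniv.lift_bijective`), as is the one for `⊙` (`lift_odotBil_bijective`): hence `j^*` is
compatible with both products. Every identity of `Γ^n 𝒱` is a sum of morphisms through `K^n`, and
`V ↦ V^{⊗ n}` is fully faithful on `Γ^n 𝒱`. Therefore `j_! F` exists as the coherent functor
`F(K^n) ⊗ Hom((K^n)^{⊗ n}, -)` over the endomorphisms of `K^n` (`exists_isLeftJ`), and the unit
`F ⟶ j^* j_! F` is an isomorphism (`leftJUnit_bijective`). So `j_!(F ⊗ G) ⟶ j_! F ⊗_ℓ j_! G` is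
bijective at tensor powers. Both sides are presented by summands of sums of tensor powers, the right
one because the module induced from `V^{⊗ m} ⊠ W^{⊗ n}` is a summand of `(V × W)^{⊗ (m + n)}`
(`exists_extension`), and a natural transformation between such functors is an isomorphism if it is
bijective at tensor powers (`IsPres.bijective`).

*The symmetric monoidal structure.* If the objects of `D` are functors on a symmetric monoidal
category `C` and a bifunctor on `D` represents bilinear maps along the product of `C`, then `D`
inherits the associator, the unitors and the braiding from `C`, and their axioms can be checked on
products of elements (`TensorSetup`). This applies twice: first to species, the functors on the
groupoid of finite sets and bijections, which become a symmetric monoidal category `C` under the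
product along disjoint unions; then to families `(F_d)` of coherent functors, regarded as the functors
`Z ↦ ∏ F_d(Z_d)` on species. A morphism `X · Y ⟶ Z` between species, where `X` and `Y` are
concentrated in the degrees `m` and `n`, is the same as a morphism `X_m ⊠ Y_n ⟶ Res Z_{m+n}`
(`exists_boxMul_comp`), so that on the summands the tensor product of families is `⊗_ℓ`
(`spIsTensor`).
-/

namespace CoherentFunctors

/-! ### Functors to finite-dimensional vector spaces, elementwise -/

section Elements
variable {K : Type u} [Field K] {C : Type*} [Category C]

/-- The linear map `f(X) → f(Y)` induced by `φ : X ⟶ Y`. -/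
def mp (f : C ⥤ FGModuleCat.{u} K) {X Y : C} (φ : X ⟶ Y) : f.obj X →ₗ[K] f.obj Y :=
  (f.map φ).hom.hom

/-- The component at `X` of a natural transformation, as a linear map. -/
def ap {f g : C ⥤ FGModuleCat.{u} K} (t : f ⟶ g) (X : C) : f.obj X →ₗ[K] g.obj X :=
  (t.app X).hom.hom

variable {f g h : C ⥤ FGModuleCat.{u} K}

@[simp] lemma mp_id (X : C) (x : f.obj X) : mp f (𝟙 X) x = x := by
  change (f.map (𝟙 X)).hom.hom x = x
  rw [f.map_id]; rfl

lemma mp_comp {X Y Z : C} (φ : X ⟶ Y) (ψ : Y ⟶ Z) (x : f.obj X) :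
    mp f (φ ≫ ψ) x = mp f ψ (mp f φ x) := by
  change (f.map (φ ≫ ψ)).hom.hom x = _
  rw [f.map_comp]; rfl

@[simp] lemma ap_id (X : C) (x : f.obj X) : ap (𝟙 f) X x = x := rfl

@[simp] lemma ap_comp (s : f ⟶ g) (t : g ⟶ h) (X : C) (x : f.obj X) :
    ap (s ≫ t) X x = ap t X (ap s X x) := rfl

lemma ap_mp (t : f ⟶ g) {X Y : C} (φ : X ⟶ Y) (x : f.obj X) :
    ap t Y (mp f φ x) = mp g φ (ap t X x) :=
  LinearMap.congr_fun (congrArg (fun s => s.hom.hom) (t.naturality φ)) x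

lemma nat_ext {s t : f ⟶ g} (e : ∀ X x, ap s X x = ap t X x) : s = t := by
  ext X : 2
  apply FGModuleCat.hom_ext
  exact LinearMap.ext (e X)

/-- A natural transformation from a natural family of linear maps. -/
def mkNat (l : ∀ X, f.obj X →ₗ[K] g.obj X)
    (e : ∀ {X Y : C} (φ : X ⟶ Y) (x : f.obj X), l Y (mp f φ x) = mp g φ (l X x)) : f ⟶ g where
  app X := FGModuleCat.ofHom (l X)
  naturality X Y φ := by
    apply FGModuleCat.hom_ext
    exact LinearMap.ext (e φ)

@[simp] lemma ap_hom_inv (s : f ≅ g) (X : C) (x : f.obj X) : ap s.inv X (ap s.hom X x) = x := by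
  rw [← ap_comp, s.hom_inv_id]; rfl

@[simp] lemma ap_inv_hom (s : f ≅ g) (X : C) (x : g.obj X) : ap s.hom X (ap s.inv X x) = x := by
  rw [← ap_comp, s.inv_hom_id]; rfl

/-- A natural isomorphism from a natural family of bijective linear maps. -/
noncomputable def mkNatIso (t : f ⟶ g) (e : ∀ X, Function.Bijective (ap t X)) : f ≅ g :=
  haveI : ∀ X, IsIso (t.app X) := fun X =>
    (LinearEquiv.toFGModuleCatIso (LinearEquiv.ofBijective (ap t X) (e X))).isIso_hom
  NatIso.ofComponents (fun X => asIso (t.app X)) (fun φ => t.naturality φ)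

@[simp] lemma mkNatIso_hom (t : f ⟶ g) (e : ∀ X, Function.Bijective (ap t X)) :
    (mkNatIso t e).hom = t := by
  ext X; rfl

lemma ap_bijective (t : f ⟶ g) [IsIso t] (X : C) : Function.Bijective (ap t X) :=
  ⟨Function.LeftInverse.injective (ap_hom_inv (asIso t) X),
    Function.RightInverse.surjective (ap_inv_hom (asIso t) X)⟩

lemma isIso_of_bijective (t : f ⟶ g) (e : ∀ X, Function.Bijective (ap t X)) : IsIso t := by
  rw [← mkNatIso_hom t e]; infer_instance

section Linear
variable [Preadditive C]

@[simp] lemma mp_add [f.Additive] {X Y : C} (φ ψ : X ⟶ Y) (x : f.obj X) :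
    mp f (φ + ψ) x = mp f φ x + mp f ψ x := by
  change (f.map (φ + ψ)).hom.hom x = _
  rw [f.map_add]; rfl

@[simp] lemma mp_zero [f.Additive] {X Y : C} (x : f.obj X) :
    mp f (0 : X ⟶ Y) x = 0 := by
  change (f.map (0 : X ⟶ Y)).hom.hom x = _
  rw [f.map_zero]; rfl

lemma mp_sub [f.Additive] {X Y : C} (φ ψ : X ⟶ Y) (x : f.obj X) :
    mp f (φ - ψ) x = mp f φ x - mp f ψ x := by
  change (f.map (φ - ψ)).hom.hom x = _
  rw [f.map_sub]; rfl

lemma mp_sum [f.Additive] {ι : Type*} (s : Finset ι) {X Y : C} (φ : ι → (X ⟶ Y)) (x : f.obj X) :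
    mp f (∑ i ∈ s, φ i) x = ∑ i ∈ s, mp f (φ i) x := by
  classical
  induction s using Finset.induction_on with
  | empty => simp
  | insert a s ha ih => rw [Finset.sum_insert ha, Finset.sum_insert ha, mp_add, ih]

@[simp] lemma mp_smul [CategoryTheory.Linear K C] [f.Additive] [f.Linear K] {X Y : C} (r : K)
    (φ : X ⟶ Y) (x : f.obj X) : mp f (r • φ) x = r • mp f φ x := by
  change (f.map (r • φ)).hom.hom x = _
  rw [f.map_smul]; rfl

end Linear

end Elements

/-! ### Presentations by generators and relations -/

section Presentations
variable {K : Type u} [Field K] {C : Type*} [Category C] [Preadditive C]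

/-- A presentation of `f`: the element `e ∈ f(M)` generates `f`, and `φ : M ⟶ X` annihilates it
if and only if `φ` factors through `a : M ⟶ N`. For linear functors it is the same as an exact
sequence `h_N → h_M → f → 0`. -/
structure IsPres (f : C ⥤ FGModuleCat.{u} K) {M N : C} (a : M ⟶ N) (e : f.obj M) : Prop where
  gen : ∀ (X : C) (x : f.obj X), ∃ φ : M ⟶ X, mp f φ e = x
  rel : ∀ (X : C) (φ : M ⟶ X), mp f φ e = 0 ↔ ∃ ψ : N ⟶ X, a ≫ ψ = φ

variable {f k : C ⥤ FGModuleCat.{u} K} {M N : C} {a : M ⟶ N} {e : f.obj M}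

omit [Preadditive C] in
lemma IsPres.hom_ext (h : IsPres f a e) {s t : f ⟶ k} (est : ap s M e = ap t M e) : s = t := by
  refine nat_ext fun X x => ?_
  obtain ⟨φ, rfl⟩ := h.gen X x
  rw [ap_mp, ap_mp, est]

omit [Preadditive C] in
lemma IsPres.rel_self (h : IsPres f a e) : mp f a e = 0 :=
  (h.rel N a).2 ⟨𝟙 N, Category.comp_id a⟩

/-- An element `y` that satisfies the relation `a` satisfies all relations between the multiples
of `e`. -/
lemma IsPres.eq_of_eq (h : IsPres f a e) [f.Additive] [k.Additive] {y : k.obj M}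
    (hy : mp k a y = 0) {X : C} {φ ψ : M ⟶ X} (hφ : mp f φ e = mp f ψ e) :
    mp k φ y = mp k ψ y := by
  obtain ⟨χ, hχ⟩ := (h.rel X (φ - ψ)).1 (by rw [mp_sub, hφ, sub_self])
  rw [← sub_eq_zero, ← mp_sub, ← hχ, mp_comp, hy, map_zero]

/-- Maps out of a presented functor are given by elements that satisfy the relation. -/
lemma IsPres.exists_desc [CategoryTheory.Linear K C] (h : IsPres f a e) [f.Additive] [f.Linear K]
    [k.Additive] [k.Linear K] {y : k.obj M} (hy : mp k a y = 0) : ∃ t : f ⟶ k, ap t M e = y := by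
  choose φ hφ using h.gen
  have key : ∀ X (ψ : M ⟶ X), mp k (φ X (mp f ψ e)) y = mp k ψ y := fun X ψ =>
    h.eq_of_eq hy (hφ X _)
  refine ⟨mkNat (fun X =>
    { toFun := fun x => mp k (φ X x) y
      map_add' := fun x x' => ?_
      map_smul' := fun r x => ?_ }) fun {X Y} ψ x => ?_, ?_⟩
  · rw [← mp_add, ← key X (φ X x + φ X x'), mp_add, hφ, hφ]
  · rw [RingHom.id_apply, ← mp_smul, ← key X (r • φ X x), mp_smul, hφ]
  · change mp k (φ Y (mp f ψ x)) y = mp k ψ (mp k (φ X x) y)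
    rw [← mp_comp]
    exact h.eq_of_eq hy (by rw [hφ, mp_comp, hφ])
  · have := key M (𝟙 M)
    rw [mp_id, mp_id] at this
    exact this

end Presentations

/-! ### Bilinear maps of functors -/

section Bilinear
variable {K : Type u} [Field K] {A B C : Type*} [Category A] [Category B] [Category C]

/-- A bilinear map from `f` and `g` to `k`, along a bifunctor `P`: a family of bilinear maps
`f(X) × g(Y) → k(P(X, Y))`, natural in `X` and `Y`. -/
structure Bil (P : A ⥤ B ⥤ C) (f : A ⥤ FGModuleCat.{u} K) (g : B ⥤ FGModuleCat.{u} K)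
    (k : C ⥤ FGModuleCat.{u} K) where
  /-- the bilinear maps -/
  fn : ∀ X Y, f.obj X →ₗ[K] g.obj Y →ₗ[K] k.obj ((P.obj X).obj Y)
  nat_left : ∀ {X X' : A} (φ : X ⟶ X') (Y : B) (x : f.obj X) (y : g.obj Y),
    fn X' Y (mp f φ x) y = mp k ((P.map φ).app Y) (fn X Y x y)
  nat_right : ∀ (X : A) {Y Y' : B} (ψ : Y ⟶ Y') (x : f.obj X) (y : g.obj Y),
    fn X Y' x (mp g ψ y) = mp k ((P.obj X).map ψ) (fn X Y x y)

variable {P : A ⥤ B ⥤ C} {f f' : A ⥤ FGModuleCat.{u} K} {g g' : B ⥤ FGModuleCat.{u} K}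
  {k k' t : C ⥤ FGModuleCat.{u} K}

/-- Composition of a bilinear map with natural transformations. -/
def Bil.comp (β : Bil P f g k) (r : f' ⟶ f) (s : g' ⟶ g) (w : k ⟶ k') : Bil P f' g' k' where
  fn X Y := ((β.fn X Y).compl₁₂ (ap r X) (ap s Y)).compr₂ (ap w _)
  nat_left φ Y x y := by
    simp only [LinearMap.compr₂_apply, LinearMap.compl₁₂_apply, ap_mp, β.nat_left]
  nat_right X _ _ ψ x y := by
    simp only [LinearMap.compr₂_apply, LinearMap.compl₁₂_apply, ap_mp, β.nat_right]

@[simp] lemma Bil.comp_fn (β : Bil P f g k) (r : f' ⟶ f) (s : g' ⟶ g) (w : k ⟶ k') (X : A) (Y : B)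
    (x : f'.obj X) (y : g'.obj Y) :
    (β.comp r s w).fn X Y x y = ap w _ (β.fn X Y (ap r X x) (ap s Y y)) := rfl

/-- A bilinear map `u` to `t` is universal for the functors with the property `Q`: bilinear maps to
a functor `k` with this property are the same as natural transformations `t ⟶ k`. -/
def Bil.IsUniv (Q : ObjectProperty (C ⥤ FGModuleCat.{u} K)) (u : Bil P f g t) : Prop :=
  ∀ k, Q k → ∀ β : Bil P f g k, ∃! s : t ⟶ k, ∀ X Y x y, ap s _ (u.fn X Y x y) = β.fn X Y x y

variable {Q : ObjectProperty (C ⥤ FGModuleCat.{u} K)} {u : Bil P f g t}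

namespace Bil.IsUniv

lemma hom_ext (hu : u.IsUniv Q) (hk : Q k) {s s' : t ⟶ k}
    (e : ∀ X Y x y, ap s _ (u.fn X Y x y) = ap s' _ (u.fn X Y x y)) : s = s' :=
  (hu k hk (u.comp (𝟙 f) (𝟙 g) s)).unique (fun _ _ _ _ => rfl) (fun X Y x y => (e X Y x y).symm)

/-- The natural transformation induced by a bilinear map. -/
noncomputable def desc (hu : u.IsUniv Q) (hk : Q k) (β : Bil P f g k) : t ⟶ k :=
  (hu k hk β).choose

@[simp] lemma ap_desc (hu : u.IsUniv Q) (hk : Q k) (β : Bil P f g k) (X : A) (Y : B) (x : f.obj X)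
    (y : g.obj Y) : ap (hu.desc hk β) _ (u.fn X Y x y) = β.fn X Y x y :=
  (hu k hk β).choose_spec.1 X Y x y

end Bil.IsUniv

section Presented
variable [Preadditive A] [Preadditive B] [Preadditive C] {M N : A} {a : M ⟶ N} {e : f.obj M}
  {M' N' : B} {a' : M' ⟶ N'} {e' : g.obj M'}

/-- A presentation of `t` by two relations: `w` generates `t` over `P(M, M')`, and the morphisms that
annihilate it are the sums of a morphism that factors through `P(a, M')` and one that factors through
`P(M, a')`. This is what the tensor product of functors presented by `a` and `a'` looks like. -/
structure Bil.IsPres₂ (P : A ⥤ B ⥤ C) (a : M ⟶ N) (a' : M' ⟶ N') (t : C ⥤ FGModuleCat.{u} K)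
    (w : t.obj ((P.obj M).obj M')) : Prop where
  gen : ∀ (Z : C) (z : t.obj Z), ∃ φ : (P.obj M).obj M' ⟶ Z, mp t φ w = z
  rel : ∀ (Z : C) (φ : (P.obj M).obj M' ⟶ Z), mp t φ w = 0 ↔
    ∃ (ψ : (P.obj N).obj M' ⟶ Z) (ψ' : (P.obj M).obj N' ⟶ Z),
      φ = (P.map a).app M' ≫ ψ + (P.obj M).map a' ≫ ψ'

variable [CategoryTheory.Linear K C]

omit [Preadditive A] [Preadditive B] in
/-- A bilinear map is universal if its value on the generators presents its target. -/
lemma Bil.IsPres₂.isUniv (hf : IsPres f a e) (hg : IsPres g a' e') [t.Additive] [t.Linear K]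
    (u : Bil P f g t) (h : Bil.IsPres₂ P a a' t (u.fn M M' e e')) :
    u.IsUniv (IsLinear K (E := C)) := by
  intro k hk β
  have := hk.1
  have := hk.2
  have van : ∀ Z (φ : (P.obj M).obj M' ⟶ Z), mp t φ (u.fn M M' e e') = 0 →
      mp k φ (β.fn M M' e e') = 0 := by
    intro Z φ hφ
    obtain ⟨ψ, ψ', rfl⟩ := (h.rel Z φ).1 hφ
    rw [mp_add, mp_comp, mp_comp, ← β.nat_left, ← β.nat_right, hf.rel_self, hg.rel_self]
    simp
  have wd : ∀ Z (φ ψ : (P.obj M).obj M' ⟶ Z), mp t φ (u.fn M M' e e') = mp t ψ (u.fn M M' e e') →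
      mp k φ (β.fn M M' e e') = mp k ψ (β.fn M M' e e') := by
    intro Z φ ψ hh
    rw [← sub_eq_zero, ← mp_sub]
    exact van Z _ (by rw [mp_sub, hh, sub_self])
  choose φ hφ using h.gen
  refine ⟨mkNat (fun Z =>
    { toFun := fun z => mp k (φ Z z) (β.fn M M' e e')
      map_add' := fun x x' => ?_
      map_smul' := fun r x => ?_ }) fun {X Y} ψ x => ?_, ?_, ?_⟩
  · rw [← mp_add]
    exact wd Z _ _ (by rw [mp_add, hφ, hφ, hφ])
  · rw [RingHom.id_apply, ← mp_smul]
    exact wd Z _ _ (by rw [mp_smul, hφ, hφ])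
  · change mp k (φ Y (mp t ψ x)) _ = mp k ψ (mp k (φ X x) _)
    rw [← mp_comp]
    exact wd Y _ _ (by rw [mp_comp, hφ, hφ])
  · intro X Y x y
    obtain ⟨ξ, rfl⟩ := hf.gen X x
    obtain ⟨η, rfl⟩ := hg.gen Y y
    have r : ∀ (v : C ⥤ FGModuleCat.{u} K) (b : Bil P f g v), b.fn X Y (mp f ξ e) (mp g η e') =
        mp v ((P.obj M).map η ≫ (P.map ξ).app Y) (b.fn M M' e e') := fun v b => by
      rw [b.nat_left, b.nat_right, mp_comp]
    rw [r k β, r t u]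
    exact wd _ _ _ (hφ _ _)
  · intro s hs
    refine nat_ext fun Z z => ?_
    obtain ⟨ψ, rfl⟩ := h.gen Z z
    rw [ap_mp, hs]
    exact wd _ _ _ (by rw [hφ])

variable [CategoryTheory.Linear K A] [CategoryTheory.Linear K B] [P.Additive]
  [∀ X, (P.obj X).Additive]

/-- A tensor product of presented functors exists, as soon as there is a functor with the
corresponding presentation. -/
lemma Bil.IsPres₂.exists_bil (hf : IsPres f a e) (hg : IsPres g a' e') [f.Additive] [g.Additive]
    [f.Linear K] [g.Linear K] [t.Additive] [t.Linear K]
    (hP : ∀ X Y (ψ : X ⟶ Y) (Z : A) (r : K), (P.obj Z).map (r • ψ) = r • (P.obj Z).map ψ)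
    (hP' : ∀ X Y (φ : X ⟶ Y) (Z : B) (r : K), (P.map (r • φ)).app Z = r • (P.map φ).app Z)
    {w : t.obj ((P.obj M).obj M')}
    (h : Bil.IsPres₂ P a a' t w) : ∃ u : Bil P f g t, u.fn M M' e e' = w := by
  have ra : ∀ {Z} (ψ : (P.obj N).obj M' ⟶ Z), mp t ((P.map a).app M' ≫ ψ) w = 0 := fun ψ =>
    (h.rel _ _).2 ⟨ψ, 0, by simp⟩
  have ra' : ∀ {Z} (ψ : (P.obj M).obj N' ⟶ Z), mp t ((P.obj M).map a' ≫ ψ) w = 0 := fun ψ =>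
    (h.rel _ _).2 ⟨0, ψ, by simp⟩
  let c : ∀ {X Y} (φ : M ⟶ X) (ψ : M' ⟶ Y), t.obj ((P.obj X).obj Y) := fun {X Y} φ ψ =>
    mp t ((P.map φ).app M' ≫ (P.obj X).map ψ) w
  have c_comm : ∀ {X Y} (φ : M ⟶ X) (ψ : M' ⟶ Y), c φ ψ =
      mp t ((P.obj M).map ψ ≫ (P.map φ).app Y) w := fun φ ψ => by
    simp only [c, (P.map φ).naturality]
  have addl : ∀ {X Y} (φ φ' : M ⟶ X) (ψ : M' ⟶ Y), c (φ + φ') ψ = c φ ψ + c φ' ψ := by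
    intro X Y φ φ' ψ
    simp only [c, P.map_add, NatTrans.app_add, Preadditive.add_comp, mp_add]
  have addr : ∀ {X Y} (φ : M ⟶ X) (ψ ψ' : M' ⟶ Y), c φ (ψ + ψ') = c φ ψ + c φ ψ' := by
    intro X Y φ ψ ψ'
    simp only [c, (P.obj X).map_add, Preadditive.comp_add, mp_add]
  have smull : ∀ {X Y} (r : K) (φ : M ⟶ X) (ψ : M' ⟶ Y), c (r • φ) ψ = r • c φ ψ := by
    intro X Y r φ ψ
    simp only [c, hP', CategoryTheory.Linear.smul_comp, mp_smul]
  have smulr : ∀ {X Y} (r : K) (φ : M ⟶ X) (ψ : M' ⟶ Y), c φ (r • ψ) = r • c φ ψ := by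
    intro X Y r φ ψ
    simp only [c, hP, CategoryTheory.Linear.comp_smul, mp_smul]
  have subl : ∀ {X Y} (φ φ' : M ⟶ X) (ψ : M' ⟶ Y), c (φ - φ') ψ = c φ ψ - c φ' ψ := by
    intro X Y φ φ' ψ
    rw [eq_sub_iff_add_eq, ← addl, sub_add_cancel]
  have subr : ∀ {X Y} (φ : M ⟶ X) (ψ ψ' : M' ⟶ Y), c φ (ψ - ψ') = c φ ψ - c φ ψ' := by
    intro X Y φ ψ ψ'
    rw [eq_sub_iff_add_eq, ← addr, sub_add_cancel]
  have wd : ∀ {X Y} (φ φ' : M ⟶ X) (ψ ψ' : M' ⟶ Y), mp f φ e = mp f φ' e →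
      mp g ψ e' = mp g ψ' e' → c φ ψ = c φ' ψ' := by
    intro X Y φ φ' ψ ψ' h1 h2
    obtain ⟨χ, hχ⟩ := (hf.rel X (φ - φ')).1 (by rw [mp_sub, h1, sub_self])
    obtain ⟨χ', hχ'⟩ := (hg.rel Y (ψ - ψ')).1 (by rw [mp_sub, h2, sub_self])
    have e1 : c (φ - φ') ψ = 0 := by
      simp only [c, ← hχ, P.map_comp, NatTrans.comp_app, Category.assoc]
      exact ra _
    have e2 : c φ' (ψ - ψ') = 0 := by
      rw [c_comm, ← hχ', (P.obj M).map_comp, Category.assoc]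
      exact ra' _
    rw [subl, sub_eq_zero] at e1
    rw [subr, sub_eq_zero] at e2
    rw [e1, e2]
  choose φ hφ using hf.gen
  choose ψ hψ using hg.gen
  refine ⟨{ fn := fun X Y => LinearMap.mk₂ K (fun x y => c (φ X x) (ψ Y y)) ?_ ?_ ?_ ?_
            nat_left := ?_
            nat_right := ?_ }, ?_⟩
  · intro x x' y
    rw [← addl]
    exact wd _ _ _ _ (by rw [mp_add, hφ, hφ, hφ]) rfl
  · intro r x y
    rw [← smull]
    exact wd _ _ _ _ (by rw [mp_smul, hφ, hφ]) rfl
  · intro x y y'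
    rw [← addr]
    exact wd _ _ _ _ rfl (by rw [mp_add, hψ, hψ, hψ])
  · intro r x y
    rw [← smulr]
    exact wd _ _ _ _ rfl (by rw [mp_smul, hψ, hψ])
  · intro X X' χ Y x y
    change c (φ X' (mp f χ x)) (ψ Y y) = mp t ((P.map χ).app Y) (c (φ X x) (ψ Y y))
    rw [wd _ (φ X x ≫ χ) _ (ψ Y y) (by rw [hφ, mp_comp, hφ]) rfl, c_comm, c_comm, P.map_comp,
      ← mp_comp, NatTrans.comp_app, Category.assoc]
  · intro X Y Y' χ x y
    change c (φ X x) (ψ Y' (mp g χ y)) = mp t ((P.obj X).map χ) (c (φ X x) (ψ Y y))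
    rw [wd _ (φ X x) _ (ψ Y y ≫ χ) rfl (by rw [hψ, mp_comp, hψ])]
    simp only [c, (P.obj X).map_comp, ← mp_comp, Category.assoc]
  · refine (wd _ (𝟙 M) _ (𝟙 M') (by rw [hφ, mp_id]) (by rw [hψ, mp_id])).trans ?_
    simp [c]

end Presented

/-! ### Bifunctors given by universal bilinear maps -/

section Bifunctor
variable {D₁ D₂ D₃ : Type*} [Category D₁] [Category D₂] [Category D₃]
  {ι₁ : D₁ ⥤ A ⥤ FGModuleCat.{u} K} {ι₂ : D₂ ⥤ B ⥤ FGModuleCat.{u} K}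
  {ι₃ : D₃ ⥤ C ⥤ FGModuleCat.{u} K}

/-- A bifunctor `T` with universal bilinear maps `d₁, d₂ → T(d₁, d₂)`, natural in `d₁` and `d₂`.
The categories `D₁`, `D₂`, `D₃` are regarded as categories of functors through `ι₁`, `ι₂`, `ι₃`. -/
structure IsTensor (P : A ⥤ B ⥤ C) (Q : ObjectProperty (C ⥤ FGModuleCat.{u} K))
    (ι₁ : D₁ ⥤ A ⥤ FGModuleCat.{u} K) (ι₂ : D₂ ⥤ B ⥤ FGModuleCat.{u} K)
    (ι₃ : D₃ ⥤ C ⥤ FGModuleCat.{u} K) (T : D₁ ⥤ D₂ ⥤ D₃) where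
  /-- the universal bilinear maps -/
  bil : ∀ d₁ d₂, Bil P (ι₁.obj d₁) (ι₂.obj d₂) (ι₃.obj ((T.obj d₁).obj d₂))
  univ : ∀ d₁ d₂, (bil d₁ d₂).IsUniv Q
  nat_left : ∀ {d₁ d₁' : D₁} (s : d₁ ⟶ d₁') (d₂ : D₂) (X : A) (Y : B) (x : (ι₁.obj d₁).obj X)
    (y : (ι₂.obj d₂).obj Y), ap (ι₃.map ((T.map s).app d₂)) _ ((bil d₁ d₂).fn X Y x y) =
      (bil d₁' d₂).fn X Y (ap (ι₁.map s) X x) y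
  nat_right : ∀ (d₁ : D₁) {d₂ d₂' : D₂} (s : d₂ ⟶ d₂') (X : A) (Y : B) (x : (ι₁.obj d₁).obj X)
    (y : (ι₂.obj d₂).obj Y), ap (ι₃.map ((T.obj d₁).map s)) _ ((bil d₁ d₂).fn X Y x y) =
      (bil d₁ d₂').fn X Y x (ap (ι₂.map s) Y y)

/-- Universal bilinear maps give rise to a bifunctor. -/
lemma exists_isTensor (P : A ⥤ B ⥤ C) (Q : ObjectProperty (C ⥤ FGModuleCat.{u} K))
    (hι : ι₃.FullyFaithful) (hQ : ∀ d, Q (ι₃.obj d))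
    (h : ∀ d₁ d₂, ∃ (t : D₃) (u : Bil P (ι₁.obj d₁) (ι₂.obj d₂) (ι₃.obj t)), u.IsUniv Q) :
    ∃ T : D₁ ⥤ D₂ ⥤ D₃, Nonempty (IsTensor P Q ι₁ ι₂ ι₃ T) := by
  choose t u hu using h
  let m : ∀ {d₁ d₁' d₂ d₂'} (r : d₁ ⟶ d₁') (s : d₂ ⟶ d₂'), t d₁ d₂ ⟶ t d₁' d₂' :=
    fun {d₁ d₁' d₂ d₂'} r s => hι.preimage ((hu d₁ d₂).desc (hQ (t d₁' d₂'))
      ((u d₁' d₂').comp (ι₁.map r) (ι₂.map s) (𝟙 _)))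
  have hm : ∀ {d₁ d₁' d₂ d₂'} (r : d₁ ⟶ d₁') (s : d₂ ⟶ d₂') X Y x y,
      ap (ι₃.map (m r s)) _ ((u d₁ d₂).fn X Y x y) =
        (u d₁' d₂').fn X Y (ap (ι₁.map r) X x) (ap (ι₂.map s) Y y) := by
    intro d₁ d₁' d₂ d₂' r s X Y x y
    simp only [m, hι.map_preimage, Bil.IsUniv.ap_desc]
    rfl
  have ext : ∀ {d₁ d₂ d} {p q : t d₁ d₂ ⟶ d}, (∀ X Y x y,
      ap (ι₃.map p) _ ((u d₁ d₂).fn X Y x y) = ap (ι₃.map q) _ ((u d₁ d₂).fn X Y x y)) → p = q :=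
    fun {d₁ d₂ d p q} e => hι.map_injective ((hu d₁ d₂).hom_ext (hQ d) e)
  have mid : ∀ d₁ d₂, m (𝟙 d₁) (𝟙 d₂) = 𝟙 (t d₁ d₂) := fun d₁ d₂ => ext fun X Y x y => by
    rw [hm, ι₁.map_id, ι₂.map_id, ι₃.map_id, ap_id, ap_id, ap_id]
  have mcomp : ∀ {d₁ d₁' d₁'' d₂ d₂' d₂''} (r : d₁ ⟶ d₁') (r' : d₁' ⟶ d₁'') (s : d₂ ⟶ d₂')
      (s' : d₂' ⟶ d₂''), m (r ≫ r') (s ≫ s') = m r s ≫ m r' s' := fun r r' s s' =>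
    ext fun X Y x y => by
      rw [ι₃.map_comp, ap_comp, hm, hm, hm, ι₁.map_comp, ι₂.map_comp, ap_comp, ap_comp]
  let T : D₁ ⥤ D₂ ⥤ D₃ :=
    { obj := fun d₁ =>
        { obj := fun d₂ => t d₁ d₂
          map := fun s => m (𝟙 d₁) s
          map_id := mid d₁
          map_comp := fun s s' => by simp only [← mcomp, Category.comp_id] }
      map := fun {d₁ d₁'} r =>
        { app := fun d₂ => m r (𝟙 d₂)
          naturality := fun d₂ d₂' s => by
            simp only [← mcomp, Category.comp_id, Category.id_comp] }
      map_id := fun d₁ => NatTrans.ext (funext fun d₂ => mid d₁ d₂)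
      map_comp := fun r r' => NatTrans.ext (funext fun d₂ =>
        (congrArg (m (r ≫ r')) (Category.comp_id (𝟙 d₂)).symm).trans (mcomp r r' _ _)) }
  refine ⟨T, ⟨{ bil := u, univ := hu, nat_left := ?_, nat_right := ?_ }⟩⟩
  · intro d₁ d₁' s d₂ X Y x y
    exact (hm s (𝟙 d₂) X Y x y).trans (by rw [ι₂.map_id, ap_id])
  · intro d₁ d₂ d₂' s X Y x y
    exact (hm (𝟙 d₁) s X Y x y).trans (by rw [ι₁.map_id, ap_id])

lemma IsTensor.hom_ext {T : D₁ ⥤ D₂ ⥤ D₃} (hι : ι₃.FullyFaithful) (hQ : ∀ d, Q (ι₃.obj d))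
    (h : IsTensor P Q ι₁ ι₂ ι₃ T) {d₁ : D₁} {d₂ : D₂} {d : D₃} {p q : (T.obj d₁).obj d₂ ⟶ d}
    (e : ∀ X Y x y, ap (ι₃.map p) _ ((h.bil d₁ d₂).fn X Y x y) =
      ap (ι₃.map q) _ ((h.bil d₁ d₂).fn X Y x y)) : p = q :=
  hι.map_injective ((h.univ d₁ d₂).hom_ext (hQ d) e)

/-- A bifunctor given by universal bilinear maps maps to every other bifunctor with natural
bilinear maps. -/
lemma IsTensor.exists_hom {T T' : D₁ ⥤ D₂ ⥤ D₃} (hι : ι₃.FullyFaithful)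
    (hQ : ∀ d, Q (ι₃.obj d)) (h : IsTensor P Q ι₁ ι₂ ι₃ T)
    (b : ∀ d₁ d₂, Bil P (ι₁.obj d₁) (ι₂.obj d₂) (ι₃.obj ((T'.obj d₁).obj d₂)))
    (hl : ∀ {d₁ d₁' : D₁} (s : d₁ ⟶ d₁') (d₂ : D₂) (X : A) (Y : B) (x : (ι₁.obj d₁).obj X)
      (y : (ι₂.obj d₂).obj Y), ap (ι₃.map ((T'.map s).app d₂)) _ ((b d₁ d₂).fn X Y x y) =
        (b d₁' d₂).fn X Y (ap (ι₁.map s) X x) y)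
    (hr : ∀ (d₁ : D₁) {d₂ d₂' : D₂} (s : d₂ ⟶ d₂') (X : A) (Y : B) (x : (ι₁.obj d₁).obj X)
      (y : (ι₂.obj d₂).obj Y), ap (ι₃.map ((T'.obj d₁).map s)) _ ((b d₁ d₂).fn X Y x y) =
        (b d₁ d₂').fn X Y x (ap (ι₂.map s) Y y)) :
    ∃ τ : T ⟶ T', ∀ d₁ d₂ X Y x y,
      ap (ι₃.map ((τ.app d₁).app d₂)) _ ((h.bil d₁ d₂).fn X Y x y) = (b d₁ d₂).fn X Y x y := by
  let m : ∀ d₁ d₂, (T.obj d₁).obj d₂ ⟶ (T'.obj d₁).obj d₂ := fun d₁ d₂ =>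
    hι.preimage ((h.univ d₁ d₂).desc (hQ _) (b d₁ d₂))
  have hm : ∀ d₁ d₂ X Y x y, ap (ι₃.map (m d₁ d₂)) _ ((h.bil d₁ d₂).fn X Y x y) =
      (b d₁ d₂).fn X Y x y := by
    intro d₁ d₂ X Y x y
    simp only [m, hι.map_preimage, Bil.IsUniv.ap_desc]
  have nr : ∀ d₁ {d₂ d₂'} (s : d₂ ⟶ d₂'), (T.obj d₁).map s ≫ m d₁ d₂' =
      m d₁ d₂ ≫ (T'.obj d₁).map s := fun d₁ d₂ d₂' s => h.hom_ext hι hQ fun X Y x y => by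
    rw [ι₃.map_comp, ι₃.map_comp, ap_comp, ap_comp, hm, h.nat_right, hr, hm]
  have nl : ∀ {d₁ d₁'} (s : d₁ ⟶ d₁') d₂, (T.map s).app d₂ ≫ m d₁' d₂ =
      m d₁ d₂ ≫ (T'.map s).app d₂ := fun {d₁ d₁'} s d₂ => h.hom_ext hι hQ fun X Y x y => by
    rw [ι₃.map_comp, ι₃.map_comp, ap_comp, ap_comp, hm, h.nat_left, hl, hm]
  exact ⟨{ app := fun d₁ => { app := fun d₂ => m d₁ d₂, naturality := fun _ _ s => nr d₁ s }
           naturality := fun _ _ r => NatTrans.ext (funext fun d₂ => nl r d₂) }, hm⟩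

/-- Bifunctors given by universal bilinear maps are unique. -/
lemma IsTensor.exists_iso {T T' : D₁ ⥤ D₂ ⥤ D₃} (hι : ι₃.FullyFaithful)
    (hQ : ∀ d, Q (ι₃.obj d)) (h : IsTensor P Q ι₁ ι₂ ι₃ T) (h' : IsTensor P Q ι₁ ι₂ ι₃ T') :
    ∃ σ : T ≅ T', ∀ d₁ d₂ X Y x y,
      ap (ι₃.map ((σ.hom.app d₁).app d₂)) _ ((h.bil d₁ d₂).fn X Y x y) =
        (h'.bil d₁ d₂).fn X Y x y := by
  obtain ⟨σ, hσ⟩ := h.exists_hom hι hQ h'.bil h'.nat_left h'.nat_right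
  obtain ⟨τ, hτ⟩ := h'.exists_hom hι hQ h.bil h.nat_left h.nat_right
  refine ⟨⟨σ, τ, ?_, ?_⟩, hσ⟩
  · refine NatTrans.ext (funext fun d₁ => NatTrans.ext (funext fun d₂ =>
      h.hom_ext hι hQ fun X Y x y => ?_))
    rw [NatTrans.comp_app, NatTrans.comp_app, ι₃.map_comp, ap_comp, hσ, hτ]
    simp
  · refine NatTrans.ext (funext fun d₁ => NatTrans.ext (funext fun d₂ =>
      h'.hom_ext hι hQ fun X Y x y => ?_))
    rw [NatTrans.comp_app, NatTrans.comp_app, ι₃.map_comp, ap_comp, hτ, hσ]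
    simp

/-- Restriction of a universal bifunctor along functors to its arguments. -/
def IsTensor.precomp {T : D₁ ⥤ D₂ ⥤ D₃} (h : IsTensor P Q ι₁ ι₂ ι₃ T) {D₁' D₂' : Type*}
    [Category D₁'] [Category D₂'] (R₁ : D₁' ⥤ D₁) (R₂ : D₂' ⥤ D₂) :
    IsTensor P Q (R₁ ⋙ ι₁) (R₂ ⋙ ι₂) ι₃ (R₁ ⋙ T ⋙ (Functor.whiskeringLeft _ _ _).obj R₂) where
  bil d₁ d₂ := h.bil (R₁.obj d₁) (R₂.obj d₂)
  univ d₁ d₂ := h.univ (R₁.obj d₁) (R₂.obj d₂)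
  nat_left s _ := h.nat_left (R₁.map s) _
  nat_right _ _ _ s := h.nat_right _ (R₂.map s)

end Bifunctor

end Bilinear

end CoherentFunctors

namespace CoherentFunctors

noncomputable section

/-! ### Coherent functors -/

instance {K : Type u} [Field K] {E : Type*} [Category E] [Preadditive E] [CategoryTheory.Linear K E]
    (f : (IsLinear K (E := E)).FullSubcategory) : f.obj.Additive := f.property.1

instance {K : Type u} [Field K] {E : Type*} [Category E] [Preadditive E] [CategoryTheory.Linear K E]
    (f : (IsLinear K (E := E)).FullSubcategory) : f.obj.Linear K := f.property.2

/-- A functor that acts additively and homogeneously on elements is linear. -/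
lemma isLinear_of_mp {K : Type u} [Field K] {E : Type*} [Category E] [Preadditive E]
    [CategoryTheory.Linear K E] (f : E ⥤ FGModuleCat.{u} K)
    (h : ∀ {X Y : E} (φ ψ : X ⟶ Y) x, mp f (φ + ψ) x = mp f φ x + mp f ψ x)
    (h' : ∀ {X Y : E} (r : K) (φ : X ⟶ Y) x, mp f (r • φ) x = r • mp f φ x) : IsLinear K f := by
  refine ⟨⟨fun {X Y φ ψ} => ?_⟩, ⟨fun {X Y} φ r => ?_⟩⟩
  · exact FGModuleCat.hom_ext (LinearMap.ext (h φ ψ))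
  · exact FGModuleCat.hom_ext (LinearMap.ext (h' r φ))

variable (K : Type u) [Field K] {G H : Type} [Group G] [Group H]

/-- A linear functor is coherent if and only if it has a presentation. -/
lemma isCoherent_iff (f : LinFun K G) : IsCoherent K f ↔
    ∃ (M N : FDRep.{u} K G) (a : M ⟶ N) (e : f.obj.obj M), IsPres f.obj a e := by
  constructor
  · rintro ⟨N, M, a, q, h⟩
    have hq : ∀ {X} (φ : M ⟶ X), mp f.obj φ (ap q.hom M (𝟙 M)) = ap q.hom X φ := fun {X} φ =>
      (ap_mp q.hom φ (𝟙 M)).symm.trans (congrArg (ap q.hom X) (Category.id_comp φ))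
    have ha : ∀ {X} (φ : N ⟶ X), ap a.hom N (𝟙 N) ≫ φ = ap a.hom X φ := fun {X} φ => by
      have := (ap_mp a.hom φ (𝟙 N)).symm
      exact this.trans (congrArg (ap a.hom X) (Category.id_comp φ))
    refine ⟨M, N, ap a.hom N (𝟙 N), ap q.hom M (𝟙 M), fun X x => ?_, fun X φ => ?_⟩
    · obtain ⟨φ, rfl⟩ := (h X).2 x
      exact ⟨φ, hq φ⟩
    · rw [hq]
      refine ((h X).1 φ).trans ⟨?_, ?_⟩
      · rintro ⟨ψ, rfl⟩
        exact ⟨ψ, ha ψ⟩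
      · rintro ⟨ψ, rfl⟩
        exact ⟨ψ, (ha ψ).symm⟩
  · rintro ⟨M, N, a, e, h⟩
    refine ⟨N, M, (hLin K G).map a.op, ObjectProperty.homMk (mkNat (fun X =>
      { toFun := fun φ : M ⟶ X => mp f.obj φ e
        map_add' := fun φ ψ => mp_add φ ψ e
        map_smul' := fun r φ => mp_smul r φ e }) fun {X Y} φ x => mp_comp x φ e),
      fun X => ⟨fun φ => h.rel X φ, fun x => h.gen X x⟩⟩

section Coker
variable {M N : FDRep.{u} K G} (a : M ⟶ N)

/-- The functor `X ↦ Hom(M, X) / a^* Hom(N, X)`, without its linearity. -/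
def cokerFunctor : FDRep.{u} K G ⥤ FGModuleCat.{u} K where
  obj X := FGModuleCat.of K ((M ⟶ X) ⧸ LinearMap.range (CategoryTheory.Linear.leftComp K X a))
  map {X Y} φ := FGModuleCat.ofHom (Submodule.mapQ _ _ (CategoryTheory.Linear.rightComp K M φ) (by
    rintro _ ⟨ψ, rfl⟩
    exact ⟨ψ ≫ φ, (Category.assoc a ψ φ).symm⟩))
  map_id X := by
    apply FGModuleCat.hom_ext
    refine Submodule.linearMap_qext _ (LinearMap.ext fun φ => ?_)
    exact congrArg (Submodule.mkQ _) (Category.comp_id φ)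
  map_comp {X Y Z} φ ψ := by
    apply FGModuleCat.hom_ext
    refine Submodule.linearMap_qext _ (LinearMap.ext fun χ => ?_)
    exact congrArg (Submodule.mkQ _) (Category.assoc χ φ ψ).symm

/-- The cokernel of `h_a : h_N ⟶ h_M` for `a : M ⟶ N`. -/
def cokerLin : LinFun K G :=
  ⟨cokerFunctor K a, isLinear_of_mp _
    (fun {X Y} φ ψ x => by
      obtain ⟨χ, rfl⟩ := Submodule.mkQ_surjective _ x
      exact congrArg (Submodule.mkQ _) (Preadditive.comp_add _ _ _ χ φ ψ))
    (fun {X Y} r φ x => by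
      obtain ⟨χ, rfl⟩ := Submodule.mkQ_surjective _ x
      exact congrArg (Submodule.mkQ _) (CategoryTheory.Linear.comp_smul _ _ _ χ r φ))⟩

/-- The generator of the cokernel of `h_a`. -/
def cokerGen : (cokerLin K a).obj.obj M := Submodule.mkQ _ (𝟙 M)

lemma mp_cokerGen {X : FDRep.{u} K G} (φ : M ⟶ X) :
    mp (cokerLin K a).obj φ (cokerGen K a) = Submodule.mkQ _ φ :=
  congrArg (Submodule.mkQ _) (Category.id_comp φ)

lemma isPres_cokerLin : IsPres (cokerLin K a).obj a (cokerGen K a) where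
  gen X x := by
    obtain ⟨χ, rfl⟩ := Submodule.mkQ_surjective _ x
    exact ⟨χ, mp_cokerGen K a χ⟩
  rel X φ := by
    rw [mp_cokerGen]
    exact Submodule.Quotient.mk_eq_zero _

lemma isCoherent_cokerLin : IsCoherent K (cokerLin K a) :=
  (isCoherent_iff K _).2 ⟨M, N, a, _, isPres_cokerLin K a⟩

end Coker

/-! ### Kernels, cokernels and sums of coherent functors -/

/-- A sequence `0 → k → f → g` of functors that is exact at every object. -/
def PtKer {C : Type*} [Category C] {k f g : C ⥤ FGModuleCat.{u} K} (i : k ⟶ f) (t : f ⟶ g) : Prop :=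
  ∀ X, Function.Injective (ap i X) ∧ ∀ x, ap t X x = 0 ↔ ∃ y, ap i X y = x

/-- A sequence `f → g → c → 0` of functors that is exact at every object. -/
def PtCok {C : Type*} [Category C] {f g c : C ⥤ FGModuleCat.{u} K} (t : f ⟶ g) (q : g ⟶ c) : Prop :=
  ∀ X, Function.Surjective (ap q X) ∧ ∀ x, ap q X x = 0 ↔ ∃ y, ap t X y = x

variable {K}

/-- The kernel of a morphism of coherent functors is coherent. If `f` is generated by
`e ∈ f(M)` and `t(e)` corresponds to `τ : M' ⟶ M`, then the kernel is generated in the pushout of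
`τ` and the relation `M' ⟶ N'` of `g`. -/
lemma isCoherent_of_ptKer {k f g : LinFun K G} {i : k ⟶ f} {t : f ⟶ g} (hf : IsCoherent K f)
    (hg : IsCoherent K g) (h : PtKer K i.hom t.hom) : IsCoherent K k := by
  rw [isCoherent_iff] at *
  obtain ⟨M, N, a, e, p⟩ := hf
  obtain ⟨M', N', a', e', p'⟩ := hg
  obtain ⟨τ, hτ⟩ := p'.gen M (ap t.hom M e)
  obtain ⟨y, hy⟩ := ((h (pushout τ a')).2 (mp f.obj (pushout.inl τ a') e)).1 (by
    rw [ap_mp, ← hτ, ← mp_comp, pushout.condition, mp_comp, p'.rel_self, map_zero])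
  refine ⟨_, _, pushout.inl (pushout.inl τ a') a, y, fun X x => ?_, fun X χ => ?_⟩
  · obtain ⟨φ, hφ⟩ := p.gen X (ap i.hom X x)
    obtain ⟨ψ, hψ⟩ := (p'.rel X (τ ≫ φ)).1 (by
      rw [mp_comp, hτ, ← ap_mp, hφ]
      exact ((h X).2 _).2 ⟨x, rfl⟩)
    refine ⟨pushout.desc φ ψ hψ.symm, (h X).1 ?_⟩
    rw [ap_mp, hy, ← mp_comp, pushout.inl_desc, hφ]
  · have e1 : mp k.obj χ y = 0 ↔ mp f.obj (pushout.inl τ a' ≫ χ) e = 0 := by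
      rw [mp_comp, ← hy, ← ap_mp]
      exact ((map_eq_zero_iff _ (h X).1)).symm
    rw [e1, p.rel]
    constructor
    · rintro ⟨ψ, hψ⟩
      exact ⟨pushout.desc χ ψ hψ.symm, pushout.inl_desc _ _ _⟩
    · rintro ⟨ψ, rfl⟩
      exact ⟨pushout.inr _ _ ≫ ψ, by rw [← Category.assoc, ← pushout.condition, Category.assoc]⟩

/-- The cokernel of a morphism of coherent functors is coherent. -/
lemma isCoherent_of_ptCok {f g c : LinFun K G} {t : f ⟶ g} {q : g ⟶ c} (hf : IsCoherent K f)
    (hg : IsCoherent K g) (h : PtCok K t.hom q.hom) : IsCoherent K c := by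
  rw [isCoherent_iff] at *
  obtain ⟨M, N, a, e, p⟩ := hf
  obtain ⟨M', N', a', e', p'⟩ := hg
  obtain ⟨τ, hτ⟩ := p'.gen M (ap t.hom M e)
  refine ⟨_, _, biprod.lift a' τ, ap q.hom M' e', fun X x => ?_, fun X φ => ?_⟩
  · obtain ⟨x, rfl⟩ := (h X).1 x
    obtain ⟨φ, rfl⟩ := p'.gen X x
    exact ⟨φ, (ap_mp _ _ _).symm⟩
  · rw [← ap_mp, (h X).2]
    constructor
    · rintro ⟨y, hy⟩
      obtain ⟨ψ, rfl⟩ := p.gen X y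
      rw [ap_mp, ← hτ, ← mp_comp] at hy
      obtain ⟨ξ, hξ⟩ := (p'.rel X (φ - τ ≫ ψ)).1 (by rw [mp_sub, hy, sub_self])
      exact ⟨biprod.desc ξ ψ, by rw [biprod.lift_desc, hξ, sub_add_cancel]⟩
    · rintro ⟨ψ, rfl⟩
      refine ⟨mp f.obj (biprod.inr ≫ ψ) e, ?_⟩
      rw [ap_mp, ← hτ, ← mp_comp]
      have : biprod.lift a' τ ≫ ψ = a' ≫ biprod.inl ≫ ψ + τ ≫ biprod.inr ≫ ψ := by
        rw [← biprod.lift_desc]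
        congr 1
        apply biprod.hom_ext' <;> simp
      rw [this, mp_add, mp_comp a', p'.rel_self, map_zero, zero_add]

/-- The product of a finite family of functors, without its linearity. -/
def piFunctor {E : Type*} [Category E] {ι : Type} [Finite ι] (f : ι → E ⥤ FGModuleCat.{u} K) :
    E ⥤ FGModuleCat.{u} K where
  obj X := FGModuleCat.of K (∀ i, (f i).obj X)
  map φ := FGModuleCat.ofHom (LinearMap.pi fun i => mp (f i) φ ∘ₗ LinearMap.proj i)
  map_id X := by
    apply FGModuleCat.hom_ext
    exact LinearMap.ext fun x => funext fun i => mp_id X (x i)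
  map_comp φ ψ := by
    apply FGModuleCat.hom_ext
    exact LinearMap.ext fun x => funext fun i => mp_comp φ ψ (x i)

/-- The product of a finite family of linear functors. -/
def piLin {ι : Type} [Finite ι] (f : ι → LinFun K G) : LinFun K G :=
  ⟨piFunctor fun i => (f i).obj, isLinear_of_mp _
    (fun φ ψ x => funext fun i => mp_add (f := (f i).obj) φ ψ (x i))
    (fun r φ x => funext fun i => mp_smul (f := (f i).obj) r φ (x i))⟩

lemma mp_piLin {ι : Type} [Finite ι] (f : ι → LinFun K G) {X Y : FDRep.{u} K G} (φ : X ⟶ Y)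
    (x : (piLin f).obj.obj X) (i : ι) : mp (piLin f).obj φ x i = mp (f i).obj φ (x i) := rfl

lemma isCoherent_piLin {ι : Type} [Finite ι] (f : ι → LinFun K G) (hf : ∀ i, IsCoherent K (f i)) :
    IsCoherent K (piLin f) := by
  have := Fintype.ofFinite ι
  have : HasFiniteBiproducts (FDRep.{u} K G) := Abelian.hasFiniteBiproducts
  classical
  simp only [isCoherent_iff] at *
  choose M N a e p using hf
  let E : (piLin f).obj.obj (⨁ M) := fun i => mp (f i).obj (biproduct.ι M i) (e i)
  have hE : ∀ X (φ : ⨁ M ⟶ X) i, mp (piLin f).obj φ E i =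
      mp (f i).obj (biproduct.ι M i ≫ φ) (e i) := fun X φ i => by
    rw [mp_piLin, ← mp_comp]
  refine ⟨⨁ M, ⨁ N, biproduct.map a, E, fun X x => ?_, fun X φ => ?_⟩
  · choose φ hφ using fun i => (p i).gen X (x i)
    exact ⟨biproduct.desc φ, funext fun i => by rw [hE, biproduct.ι_desc, hφ]⟩
  · constructor
    · intro h0
      have : ∀ i, ∃ ψ, a i ≫ ψ = biproduct.ι M i ≫ φ := fun i =>
        ((p i).rel X _).1 (by rw [← hE, h0]; rfl)
      choose ψ hψ using this
      refine ⟨biproduct.desc ψ, biproduct.hom_ext' _ _ fun i => ?_⟩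
      rw [biproduct.ι_map_assoc, biproduct.ι_desc, hψ]
    · rintro ⟨ψ, rfl⟩
      refine funext fun i => ?_
      rw [hE, biproduct.ι_map_assoc, mp_comp, (p i).rel_self, map_zero]
      rfl

section Category
variable (K G)

/-- Coherent functors regarded as functors. -/
abbrev cohι : Coh K G ⥤ FDRep.{u} K G ⥤ FGModuleCat.{u} K :=
  Coh.incl K G ⋙ ObjectProperty.ι _

/-- Coherent functors form a full subcategory of the category of functors. -/
def cohιFF : (cohι K G).FullyFaithful :=
  (ObjectProperty.fullyFaithfulι _).comp (ObjectProperty.fullyFaithfulι _)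

variable {K G}

/-- A morphism of coherent functors is a natural transformation. -/
def mkCoh {f g : Coh K G} (t : f.obj.obj ⟶ g.obj.obj) : f ⟶ g := (cohιFF K G).preimage t

lemma coh_ext {f g : Coh K G} {s t : f ⟶ g} (h : ∀ X x, ap s.hom.hom X x = ap t.hom.hom X x) :
    s = t :=
  (cohιFF K G).map_injective (nat_ext h)

/-- The pointwise kernel of a natural transformation. -/
def kerFunctor {E : Type*} [Category E] {f g : E ⥤ FGModuleCat.{u} K} (t : f ⟶ g) :
    E ⥤ FGModuleCat.{u} K where
  obj X := FGModuleCat.of K (LinearMap.ker (ap t X))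
  map {X Y} φ := FGModuleCat.ofHom ((mp f φ).restrict fun x hx => by
    rw [LinearMap.mem_ker] at *
    rw [ap_mp, hx, map_zero])
  map_id X := by
    apply FGModuleCat.hom_ext
    exact LinearMap.ext fun x => Subtype.ext (mp_id X x.1)
  map_comp φ ψ := by
    apply FGModuleCat.hom_ext
    exact LinearMap.ext fun x => Subtype.ext (mp_comp φ ψ x.1)

/-- The pointwise cokernel of a natural transformation. -/
def cokFunctor {E : Type*} [Category E] {f g : E ⥤ FGModuleCat.{u} K} (t : f ⟶ g) :
    E ⥤ FGModuleCat.{u} K where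
  obj X := FGModuleCat.of K (g.obj X ⧸ LinearMap.range (ap t X))
  map {X Y} φ := FGModuleCat.ofHom (Submodule.mapQ _ _ (mp g φ) (by
    rintro _ ⟨x, rfl⟩
    exact ⟨mp f φ x, ap_mp t φ x⟩))
  map_id X := by
    apply FGModuleCat.hom_ext
    exact Submodule.linearMap_qext _ (LinearMap.ext fun x =>
      congrArg (Submodule.mkQ _) (mp_id X x))
  map_comp φ ψ := by
    apply FGModuleCat.hom_ext
    exact Submodule.linearMap_qext _ (LinearMap.ext fun x =>
      congrArg (Submodule.mkQ _) (mp_comp φ ψ x))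

/-- The pointwise kernel of a morphism of coherent functors is coherent. -/
lemma exists_ptKer {f g : Coh K G} (t : f ⟶ g) :
    ∃ (k : Coh K G) (i : k ⟶ f), PtKer K i.hom.hom t.hom.hom := by
  let k : LinFun K G := ⟨kerFunctor t.hom.hom, isLinear_of_mp _
    (fun φ ψ x => Subtype.ext (mp_add (f := f.obj.obj) φ ψ x.1))
    (fun r φ x => Subtype.ext (mp_smul (f := f.obj.obj) r φ x.1))⟩
  let i : k ⟶ f.obj := ObjectProperty.homMk (mkNat (fun X => (LinearMap.ker (ap t.hom.hom X)).subtype)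
    fun φ x => rfl)
  have hi : PtKer K i.hom t.hom.hom := fun X => ⟨Subtype.val_injective, fun x =>
    ⟨fun hx => ⟨⟨x, hx⟩, rfl⟩, by rintro ⟨y, rfl⟩; exact y.2⟩⟩
  exact ⟨⟨k, isCoherent_of_ptKer f.property g.property hi⟩, mkCoh i.hom, hi⟩

/-- The pointwise cokernel of a morphism of coherent functors is coherent. -/
lemma exists_ptCok {f g : Coh K G} (t : f ⟶ g) :
    ∃ (c : Coh K G) (q : g ⟶ c), PtCok K t.hom.hom q.hom.hom := by
  let c : LinFun K G := ⟨cokFunctor t.hom.hom, isLinear_of_mp _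
    (fun φ ψ x => by
      obtain ⟨x, rfl⟩ := Submodule.mkQ_surjective _ x
      exact congrArg (Submodule.mkQ _) (mp_add (f := g.obj.obj) φ ψ x))
    (fun r φ x => by
      obtain ⟨x, rfl⟩ := Submodule.mkQ_surjective _ x
      exact congrArg (Submodule.mkQ _) (mp_smul (f := g.obj.obj) r φ x))⟩
  let q : g.obj ⟶ c := ObjectProperty.homMk (mkNat
    (fun X => (LinearMap.range (ap t.hom.hom X)).mkQ) fun φ x => rfl)
  have hq : PtCok K t.hom.hom q.hom := fun X => ⟨Submodule.mkQ_surjective _, fun x =>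
    Submodule.Quotient.mk_eq_zero _⟩
  exact ⟨⟨c, isCoherent_of_ptCok f.property g.property hq⟩, mkCoh q.hom, hq⟩

lemma PtKer.comp_eq_zero {k f g : Coh K G} {i : k ⟶ f} {t : f ⟶ g}
    (h : PtKer K i.hom.hom t.hom.hom) : i ≫ t = 0 :=
  coh_ext fun X x => ((h X).2 _).2 ⟨x, rfl⟩

lemma PtCok.comp_eq_zero {f g c : Coh K G} {t : f ⟶ g} {q : g ⟶ c}
    (h : PtCok K t.hom.hom q.hom.hom) : t ≫ q = 0 :=
  coh_ext fun X x => ((h X).2 _).2 ⟨x, rfl⟩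

/-- Pointwise kernels are kernels. -/
def PtKer.isLimit {k f g : Coh K G} {i : k ⟶ f} {t : f ⟶ g} (h : PtKer K i.hom.hom t.hom.hom) :
    IsLimit (KernelFork.ofι i h.comp_eq_zero) := by
  have : ∀ {k' : Coh K G} (s : k' ⟶ f), s ≫ t = 0 → ∃ l : k' ⟶ k, l ≫ i = s := by
    intro k' s hs
    have : ∀ X (x : k'.obj.obj.obj X), ∃ y, ap i.hom.hom X y = ap s.hom.hom X x := fun X x =>
      ((h X).2 _).1 (congrArg (fun w : k' ⟶ g => ap w.hom.hom X x) hs)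
    choose l hl using this
    refine ⟨mkCoh (mkNat (fun X =>
      { toFun := l X
        map_add' := fun x y => (h X).1 (by simp [hl])
        map_smul' := fun r x => (h X).1 (by simp [hl]) }) fun {X Y} φ x => (h Y).1 ?_), ?_⟩
    · change ap i.hom.hom Y (l Y _) = _
      rw [hl, ap_mp, ap_mp]
      exact congrArg _ (hl X x).symm
    · exact coh_ext hl
  choose l hl using @this
  refine KernelFork.IsLimit.ofι i h.comp_eq_zero (fun {k'} s hs => l s hs)
    (fun {k'} s hs => hl s hs) fun {k'} s hs m hm => ?_
  refine coh_ext fun X x => (h X).1 ?_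
  exact congrArg (fun w : k' ⟶ f => ap w.hom.hom X x) (hm.trans (hl s hs).symm)

/-- Pointwise cokernels are cokernels. -/
def PtCok.isColimit {f g c : Coh K G} {t : f ⟶ g} {q : g ⟶ c}
    (h : PtCok K t.hom.hom q.hom.hom) : IsColimit (CokernelCofork.ofπ q h.comp_eq_zero) := by
  have : ∀ {c' : Coh K G} (s : g ⟶ c'), t ≫ s = 0 → ∃ l : c ⟶ c', q ≫ l = s := by
    intro c' s hs
    choose l hl using fun X => (h X).1
    have wd : ∀ X x y, ap q.hom.hom X x = ap q.hom.hom X y →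
        ap s.hom.hom X x = ap s.hom.hom X y := by
      intro X x y hxy
      obtain ⟨z, hz⟩ := ((h X).2 (x - y)).1 (by rw [map_sub, hxy, sub_self])
      rw [← sub_eq_zero, ← map_sub, ← hz]
      exact congrArg (fun w : f ⟶ c' => ap w.hom.hom X z) hs
    refine ⟨mkCoh (mkNat (fun X =>
      { toFun := fun x => ap s.hom.hom X (l X x)
        map_add' := fun x y => by
          rw [← map_add]
          exact wd X _ _ (by simp [hl])
        map_smul' := fun r x => by
          rw [← map_smul]
          exact wd X _ _ (by simp [hl]) }) fun {X Y} φ x => ?_), ?_⟩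
    · change ap s.hom.hom Y (l Y _) = mp _ φ (ap s.hom.hom X (l X x))
      rw [← ap_mp]
      exact wd Y _ _ (by rw [hl, ap_mp, hl])
    · exact coh_ext fun X x => wd X _ _ (hl X _)
  choose l hl using @this
  refine CokernelCofork.IsColimit.ofπ q h.comp_eq_zero (fun {k'} s hs => l s hs)
    (fun {k'} s hs => hl s hs) fun {k'} s hs m hm => ?_
  refine coh_ext fun X x => ?_
  obtain ⟨y, rfl⟩ := (h X).1 x
  exact congrArg (fun w : g ⟶ k' => ap w.hom.hom X y) (hm.trans (hl s hs).symm)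

instance : HasKernels (Coh K G) where
  has_limit t := by
    obtain ⟨k, i, h⟩ := exists_ptKer t
    exact ⟨⟨_, h.isLimit⟩⟩

instance : HasCokernels (Coh K G) where
  has_colimit t := by
    obtain ⟨k, i, h⟩ := exists_ptCok t
    exact ⟨⟨_, h.isColimit⟩⟩

instance : HasFiniteBiproducts (Coh K G) where
  out n := ⟨fun f => by
    classical
    let P : Coh K G := ⟨piLin fun i => (f i).obj, isCoherent_piLin _ fun i => (f i).property⟩
    let π : ∀ i, P ⟶ f i := fun i => mkCoh (mkNat (fun X => LinearMap.proj i) fun φ x => rfl)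
    let ι : ∀ i, f i ⟶ P := fun i => mkCoh (mkNat (fun X => LinearMap.single K (fun j => (f j).obj.obj.obj X) i) fun φ x => by
      refine funext fun j => ?_
      rw [mp_piLin]
      exact (Pi.apply_single (fun j => mp (f j).obj.obj φ) (fun j => map_zero _) i x j).symm)
    refine hasBiproduct_of_total
      { pt := P
        π := π
        ι := ι
        ι_π := fun i j => ?_ } ?_
    · split_ifs with h
      · subst h
        exact coh_ext fun X x => Pi.single_eq_same (M := fun j => (f j).obj.obj.obj X) i x
      · exact coh_ext fun X x => Pi.single_eq_of_ne (M := fun j => (f j).obj.obj.obj X) (Ne.symm h) x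
    · refine coh_ext fun X x => ?_
      have : ∀ s : Finset (Fin n), ap (∑ j ∈ s, π j ≫ ι j).hom.hom X x =
          ∑ j ∈ s, Pi.single (M := fun j => (f j).obj.obj.obj X) j (x j) := by
        intro s
        induction s using Finset.induction_on with
        | empty => rfl
        | insert a s ha ih => rw [Finset.sum_insert ha, Finset.sum_insert ha, ← ih]; rfl
      refine (this _).trans ?_
      exact Finset.univ_sum_single (M := fun j => (f j).obj.obj.obj X) x⟩

instance : HasEqualizers (Coh K G) := Preadditive.hasEqualizers_of_hasKernels
instance : HasCoequalizers (Coh K G) := Preadditive.hasCoequalizers_of_hasCokernels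
instance : HasBinaryBiproducts (Coh K G) := hasBinaryBiproducts_of_finite_biproducts _

/-- An additive functor that preserves pointwise kernels is left exact. -/
lemma preservesFiniteLimits_of_ptKer (Φ : Coh K G ⥤ Coh K H) [Φ.Additive]
    (h : ∀ {k f g : Coh K G} (i : k ⟶ f) (t : f ⟶ g), PtKer K i.hom.hom t.hom.hom →
      PtKer K (Φ.map i).hom.hom (Φ.map t).hom.hom) : PreservesFiniteLimits Φ := by
  have : ∀ {f g : Coh K G} (t : f ⟶ g), PreservesLimit (parallelPair t 0) Φ := by
    intro f g t
    obtain ⟨k, i, hi⟩ := exists_ptKer t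
    refine preservesLimit_of_preserves_limit_cone hi.isLimit ?_
    exact (KernelFork.isLimitMapConeEquiv _ Φ).symm (IsLimit.ofIsoLimit (h i t hi).isLimit
      (Fork.ext (Iso.refl _) (Category.id_comp _)))
  exact Φ.preservesFiniteLimits_of_preservesKernels

/-- An additive functor that preserves pointwise cokernels is right exact. -/
lemma preservesFiniteColimits_of_ptCok (Φ : Coh K G ⥤ Coh K H) [Φ.Additive]
    (h : ∀ {f g c : Coh K G} (t : f ⟶ g) (q : g ⟶ c), PtCok K t.hom.hom q.hom.hom →
      PtCok K (Φ.map t).hom.hom (Φ.map q).hom.hom) : PreservesFiniteColimits Φ := by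
  have : ∀ {f g : Coh K G} (t : f ⟶ g), PreservesColimit (parallelPair t 0) Φ := by
    intro f g t
    obtain ⟨c, q, hq⟩ := exists_ptCok t
    refine preservesColimit_of_preserves_colimit_cocone hq.isColimit ?_
    exact (CokernelCofork.isColimitMapCoconeEquiv _ Φ).symm (IsColimit.ofIsoColimit
      (h t q hq).isColimit (Cofork.ext (Iso.refl _) (Category.comp_id _)))
  exact Φ.preservesFiniteColimits_of_preservesCokernels

end Category

end

end CoherentFunctors

namespace CoherentFunctors

noncomputable section

/-! ### Representations elementwise -/

section RepElements
variable {K : Type u} [Field K] {G H : Type} [Group G] [Group H]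

/-- The linear map underlying a morphism of representations. -/
def lin {X Y : FDRep.{u} K G} (φ : X ⟶ Y) : X.V →ₗ[K] Y.V := φ.hom.hom.hom

lemma rep_ext {X Y : FDRep.{u} K G} {φ ψ : X ⟶ Y} (h : ∀ x, lin φ x = lin ψ x) : φ = ψ :=
  Action.Hom.ext (FGModuleCat.hom_ext (LinearMap.ext h))

lemma lin_ρ {X Y : FDRep.{u} K G} (φ : X ⟶ Y) (g : G) (x : X.V) :
    lin φ (X.ρ g x) = Y.ρ g (lin φ x) :=
  LinearMap.congr_fun (congrArg (fun t => t.hom.hom) (φ.comm g)) x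

/-- A morphism of representations from an equivariant linear map. -/
def mkRep {X Y : FDRep.{u} K G} (l : X.V →ₗ[K] Y.V) (h : ∀ g x, l (X.ρ g x) = Y.ρ g (l x)) :
    X ⟶ Y where
  hom := FGModuleCat.ofHom l
  comm g := FGModuleCat.hom_ext (LinearMap.ext (h g))

@[simp] lemma lin_mkRep {X Y : FDRep.{u} K G} (l : X.V →ₗ[K] Y.V)
    (h : ∀ g x, l (X.ρ g x) = Y.ρ g (l x)) : lin (mkRep l h) = l := rfl

@[simp] lemma lin_comp {X Y Z : FDRep.{u} K G} (φ : X ⟶ Y) (ψ : Y ⟶ Z) (x : X.V) :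
    lin (φ ≫ ψ) x = lin ψ (lin φ x) := rfl

@[simp] lemma lin_add {X Y : FDRep.{u} K G} (φ ψ : X ⟶ Y) : lin (φ + ψ) = lin φ + lin ψ := rfl

@[simp] lemma lin_smul {X Y : FDRep.{u} K G} (r : K) (φ : X ⟶ Y) : lin (r • φ) = r • lin φ := rfl

@[simp] lemma lin_zero {X Y : FDRep.{u} K G} : lin (0 : X ⟶ Y) = 0 := rfl

lemma lin_injective (X Y : FDRep.{u} K G) :
    Function.Injective (lin : (X ⟶ Y) → (X.V →ₗ[K] Y.V)) := fun _ _ h =>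
  rep_ext fun x => LinearMap.congr_fun h x

variable (K) in
/-- The external tensor product of representations. -/
abbrev box (M : FDRep.{u} K G) (N : FDRep.{u} K H) : FDRep.{u} K (G × H) :=
  ((boxRep K G H).obj M).obj N

/-- The bilinear map `(x, y) ↦ x ⊗ y`. -/
def boxMk (M : FDRep.{u} K G) (N : FDRep.{u} K H) : M.V →ₗ[K] N.V →ₗ[K] (box K M N).V :=
  TensorProduct.mk K M.V N.V

/-- The linear map on `M ⊠ N` induced by a bilinear map. -/
def boxLift {M : FDRep.{u} K G} {N : FDRep.{u} K H} {W : Type*} [AddCommGroup W] [Module K W]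
    (b : M.V →ₗ[K] N.V →ₗ[K] W) : (box K M N).V →ₗ[K] W :=
  TensorProduct.lift b

@[simp] lemma boxLift_mk {M : FDRep.{u} K G} {N : FDRep.{u} K H} {W : Type*} [AddCommGroup W]
    [Module K W] (b : M.V →ₗ[K] N.V →ₗ[K] W) (x : M.V) (y : N.V) :
    boxLift b (boxMk M N x y) = b x y :=
  TensorProduct.lift.tmul x y

lemma box_lin_ext {M : FDRep.{u} K G} {N : FDRep.{u} K H} {W : Type*} [AddCommGroup W] [Module K W]
    {s t : (box K M N).V →ₗ[K] W} (h : ∀ x y, s (boxMk M N x y) = t (boxMk M N x y)) : s = t :=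
  TensorProduct.ext' h

lemma box_ρ (M : FDRep.{u} K G) (N : FDRep.{u} K H) (g : G) (h : H) (x : M.V) (y : N.V) :
    (box K M N).ρ (g, h) (boxMk M N x y) = boxMk M N (M.ρ g x) (N.ρ h y) := rfl

@[simp] lemma lin_boxRep_map {M M' : FDRep.{u} K G} (φ : M ⟶ M') (N : FDRep.{u} K H) (x : M.V)
    (y : N.V) : lin (((boxRep K G H).map φ).app N) (boxMk M N x y) = boxMk M' N (lin φ x) y := rfl

@[simp] lemma lin_boxRep_obj_map (M : FDRep.{u} K G) {N N' : FDRep.{u} K H} (ψ : N ⟶ N') (x : M.V)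
    (y : N.V) : lin (((boxRep K G H).obj M).map ψ) (boxMk M N x y) = boxMk M N' x (lin ψ y) := rfl

lemma box_ext {M : FDRep.{u} K G} {N : FDRep.{u} K H} {Z : FDRep.{u} K (G × H)}
    {φ ψ : box K M N ⟶ Z} (h : ∀ x y, lin φ (boxMk M N x y) = lin ψ (boxMk M N x y)) : φ = ψ :=
  lin_injective _ _ (box_lin_ext h)

/-- A morphism from `M ⊠ N` from an equivariant bilinear map. -/
def boxDesc {M : FDRep.{u} K G} {N : FDRep.{u} K H} {Z : FDRep.{u} K (G × H)}
    (b : M.V →ₗ[K] N.V →ₗ[K] Z.V) (hb : ∀ g h x y, b (M.ρ g x) (N.ρ h y) = Z.ρ (g, h) (b x y)) :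
    box K M N ⟶ Z :=
  mkRep (boxLift b) fun gh x => LinearMap.congr_fun
    (box_lin_ext (s := boxLift b ∘ₗ (box K M N).ρ gh) (t := Z.ρ gh ∘ₗ boxLift b)
      fun x y => by
        rw [LinearMap.comp_apply, LinearMap.comp_apply, box_ρ, boxLift_mk, boxLift_mk, hb]) x

@[simp] lemma boxDesc_mk {M : FDRep.{u} K G} {N : FDRep.{u} K H} {Z : FDRep.{u} K (G × H)}
    (b : M.V →ₗ[K] N.V →ₗ[K] Z.V) (hb : ∀ g h x y, b (M.ρ g x) (N.ρ h y) = Z.ρ (g, h) (b x y))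
    (x : M.V) (y : N.V) : lin (boxDesc b hb) (boxMk M N x y) = b x y :=
  boxLift_mk b x y

instance : (boxRep.{u} K G H).Additive where
  map_add {M M' φ ψ} := NatTrans.ext (funext fun N => box_ext fun x y => by
    change boxMk M' N (lin (φ + ψ) x) y = boxMk M' N (lin φ x) y + boxMk M' N (lin ψ x) y
    rw [lin_add, LinearMap.add_apply, map_add, LinearMap.add_apply])

instance (M : FDRep.{u} K G) : ((boxRep.{u} K G H).obj M).Additive where
  map_add {N N' φ ψ} := box_ext fun x y => by
    change boxMk M N' x (lin (φ + ψ) y) = boxMk M N' x (lin φ y) + boxMk M N' x (lin ψ y)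
    rw [lin_add, LinearMap.add_apply, map_add]

lemma boxRep_obj_map_smul (N N' : FDRep.{u} K H) (ψ : N ⟶ N') (M : FDRep.{u} K G) (r : K) :
    ((boxRep K G H).obj M).map (r • ψ) = r • ((boxRep K G H).obj M).map ψ :=
  box_ext fun x y => by
    change boxMk M N' x (lin (r • ψ) y) = r • boxMk M N' x (lin ψ y)
    rw [lin_smul, LinearMap.smul_apply, map_smul]

lemma boxRep_map_smul (M M' : FDRep.{u} K G) (φ : M ⟶ M') (N : FDRep.{u} K H) (r : K) :
    ((boxRep K G H).map (r • φ)).app N = r • ((boxRep K G H).map φ).app N :=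
  box_ext fun x y => by
    change boxMk M' N (lin (r • φ) x) y = r • boxMk M' N (lin φ x) y
    rw [lin_smul, LinearMap.smul_apply, map_smul, LinearMap.smul_apply]

/-- The external tensor product of morphisms. -/
abbrev boxHom {M M' : FDRep.{u} K G} {N N' : FDRep.{u} K H} (φ : M ⟶ M') (ψ : N ⟶ N') :
    box K M N ⟶ box K M' N' :=
  ((boxRep K G H).map φ).app N ≫ ((boxRep K G H).obj M').map ψ

/-- The bilinear map `(φ, ψ) ↦ φ ⊠ ψ`. -/
def boxHomBil (M X : FDRep.{u} K G) (N Y : FDRep.{u} K H) :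
    (M ⟶ X) →ₗ[K] (N ⟶ Y) →ₗ[K] (box K M N ⟶ box K X Y) :=
  LinearMap.mk₂ K (fun φ ψ => boxHom φ ψ)
    (fun φ φ' ψ => by simp only [boxHom, Functor.map_add, NatTrans.app_add, Preadditive.add_comp])
    (fun r φ ψ => by simp only [boxHom, boxRep_map_smul, CategoryTheory.Linear.smul_comp])
    (fun φ ψ ψ' => by simp only [boxHom, Functor.map_add, Preadditive.comp_add])
    (fun r φ ψ => by simp only [boxHom, boxRep_obj_map_smul, CategoryTheory.Linear.comp_smul])

/-- The canonical map `Hom_G(M, X) ⊗ Hom_H(N, Y) → Hom_{G × H}(M ⊠ N, X ⊠ Y)`. -/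
def boxHomMap (M X : FDRep.{u} K G) (N Y : FDRep.{u} K H) :
    (M ⟶ X) ⊗[K] (N ⟶ Y) →ₗ[K] (box K M N ⟶ box K X Y) :=
  TensorProduct.lift (boxHomBil M X N Y)

@[simp] lemma boxHomMap_tmul {M X : FDRep.{u} K G} {N Y : FDRep.{u} K H} (φ : M ⟶ X) (ψ : N ⟶ Y) :
    boxHomMap M X N Y (φ ⊗ₜ ψ) = boxHom φ ψ := rfl

/-- The linear map underlying a morphism of representations, as a linear function. -/
def linL (X Y : FDRep.{u} K G) : (X ⟶ Y) →ₗ[K] (X.V →ₗ[K] Y.V) where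
  toFun := lin
  map_add' _ _ := rfl
  map_smul' _ _ := rfl

lemma linL_boxHomMap {M X : FDRep.{u} K G} {N Y : FDRep.{u} K H} (z : (M ⟶ X) ⊗[K] (N ⟶ Y)) :
    lin (boxHomMap M X N Y z) = TensorProduct.homTensorHomMap (RingHom.id K) M.V N.V X.V Y.V
      (TensorProduct.map (linL M X) (linL N Y) z) := by
  induction z with
  | zero => rw [map_zero, map_zero, map_zero, lin_zero]; rfl
  | add a b ha hb => rw [map_add, map_add, map_add, lin_add, ha, hb]; rfl
  | tmul φ ψ => exact box_lin_ext fun x y => rfl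

lemma homTensorHomMap_linHom {A B X Y : Type*} [AddCommGroup A] [Module K A] [AddCommGroup B]
    [Module K B] [AddCommGroup X] [Module K X] [AddCommGroup Y] [Module K Y]
    (s : A →ₗ[K] A) (t : X →ₗ[K] X) (s' : B →ₗ[K] B) (t' : Y →ₗ[K] Y)
    (y : (A →ₗ[K] X) ⊗[K] (B →ₗ[K] Y)) :
    TensorProduct.homTensorHomMap (RingHom.id K) A B X Y (TensorProduct.map
      ((LinearMap.llcomp K A X X t) ∘ₗ (LinearMap.lcomp K X s))
      ((LinearMap.llcomp K B Y Y t') ∘ₗ (LinearMap.lcomp K Y s')) y) =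
    TensorProduct.map t t' ∘ₗ TensorProduct.homTensorHomMap (RingHom.id K) A B X Y y ∘ₗ
      TensorProduct.map s s' := by
  induction y with
  | zero => simp only [map_zero, LinearMap.comp_zero, LinearMap.zero_comp]
  | add a b ha hb => simp only [map_add, LinearMap.comp_add, LinearMap.add_comp, ha, hb]
  | tmul φ ψ => exact TensorProduct.ext' fun a b => rfl

lemma boxHomMap_bijective (M X : FDRep.{u} K G) (N Y : FDRep.{u} K H) :
    Function.Bijective (boxHomMap M X N Y) := by
  have bij : Function.Bijective
      (TensorProduct.homTensorHomMap (RingHom.id K) M.V N.V X.V Y.V) := by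
    have : ⇑(TensorProduct.homTensorHomMap (RingHom.id K) M.V N.V X.V Y.V) =
        homTensorHomEquiv K M.V N.V X.V Y.V := funext fun y => (homTensorHomEquiv_apply y).symm
    rw [this]
    exact (homTensorHomEquiv K M.V N.V X.V Y.V).bijective
  have inj := bij.1
  constructor
  · have i : Function.Injective (TensorProduct.map (linL M X) (linL N Y)) :=
      TensorProduct.map_injective_of_flat_flat _ _ (lin_injective M X) (lin_injective N Y)
    intro z z' h
    exact i (inj (by rw [← linL_boxHomMap, ← linL_boxHomMap, h]))
  · intro φ
    obtain ⟨y, hy⟩ := bij.2 (lin φ)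
    have key : ∀ g h, TensorProduct.map (Representation.linHom M.ρ X.ρ g)
        (Representation.linHom N.ρ Y.ρ h) y = y := fun g h => inj (by
      refine (homTensorHomMap_linHom (M.ρ g⁻¹) (X.ρ g) (N.ρ h⁻¹) (Y.ρ h) y).trans ?_
      rw [hy]
      refine LinearMap.ext fun v => ?_
      have e1 := lin_ρ φ (g, h) ((box K M N).ρ (g⁻¹, h⁻¹) v)
      refine e1.symm.trans (congrArg (lin φ) ?_)
      change ((box K M N).ρ (g, h) * (box K M N).ρ (g⁻¹, h⁻¹)) v = v
      rw [← map_mul]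
      simp only [Prod.mk_mul_mk, mul_inv_cancel]
      change (box K M N).ρ 1 v = v
      rw [map_one]; rfl)
    obtain ⟨z, rfl⟩ := range_of_invariant (Representation.linHom M.ρ X.ρ)
      (Representation.linHom N.ρ Y.ρ) y
      (fun g => by simpa [LinearMap.rTensor, Module.End.one_eq_id] using key g 1)
      (fun h => by simpa [LinearMap.lTensor, Module.End.one_eq_id] using key 1 h)
    have mk : ∀ (L : Type) [Group L] (A B : FDRep.{u} K L)
        (a : (Representation.linHom A.ρ B.ρ).invariants), ∃ α : A ⟶ B, lin α = a.1 := by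
      intro L _ A B a
      refine ⟨mkRep a.1 fun g x => ?_, rfl⟩
      have := LinearMap.congr_fun (a.2 g) (A.ρ g x)
      refine this.symm.trans ?_
      change B.ρ g (a.1 (A.ρ g⁻¹ (A.ρ g x))) = _
      rw [Representation.inv_self_apply]
    have : ∀ z : (Representation.linHom M.ρ X.ρ).invariants ⊗[K]
        (Representation.linHom N.ρ Y.ρ).invariants, ∃ z' : (M ⟶ X) ⊗[K] (N ⟶ Y),
        TensorProduct.map (linL M X) (linL N Y) z' =
          TensorProduct.map (Submodule.subtype _) (Submodule.subtype _) z := by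
      intro z
      induction z with
      | zero => exact ⟨0, by simp only [map_zero]⟩
      | add a b ha hb =>
        obtain ⟨a', ha⟩ := ha
        obtain ⟨b', hb⟩ := hb
        exact ⟨a' + b', by simp only [map_add, ha, hb]⟩
      | tmul a b =>
        obtain ⟨α, hα⟩ := mk _ _ _ a
        obtain ⟨β, hβ⟩ := mk _ _ _ b
        exact ⟨α ⊗ₜ β, congrArg₂ (fun x y => x ⊗ₜ[K] y) hα hβ⟩
    obtain ⟨z', hz'⟩ := this z
    refine ⟨z', lin_injective _ _ ?_⟩
    rw [linL_boxHomMap, hz', hy]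

end RepElements

end

end CoherentFunctors

namespace CoherentFunctors

noncomputable section

/-! ### Exactness of bifunctors given by universal bilinear maps -/

section Exactness
variable {K : Type u} [Field K]

section Flip
variable {A B C : Type*} [Category A] [Category B] [Category C] {P : A ⥤ B ⥤ C}
  {f : A ⥤ FGModuleCat.{u} K} {g g' g'' : B ⥤ FGModuleCat.{u} K} {k t : C ⥤ FGModuleCat.{u} K}

/-- A bilinear map with its arguments exchanged. -/
def Bil.flip (β : Bil P f g k) : Bil P.flip g f k where
  fn Y X := (β.fn X Y).flip
  nat_left ψ X y x := β.nat_right X ψ x y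
  nat_right Y _ _ φ y x := β.nat_left φ Y x y

lemma Bil.IsUniv.flip {Q : ObjectProperty (C ⥤ FGModuleCat.{u} K)} {u : Bil P f g t}
    (hu : u.IsUniv Q) : u.flip.IsUniv Q := fun k hk β => by
  obtain ⟨s, hs, hs'⟩ := hu k hk β.flip
  exact ⟨s, fun Y X y x => hs X Y x y, fun s' h => hs' s' fun X Y x y => h Y X y x⟩

/-- A bilinear map descends to a pointwise cokernel in its second argument. -/
lemma Bil.exists_descRight (β : Bil P f g' k) {s : g ⟶ g'} {q : g' ⟶ g''} (h : PtCok K s q)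
    (h0 : ∀ X Y x y, β.fn X Y x (ap s Y y) = 0) :
    ∃ β' : Bil P f g'' k, ∀ X Y x y, β'.fn X Y x (ap q Y y) = β.fn X Y x y := by
  choose l hl using fun Y => (h Y).1
  have wd : ∀ X Y x y y', ap q Y y = ap q Y y' → β.fn X Y x y = β.fn X Y x y' := by
    intro X Y x y y' e
    obtain ⟨z, hz⟩ := ((h Y).2 (y - y')).1 (by rw [map_sub, e, sub_self])
    rw [← sub_eq_zero, ← map_sub, ← hz, h0]
  refine ⟨⟨fun X Y => LinearMap.mk₂ K (fun x y => β.fn X Y x (l Y y))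
    (fun x x' y => by rw [map_add, LinearMap.add_apply])
    (fun r x y => by rw [map_smul, LinearMap.smul_apply])
    (fun x y y' => ?_) (fun r x y => ?_), fun φ Y x y => β.nat_left φ Y x (l Y y),
    fun X Y Y' ψ x y => ?_⟩, fun X Y x y => wd X Y x _ _ (hl Y _)⟩
  · rw [← map_add]
    exact wd _ _ _ _ _ (by rw [map_add, hl, hl, hl])
  · rw [← map_smul]
    exact wd _ _ _ _ _ (by rw [map_smul, hl, hl])
  · change β.fn X Y' x (l Y' (mp g'' ψ y)) = mp k _ (β.fn X Y x (l Y y))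
    rw [← β.nat_right]
    exact wd _ _ _ _ _ (by rw [ap_mp, hl, hl])

variable {D₁ D₂ D₃ : Type*} [Category D₁] [Category D₂] [Category D₃]
  {ι₁ : D₁ ⥤ A ⥤ FGModuleCat.{u} K} {ι₂ : D₂ ⥤ B ⥤ FGModuleCat.{u} K}
  {ι₃ : D₃ ⥤ C ⥤ FGModuleCat.{u} K} {Q : ObjectProperty (C ⥤ FGModuleCat.{u} K)}
  {T : D₁ ⥤ D₂ ⥤ D₃}

/-- Exchanging the arguments of a bifunctor given by universal bilinear maps. -/
def IsTensor.flip (h : IsTensor P Q ι₁ ι₂ ι₃ T) : IsTensor P.flip Q ι₂ ι₁ ι₃ T.flip where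
  bil d₂ d₁ := (h.bil d₁ d₂).flip
  univ d₂ d₁ := (h.univ d₁ d₂).flip
  nat_left s d₁ Y X y x := h.nat_right d₁ s X Y x y
  nat_right d₂ _ _ s Y X y x := h.nat_left s d₂ X Y x y

lemma IsTensor.additive_obj [Preadditive D₂] [Preadditive D₃] [ι₂.Additive] [ι₃.Additive]
    (hι : ι₃.FullyFaithful) (hQ : ∀ d, Q (ι₃.obj d)) (h : IsTensor P Q ι₁ ι₂ ι₃ T) (d₁ : D₁) :
    (T.obj d₁).Additive where
  map_add {d₂ d₂' r s} := h.hom_ext hι hQ fun X Y x y => by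
    rw [h.nat_right, ι₃.map_add, ι₂.map_add]
    change (h.bil d₁ d₂').fn X Y x (ap (ι₂.map r) Y y + ap (ι₂.map s) Y y) =
      ap (ι₃.map ((T.obj d₁).map r)) _ _ + ap (ι₃.map ((T.obj d₁).map s)) _ _
    rw [map_add, h.nat_right, h.nat_right]

end Flip

variable {G H L : Type} [Group G] [Group H] [Group L] {A D₁ : Type*} [Category A] [Category D₁]
  {P : A ⥤ FDRep.{u} K H ⥤ FDRep.{u} K L} {ι₁ : D₁ ⥤ A ⥤ FGModuleCat.{u} K}
  {T : D₁ ⥤ Coh K H ⥤ Coh K L}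

lemma cohι_isLinear (f : Coh K G) : IsLinear K ((cohι K G).obj f) := f.obj.property

/-- A bifunctor given by universal bilinear maps preserves pointwise cokernels. -/
lemma IsTensor.ptCok (h : IsTensor P (IsLinear K) ι₁ (cohι K H) (cohι K L) T) (d : D₁)
    {f g c : Coh K H} (t : f ⟶ g) (q : g ⟶ c) (hq : PtCok K t.hom.hom q.hom.hom) :
    PtCok K ((T.obj d).map t).hom.hom ((T.obj d).map q).hom.hom := by
  have := h.additive_obj (cohιFF K L) cohι_isLinear d
  have w : (T.obj d).map t ≫ (T.obj d).map q = 0 := by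
    rw [← Functor.map_comp, hq.comp_eq_zero, Functor.map_zero]
  have nr : ∀ {g g' : Coh K H} (s : g ⟶ g') X Y x y, ap ((T.obj d).map s).hom.hom _
      ((h.bil d g).fn X Y x y) = (h.bil d g').fn X Y x (ap s.hom.hom Y y) :=
    fun s X Y x y => h.nat_right d s X Y x y
  intro Z
  constructor
  · obtain ⟨c', r, hr⟩ := exists_ptCok ((T.obj d).map q)
    have r0 : r = 0 := h.hom_ext (cohιFF K L) cohι_isLinear fun X Y x y => by
      obtain ⟨y, rfl⟩ := (hq Y).1 y
      have := nr q X Y x y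
      refine (congrArg (ap r.hom.hom _) this.symm).trans ?_
      exact ((hr _).2 _).2 ⟨_, rfl⟩
    intro z
    obtain ⟨y, hy⟩ := ((hr Z).2 z).1 (by rw [r0]; rfl)
    exact ⟨y, hy⟩
  · obtain ⟨c', p, hp⟩ := exists_ptCok ((T.obj d).map t)
    obtain ⟨β, hβ⟩ := ((h.bil d g).comp (𝟙 _) (𝟙 _) p.hom.hom).exists_descRight hq
      (fun X Y x y => by
        have := nr t X Y x y
        refine (congrArg (ap p.hom.hom _) this.symm).trans ?_
        exact ((hp _).2 _).2 ⟨_, rfl⟩)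
    have e : (T.obj d).map q ≫ mkCoh ((h.univ d c).desc (cohι_isLinear c') β) = p :=
      h.hom_ext (cohιFF K L) cohι_isLinear fun X Y x y => by
        refine (congrArg (ap ((h.univ d c).desc (cohι_isLinear c') β) _) (nr q X Y x y)).trans ?_
        rw [Bil.IsUniv.ap_desc, hβ]
        rfl
    intro z
    constructor
    · intro hz
      refine ((hp Z).2 z).1 ?_
      rw [← e]
      change ap _ Z (ap _ Z z) = 0
      rw [hz, map_zero]
    · rintro ⟨y, rfl⟩
      exact congrArg (fun s : (T.obj d).obj f ⟶ _ => ap s.hom.hom Z y) w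

/-- A bifunctor given by universal bilinear maps is right exact. -/
lemma IsTensor.preservesFiniteColimits
    (h : IsTensor P (IsLinear K) ι₁ (cohι K H) (cohι K L) T) (d : D₁) :
    PreservesFiniteColimits (T.obj d) :=
  have := h.additive_obj (cohιFF K L) cohι_isLinear d
  preservesFiniteColimits_of_ptCok _ fun t q hq => h.ptCok d t q hq

end Exactness

/-! ### External tensor products of coherent functors -/

section External
variable (K : Type u) [Field K] (G H : Type) [Group G] [Group H]

section
variable {K G H}
variable {f : FDRep.{u} K G ⥤ FGModuleCat.{u} K} {g : FDRep.{u} K H ⥤ FGModuleCat.{u} K}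
  {t t' : FDRep.{u} K (G × H) ⥤ FGModuleCat.{u} K}
  {M N : FDRep.{u} K G} {M' N' : FDRep.{u} K H} {a : M ⟶ N} {a' : M' ⟶ N'} {e : f.obj M}
  {e' : g.obj M'}

lemma isPres₂_of_isPres_lift {A B C : Type*} [Category A] [Category B] [Category C] [Preadditive C]
    [HasBinaryBiproducts C] {P : A ⥤ B ⥤ C} {t : C ⥤ FGModuleCat.{u} K} {M N : A} {M' N' : B}
    {a : M ⟶ N} {a' : M' ⟶ N'} {w : t.obj ((P.obj M).obj M')}
    (h : IsPres t (biprod.lift ((P.map a).app M') ((P.obj M).map a')) w) :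
    Bil.IsPres₂ P a a' t w where
  gen := h.gen
  rel Z φ := by
    rw [h.rel]
    constructor
    · rintro ⟨ψ, rfl⟩
      refine ⟨biprod.inl ≫ ψ, biprod.inr ≫ ψ, ?_⟩
      rw [← biprod.lift_desc]
      congr 1
      apply biprod.hom_ext' <;> simp
    · rintro ⟨ψ, ψ', rfl⟩
      exact ⟨biprod.desc ψ ψ', by rw [biprod.lift_desc]⟩

/-- Coherent functors have a tensor product, presented by the tensor product of their
presentations. -/
lemma exists_bil (hf : IsPres f a e) (hg : IsPres g a' e') (lf : IsLinear K f)
    (lg : IsLinear K g) : ∃ (t : Coh K (G × H)) (u : Bil (boxRep K G H) f g t.obj.obj),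
      Bil.IsPres₂ (boxRep K G H) a a' t.obj.obj (u.fn M M' e e') ∧ u.IsUniv (IsLinear K) := by
  have := lf.1
  have := lf.2
  have := lg.1
  have := lg.2
  let b := biprod.lift (((boxRep K G H).map a).app M') (((boxRep K G H).obj M).map a')
  have h := isPres₂_of_isPres_lift (isPres_cokerLin K b)
  obtain ⟨u, hu⟩ := h.exists_bil hf hg (fun X Y ψ Z r => boxRep_obj_map_smul X Y ψ Z r)
    (fun X Y φ Z r => boxRep_map_smul X Y φ Z r)
  rw [← hu] at h
  exact ⟨⟨cokerLin K b, isCoherent_cokerLin K b⟩, u, h, h.isUniv hf hg⟩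

/-- A universal bilinear map presents its target. -/
lemma Bil.IsUniv.isPres₂ {u : Bil (boxRep K G H) f g t} (hu : u.IsUniv (IsLinear K))
    (hf : IsPres f a e) (hg : IsPres g a' e') (lf : IsLinear K f) (lg : IsLinear K g)
    (lt : IsLinear K t) : Bil.IsPres₂ (boxRep K G H) a a' t (u.fn M M' e e') := by
  obtain ⟨t', u', h, hu'⟩ := exists_bil hf hg lf lg
  have lt' : IsLinear K t'.obj.obj := t'.obj.property
  have h1 := hu.ap_desc lt' u'
  have h2 := hu'.ap_desc lt u
  have e1 : ∀ Z z, ap (hu'.desc lt u) Z (ap (hu.desc lt' u') Z z) = z := fun Z z => by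
    have : hu.desc lt' u' ≫ hu'.desc lt u = 𝟙 _ := hu.hom_ext lt fun X Y x y => by
      rw [ap_comp, h1, h2]; rfl
    exact congrArg (fun s => ap s Z z) this
  refine ⟨fun Z z => ?_, fun Z φ => ?_⟩
  · obtain ⟨φ, hφ⟩ := h.gen Z (ap (hu.desc lt' u') Z z)
    exact ⟨φ, by rw [← h2, ← ap_mp, hφ, e1]⟩
  · rw [← h.rel, ← h1, ← ap_mp]
    exact (map_eq_zero_iff _ (Function.LeftInverse.injective (e1 Z))).symm

/-- For the external tensor product `t` of coherent functors `f` and `g`, the map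
`f(X) ⊗ g(Y) → t(X ⊠ Y)` is bijective. On representable functors it is the bijection
`Hom(M, X) ⊗ Hom(M', Y) → Hom(M ⊠ M', X ⊠ Y)`. -/
lemma Bil.IsUniv.lift_bijective {u : Bil (boxRep K G H) f g t} (hu : u.IsUniv (IsLinear K))
    (hf : IsPres f a e) (hg : IsPres g a' e') (lf : IsLinear K f) (lg : IsLinear K g)
    (lt : IsLinear K t) (X : FDRep.{u} K G) (Y : FDRep.{u} K H) :
    Function.Bijective (TensorProduct.lift (u.fn X Y)) := by
  have := lf.1
  have := lf.2
  have := lg.1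
  have := lg.2
  have := lt.1
  have := lt.2
  have h := hu.isPres₂ hf hg lf lg lt
  let p : (M ⟶ X) →ₗ[K] f.obj X :=
    { toFun := fun φ => mp f φ e, map_add' := fun φ ψ => mp_add φ ψ e
      map_smul' := fun r φ => mp_smul r φ e }
  let p' : (M' ⟶ Y) →ₗ[K] g.obj Y :=
    { toFun := fun φ => mp g φ e', map_add' := fun φ ψ => mp_add φ ψ e'
      map_smul' := fun r φ => mp_smul r φ e' }
  have key : ∀ z, TensorProduct.lift (u.fn X Y) (TensorProduct.map p p' z) =
      mp t (boxHomMap M X M' Y z) (u.fn M M' e e') := by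
    intro z
    induction z with
    | zero => rw [map_zero, map_zero, map_zero, mp_zero]
    | add a b ha hb => rw [map_add, map_add, map_add, mp_add, ha, hb]
    | tmul φ ψ =>
      rw [TensorProduct.map_tmul, TensorProduct.lift.tmul, boxHomMap_tmul]
      change u.fn X Y (mp f φ e) (mp g ψ e') = _
      rw [u.nat_right, u.nat_left, mp_comp]
  have hp : Function.Surjective p := hf.gen X
  have hp' : Function.Surjective p' := hg.gen Y
  constructor
  · rw [injective_iff_map_eq_zero]
    intro y hy
    obtain ⟨z, rfl⟩ := TensorProduct.map_surjective hp hp' y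
    rw [key, h.rel] at hy
    obtain ⟨ψ, ψ', hψ⟩ := hy
    obtain ⟨w, rfl⟩ := (boxHomMap_bijective N X M' Y).2 ψ
    obtain ⟨w', rfl⟩ := (boxHomMap_bijective M X N' Y).2 ψ'
    have e1 : ∀ w, ((boxRep K G H).map a).app M' ≫ boxHomMap N X M' Y w = boxHomMap M X M' Y
        ((CategoryTheory.Linear.leftComp K X a).rTensor _ w) := by
      intro w
      induction w with
      | zero => simp only [map_zero, comp_zero]
      | add a b ha hb => simp only [map_add, Preadditive.comp_add, ha, hb]
      | tmul φ ψ => exact box_ext fun x y => rfl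
    have e2 : ∀ w, ((boxRep K G H).obj M).map a' ≫ boxHomMap M X N' Y w = boxHomMap M X M' Y
        ((CategoryTheory.Linear.leftComp K Y a').lTensor _ w) := by
      intro w
      induction w with
      | zero => simp only [map_zero, comp_zero]
      | add a b ha hb => simp only [map_add, Preadditive.comp_add, ha, hb]
      | tmul φ ψ => exact box_ext fun x y => rfl
    rw [e1, e2, ← map_add] at hψ
    rw [(boxHomMap_bijective M X M' Y).1 hψ, map_add]
    have z1 : p ∘ₗ CategoryTheory.Linear.leftComp K X a = 0 :=
      LinearMap.ext fun φ => (hf.rel X _).2 ⟨φ, rfl⟩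
    have z2 : p' ∘ₗ CategoryTheory.Linear.leftComp K Y a' = 0 :=
      LinearMap.ext fun φ => (hg.rel Y _).2 ⟨φ, rfl⟩
    rw [← LinearMap.comp_apply, ← LinearMap.comp_apply, LinearMap.map_comp_rTensor,
      LinearMap.map_comp_lTensor, z1, z2, TensorProduct.map_zero_left,
      TensorProduct.map_zero_right, LinearMap.zero_apply, LinearMap.zero_apply, add_zero]
  · intro z
    obtain ⟨φ, rfl⟩ := h.gen _ z
    obtain ⟨w, rfl⟩ := (boxHomMap_bijective M X M' Y).2 φ
    exact ⟨_, key w⟩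

end

lemma exists_leftTensor : ∃ E : Coh K G ⥤ Coh K H ⥤ Coh K (G × H),
    Nonempty (IsTensor (boxRep K G H) (IsLinear K) (cohι K G) (cohι K H) (cohι K (G × H)) E) := by
  refine exists_isTensor _ _ (cohιFF K _) cohι_isLinear fun f g => ?_
  obtain ⟨M, N, a, e, hf⟩ := (isCoherent_iff K f.obj).1 f.property
  obtain ⟨M', N', a', e', hg⟩ := (isCoherent_iff K g.obj).1 g.property
  obtain ⟨t, u, -, hu⟩ := exists_bil hf hg (cohι_isLinear f) (cohι_isLinear g)
  exact ⟨t, u, hu⟩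

/-- The external tensor product `⊠_ℓ` of coherent functors. -/
def leftTensor : Coh K G ⥤ Coh K H ⥤ Coh K (G × H) := (exists_leftTensor K G H).choose

/-- The universal bilinear maps of the external tensor product. -/
def leftTensorIsTensor : IsTensor (boxRep K G H) (IsLinear K) (cohι K G) (cohι K H)
    (cohι K (G × H)) (leftTensor K G H) := (exists_leftTensor K G H).choose_spec.some

variable {G H} in
/-- A presentation of a representable functor. -/
lemma isPres_h (M : FDRep.{u} K G) :
    IsPres ((hLin K G).obj (.op M)).obj (0 : M ⟶ M) (𝟙 M : M ⟶ M) where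
  gen X x := ⟨x, Category.id_comp (X := M) (Y := X) x⟩
  rel X φ := by
    have : mp ((hLin K G).obj (.op M)).obj φ (𝟙 M : M ⟶ M) = φ := Category.id_comp φ
    rw [this]
    constructor
    · intro h
      exact ⟨0, h.symm ▸ comp_zero⟩
    · rintro ⟨ψ, hψ⟩
      rw [zero_comp] at hψ
      exact hψ.symm

variable {K G H} in
lemma boxHom_comp_left {M X X' : FDRep.{u} K G} {N Y : FDRep.{u} K H} (α : M ⟶ X) (φ : X ⟶ X')
    (β : N ⟶ Y) : boxHom (α ≫ φ) β = boxHom α β ≫ ((boxRep K G H).map φ).app Y :=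
  box_ext fun _ _ => rfl

variable {K G H} in
lemma boxHom_comp_right {M X : FDRep.{u} K G} {N Y Y' : FDRep.{u} K H} (α : M ⟶ X) (β : N ⟶ Y)
    (ψ : Y ⟶ Y') : boxHom α (β ≫ ψ) = boxHom α β ≫ ((boxRep K G H).obj X).map ψ :=
  box_ext fun _ _ => rfl

/-- The bilinear map `(φ, ψ) ↦ φ ⊠ ψ` of representable functors. -/
def hBil (M : FDRep.{u} K G) (N : FDRep.{u} K H) : Bil (boxRep K G H)
    ((hLin K G).obj (.op M)).obj ((hLin K H).obj (.op N)).obj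
    ((hLin K (G × H)).obj (.op (box K M N))).obj where
  fn X Y := boxHomBil M X N Y
  nat_left φ _ x y := boxHom_comp_left x φ y
  nat_right _ _ _ ψ x y := boxHom_comp_right x y ψ

lemma hBil_isUniv (M : FDRep.{u} K G) (N : FDRep.{u} K H) :
    (hBil K G H M N).IsUniv (IsLinear K) := by
  have e0 : (hBil K G H M N).fn M N (𝟙 M : M ⟶ M) (𝟙 N : N ⟶ N) = (𝟙 (box K M N) : _ ⟶ _) :=
    box_ext fun _ _ => rfl
  have h := isPres_h K (box K M N)
  refine Bil.IsPres₂.isUniv (isPres_h K M) (isPres_h K N) _ ⟨?_, ?_⟩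
  · rw [e0]
    exact h.gen
  · intro Z φ
    rw [e0]
    refine (h.rel Z φ).trans ⟨?_, ?_⟩
    · rintro ⟨ψ, rfl⟩
      exact ⟨0, 0, by simp⟩
    · rintro ⟨ψ, ψ', rfl⟩
      exact ⟨0, by simp⟩

/-- The bifunctor `(M, N) ↦ h_{M ⊠ N}` is given by universal bilinear maps. -/
def hBoxIsTensor : IsTensor (boxRep K G H) (IsLinear K) (hFun K G ⋙ cohι K G)
    (hFun K H ⋙ cohι K H) (cohι K (G × H)) (hBox K G H) where
  bil M N := hBil K G H M.unop N.unop
  univ M N := hBil_isUniv K G H M.unop N.unop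
  nat_left _ _ _ _ _ _ := box_ext fun _ _ => rfl
  nat_right _ _ _ _ _ _ _ _ := box_ext fun _ _ => rfl

instance : (cohι K G).Additive where

lemma leftTensor_isRightExact₂ : IsRightExact₂ (leftTensor K G H) :=
  ⟨(leftTensorIsTensor K G H).preservesFiniteColimits,
    (leftTensorIsTensor K G H).flip.preservesFiniteColimits⟩

lemma leftTensor_isLeftExternalTensor : IsLeftExternalTensor K (leftTensor K G H) where
  rightExact := leftTensor_isRightExact₂ K G H
  onRepresentables := by
    obtain ⟨σ, -⟩ := ((leftTensorIsTensor K G H).precomp (hFun K G) (hFun K H)).exists_iso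
      (cohιFF K _) cohι_isLinear (hBoxIsTensor K G H)
    exact ⟨σ⟩

end External

/-! ### Exactness of induction -/

section Induction
variable (K : Type u) [Field K] {G H : Type} [Group G] [Group H] [Finite G] (φ : H →* G)

instance : (indCoh K φ).Additive where

lemma indCoh_preservesFiniteLimits : PreservesFiniteLimits (indCoh K φ) :=
  preservesFiniteLimits_of_ptKer _ fun _ _ h X => h ((resRep K φ).obj X)

lemma indCoh_preservesFiniteColimits : PreservesFiniteColimits (indCoh K φ) :=
  preservesFiniteColimits_of_ptCok _ fun _ _ h X => h ((resRep K φ).obj X)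

end Induction

end

end CoherentFunctors

namespace CoherentFunctors

noncomputable section

/-! ### The bilinear map `f, g → f ⊙ g` -/

section Odot
variable (K : Type u) [Field K] {G H : Type} [Group G] [Group H]

/-- The map `y ↦ x ⊗ y`, as a morphism of representations of `H` that depends linearly on `x`. -/
def boxIns (X : FDRep.{u} K G) (Y : FDRep.{u} K H) :
    X.V →ₗ[K] (Y ⟶ (resRep K (MonoidHom.inr G H)).obj (box K X Y)) where
  toFun x := mkRep (boxMk X Y x) fun h y => by
    change _ = (box K X Y).ρ (1, h) (boxMk X Y x y)
    rw [box_ρ, map_one]; rfl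
  map_add' x x' := rep_ext fun y => by
    change boxMk X Y (x + x') y = boxMk X Y x y + boxMk X Y x' y
    rw [map_add, LinearMap.add_apply]
  map_smul' r x := rep_ext fun y => by
    change boxMk X Y (r • x) y = r • boxMk X Y x y
    rw [map_smul, LinearMap.smul_apply]

lemma evalRight_ρ (g : LinFun K H) (Z : FDRep.{u} K (G × H)) (a : G)
    (z : ((evalRight K G g).obj Z).V) :
    ((evalRight K G g).obj Z).ρ a z = mp g.obj (actLeft K Z a) z := rfl

lemma boxIns_ρ (X : FDRep.{u} K G) (Y : FDRep.{u} K H) (a : G) (x : X.V) :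
    boxIns K X Y (X.ρ a x) = boxIns K X Y x ≫ actLeft K (box K X Y) a :=
  rep_ext fun y => by
    change boxMk X Y (X.ρ a x) y = (box K X Y).ρ (a, 1) (boxMk X Y x y)
    rw [box_ρ, map_one]; rfl

lemma boxIns_map_left {X X' : FDRep.{u} K G} (φ : X ⟶ X') (Y : FDRep.{u} K H) (x : X.V) :
    boxIns K X' Y (lin φ x) = boxIns K X Y x ≫
      (resRep K (MonoidHom.inr G H)).map (((boxRep K G H).map φ).app Y) :=
  rep_ext fun _ => rfl

lemma boxIns_map_right (X : FDRep.{u} K G) {Y Y' : FDRep.{u} K H} (ψ : Y ⟶ Y') (x : X.V) :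
    ψ ≫ boxIns K X Y' x = boxIns K X Y x ≫
      (resRep K (MonoidHom.inr G H)).map (((boxRep K G H).obj X).map ψ) :=
  rep_ext fun _ => rfl

/-- For `b ∈ g(Y)`, the map `X → g(X ⊠ Y)` that sends `x` to the image of `b` under
`y ↦ x ⊗ y`. -/
def evIns (g : LinFun K H) (X : FDRep.{u} K G) (Y : FDRep.{u} K H) :
    g.obj.obj Y →ₗ[K] (X ⟶ (evalRight K G g).obj (box K X Y)) where
  toFun b := mkRep
    { toFun := fun x => mp g.obj (boxIns K X Y x) b
      map_add' := fun x x' => by rw [map_add, mp_add]; rfl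
      map_smul' := fun r x => by rw [map_smul, mp_smul]; rfl }
    fun a x => by
      rw [evalRight_ρ]
      change mp g.obj (boxIns K X Y (X.ρ a x)) b = mp g.obj _ (mp g.obj (boxIns K X Y x) b)
      rw [boxIns_ρ, mp_comp]
  map_add' b b' := rep_ext fun x => map_add (mp g.obj (boxIns K X Y x)) b b'
  map_smul' r b := rep_ext fun x => map_smul (mp g.obj (boxIns K X Y x)) r b

lemma evIns_map_left (g : LinFun K H) {X X' : FDRep.{u} K G} (φ : X ⟶ X') (Y : FDRep.{u} K H)
    (b : g.obj.obj Y) : φ ≫ evIns K g X' Y b =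
      evIns K g X Y b ≫ (evalRight K G g).map (((boxRep K G H).map φ).app Y) :=
  rep_ext fun x => by
    change mp g.obj (boxIns K X' Y (lin φ x)) b =
      mp g.obj ((resRep K (MonoidHom.inr G H)).map _) (mp g.obj (boxIns K X Y x) b)
    rw [boxIns_map_left, mp_comp]

lemma evIns_map_right (g : LinFun K H) (X : FDRep.{u} K G) {Y Y' : FDRep.{u} K H} (ψ : Y ⟶ Y')
    (b : g.obj.obj Y) : evIns K g X Y' (mp g.obj ψ b) =
      evIns K g X Y b ≫ (evalRight K G g).map (((boxRep K G H).obj X).map ψ) :=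
  rep_ext fun x => by
    change mp g.obj (boxIns K X Y' x) (mp g.obj ψ b) =
      mp g.obj ((resRep K (MonoidHom.inr G H)).map _) (mp g.obj (boxIns K X Y x) b)
    rw [← mp_comp, boxIns_map_right, mp_comp]

/-- The bilinear map `f(X) × g(Y) → f(g(X ⊠ Y))`. -/
def odotBil (f : LinFun K G) (g : LinFun K H) :
    Bil (boxRep K G H) f.obj g.obj (((odot K G H).obj f).obj g).obj where
  fn X Y := LinearMap.mk₂ K (fun x y => mp f.obj (evIns K g X Y y) x)
    (fun x x' y => map_add _ x x') (fun r x y => map_smul _ r x)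
    (fun x y y' => by rw [map_add, mp_add]; rfl) (fun r x y => by rw [map_smul, mp_smul]; rfl)
  nat_left φ Y x y := by
    change mp f.obj (evIns K g _ Y y) (mp f.obj φ x) =
      mp f.obj ((evalRight K G g).map _) (mp f.obj (evIns K g _ Y y) x)
    rw [← mp_comp, ← mp_comp, evIns_map_left]
  nat_right X Y Y' ψ x y := by
    change mp f.obj (evIns K g X Y' (mp g.obj ψ y)) x =
      mp f.obj ((evalRight K G g).map _) (mp f.obj (evIns K g X Y y) x)
    rw [← mp_comp, evIns_map_right]

/-- The evaluation `Hom_H(N, Z) ⊠ N → Z`. -/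
def evalBox (N : FDRep.{u} K H) (Z : FDRep.{u} K (G × H)) :
    box K ((evalRight K G ((hLin K H).obj (.op N))).obj Z) N ⟶ Z :=
  boxDesc (M := (evalRight K G ((hLin K H).obj (.op N))).obj Z)
    (linL N ((resRep K (MonoidHom.inr G H)).obj Z)) fun a h w n =>
    (congrArg (Z.ρ (a, 1)) (lin_ρ (Y := (resRep K (MonoidHom.inr G H)).obj Z) w h n)).trans <| by
      change (Z.ρ (a, 1) * Z.ρ (1, h)) _ = _
      rw [← map_mul]
      simp only [Prod.mk_mul_mk, mul_one, one_mul]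
      rfl

/-- If `g` is representable, then `f ⊙ g` is the external tensor product of `f` and `g`. -/
lemma odotBil_isUniv (f : LinFun K G) (N : FDRep.{u} K H) :
    (odotBil K f ((hLin K H).obj (.op N))).IsUniv (IsLinear K) := by
  intro k hk β
  let g := (hLin K H).obj (.op N)
  let i : g.obj.obj N := (𝟙 N : N ⟶ N)
  refine ⟨mkNat (fun Z => mp k (evalBox K N Z) ∘ₗ
      (β.fn ((evalRight K G g).obj Z) N).flip i) fun {Z Z'} ζ x => ?_, ?_, ?_⟩
  · change mp k (evalBox K N Z') (β.fn ((evalRight K G g).obj Z') N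
      (mp f.obj ((evalRight K G g).map ζ) x) i) = mp k ζ (mp k (evalBox K N Z) (β.fn _ N x i))
    refine (congrArg (mp k _) (β.nat_left ((evalRight K G g).map ζ) N x i)).trans ?_
    refine (mp_comp ..).symm.trans ?_
    refine Eq.trans ?_ (mp_comp (evalBox K N Z) ζ _)
    exact congrArg (fun t => mp k t _) (box_ext fun w n => rfl)
  · intro X Y x b
    change mp k (evalBox K N (box K X Y)) (β.fn ((evalRight K G g).obj (box K X Y)) N
      (mp f.obj (evIns K g X Y b) x) i) = _
    have hb : mp g.obj b i = b := Category.id_comp (X := N) (Y := Y) b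
    refine (congrArg (mp k _) (β.nat_left (evIns K g X Y b) N x i)).trans ?_
    refine (mp_comp ..).symm.trans ?_
    refine Eq.trans ?_ (congrArg (β.fn X Y x) hb)
    refine Eq.trans ?_ (β.nat_right X b x i).symm
    exact congrArg (fun t => mp k t _) (box_ext fun w n => rfl)
  · intro s hs
    refine nat_ext fun Z x => ?_
    change f.obj.obj ((evalRight K G g).obj Z) at x
    have e : (odotBil K f g).fn ((evalRight K G g).obj Z) N x i =
        mp f.obj (evIns K g ((evalRight K G g).obj Z) N i) x := rfl
    have e1 : evIns K g ((evalRight K G g).obj Z) N i ≫ (evalRight K G g).map (evalBox K N Z) =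
        𝟙 _ := rep_ext fun w => rep_ext (Y := (resRep K (MonoidHom.inr G H)).obj Z) fun n => rfl
    have e2 : x = mp (((odot K G H).obj f).obj g).obj (evalBox K N Z)
        ((odotBil K f g).fn ((evalRight K G g).obj Z) N x i) := by
      refine (mp_id _ x).symm.trans ?_
      rw [← e1, mp_comp]
      rfl
    refine (congrArg (ap s Z) e2).trans ?_
    rw [ap_mp, hs]
    rfl

end Odot

end

end CoherentFunctors

namespace CoherentFunctors

noncomputable section

/-! ### The values of `f ⊙ g` at external tensor products -/

/-- If `W` has a basis `w` and `U` is the direct sum of the images of the maps `b(w j, -)`, with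
projections `q j`, then `b` identifies `W ⊗ V` with `U`. -/
lemma lift_bijective_of_projections {K W V U : Type*} [Field K] [AddCommGroup W] [Module K W]
    [AddCommGroup V] [Module K V] [AddCommGroup U] [Module K U] {ι : Type*} [Fintype ι]
    [DecidableEq ι] (w : Module.Basis ι K W) (b : W →ₗ[K] V →ₗ[K] U) (q : ι → U →ₗ[K] V)
    (hq : ∀ i j v, q j (b (w i) v) = if i = j then v else 0)
    (hs : ∀ u, ∑ j, b (w j) (q j u) = u) : Function.Bijective (TensorProduct.lift b) := by
  let r : U →ₗ[K] W ⊗[K] V := ∑ j, TensorProduct.mk K W V (w j) ∘ₗ q j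
  have hr : ∀ u, r u = ∑ j, w j ⊗ₜ[K] q j u := fun u => by simp [r]
  have e : r ∘ₗ TensorProduct.lift b = LinearMap.id := by
    refine TensorProduct.ext (w.ext fun i => LinearMap.ext fun v => ?_)
    change r (TensorProduct.lift b (w i ⊗ₜ v)) = w i ⊗ₜ v
    rw [TensorProduct.lift.tmul, hr, Finset.sum_eq_single i]
    · rw [hq, if_pos rfl]
    · intro j _ hj
      rw [hq, if_neg hj.symm, TensorProduct.tmul_zero]
    · simp
  refine ⟨Function.LeftInverse.injective (LinearMap.congr_fun e), fun u => ⟨r u, ?_⟩⟩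
  rw [hr, map_sum]
  exact hs u

section Odot
variable {K : Type u} [Field K] {G H : Type} [Group G] [Group H]

lemma lin_smul_id (X : FDRep.{u} K G) (r : K) (x : X.V) : lin (r • 𝟙 X) x = r • x := rfl

lemma lin_sum {X Y : FDRep.{u} K G} {ι : Type*} (s : Finset ι) (φ : ι → (X ⟶ Y)) (x : X.V) :
    lin (∑ j ∈ s, φ j) x = ∑ j ∈ s, lin (φ j) x := by
  change linL X Y (∑ j ∈ s, φ j) x = _
  rw [map_sum, LinearMap.sum_apply]
  rfl

/-- The projection `X ⊠ Y → Y` defined by a linear form on `X`. -/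
def boxProj (X : FDRep.{u} K G) (Y : FDRep.{u} K H) (ξ : X.V →ₗ[K] K) :
    (resRep K (MonoidHom.inr G H)).obj (box K X Y) ⟶ Y :=
  mkRep (boxLift (M := X) (N := Y) ((LinearMap.lsmul K Y.V).comp ξ)) fun h z => by
    have e : boxLift (M := X) (N := Y) ((LinearMap.lsmul K Y.V).comp ξ) ∘ₗ (box K X Y).ρ (1, h) =
        Y.ρ h ∘ₗ boxLift (M := X) (N := Y) ((LinearMap.lsmul K Y.V).comp ξ) :=
      box_lin_ext fun x y => by
        rw [LinearMap.comp_apply, LinearMap.comp_apply, box_ρ, boxLift_mk, boxLift_mk, map_one]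
        exact (map_smul (Y.ρ h) (ξ x) y).symm
    exact LinearMap.congr_fun e z

lemma lin_boxProj (X : FDRep.{u} K G) (Y : FDRep.{u} K H) (ξ : X.V →ₗ[K] K) (x : X.V) (y : Y.V) :
    lin (boxProj X Y ξ) (boxMk X Y x y) = ξ x • y := boxLift_mk _ _ _

lemma boxIns_boxProj (X : FDRep.{u} K G) (Y : FDRep.{u} K H) (ξ : X.V →ₗ[K] K) (x : X.V) :
    boxIns K X Y x ≫ boxProj X Y ξ = ξ x • 𝟙 Y :=
  rep_ext fun y => (lin_boxProj X Y ξ x y).trans (lin_smul_id _ _ _).symm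

lemma sum_boxProj_boxIns (X : FDRep.{u} K G) (Y : FDRep.{u} K H) {ι : Type*} [Fintype ι]
    (w : Module.Basis ι K X.V) :
    ∑ j, boxProj X Y (w.coord j) ≫ boxIns K X Y (w j) = 𝟙 _ := by
  have e : ∀ x y, lin (∑ j, boxProj X Y (w.coord j) ≫ boxIns K X Y (w j)) (boxMk X Y x y) =
      boxMk X Y x y := fun x y => by
    refine (lin_sum _ _ _).trans ?_
    have : ∀ j, lin (boxProj X Y (w.coord j) ≫ boxIns K X Y (w j)) (boxMk X Y x y) =
        boxMk X Y (w.coord j x • w j) y := fun j => by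
      change boxMk X Y (w j) (lin (boxProj X Y (w.coord j)) (boxMk X Y x y)) = _
      rw [lin_boxProj, map_smul, map_smul, LinearMap.smul_apply]
    refine (Finset.sum_congr rfl fun j _ => this j).trans ?_
    exact ((map_sum ((boxMk X Y).flip y) _ _).symm).trans
      (congrArg (fun z => boxMk X Y z y) (w.sum_repr x))
  have e' : lin (∑ j, boxProj X Y (w.coord j) ≫ boxIns K X Y (w j)) =
    (LinearMap.id : (box K X Y).V →ₗ[K] (box K X Y).V) := box_lin_ext e
  exact rep_ext (LinearMap.congr_fun e')

/-- The bilinear map `(x, y) ↦ g(x ⊗ -)(y)` from `X × g(Y)` to `g(X ⊠ Y)`. -/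
def evBil (g : LinFun K H) (X : FDRep.{u} K G) (Y : FDRep.{u} K H) :
    X.V →ₗ[K] g.obj.obj Y →ₗ[K] g.obj.obj ((resRep K (MonoidHom.inr G H)).obj (box K X Y)) :=
  LinearMap.mk₂ K (fun x y => mp g.obj (boxIns K X Y x) y)
    (fun x x' y => by rw [map_add, mp_add]) (fun r x y => by rw [map_smul, mp_smul])
    (fun x y y' => map_add _ y y') (fun r x y => map_smul _ r y)

lemma evBil_apply (g : LinFun K H) (X : FDRep.{u} K G) (Y : FDRep.{u} K H) (x : X.V)
    (y : g.obj.obj Y) : evBil g X Y x y = mp g.obj (boxIns K X Y x) y := rfl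

lemma lift_evBil_bijective (g : LinFun K H) (X : FDRep.{u} K G) (Y : FDRep.{u} K H) :
    Function.Bijective (TensorProduct.lift (evBil g X Y)) := by
  classical
  let w := Module.finBasis K X.V
  refine lift_bijective_of_projections w _ (fun j => mp g.obj (boxProj X Y (w.coord j))) ?_ ?_
  · intro i j v
    rw [evBil_apply, ← mp_comp, boxIns_boxProj, mp_smul, mp_id, Module.Basis.coord_apply,
      w.repr_self, Finsupp.single_apply, ite_smul, one_smul, zero_smul]
  · intro z
    simp only [evBil_apply, ← mp_comp]
    rw [← mp_sum, sum_boxProj_boxIns, mp_id]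

/-- The projection `g(X ⊠ Y) ≅ X ⊗ g(Y) → X` defined by a linear form on `g(Y)`. -/
lemma exists_evProj (g : LinFun K H) (X : FDRep.{u} K G) (Y : FDRep.{u} K H)
    (θ : g.obj.obj Y →ₗ[K] K) : ∃ π : (evalRight K G g).obj (box K X Y) ⟶ X,
      ∀ x y, lin π (evBil g X Y x y) = θ y • x := by
  let e := LinearEquiv.ofBijective _ (lift_evBil_bijective g X Y)
  have he : ∀ x y, e.symm (evBil g X Y x y) = x ⊗ₜ y := fun x y =>
    e.symm_apply_eq.2 (TensorProduct.lift.tmul _ _).symm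
  let p : g.obj.obj ((resRep K (MonoidHom.inr G H)).obj (box K X Y)) →ₗ[K] X.V :=
    TensorProduct.lift ((LinearMap.lsmul K X.V).flip.compl₂ θ) ∘ₗ e.symm.toLinearMap
  have hp : ∀ x y, p (evBil g X Y x y) = θ y • x := fun x y => by
    change TensorProduct.lift _ (e.symm (evBil g X Y x y)) = _
    rw [he, TensorProduct.lift.tmul]
    rfl
  refine ⟨mkRep (X := (evalRight K G g).obj (box K X Y)) p fun a z => ?_, hp⟩
  obtain ⟨z, rfl⟩ := (lift_evBil_bijective g X Y).2 z
  have : p ∘ₗ mp g.obj (actLeft K (box K X Y) a) ∘ₗ TensorProduct.lift (evBil g X Y) =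
      X.ρ a ∘ₗ p ∘ₗ TensorProduct.lift (evBil g X Y) := TensorProduct.ext' fun x y => by
    have e1 : mp g.obj (actLeft K (box K X Y) a) (evBil g X Y x y) = evBil g X Y (X.ρ a x) y := by
      rw [evBil_apply, evBil_apply, boxIns_ρ, mp_comp]
    simp only [LinearMap.comp_apply, TensorProduct.lift.tmul]
    rw [hp, map_smul, e1, hp]
  exact LinearMap.congr_fun this z

/-- The map `f(X) ⊗ g(Y) → (f ⊙ g)(X ⊠ Y)` is bijective, since `g(X ⊠ Y) ≅ X ⊗ g(Y)` is a sum of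
copies of `X`. -/
lemma lift_odotBil_bijective (f : LinFun K G) (g : LinFun K H) (X : FDRep.{u} K G)
    (Y : FDRep.{u} K H) : Function.Bijective (TensorProduct.lift ((odotBil K f g).fn X Y)) := by
  classical
  let w := Module.finBasis K (g.obj.obj Y)
  choose π hπ using exists_evProj g X Y
  have h1 : ∀ y θ, evIns K g X Y y ≫ π θ = θ y • 𝟙 X := fun y θ => rep_ext fun x =>
    (hπ θ x y).trans (lin_smul_id _ _ _).symm
  have h2 : ∑ j, π (w.coord j) ≫ evIns K g X Y (w j) = 𝟙 _ := by
    refine rep_ext fun z => (lin_sum _ _ _).trans ?_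
    obtain ⟨z, rfl⟩ := (lift_evBil_bijective g X Y).2 z
    let F : ∀ j, X.V ⊗[K] g.obj.obj Y →ₗ[K]
        g.obj.obj ((resRep K (MonoidHom.inr G H)).obj (box K X Y)) := fun j =>
      (evBil g X Y).flip (w j) ∘ₗ lin (π (w.coord j)) ∘ₗ TensorProduct.lift (evBil g X Y)
    have : ∑ j, F j = TensorProduct.lift (evBil g X Y) :=
      TensorProduct.ext' fun x y => by
        rw [LinearMap.sum_apply, TensorProduct.lift.tmul]
        have : ∀ j, F j (x ⊗ₜ y) = evBil g X Y x (w.coord j y • w j) := fun j => by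
          refine (congrArg (fun z => evBil g X Y (lin (π (w.coord j)) z) (w j))
            (TensorProduct.lift.tmul x y)).trans ?_
          refine (congrArg (fun z => evBil g X Y z (w j)) (hπ _ x y)).trans ?_
          rw [map_smul, map_smul]
          rfl
        exact (Finset.sum_congr rfl fun j _ => this j).trans ((map_sum (evBil g X Y x) _ _).symm.trans
          (congrArg (evBil g X Y x) (w.sum_repr y)))
    exact (LinearMap.sum_apply _ F z).symm.trans (LinearMap.congr_fun this z)
  have key := lift_bijective_of_projections w ((odotBil K f g).fn X Y).flip
    (fun j => mp f.obj (π (w.coord j))) (fun i j v => by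
      change mp f.obj (π (w.coord j)) (mp f.obj (evIns K g X Y (w i)) v) = _
      rw [← mp_comp, h1, mp_smul, mp_id, Module.Basis.coord_apply,
        w.repr_self, Finsupp.single_apply, ite_smul, one_smul, zero_smul]) (fun z => by
      refine (Finset.sum_congr rfl fun j _ => (mp_comp (f := f.obj) (π (w.coord j))
        (evIns K g X Y (w j)) z).symm).trans ?_
      exact (mp_sum (f := f.obj) _ _ z).symm.trans ((congrArg (fun t => mp f.obj t z) h2).trans
        (mp_id (f := f.obj) ((evalRight K G g).obj (box K X Y)) z)))
  have e : ⇑(TensorProduct.lift ((odotBil K f g).fn X Y)) =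
      ⇑(TensorProduct.lift ((odotBil K f g).fn X Y).flip) ∘ ⇑(TensorProduct.comm K _ _) := by
    have : TensorProduct.lift ((odotBil K f g).fn X Y) =
        TensorProduct.lift ((odotBil K f g).fn X Y).flip ∘ₗ
          (TensorProduct.comm K _ _).toLinearMap := TensorProduct.ext' fun x y => rfl
    rw [this]
    rfl
  rw [e]
  exact key.comp (TensorProduct.comm K _ _).bijective

/-! ### Coherence of `f ⊙ g` -/

/-- `h_M ⊙ g` is coherent: `Hom_G(M, V)` is the kernel of a map between finite powers of `V`. -/
lemma isCoherent_odot_h [Finite G] [Finite H] (M : FDRep.{u} K G) (g : LinFun K H)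
    (hg : IsCoherent K g) :
    IsCoherent K (((odot K G H).obj ((hLin K G).obj (.op M))).obj g) := by
  let w := Module.finBasis K M.V
  let g' : LinFun K (G × H) := (indLin K (MonoidHom.inr G H)).obj g
  have hg' : IsCoherent K g' := isCoherent_indLin K _ g hg
  let ι := Fin (Module.finrank K M.V)
  let V : FDRep.{u} K (G × H) → Type u := fun Z =>
    g.obj.obj ((resRep K (MonoidHom.inr G H)).obj Z)
  -- a family `v` of vectors is sent to the defects of equivariance of the map `w j ↦ v j`
  let T : ∀ Z, (ι → V Z) →ₗ[K] (G × ι → V Z) := fun Z =>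
    LinearMap.pi fun p => ((w.constr K : (ι → V Z) ≃ₗ[K] _).toLinearMap.flip (M.ρ p.1 (w p.2))) -
      mp g.obj (actLeft K Z p.1) ∘ₗ LinearMap.proj p.2
  have hT : ∀ Z v a j, T Z v (a, j) = w.constr K v (M.ρ a (w j)) -
      mp g.obj (actLeft K Z a) (v j) := fun _ _ _ _ => rfl
  have nT : ∀ {Z Z'} (ζ : Z ⟶ Z') (v : ι → V Z) (p : G × ι),
      T Z' (fun j => mp g.obj ((resRep K (MonoidHom.inr G H)).map ζ) (v j)) p =
        mp g.obj ((resRep K (MonoidHom.inr G H)).map ζ) (T Z v p) := by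
    rintro Z Z' ζ v ⟨a, j⟩
    rw [hT, hT, map_sub, ← mp_comp, ← mp_comp]
    congr 1
    · have : w.constr K (fun j => mp g.obj ((resRep K (MonoidHom.inr G H)).map ζ) (v j)) =
          mp g.obj ((resRep K (MonoidHom.inr G H)).map ζ) ∘ₗ w.constr K v :=
        w.ext fun j => by
          rw [LinearMap.comp_apply, Module.Basis.constr_basis, Module.Basis.constr_basis]
      rw [this]
      rfl
    · exact congrArg (fun t => mp g.obj t (v j)) (rep_ext fun z => (lin_ρ ζ (a, 1) z).symm)
  have eT : ∀ Z (v : ι → V Z), T Z v = 0 → ∀ a x, w.constr K v (M.ρ a x) =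
      mp g.obj (actLeft K Z a) (w.constr K v x) := by
    intro Z v h a x
    have : (w.constr K v) ∘ₗ M.ρ a = mp g.obj (actLeft K Z a) ∘ₗ w.constr K v :=
      w.ext fun j => by
        rw [LinearMap.comp_apply, LinearMap.comp_apply, Module.Basis.constr_basis]
        exact sub_eq_zero.1 (congrFun h (a, j))
    exact LinearMap.congr_fun this x
  refine isCoherent_of_ptKer (f := piLin fun _ : ι => g') (g := piLin fun _ : G × ι => g')
    (i := ObjectProperty.homMk (mkNat (fun Z => LinearMap.pi fun j =>
      (linL M ((evalRight K G g).obj Z)).flip (w j)) fun {Z Z'} ζ x => rfl))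
    (t := ObjectProperty.homMk (mkNat T fun {Z Z'} ζ v => funext (nT ζ v)))
    (isCoherent_piLin _ fun _ => hg') (isCoherent_piLin _ fun _ => hg') fun Z => ⟨?_, ?_⟩
  · intro φ φ' h
    have : lin (Y := (evalRight K G g).obj Z) φ = lin (Y := (evalRight K G g).obj Z) φ' :=
      w.ext fun j => congrFun h j
    exact lin_injective M ((evalRight K G g).obj Z) this
  · intro v
    constructor
    · intro h
      exact ⟨mkRep (Y := (evalRight K G g).obj Z) (w.constr K v) (eT Z v h),
        funext fun j => w.constr_basis K v j⟩
    · rintro ⟨φ, rfl⟩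
      refine funext fun p => sub_eq_zero.2 ?_
      have : w.constr K (fun j => lin (Y := (evalRight K G g).obj Z) φ (w j)) =
          lin (Y := (evalRight K G g).obj Z) φ := w.ext fun j => w.constr_basis K _ j
      refine (LinearMap.congr_fun this _).trans ?_
      exact lin_ρ (Y := (evalRight K G g).obj Z) φ p.1 (w p.2)

lemma isCoherent_odot [Finite G] [Finite H] (f : LinFun K G) (g : LinFun K H)
    (hf : IsCoherent K f) (hg : IsCoherent K g) : IsCoherent K (((odot K G H).obj f).obj g) := by
  obtain ⟨M, N, a, e, hp⟩ := (isCoherent_iff K f).1 hf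
  refine isCoherent_of_ptCok (f := ((odot K G H).obj ((hLin K G).obj (.op N))).obj g)
    (g := ((odot K G H).obj ((hLin K G).obj (.op M))).obj g)
    (t := ((odot K G H).map ((hLin K G).map a.op)).app g)
    (q := ObjectProperty.homMk (mkNat (fun Z =>
      { toFun := fun φ => mp f.obj (X := M) (Y := (evalRight K G g).obj Z) φ e
        map_add' := fun φ φ' => mp_add (f := f.obj) (X := M) (Y := (evalRight K G g).obj Z) φ φ' e
        map_smul' := fun r φ => mp_smul (f := f.obj) (X := M)
          (Y := (evalRight K G g).obj Z) r φ e }) fun {Z Z'} ζ φ =>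
        mp_comp (f := f.obj) (X := M) (Y := (evalRight K G g).obj Z) φ
          ((evalRight K G g).map ζ) e))
    (isCoherent_odot_h N g hg) (isCoherent_odot_h M g hg) fun Z => ⟨?_, ?_⟩
  · exact hp.gen ((evalRight K G g).obj Z)
  · exact hp.rel ((evalRight K G g).obj Z)

end Odot

end

end CoherentFunctors

namespace CoherentFunctors

noncomputable section

/-! ### The comparison of `⊠_ℓ` and `⊙` -/

section Comparison
variable (K : Type u) [Field K] (G H : Type) [Group G] [Group H]

/-- The bifunctor `⊙` on coherent functors, with values regarded as linear functors. -/
def odotCoh : Coh K G ⥤ Coh K H ⥤ LinFun K (G × H) :=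
  Coh.incl K G ⋙ odot K G H ⋙ (Functor.whiskeringLeft _ _ _).obj (Coh.incl K H)

/-- The external tensor product, with values regarded as linear functors, is given by universal
bilinear maps. -/
def leftTensorInclIsTensor : IsTensor (boxRep K G H) (IsLinear K) (cohι K G) (cohι K H)
    (ObjectProperty.ι (IsLinear K))
    (leftTensor K G H ⋙ (Functor.whiskeringRight _ _ _).obj (Coh.incl K (G × H))) where
  bil := (leftTensorIsTensor K G H).bil
  univ := (leftTensorIsTensor K G H).univ
  nat_left := (leftTensorIsTensor K G H).nat_left
  nat_right := (leftTensorIsTensor K G H).nat_right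

lemma exists_comparison :
    ∃ τ : leftTensor K G H ⋙ (Functor.whiskeringRight _ _ _).obj (Coh.incl K (G × H)) ⟶
      odotCoh K G H, ∀ f g X Y x y, ap ((τ.app f).app g).hom _
        (((leftTensorIsTensor K G H).bil f g).fn X Y x y) = (odotBil K f.obj g.obj).fn X Y x y :=
  (leftTensorInclIsTensor K G H).exists_hom (T' := odotCoh K G H)
    (ObjectProperty.fullyFaithfulι _) (fun d => d.property)
    (fun f g => odotBil K f.obj g.obj) (fun {f f'} s g X Y x y => ap_mp s.hom.hom _ x)
    (fun f {g g'} s X Y x y => by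
      change mp f.obj.obj ((evalRightMap K s.hom).app _) (mp f.obj.obj (evIns K g.obj X Y y) x) =
        mp f.obj.obj (evIns K g'.obj X Y (ap s.hom.hom Y y)) x
      rw [← mp_comp]
      congr 2
      exact rep_ext fun z => ap_mp s.hom.hom (boxIns K X Y z) y)

/-- The comparison morphism `f ⊠_ℓ g ⟶ f ⊙ g`. -/
def comparison : leftTensor K G H ⋙ (Functor.whiskeringRight _ _ _).obj (Coh.incl K (G × H)) ⟶
    odotCoh K G H := (exists_comparison K G H).choose

variable {K G H}

lemma comparison_bil (f : Coh K G) (g : Coh K H) (X : FDRep.{u} K G) (Y : FDRep.{u} K H)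
    (x : f.obj.obj.obj X) (y : g.obj.obj.obj Y) : ap (((comparison K G H).app f).app g).hom _
      (((leftTensorIsTensor K G H).bil f g).fn X Y x y) = (odotBil K f.obj g.obj).fn X Y x y :=
  (exists_comparison K G H).choose_spec f g X Y x y

/-- A natural transformation between the targets of two universal bilinear maps that respects
them is an isomorphism. -/
lemma Bil.IsUniv.bijective_of_comp {A B C : Type*} [Category A] [Category B] [Category C]
    {P : A ⥤ B ⥤ C} {f : A ⥤ FGModuleCat.{u} K} {g : B ⥤ FGModuleCat.{u} K}
    {t t' : C ⥤ FGModuleCat.{u} K} {Q : ObjectProperty (C ⥤ FGModuleCat.{u} K)}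
    {u : Bil P f g t} {u' : Bil P f g t'} (hu : u.IsUniv Q) (hu' : u'.IsUniv Q) (ht : Q t)
    (ht' : Q t') (s : t ⟶ t') (hs : ∀ X Y x y, ap s _ (u.fn X Y x y) = u'.fn X Y x y) (Z : C) :
    Function.Bijective (ap s Z) := by
  have e1 : s ≫ hu'.desc ht u = 𝟙 _ := hu.hom_ext ht fun X Y x y => by
    rw [ap_comp, hs, Bil.IsUniv.ap_desc]; rfl
  have e2 : hu'.desc ht u ≫ s = 𝟙 _ := hu'.hom_ext ht' fun X Y x y => by
    rw [ap_comp, Bil.IsUniv.ap_desc, hs]; rfl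
  exact Function.bijective_iff_has_inverse.2 ⟨ap (hu'.desc ht u) Z,
    fun z => congrArg (fun r => ap r Z z) e1, fun z => congrArg (fun r => ap r Z z) e2⟩

lemma comparison_h_bijective (f : Coh K G) (N : (FDRep.{u} K H)ᵒᵖ) (Z : FDRep.{u} K (G × H)) :
    Function.Bijective (ap (((comparison K G H).app f).app ((hFun K H).obj N)).hom Z) :=
  ((leftTensorIsTensor K G H).univ f ((hFun K H).obj N)).bijective_of_comp
    (odotBil_isUniv K f.obj N.unop) (ObjectProperty.FullSubcategory.property _)
    (ObjectProperty.FullSubcategory.property _) _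
    (comparison_bil f ((hFun K H).obj N)) Z

/-- A projective coherent functor is a retract of a representable functor. -/
lemma exists_retract (g : Coh K G) [Projective g] :
    ∃ (N : (FDRep.{u} K G)ᵒᵖ) (i : g ⟶ (hFun K G).obj N) (r : (hFun K G).obj N ⟶ g),
      i ≫ r = 𝟙 g := by
  obtain ⟨M, N, a, e, hp⟩ := (isCoherent_iff K g.obj).1 g.property
  let q : (hFun K G).obj (.op M) ⟶ g := mkCoh (mkNat (fun Z =>
      { toFun := fun φ => mp g.obj.obj (X := M) (Y := Z) φ e
        map_add' := fun φ φ' => mp_add (f := g.obj.obj) (X := M) (Y := Z) φ φ' e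
        map_smul' := fun r φ => mp_smul (f := g.obj.obj) (X := M) (Y := Z) r φ e })
      fun {Z Z'} ζ φ => mp_comp (f := g.obj.obj) (X := M) (Y := Z) φ ζ e)
  have : Epi q := ⟨fun s t h => coh_ext fun X x => by
    obtain ⟨φ, rfl⟩ := hp.gen X x
    exact congrArg (fun r => ap r.hom.hom X φ) h⟩
  exact ⟨.op M, Projective.factorThru (𝟙 g) q, q, Projective.factorThru_comp _ _⟩

lemma comparison_bijective (f : Coh K G) (g : Coh K H) [Projective g] (Z : FDRep.{u} K (G × H)) :
    Function.Bijective (ap (((comparison K G H).app f).app g).hom Z) := by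
  obtain ⟨N, i, r, hir⟩ := exists_retract g
  have hN := comparison_h_bijective f N Z
  let E := (leftTensor K G H).obj f
  let O := (odotCoh K G H).obj f
  let τ : ∀ g, (E.obj g).obj.obj.obj Z →ₗ[K] (O.obj g).obj.obj Z := fun g =>
    ap (((comparison K G H).app f).app g).hom Z
  have nat : ∀ {g g' : Coh K H} (s : g ⟶ g') z, τ g' (ap (E.map s).hom.hom Z z) =
      ap (O.map s).hom Z (τ g z) := fun s z =>
    congrArg (fun t => ap t.hom Z z) (((comparison K G H).app f).naturality s)
  have e1 : ∀ z, ap (E.map r).hom.hom Z (ap (E.map i).hom.hom Z z) = z := fun z => by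
    have : E.map i ≫ E.map r = 𝟙 _ := by rw [← Functor.map_comp, hir, CategoryTheory.Functor.map_id]
    exact congrArg (fun t => ap t.hom.hom Z z) this
  have e2 : ∀ z, ap (O.map r).hom Z (ap (O.map i).hom Z z) = z := fun z => by
    have : O.map i ≫ O.map r = 𝟙 _ := by rw [← Functor.map_comp, hir, CategoryTheory.Functor.map_id]
    exact congrArg (fun t => ap t.hom Z z) this
  constructor
  · intro z z' h
    rw [← e1 z, ← e1 z']
    refine congrArg _ (hN.1 ?_)
    change τ _ _ = τ _ _
    rw [nat, nat]
    exact congrArg _ h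
  · intro y
    obtain ⟨z, hz⟩ := hN.2 (ap (O.map i).hom Z y)
    refine ⟨ap (E.map r).hom.hom Z z, (nat r z).trans ?_⟩
    exact (congrArg _ hz).trans (e2 y)

lemma isIso_of_ap_bijective {E : Type*} [Category E] [Preadditive E] [CategoryTheory.Linear K E]
    {f g : (IsLinear K (E := E)).FullSubcategory} (t : f ⟶ g)
    (h : ∀ X, Function.Bijective (ap t.hom X)) : IsIso t :=
  have : IsIso ((ObjectProperty.ι (IsLinear K (E := E))).map t) := isIso_of_bijective _ h
  isIso_of_reflects_iso t (ObjectProperty.ι _)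

/-! ### Exactness of `⊠_ℓ` -/

/-- If `g` is projective, then `- ⊠_ℓ g` preserves kernels, since it is `f ↦ f ⊙ g`. -/
lemma leftTensor_ptKer_left (g : Coh K H) [Projective g] {k f f' : Coh K G} (i : k ⟶ f)
    (t : f ⟶ f') (h : PtKer K i.hom.hom t.hom.hom) :
    PtKer K (((leftTensor K G H).map i).app g).hom.hom
      (((leftTensor K G H).map t).app g).hom.hom := by
  intro Z
  have nat : ∀ {f f' : Coh K G} (s : f ⟶ f') z,
      ap (((comparison K G H).app f').app g).hom Z
        (ap (((leftTensor K G H).map s).app g).hom.hom Z z) =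
      ap s.hom.hom ((evalRight K G g.obj).obj Z)
        (ap (((comparison K G H).app f).app g).hom Z z) := fun s z =>
    congrArg (fun t => ap t.hom Z z) (congrArg (fun t => NatTrans.app t g)
      ((comparison K G H).naturality s))
  have b : ∀ f, Function.Bijective (ap (((comparison K G H).app f).app g).hom Z) :=
    fun f => comparison_bijective f g Z
  obtain ⟨h1, h2⟩ := h ((evalRight K G g.obj).obj Z)
  constructor
  · intro z z' e
    apply (b k).1
    apply h1
    refine (nat i z).symm.trans (Eq.trans ?_ (nat i z'))
    exact congrArg _ e
  · intro z
    constructor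
    · intro hz
      obtain ⟨y, hy⟩ := (h2 (ap (((comparison K G H).app f).app g).hom Z z)).1
        ((nat t z).symm.trans ((congrArg _ hz).trans (map_zero _)))
      obtain ⟨y, rfl⟩ := (b k).2 y
      exact ⟨y, (b f).1 ((nat i y).trans hy)⟩
    · rintro ⟨y, rfl⟩
      apply (b f').1
      refine (nat t _).trans (Eq.trans ?_ (map_zero _).symm)
      exact (h2 _).2 ⟨_, (nat i y).symm⟩

/-! ### Exchanging the groups -/

/-- The exchange `Y ⊠ X → X ⊠ Y`. -/
def boxSwap (X : FDRep.{u} K G) (Y : FDRep.{u} K H) :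
    box K Y X ⟶ (resRep K (MulEquiv.prodComm : H × G ≃* G × H).toMonoidHom).obj (box K X Y) :=
  boxDesc (Z := (resRep K (MulEquiv.prodComm : H × G ≃* G × H).toMonoidHom).obj (box K X Y))
    (boxMk X Y).flip fun h g y x => (box_ρ X Y g h x y).symm

/-- Restriction of representations of `G × H` to representations of `H × G`. -/
abbrev resSwap (K : Type u) [Field K] (G H : Type) [Group G] [Group H] :
    FDRep.{u} K (G × H) ⥤ FDRep.{u} K (H × G) :=
  resRep K (MulEquiv.prodComm : H × G ≃* G × H).toMonoidHom

/-- Exchanging the groups in a bilinear map. -/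
def Bil.swap {f : FDRep.{u} K G ⥤ FGModuleCat.{u} K} {g : FDRep.{u} K H ⥤ FGModuleCat.{u} K}
    {k : FDRep.{u} K (H × G) ⥤ FGModuleCat.{u} K} (β : Bil (boxRep K H G) g f k) :
    Bil (boxRep K G H) f g (resSwap K G H ⋙ k) where
  fn X Y := (β.fn Y X).flip.compr₂ (mp k (boxSwap X Y))
  nat_left {X X'} φ Y x y := by
    change mp k (boxSwap X' Y) (β.fn Y X' y (mp f φ x)) =
      mp k ((resSwap K G H).map _) (mp k (boxSwap X Y) (β.fn Y X y x))
    rw [β.nat_right, ← mp_comp, ← mp_comp]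
    exact congrArg (fun t => mp k t _) (box_ext fun _ _ => rfl)
  nat_right X {Y Y'} ψ x y := by
    change mp k (boxSwap X Y') (β.fn Y' X (mp g ψ y) x) =
      mp k ((resSwap K G H).map _) (mp k (boxSwap X Y) (β.fn Y X y x))
    rw [β.nat_left, ← mp_comp, ← mp_comp]
    exact congrArg (fun t => mp k t _) (box_ext fun _ _ => rfl)

lemma Bil.swap_fn {f : FDRep.{u} K G ⥤ FGModuleCat.{u} K} {g : FDRep.{u} K H ⥤ FGModuleCat.{u} K}
    {k : FDRep.{u} K (H × G) ⥤ FGModuleCat.{u} K} (β : Bil (boxRep K H G) g f k)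
    (X : FDRep.{u} K G) (Y : FDRep.{u} K H) (x : f.obj X) (y : g.obj Y) :
    β.swap.fn X Y x y = mp k (boxSwap X Y) (β.fn Y X y x) := rfl

lemma resSwap_isLinear {k : FDRep.{u} K (H × G) ⥤ FGModuleCat.{u} K} (hk : IsLinear K k) :
    IsLinear K (resSwap K G H ⋙ k) :=
  ((indLin K (MulEquiv.prodComm : H × G ≃* G × H).toMonoidHom).obj ⟨k, hk⟩).property

/-- Restriction along the exchange of the groups is an involution. -/
def unswap (Z : FDRep.{u} K (G × H)) : (resSwap K H G).obj ((resSwap K G H).obj Z) ⟶ Z :=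
  mkRep (X := (resSwap K H G).obj ((resSwap K G H).obj Z)) (Y := Z) (LinearMap.id : Z.V →ₗ[K] Z.V)
    fun _ _ => rfl

lemma Bil.IsUniv.swap {f : FDRep.{u} K G ⥤ FGModuleCat.{u} K}
    {g : FDRep.{u} K H ⥤ FGModuleCat.{u} K} {k : FDRep.{u} K (H × G) ⥤ FGModuleCat.{u} K}
    {β : Bil (boxRep K H G) g f k} (h : β.IsUniv (IsLinear K)) : β.swap.IsUniv (IsLinear K) := by
  intro k' hk' γ
  let d := h.desc (resSwap_isLinear hk') γ.swap
  have hd : ∀ X Y x y, ap d _ (β.fn Y X y x) = mp k' (boxSwap Y X) (γ.fn X Y x y) :=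
    fun X Y x y => h.ap_desc (resSwap_isLinear hk') γ.swap Y X y x
  refine ⟨mkNat (fun Z => mp k' (unswap Z) ∘ₗ ap d ((resSwap K G H).obj Z)) fun {Z Z'} ζ z => ?_,
    fun X Y x y => ?_, fun s hs => ?_⟩
  · change mp k' (unswap Z') (ap d _ (mp k ((resSwap K G H).map ζ) z)) =
      mp k' ζ (mp k' (unswap Z) (ap d _ z))
    rw [ap_mp, ← mp_comp]
    refine (mp_comp (f := k') ((resSwap K H G).map ((resSwap K G H).map ζ)) (unswap Z') _).symm.trans
      ?_
    exact congrArg (fun t => mp k' t (ap d ((resSwap K G H).obj Z) z)) (rep_ext fun _ => rfl)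
  · change mp k' (unswap _) (ap d _ (mp k (boxSwap X Y) (β.fn Y X y x))) = γ.fn X Y x y
    rw [ap_mp, hd]
    refine (mp_comp (f := k') _ _ _).symm.trans ?_
    refine (mp_comp (f := k') _ _ _).symm.trans ?_
    refine Eq.trans ?_ (mp_id _ _)
    exact congrArg (fun t => mp k' t (γ.fn X Y x y)) (box_ext fun _ _ => rfl)
  · refine nat_ext fun Z z => ?_
    let z' : k.obj ((resSwap K G H).obj Z) := z
    let r : k ⟶ resSwap K H G ⋙ k' := mkNat (fun W => ap s ((resSwap K H G).obj W) ∘ₗ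
      mp k (mkRep (X := W) (Y := (resSwap K G H).obj ((resSwap K H G).obj W))
        (LinearMap.id : W.V →ₗ[K] W.V) fun _ _ => rfl)) fun {W W'} ω w => by
      change ap s _ (mp k _ (mp k ω w)) = mp k' ((resSwap K H G).map ω) (ap s _ (mp k _ w))
      rw [← ap_mp, ← mp_comp]
      refine congrArg (ap s _) ?_
      refine Eq.trans ?_ (mp_comp (f := k) _ ((resSwap K G H).map ((resSwap K H G).map ω)) w)
      exact congrArg (fun t => mp k t w) (rep_ext fun _ => rfl)
    have hr : r = d := h.hom_ext (resSwap_isLinear hk') fun Y X y x => by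
      rw [hd, ← hs, Bil.swap_fn, ← ap_mp]
      change ap s _ (mp k _ (β.fn Y X y x)) = _
      refine congrArg (ap s _) ?_
      refine Eq.trans ?_ (mp_comp (f := k) _ ((resSwap K G H).map (boxSwap Y X)) _)
      exact congrArg (fun t => mp k t (β.fn Y X y x)) (box_ext fun _ _ => rfl)
    change ap s Z z' = mp k' (unswap Z) (ap d _ z')
    rw [← hr]
    change _ = mp k' (unswap Z) (ap s _ (mp k _ z'))
    rw [← ap_mp]
    refine congrArg (ap s Z) ?_
    refine Eq.trans (mp_id _ _).symm ?_
    refine Eq.trans ?_ (mp_comp (f := k) _ ((resSwap K G H).map (unswap Z)) z')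
    exact congrArg (fun t => mp k t z') (rep_ext fun _ => rfl)

variable (K G H)

/-- The external tensor product of coherent functors on `H` and `G`, regarded as a functor on
`G × H`. -/
def leftTensorSwap [Finite G] [Finite H] : Coh K G ⥤ Coh K H ⥤ Coh K (G × H) :=
  (leftTensor K H G).flip ⋙ (Functor.whiskeringRight _ _ _).obj
    (indCoh K (MulEquiv.prodComm : H × G ≃* G × H).toMonoidHom)

/-- The exchanged external tensor product is given by universal bilinear maps. -/
def leftTensorSwapIsTensor [Finite G] [Finite H] : IsTensor (boxRep K G H) (IsLinear K) (cohι K G)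
    (cohι K H) (cohι K (G × H)) (leftTensorSwap K G H) where
  bil f g := ((leftTensorIsTensor K H G).bil g f).swap
  univ f g := ((leftTensorIsTensor K H G).univ g f).swap
  nat_left {f f'} s g X Y x y := by
    refine (ap_mp ((leftTensor K H G).obj g |>.map s).hom.hom (boxSwap X Y) _).trans ?_
    exact congrArg _ ((leftTensorIsTensor K H G).nat_right g s Y X y x)
  nat_right f {g g'} s X Y x y := by
    refine (ap_mp (((leftTensor K H G).map s).app f).hom.hom (boxSwap X Y) _).trans ?_
    exact congrArg _ ((leftTensorIsTensor K H G).nat_left s f Y X y x)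

variable {K G H}

/-- If `f` is projective, then `f ⊠_ℓ -` preserves kernels. -/
lemma leftTensor_ptKer_right [Finite G] [Finite H] (f : Coh K G) [Projective f] {k g g' : Coh K H}
    (i : k ⟶ g) (t : g ⟶ g') (h : PtKer K i.hom.hom t.hom.hom) :
    PtKer K (((leftTensor K G H).obj f).map i).hom.hom
      (((leftTensor K G H).obj f).map t).hom.hom := by
  obtain ⟨σ, -⟩ := (leftTensorIsTensor K G H).exists_iso (cohιFF K _) cohι_isLinear
    (leftTensorSwapIsTensor K G H)
  intro Z
  let τ : ∀ g : Coh K H, (((leftTensor K G H).obj f).obj g).obj.obj.obj Z →ₗ[K]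
      (((leftTensorSwap K G H).obj f).obj g).obj.obj.obj Z := fun g =>
    ap ((cohι K (G × H)).map ((σ.hom.app f).app g)) Z
  have b : ∀ g, Function.Bijective (τ g) := fun g => ap_bijective _ Z
  have nat : ∀ {g g' : Coh K H} (s : g ⟶ g') z,
      τ g' (ap (((leftTensor K G H).obj f).map s).hom.hom Z z) =
        ap (((leftTensor K H G).map s).app f).hom.hom ((resSwap K G H).obj Z) (τ g z) :=
    fun s z => congrArg (fun t => ap t.hom.hom Z z) ((σ.hom.app f).naturality s)
  obtain ⟨h1, h2⟩ := leftTensor_ptKer_left f i t h ((resSwap K G H).obj Z)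
  constructor
  · intro z z' e
    apply (b k).1
    apply h1
    refine (nat i z).symm.trans (Eq.trans ?_ (nat i z'))
    exact congrArg _ e
  · intro z
    constructor
    · intro hz
      obtain ⟨y, hy⟩ := (h2 (τ g z)).1 ((nat t z).symm.trans ((congrArg _ hz).trans (map_zero _)))
      obtain ⟨y, rfl⟩ := (b k).2 y
      exact ⟨y, (b g).1 ((nat i y).trans hy)⟩
    · rintro ⟨y, rfl⟩
      apply (b g').1
      refine (nat t _).trans (Eq.trans ?_ (map_zero _).symm)
      exact (h2 _).2 ⟨_, (nat i y).symm⟩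

variable (K G H) in
lemma leftTensor_isBalanced [Finite G] [Finite H] : IsBalanced (leftTensor K G H) := by
  constructor
  · intro f hf
    have := (leftTensorIsTensor K G H).additive_obj (cohιFF K _) cohι_isLinear f
    exact ⟨preservesFiniteLimits_of_ptKer _ fun i t h => leftTensor_ptKer_right f i t h,
      (leftTensor_isRightExact₂ K G H).1 f⟩
  · intro g hg
    have := (leftTensorIsTensor K G H).flip.additive_obj (cohιFF K _) cohι_isLinear g
    exact ⟨preservesFiniteLimits_of_ptKer _ fun i t h => leftTensor_ptKer_left g i t h,
      (leftTensor_isRightExact₂ K G H).2 g⟩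

end Comparison

/-! ### Products of coherent functors on symmetric groups -/

section Symmetric
variable (K : Type u) [Field K] (m n : ℕ)

/-- The product `f ⊗_ℓ g` of coherent functors on symmetric groups. -/
def tensorL : Coh K (SymGp m) ⥤ Coh K (SymGp n) ⥤ Coh K (SymGp (m + n)) :=
  indTensor K (leftTensor K (SymGp m) (SymGp n))

lemma tensorL_isRightExact₂ : IsRightExact₂ (tensorL K m n) := by
  have := indCoh_preservesFiniteColimits K (young m n)
  have h := leftTensor_isRightExact₂ K (SymGp m) (SymGp n)
  constructor
  · intro f
    have := h.1 f
    exact comp_preservesFiniteColimits ((leftTensor K _ _).obj f) (indCoh K (young m n))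
  · intro g
    have := h.2 g
    exact comp_preservesFiniteColimits ((leftTensor K _ _).flip.obj g) (indCoh K (young m n))

lemma tensorL_isBalanced : IsBalanced (tensorL K m n) := by
  have := indCoh_preservesFiniteLimits K (young m n)
  have h := leftTensor_isBalanced K (SymGp m) (SymGp n)
  constructor
  · intro f hf
    have := (h.1 f hf).1
    exact ⟨comp_preservesFiniteLimits ((leftTensor K _ _).obj f) (indCoh K (young m n)),
      (tensorL_isRightExact₂ K m n).1 f⟩
  · intro g hg
    have := (h.2 g hg).1
    exact ⟨comp_preservesFiniteLimits ((leftTensor K _ _).flip.obj g) (indCoh K (young m n)),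
      (tensorL_isRightExact₂ K m n).2 g⟩

lemma isCoherent_dot (f : Coh K (SymGp m)) (g : Coh K (SymGp n)) :
    IsCoherent K (((dot K m n).obj f).obj g) :=
  isCoherent_indLin K _ _ (isCoherent_odot _ _ f.property g.property)

/-- The comparison morphism `f ⊗_ℓ g ⟶ f · g`. -/
def comparisonL : tensorL K m n ⋙ (Functor.whiskeringRight _ _ _).obj
    (Coh.incl K (SymGp (m + n))) ⟶ dot K m n :=
  Functor.whiskerRight (comparison K (SymGp m) (SymGp n))
    ((Functor.whiskeringRight _ _ _).obj (indLin K (young m n)))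

variable {m n}

lemma isIso_comparisonL (f : Coh K (SymGp m)) (g : Coh K (SymGp n)) [Projective g] :
    IsIso (((comparisonL K m n).app f).app g) :=
  isIso_of_ap_bijective _ fun X => comparison_bijective f g ((resRep K (young m n)).obj X)

lemma isIso_comparisonL_h (f : Coh K (SymGp m)) (N : (FDRep.{u} K (SymGp n))ᵒᵖ) :
    IsIso (((comparisonL K m n).app f).app ((hFun K (SymGp n)).obj N)) :=
  isIso_of_ap_bijective _ fun X => comparison_h_bijective f N ((resRep K (young m n)).obj X)

variable (m n)

lemma indLinH_naturality {G H : Type} [Group G] [Group H] [Finite G] (φ : H →* G)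
    {N N' : FDRep.{u} K H} (a : N ⟶ N') (X : FDRep.{u} K G) (x : (indRep K φ).obj N' ⟶ X) :
    frobenius K φ N X ((indRep K φ).map a ≫ x) = a ≫ frobenius K φ N' X x := rfl

/-- `h_{Ind N} ≅ Ind h_N`, naturally in `N`. -/
def indCohH {G H : Type} [Group G] [Group H] [Finite G] (φ : H →* G) :
    (indRep K φ).op ⋙ hFun K G ≅ hFun K H ⋙ indCoh K φ :=
  NatIso.ofComponents (fun N => ObjectProperty.isoMk _ (indLinH K φ N.unop)) fun a =>
    coh_ext fun X x => indLinH_naturality K φ a.unop X x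

lemma tensorL_h : Nonempty (hFun K (SymGp m) ⋙ tensorL K m n ⋙
    (Functor.whiskeringLeft _ _ _).obj (hFun K (SymGp n)) ≅ hTens K m n) := by
  obtain ⟨σ⟩ := (leftTensor_isLeftExternalTensor K (SymGp m) (SymGp n)).onRepresentables
  let σ' := Functor.isoWhiskerRight σ ((Functor.whiskeringRight _ _ _).obj (indCoh K (young m n)))
  let ρ := Functor.isoWhiskerLeft ((boxRep K (SymGp m) (SymGp n)).op ⋙ Functor.opHom _ _)
    ((Functor.whiskeringRight (FDRep.{u} K (SymGp n))ᵒᵖ _ _).mapIso (indCohH K (young m n)))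
  exact ⟨σ' ≪≫ ρ.symm⟩

lemma hTens_dot : Nonempty (hTens K m n ⋙ (Functor.whiskeringRight _ _ _).obj
      (Coh.incl K (SymGp (m + n))) ≅
    hFun K (SymGp m) ⋙ dot K m n ⋙ (Functor.whiskeringLeft _ _ _).obj (hFun K (SymGp n))) := by
  obtain ⟨σ⟩ := tensorL_h K m n
  let τ := Functor.whiskerLeft (hFun K (SymGp m)) (Functor.whiskerRight (comparisonL K m n)
    ((Functor.whiskeringLeft _ _ _).obj (hFun K (SymGp n))))
  have : ∀ M N, IsIso ((τ.app M).app N) := fun M N => isIso_comparisonL_h K _ N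
  have : ∀ M, IsIso (τ.app M) := fun M => NatIso.isIso_of_isIso_app _
  have : IsIso τ := NatIso.isIso_of_isIso_app _
  exact ⟨(Functor.isoWhiskerRight σ ((Functor.whiskeringRight _ _ _).obj
    (Coh.incl K (SymGp (m + n))))).symm ≪≫ asIso τ⟩

end Symmetric

end

end CoherentFunctors

namespace CoherentFunctors

noncomputable section

/-! ### Products and strict polynomial functors -/

section Evaluation
variable (K : Type u) [Field K] (m n : ℕ)

/-- The isomorphism of `V^{⊗ m} ⊠ V^{⊗ n}` with the restriction of `V^{⊗ (m + n)}`. -/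
def mulRep (V : GamCat K (m + n)) : box K ((iFun K m).obj ⟨V.space⟩) ((iFun K n).obj ⟨V.space⟩) ⟶
    (resRep K (young m n)).obj ((iFun K (m + n)).obj V) :=
  boxDesc (M := (iFun K m).obj ⟨V.space⟩) (N := (iFun K n).obj ⟨V.space⟩)
    (Z := (resRep K (young m n)).obj ((iFun K (m + n)).obj V))
    ((TensorProduct.mk K (⨂[K]^m V.space) (⨂[K]^n V.space)).compr₂
      TensorPower.mulEquiv.toLinearMap) fun σ τ x y =>
        (permAct_young K V.space m n σ τ (x ⊗ₜ y)).symm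

lemma mulRep_mk (V : GamCat K (m + n)) (x : ⨂[K]^m V.space) (y : ⨂[K]^n V.space) :
    lin (mulRep K m n V) (boxMk ((iFun K m).obj ⟨V.space⟩) ((iFun K n).obj ⟨V.space⟩) x y) =
      TensorPower.mulEquiv (x ⊗ₜ[K] y) := boxDesc_mk _ _ _ _

/-- The identity, as a map from `V^{⊗ m} ⊗ V^{⊗ n}` to `V^{⊗ m} ⊠ V^{⊗ n}`. -/
def boxPow (V : FGModuleCat.{u} K) : (⨂[K]^m V) ⊗[K] (⨂[K]^n V) →ₗ[K]
    (box K ((iFun K m).obj ⟨V⟩) ((iFun K n).obj ⟨V⟩)).V :=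
  TensorProduct.lift (boxMk ((iFun K m).obj ⟨V⟩) ((iFun K n).obj ⟨V⟩))

lemma boxPow_tmul (V : FGModuleCat.{u} K) (x : ⨂[K]^m V) (y : ⨂[K]^n V) :
    boxPow K m n V (x ⊗ₜ y) = boxMk ((iFun K m).obj ⟨V⟩) ((iFun K n).obj ⟨V⟩) x y :=
  TensorProduct.lift.tmul _ _

lemma boxPow_permAct (V : FGModuleCat.{u} K) (σ : SymGp m × SymGp n)
    (z : (⨂[K]^m V) ⊗[K] (⨂[K]^n V)) :
    boxPow K m n V (TensorProduct.map (permAct K V m σ.1) (permAct K V n σ.2) z) =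
      (box K ((iFun K m).obj ⟨V⟩) ((iFun K n).obj ⟨V⟩)).ρ σ (boxPow K m n V z) := by
  have : boxPow K m n V ∘ₗ TensorProduct.map (permAct K V m σ.1) (permAct K V n σ.2) =
      (box K ((iFun K m).obj ⟨V⟩) ((iFun K n).obj ⟨V⟩)).ρ σ ∘ₗ boxPow K m n V :=
    TensorProduct.ext' fun x y => by
      rw [LinearMap.comp_apply, LinearMap.comp_apply, TensorProduct.map_tmul, boxPow_tmul,
        boxPow_tmul]
      exact (box_ρ ((iFun K m).obj ⟨V⟩) ((iFun K n).obj ⟨V⟩) σ.1 σ.2 x y).symm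
  exact LinearMap.congr_fun this z

lemma mulRep_boxPow (V : GamCat K (m + n)) (z : (⨂[K]^m V.space) ⊗[K] (⨂[K]^n V.space)) :
    lin (mulRep K m n V) (boxPow K m n V.space z) = TensorPower.mulEquiv z := by
  have : lin (mulRep K m n V) ∘ₗ boxPow K m n V.space = TensorPower.mulEquiv.toLinearMap :=
    TensorProduct.ext' fun x y => (congrArg (lin (mulRep K m n V))
      (boxPow_tmul K m n V.space x y)).trans (mulRep_mk K m n V x y)
  exact LinearMap.congr_fun this z

/-- The inverse of `mulRep`. -/
def mulRepInv (V : GamCat K (m + n)) : (resRep K (young m n)).obj ((iFun K (m + n)).obj V) ⟶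
    box K ((iFun K m).obj ⟨V.space⟩) ((iFun K n).obj ⟨V.space⟩) :=
  mkRep (X := (resRep K (young m n)).obj ((iFun K (m + n)).obj V))
    (boxPow K m n V.space ∘ₗ
      (TensorPower.mulEquiv (R := K) (M := V.space) (n := m) (m := n)).symm.toLinearMap) fun σ z => by
    obtain ⟨z, rfl⟩ := (TensorPower.mulEquiv (R := K) (M := V.space) (n := m) (m := n)).surjective z
    have e := permAct_young K V.space m n σ.1 σ.2 z
    change boxPow K m n V.space (TensorPower.mulEquiv.symm
      (permAct K V.space (m + n) (young m n (σ.1, σ.2)) (TensorPower.mulEquiv z))) =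
      (box K _ _).ρ σ (boxPow K m n V.space
        (TensorPower.mulEquiv.symm (TensorPower.mulEquiv z)))
    rw [e, LinearEquiv.symm_apply_apply, LinearEquiv.symm_apply_apply, boxPow_permAct]

lemma lin_mulRepInv (V : GamCat K (m + n)) (z : (⨂[K]^m V.space) ⊗[K] (⨂[K]^n V.space)) :
    lin (mulRepInv K m n V) (TensorPower.mulEquiv z) = boxPow K m n V.space z :=
  congrArg (boxPow K m n V.space) (LinearEquiv.symm_apply_apply _ z)

lemma mulRep_inv (V : GamCat K (m + n)) : mulRep K m n V ≫ mulRepInv K m n V = 𝟙 _ :=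
  box_ext fun x y => (congrArg (lin (mulRepInv K m n V)) (mulRep_mk K m n V x y)).trans
    ((lin_mulRepInv K m n V _).trans (boxPow_tmul K m n V.space x y))

lemma mulRepInv_mulRep (V : GamCat K (m + n)) : mulRepInv K m n V ≫ mulRep K m n V = 𝟙 _ := by
  refine rep_ext fun z => ?_
  obtain ⟨z, rfl⟩ := (TensorPower.mulEquiv (R := K) (M := V.space) (n := m) (m := n)).surjective z
  exact (congrArg (lin (mulRep K m n V)) (lin_mulRepInv K m n V z)).trans (mulRep_boxPow K m n V z)

lemma mp_mulRep_bijective (k : FDRep.{u} K (SymGp m × SymGp n) ⥤ FGModuleCat.{u} K)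
    (V : GamCat K (m + n)) : Function.Bijective (mp k (mulRep K m n V)) :=
  Function.bijective_iff_has_inverse.2 ⟨mp k (mulRepInv K m n V),
    fun x => by rw [← mp_comp, mulRep_inv, mp_id], fun x => by rw [← mp_comp, mulRepInv_mulRep, mp_id]⟩

/-- The action of `Γ^m(Hom(V, W)) ⊗ Γ^n(Hom(V, W))` on external products of tensor powers. -/
def boxAct (V W : FGModuleCat.{u} K) : Gam K (V →ₗ[K] W) m ⊗[K] Gam K (V →ₗ[K] W) n →ₗ[K]
    (box K ((iFun K m).obj ⟨V⟩) ((iFun K n).obj ⟨V⟩) ⟶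
      box K ((iFun K m).obj ⟨W⟩) ((iFun K n).obj ⟨W⟩)) :=
  TensorProduct.lift ((boxHomBil ((iFun K m).obj ⟨V⟩) ((iFun K m).obj ⟨W⟩) ((iFun K n).obj ⟨V⟩)
    ((iFun K n).obj ⟨W⟩)).compl₁₂
      ((iFun K m).mapLinearMap K (X := (⟨V⟩ : GamCat K m)) (Y := ⟨W⟩))
      ((iFun K n).mapLinearMap K (X := (⟨V⟩ : GamCat K n)) (Y := ⟨W⟩)))

lemma boxAct_tmul (V W : FGModuleCat.{u} K) (a : Gam K (V →ₗ[K] W) m) (b : Gam K (V →ₗ[K] W) n) :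
    boxAct K m n V W (a ⊗ₜ b) = boxHom ((iFun K m).map (X := (⟨V⟩ : GamCat K m)) (Y := ⟨W⟩) a)
      ((iFun K n).map (X := (⟨V⟩ : GamCat K n)) (Y := ⟨W⟩) b) :=
  TensorProduct.lift.tmul _ _

lemma lin_boxAct (V W : FGModuleCat.{u} K) (s : Gam K (V →ₗ[K] W) m ⊗[K] Gam K (V →ₗ[K] W) n)
    (z : (⨂[K]^m V) ⊗[K] (⨂[K]^n V)) :
    lin (boxAct K m n V W s) (boxPow K m n V z) =
      boxPow K m n W (TensorProduct.map₂ (powBil K m LinearMap.id) (powBil K n LinearMap.id)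
        (TensorProduct.map (Gam K (V →ₗ[K] W) m).subtype (Gam K (V →ₗ[K] W) n).subtype s) z) := by
  induction s with
  | zero => simp only [map_zero, LinearMap.zero_apply]; rfl
  | add s s' h h' => simp only [map_add, LinearMap.add_apply, lin_add, h, h']
  | tmul a b =>
    have : lin (boxAct K m n V W (a ⊗ₜ b)) ∘ₗ boxPow K m n V = boxPow K m n W ∘ₗ
        TensorProduct.map (powBil K m LinearMap.id a.1) (powBil K n LinearMap.id b.1) :=
      TensorProduct.ext' fun x y => by
        rw [LinearMap.comp_apply, LinearMap.comp_apply, TensorProduct.map_tmul, boxPow_tmul,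
          boxPow_tmul, boxAct_tmul]
        rfl
    exact LinearMap.congr_fun this z

lemma mulRep_naturality {V W : GamCat K (m + n)} (a : V ⟶ W) :
    mulRep K m n V ≫ (resRep K (young m n)).map ((iFun K (m + n)).map a) =
      boxAct K m n V.space W.space (gamSplit K (V.space →ₗ[K] W.space) m n a) ≫ mulRep K m n W := by
  refine box_ext fun x y => ?_
  have h := gamMul_gamSplit K (V.space →ₗ[K] W.space) m n a
  have h1 := mulRep_mk K m n V x y
  have h2 := (congrArg (lin (boxAct K m n V.space W.space (gamSplit K _ m n a)))
    (boxPow_tmul K m n V.space x y).symm).trans (lin_boxAct K m n V.space W.space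
      (gamSplit K (V.space →ₗ[K] W.space) m n a) (x ⊗ₜ y))
  refine (congrArg (powBil K (m + n) LinearMap.id a.1) h1).trans ?_
  refine Eq.trans ?_ (congrArg (lin (mulRep K m n W)) h2).symm
  rw [mulRep_boxPow, ← h]
  exact powBil_mulEquiv K m n LinearMap.id _ _

variable {K m n}
variable {f : LinFun K (SymGp m)} {g : LinFun K (SymGp n)} {k : LinFun K (SymGp m × SymGp n)}

/-- The values of a bilinear map at tensor powers of `V`. -/
def Bil.pow (β : Bil (boxRep K _ _) f.obj g.obj k.obj) (V : FGModuleCat.{u} K) :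
    ((jLin K m).obj f).obj.obj ⟨V⟩ ⊗[K] ((jLin K n).obj g).obj.obj ⟨V⟩ →ₗ[K]
      k.obj.obj (box K ((iFun K m).obj ⟨V⟩) ((iFun K n).obj ⟨V⟩)) :=
  TensorProduct.lift (β.fn ((iFun K m).obj ⟨V⟩) ((iFun K n).obj ⟨V⟩))

lemma Bil.pow_tmul (β : Bil (boxRep K _ _) f.obj g.obj k.obj) (V : FGModuleCat.{u} K)
    (x : ((jLin K m).obj f).obj.obj ⟨V⟩) (y : ((jLin K n).obj g).obj.obj ⟨V⟩) :
    β.pow V (x ⊗ₜ y) = β.fn ((iFun K m).obj ⟨V⟩) ((iFun K n).obj ⟨V⟩) x y :=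
  TensorProduct.lift.tmul _ _

lemma pow_tensAct (β : Bil (boxRep K _ _) f.obj g.obj k.obj) (V W : FGModuleCat.{u} K)
    (s : Gam K (V →ₗ[K] W) m ⊗[K] Gam K (V →ₗ[K] W) n)
    (z : ((jLin K m).obj f).obj.obj ⟨V⟩ ⊗[K] ((jLin K n).obj g).obj.obj ⟨V⟩) :
    β.pow W (tensAct K ((jLin K m).obj f) ((jLin K n).obj g) V W s z) =
      mp k.obj (boxAct K m n V W s) (β.pow V z) := by
  induction s with
  | zero => rw [map_zero, map_zero, mp_zero, LinearMap.zero_apply, map_zero]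
  | add s s' h h' => rw [map_add, map_add, mp_add, ← h, ← h', LinearMap.add_apply, map_add]
  | tmul a b =>
    rw [boxAct_tmul, tensAct_tmul]
    induction z with
    | zero => simp only [map_zero]
    | add z z' h h' => rw [map_add, map_add, map_add, map_add, h, h']
    | tmul x y =>
      rw [TensorProduct.map_tmul, Bil.pow_tmul, Bil.pow_tmul]
      change β.fn _ _ (mp f.obj ((iFun K m).map (X := (⟨V⟩ : GamCat K m)) (Y := ⟨W⟩) a) x)
        (mp g.obj ((iFun K n).map (X := (⟨V⟩ : GamCat K n)) (Y := ⟨W⟩) b) y) = _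
      refine (β.nat_left _ _ _ _).trans ((congrArg _ (β.nat_right _ _ _ _)).trans ?_)
      refine (mp_comp (f := k.obj) _ _ _).symm.trans ?_
      exact congrArg (fun t => mp k.obj t _) (box_ext fun _ _ => rfl)

lemma Bil.pow_naturality (β : Bil (boxRep K _ _) f.obj g.obj k.obj) {V W : GamCat K (m + n)}
    (a : V ⟶ W)
    (z : ((jLin K m).obj f).obj.obj ⟨V.space⟩ ⊗[K] ((jLin K n).obj g).obj.obj ⟨V.space⟩) :
    mp k.obj (mulRep K m n W) (β.pow W.space (tensAct K ((jLin K m).obj f)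
          ((jLin K n).obj g) V.space W.space (gamSplit K _ m n a) z)) =
        mp k.obj ((resRep K (young m n)).map ((iFun K (m + n)).map a))
          (mp k.obj (mulRep K m n V) (β.pow V.space z)) := by
  rw [pow_tensAct, ← mp_comp, ← mp_comp, mulRep_naturality]

/-- A bilinear map from `f` and `g` to `k` induces a morphism `j^*(f) ⊗ j^*(g) ⟶ j^*(Ind k)`. -/
def jBil (β : Bil (boxRep K _ _) f.obj g.obj k.obj) :
    ((Pol.tensor K m n).obj ((jLin K m).obj f)).obj ((jLin K n).obj g) ⟶
      (jLin K (m + n)).obj ((indLin K (young m n)).obj k) :=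
  ObjectProperty.homMk (mkNat (fun V => mp k.obj (mulRep K m n V) ∘ₗ β.pow V.space)
    fun a z => β.pow_naturality a z)

lemma Bil.pow_map {f' : LinFun K (SymGp m)} {g' : LinFun K (SymGp n)}
    {k' : LinFun K (SymGp m × SymGp n)} (β : Bil (boxRep K _ _) f.obj g.obj k.obj)
    (β' : Bil (boxRep K _ _) f'.obj g'.obj k'.obj) (s : f ⟶ f') (t : g ⟶ g') (r : k ⟶ k')
    (h : ∀ X Y x y, ap r.hom _ (β.fn X Y x y) = β'.fn X Y (ap s.hom X x) (ap t.hom Y y))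
    (V : FGModuleCat.{u} K)
    (z : ((jLin K m).obj f).obj.obj ⟨V⟩ ⊗[K] ((jLin K n).obj g).obj.obj ⟨V⟩) :
    β'.pow V (TensorProduct.map (ap ((jLin K m).map s).hom ⟨V⟩) (ap ((jLin K n).map t).hom ⟨V⟩) z) =
      ap r.hom _ (β.pow V z) := by
  induction z with
  | zero => simp only [map_zero]
  | add z z' h h' => rw [map_add, map_add, map_add, map_add, h, h']
  | tmul x y =>
    rw [TensorProduct.map_tmul, Bil.pow_tmul, Bil.pow_tmul]
    exact (h _ _ x y).symm

/-- Naturality of `jBil`. -/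
lemma jBil_map {f' : LinFun K (SymGp m)} {g' : LinFun K (SymGp n)}
    {k' : LinFun K (SymGp m × SymGp n)} (β : Bil (boxRep K _ _) f.obj g.obj k.obj)
    (β' : Bil (boxRep K _ _) f'.obj g'.obj k'.obj) (s : f ⟶ f') (t : g ⟶ g') (r : k ⟶ k')
    (h : ∀ X Y x y, ap r.hom _ (β.fn X Y x y) = β'.fn X Y (ap s.hom X x) (ap t.hom Y y)) :
    Pol.tensorMap K ((jLin K m).map s) ((jLin K n).map t) ≫ jBil β' =
      jBil β ≫ (jLin K (m + n)).map ((indLin K (young m n)).map r) := by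
  refine ObjectProperty.hom_ext _ (nat_ext fun V z => ?_)
  refine (congrArg (mp k'.obj (mulRep K m n V)) (Bil.pow_map β β' s t r h V.space z)).trans ?_
  exact (ap_mp r.hom (mulRep K m n V) _).symm

lemma leftTensor_lift_bijective {G H : Type} [Group G] [Group H] (f : Coh K G) (g : Coh K H)
    (X : FDRep.{u} K G) (Y : FDRep.{u} K H) :
    Function.Bijective (TensorProduct.lift (((leftTensorIsTensor K G H).bil f g).fn X Y)) := by
  obtain ⟨M, N, a, e, hf⟩ := (isCoherent_iff K f.obj).1 f.property
  obtain ⟨M', N', a', e', hg⟩ := (isCoherent_iff K g.obj).1 g.property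
  exact ((leftTensorIsTensor K G H).univ f g).lift_bijective hf hg (cohι_isLinear f)
    (cohι_isLinear g) (cohι_isLinear _) X Y

variable (K m n)

lemma jCoh_tensor : Nonempty (jCoh K m ⋙ Pol.tensor K m n ⋙
      (Functor.whiskeringLeft _ _ _).obj (jCoh K n) ≅
    tensorL K m n ⋙ (Functor.whiskeringRight _ _ _).obj (jCoh K (m + n))) := by
  let h := leftTensorIsTensor K (SymGp m) (SymGp n)
  let b : ∀ (f : Coh K (SymGp m)) (g : Coh K (SymGp n)),
      Bil (boxRep K _ _) f.obj.obj g.obj.obj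
        (((leftTensor K (SymGp m) (SymGp n)).obj f).obj g).obj.obj := fun f g => h.bil f g
  have hl : ∀ {f f' : Coh K (SymGp m)} (s : f ⟶ f') (g : Coh K (SymGp n)),
      ((Pol.tensor K m n).map ((jCoh K m).map s)).app ((jCoh K n).obj g) ≫ jBil (b f' g) =
        jBil (b f g) ≫ (jCoh K (m + n)).map (((tensorL K m n).map s).app g) := fun s g =>
    jBil_map (b _ g) (b _ g) s.hom (𝟙 g.obj) (((leftTensor K _ _).map s).app g).hom (h.nat_left s g)
  have hr : ∀ (f : Coh K (SymGp m)) {g g' : Coh K (SymGp n)} (s : g ⟶ g'),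
      ((Pol.tensor K m n).obj ((jCoh K m).obj f)).map ((jCoh K n).map s) ≫ jBil (b f g') =
        jBil (b f g) ≫ (jCoh K (m + n)).map (((tensorL K m n).obj f).map s) := fun f _ _ s =>
    jBil_map (b f _) (b f _) (𝟙 f.obj) s.hom (((leftTensor K _ _).obj f).map s).hom (h.nat_right f s)
  let τ : jCoh K m ⋙ Pol.tensor K m n ⋙ (Functor.whiskeringLeft _ _ _).obj (jCoh K n) ⟶
      tensorL K m n ⋙ (Functor.whiskeringRight _ _ _).obj (jCoh K (m + n)) :=
    { app := fun f => { app := fun g => jBil (b f g), naturality := fun _ _ s => hr f s }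
      naturality := fun _ _ s => NatTrans.ext (funext fun g => hl s g) }
  have : ∀ f g, IsIso ((τ.app f).app g) := fun f g => isIso_of_ap_bijective (jBil (b f g)) fun V =>
    (mp_mulRep_bijective K m n _ V).comp (leftTensor_lift_bijective f g _ _)
  have : ∀ f, IsIso (τ.app f) := fun f => NatIso.isIso_of_isIso_app _
  have : IsIso τ := NatIso.isIso_of_isIso_app _
  exact ⟨asIso τ⟩

variable {K} in
lemma Bil.bijective_of_lift_bijective {A B C : Type*} [Category A] [Category B] [Category C]
    {P : A ⥤ B ⥤ C} {f : A ⥤ FGModuleCat.{u} K} {g : B ⥤ FGModuleCat.{u} K}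
    {t t' : C ⥤ FGModuleCat.{u} K} {u : Bil P f g t} {u' : Bil P f g t'} (s : t ⟶ t')
    (hs : ∀ X Y x y, ap s _ (u.fn X Y x y) = u'.fn X Y x y) (X : A) (Y : B)
    (h : Function.Bijective (TensorProduct.lift (u.fn X Y)))
    (h' : Function.Bijective (TensorProduct.lift (u'.fn X Y))) :
    Function.Bijective (ap s ((P.obj X).obj Y)) := by
  have e : ap s _ ∘ₗ TensorProduct.lift (u.fn X Y) = TensorProduct.lift (u'.fn X Y) :=
    TensorProduct.ext' fun x y => by
      rw [LinearMap.comp_apply, TensorProduct.lift.tmul, TensorProduct.lift.tmul, hs]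
  refine (Function.Bijective.of_comp_iff _ h).1 ?_
  rw [← e] at h'
  exact h'

variable {K m n} in
lemma comparison_mulRep_bijective (f : Coh K (SymGp m)) (g : Coh K (SymGp n))
    (V : GamCat K (m + n)) : Function.Bijective
      (ap (((comparison K _ _).app f).app g).hom ((resRep K (young m n)).obj
        ((iFun K (m + n)).obj V))) := by
  let B := box K ((iFun K m).obj ⟨V.space⟩) ((iFun K n).obj ⟨V.space⟩)
  have h1 : Function.Bijective (ap (((comparison K _ _).app f).app g).hom B) := by
    exact Bil.bijective_of_lift_bijective (u := (leftTensorIsTensor K _ _).bil f g)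
      (u' := odotBil K f.obj g.obj) (((comparison K _ _).app f).app g).hom (comparison_bil f g) _ _
      (leftTensor_lift_bijective f g _ _)
      (lift_odotBil_bijective f.obj g.obj _ _)
  refine (Function.Bijective.of_comp_iff _ (mp_mulRep_bijective K m n
    (((leftTensor K _ _).obj f).obj g).obj.obj V)).1 ?_
  have : ⇑(ap (((comparison K _ _).app f).app g).hom ((resRep K (young m n)).obj
        ((iFun K (m + n)).obj V))) ∘ ⇑(mp (((leftTensor K _ _).obj f).obj g).obj.obj
          (mulRep K m n V)) = ⇑(mp (((odotCoh K _ _).obj f).obj g).obj (mulRep K m n V)) ∘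
            ⇑(ap (((comparison K _ _).app f).app g).hom B) := funext fun z =>
    ap_mp (((comparison K _ _).app f).app g).hom (mulRep K m n V) z
  rw [this]
  exact (mp_mulRep_bijective K m n _ V).comp h1

lemma jCoh_dot : Nonempty (tensorL K m n ⋙ (Functor.whiskeringRight _ _ _).obj (jCoh K (m + n)) ≅
    dot K m n ⋙ (Functor.whiskeringRight _ _ _).obj (jLin K (m + n))) := by
  let τ := Functor.whiskerRight (comparisonL K m n)
    ((Functor.whiskeringRight _ _ _).obj (jLin K (m + n)))
  have : ∀ f g, IsIso ((τ.app f).app g) := fun f g => isIso_of_ap_bijective _ fun V =>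
    comparison_mulRep_bijective f g V
  have : ∀ f, IsIso (τ.app f) := fun f => NatIso.isIso_of_isIso_app _
  have : IsIso τ := NatIso.isIso_of_isIso_app _
  exact ⟨@asIso _ _ _ _ τ this⟩

end Evaluation

end

end CoherentFunctors

namespace CoherentFunctors

noncomputable section

/-! ### Divided powers of spaces of linear maps -/

section Gamma
variable {K : Type u} [Field K] {n : ℕ}

/-- The canonical map `Hom(V, W)^{⊗ n} → Hom(V^{⊗ n}, W^{⊗ n})` is bijective: it sends elementary
matrices to elementary matrices. -/
lemma powBil_id_bijective (V W : FGModuleCat.{u} K) :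
    Function.Bijective (powBil K n (LinearMap.id : (V →ₗ[K] W) →ₗ[K] V →ₗ[K] W)) := by
  classical
  let b := Module.finBasis K V
  let c := Module.finBasis K W
  let B := Basis.piTensorProduct fun _ : Fin n => b.linearMap c
  let B' := (Basis.piTensorProduct fun _ : Fin n => b).linearMap
    (Basis.piTensorProduct fun _ : Fin n => c)
  have e : powBil K n (LinearMap.id : (V →ₗ[K] W) →ₗ[K] V →ₗ[K] W) =
      (B.equiv B' (Equiv.arrowProdEquivProdArrow _ _ _)).toLinearMap := by
    refine B.ext fun p => (Basis.piTensorProduct fun _ : Fin n => b).ext fun q => ?_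
    rw [LinearEquiv.coe_coe, Module.Basis.equiv_apply, Module.Basis.linearMap_apply_apply,
      Basis.piTensorProduct_apply, Basis.piTensorProduct_apply, powBil_tprod]
    simp only [LinearMap.id_apply, Module.Basis.linearMap_apply_apply]
    by_cases h : (Equiv.arrowProdEquivProdArrow _ _ _ p).2 = q
    · rw [if_pos h, Basis.piTensorProduct_apply]
      congr 1
      funext i
      exact if_pos (congrFun h i)
    · rw [if_neg h]
      obtain ⟨i, hi⟩ := Function.ne_iff.1 h
      exact MultilinearMap.map_coord_zero _ i (if_neg hi)
  rw [e]
  exact LinearEquiv.bijective _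

/-- The functor `V ↦ V^{⊗ n}` is fully faithful. -/
lemma iFun_map_bijective (V W : GamCat K n) :
    Function.Bijective ((iFun K n).map : (V ⟶ W) → _) := by
  have h := powBil_id_bijective (n := n) V.space W.space
  constructor
  · intro a a' e
    refine Subtype.ext (h.1 ?_)
    exact congrArg lin e
  · intro φ
    obtain ⟨a, ha⟩ := h.2 (lin φ)
    refine ⟨⟨a, fun σ => h.1 (LinearMap.ext fun x => ?_)⟩, rep_ext (LinearMap.congr_fun ha)⟩
    obtain ⟨y, rfl⟩ : ∃ y, permAct K V.space n σ y = x :=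
      ⟨permAct K V.space n σ⁻¹ x, Representation.self_inv_apply _ _ _⟩
    refine (permAct_powBil K n LinearMap.id σ a y).symm.trans ?_
    rw [ha]
    exact (lin_ρ φ σ y).symm

lemma gam_comp {U V W : FGModuleCat.{u} K} (a : U →ₗ[K] V) (b : V →ₗ[K] W) :
    gamComp K n U V W (gam n b) (gam n a) = gam n (b ∘ₗ a) :=
  Subtype.ext (powBil_tprod K n _ _ _)

variable (K n) in
/-- The space `K^n`, through which every identity of `Γ^n 𝒱` factors. -/
def stdObj : GamCat K n := ⟨FGModuleCat.of K (Fin n → K)⟩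

/-- The projection onto the line spanned by a vector of a basis. -/
def basisProj {W ι : Type*} [AddCommGroup W] [Module K W] (w : Module.Basis ι K W) (j : ι) :
    W →ₗ[K] W :=
  LinearMap.toSpanSingleton K W (w j) ∘ₗ w.coord j

lemma basisProj_apply {W ι : Type*} [AddCommGroup W] [Module K W] (w : Module.Basis ι K W) (j : ι)
    (x : W) : basisProj w j x = w.coord j x • w j := rfl

lemma exists_factor_projections {V W ι : Type*} [AddCommGroup W] [Module K W] [AddCommGroup V]
    [Module K V] (v : Module.Basis (Fin n) K V) (w : Module.Basis ι K W) (S : Finset ι)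
    (hS : S.card ≤ n) : ∃ (a : W →ₗ[K] V) (b : V →ₗ[K] W),
      ∀ j ∈ S, basisProj w j ∘ₗ b ∘ₗ a = basisProj w j := by
  classical
  obtain ⟨ε⟩ : Nonempty (S ↪ Fin n) := Function.Embedding.nonempty_of_card_le (by simpa using hS)
  let a : W →ₗ[K] V := ∑ s : S, LinearMap.toSpanSingleton K V (v (ε s)) ∘ₗ w.coord s
  let b : V →ₗ[K] W := ∑ s : S, LinearMap.toSpanSingleton K W (w s) ∘ₗ v.coord (ε s)
  have ha : ∀ x (s : S), v.coord (ε s) (a x) = w.coord s x := fun x s => by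
    simp only [a, LinearMap.sum_apply, LinearMap.comp_apply, LinearMap.toSpanSingleton_apply,
      map_sum, map_smul, Module.Basis.coord_apply, Module.Basis.repr_self]
    rw [Finset.sum_eq_single s]
    · rw [Finsupp.single_eq_same, smul_eq_mul, mul_one]
    · intro t _ ht
      rw [Finsupp.single_eq_of_ne fun e => ht (ε.injective e).symm, smul_zero]
    · simp
  refine ⟨a, b, fun j hj => LinearMap.ext fun x => ?_⟩
  have : b (a x) = ∑ s : S, w.coord s x • w s := by
    simp only [b, LinearMap.sum_apply, LinearMap.comp_apply, ha, LinearMap.toSpanSingleton_apply]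
  rw [LinearMap.comp_apply, LinearMap.comp_apply, this, basisProj_apply, basisProj_apply, map_sum,
    Finset.sum_eq_single ⟨j, hj⟩]
  · simp
  · intro t _ ht
    have : (t : ι) ≠ j := fun e => ht (Subtype.ext e)
    simp [this]
  · simp

lemma gamComp_gam_of_sum {ι : Type*} {W : FGModuleCat.{u} K} (p : Gam K (W →ₗ[K] W) n)
    (s : Finset ι) (E : ι → Fin n → (W →ₗ[K] W)) (hp : p.1 = ∑ r ∈ s, PiTensorProduct.tprod K (E r))
    (c : W →ₗ[K] W) (hc : ∀ r ∈ s, ∀ i, E r i ∘ₗ c = E r i) :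
    gamComp K n W W W p (gam n c) = p := by
  refine Subtype.ext ?_
  change powBil K n (LinearMap.llcomp K W W W) p.1 (gam n c : Gam K (W →ₗ[K] W) n).1 = p.1
  rw [hp, map_sum, LinearMap.sum_apply]
  exact Finset.sum_congr rfl fun r hr => (powBil_tprod K n _ _ _).trans
    (congrArg _ (funext fun i => hc r hr i))

variable (n) in
/-- The sum of the tensors `e_{r 1} ⊗ ⋯ ⊗ e_{r n}` of projections onto the lines of a basis over the
maps `r` with image `S`. -/
def basisPart {d : ℕ} {W : FGModuleCat.{u} K} (w : Module.Basis (Fin d) K W)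
    (S : Finset (Fin d)) : Gam K (W →ₗ[K] W) n :=
  ⟨∑ r : Fin n → Fin d with Finset.univ.image r = S,
    PiTensorProduct.tprod K fun i => basisProj w (r i), fun σ => by
    classical
    simp only [map_sum, permAct_tprod]
    refine Finset.sum_equiv (Equiv.arrowCongr σ (Equiv.refl _)) (fun r => ?_) fun r _ => rfl
    simp only [Finset.mem_filter, Finset.mem_univ, true_and]
    have : Finset.univ.image (Equiv.arrowCongr σ (Equiv.refl _) r) = Finset.univ.image r := by
      ext j
      simp only [Finset.mem_image, Finset.mem_univ, true_and, Equiv.arrowCongr_apply,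
        Function.comp_apply, Equiv.coe_refl, id]
      exact ⟨fun ⟨i, hi⟩ => ⟨_, hi⟩, fun ⟨i, hi⟩ => ⟨σ i, by rw [Equiv.symm_apply_apply, hi]⟩⟩
    rw [this]⟩

lemma basisPart_coe {d : ℕ} {W : FGModuleCat.{u} K} (w : Module.Basis (Fin d) K W)
    (S : Finset (Fin d)) : (basisPart n w S).1 =
      ∑ r : Fin n → Fin d with Finset.univ.image r = S,
        PiTensorProduct.tprod K fun i => basisProj w (r i) := rfl

lemma sum_basisPart {d : ℕ} {W : FGModuleCat.{u} K} (w : Module.Basis (Fin d) K W) :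
    ∑ S, basisPart n w S = gam n LinearMap.id := by
  classical
  refine Subtype.ext ?_
  rw [AddSubmonoidClass.coe_finsetSum]
  change _ = PiTensorProduct.tprod K fun _ => LinearMap.id
  have h2 : (LinearMap.id : W →ₗ[K] W) = ∑ j, basisProj w j := LinearMap.ext fun x => by
    rw [LinearMap.sum_apply]
    exact (w.sum_repr x).symm
  rw [h2, MultilinearMap.map_sum]
  exact Finset.sum_fiberwise Finset.univ (fun r : Fin n → Fin d => Finset.univ.image r) _

lemma gamComp_assoc (U V W Z : FGModuleCat.{u} K) (c : Gam K (W →ₗ[K] Z) n)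
    (b : Gam K (V →ₗ[K] W) n) (a : Gam K (U →ₗ[K] V) n) :
    gamComp K n U W Z c (gamComp K n U V W b a) = gamComp K n U V Z (gamComp K n V W Z c b) a :=
  (Category.assoc (obj := GamCat K n) (W := ⟨U⟩) (X := ⟨V⟩) (Y := ⟨W⟩) (Z := ⟨Z⟩) a b c)

/-- A part with at most `n` projections factors through `K^n`; the other parts vanish, as a tensor
involves at most `n` projections. -/
lemma exists_factor_basisPart {d : ℕ} {V W : FGModuleCat.{u} K} (v : Module.Basis (Fin n) K V)
    (w : Module.Basis (Fin d) K W) (S : Finset (Fin d)) : ∃ (a : Gam K (W →ₗ[K] V) n)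
      (b : Gam K (V →ₗ[K] W) n), gamComp K n W V W b a = basisPart n w S := by
  by_cases hS : S.card ≤ n
  · obtain ⟨a, b, hab⟩ := exists_factor_projections v w S hS
    have h : gamComp K n W W W (basisPart n w S) (gam n (b ∘ₗ a)) = basisPart n w S := by
      refine gamComp_gam_of_sum (W := W) (basisPart n w S)
        (Finset.univ.filter fun r : Fin n → Fin d => Finset.univ.image r = S)
        (fun r i => basisProj w (r i)) (basisPart_coe w S) (b ∘ₗ a) fun r hr i => hab (r i) ?_
      rw [← (Finset.mem_filter.1 hr).2]
      exact Finset.mem_image_of_mem r (Finset.mem_univ i)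
    refine ⟨gam n a, gamComp K n V W W (basisPart n w S) (gam n b), ?_⟩
    rw [← gamComp_assoc, gam_comp, h]
  · refine ⟨0, 0, ?_⟩
    rw [map_zero]
    refine Subtype.ext ((basisPart_coe w S).trans
      (Finset.sum_eq_zero fun r hr => absurd ?_ hS)).symm
    rw [← (Finset.mem_filter.1 hr).2]
    exact Finset.card_image_le.trans (by simp)

/-- Every identity in `Γ^n 𝒱` is a sum of morphisms that factor through `K^n`. -/
lemma exists_sum_eq_id (W : GamCat K n) : ∃ (ι : Type) (_ : Fintype ι) (α : ι → (W ⟶ stdObj K n))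
    (β : ι → (stdObj K n ⟶ W)), ∑ i, α i ≫ β i = 𝟙 W := by
  let w := Module.finBasis K W.space
  choose a b h using exists_factor_basisPart (V := (stdObj K n).space) (Pi.basisFun K (Fin n)) w
  refine ⟨Finset (Fin (Module.finrank K W.space)), inferInstance, a, b, ?_⟩
  exact (Finset.sum_congr rfl fun S _ => h S).trans (sum_basisPart w)

end Gamma

/-! ### Presentations by tensor powers -/

section IsGenBy
variable {C D : Type*} [Category C] [Preadditive C] [Category D] [Preadditive D]

/-- The identity of `X` is a sum of morphisms that factor through objects with the property `S`;
in other words, `X` is a direct summand of a finite sum of such objects, if these sums exist. -/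
def IsGenBy (S : C → Prop) (X : C) : Prop :=
  ∃ (ι : Type) (_ : Fintype ι) (Y : ι → C) (α : ∀ i, X ⟶ Y i) (β : ∀ i, Y i ⟶ X),
    (∀ i, S (Y i)) ∧ ∑ i, α i ≫ β i = 𝟙 X

lemma IsGenBy.of {S : C → Prop} {X : C} (h : S X) : IsGenBy S X :=
  ⟨Unit, inferInstance, fun _ => X, fun _ => 𝟙 X, fun _ => 𝟙 X, fun _ => h, by simp⟩

lemma IsGenBy.trans {S S' : C → Prop} {X : C} (h : IsGenBy S X) (h' : ∀ Y, S Y → IsGenBy S' Y) :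
    IsGenBy S' X := by
  obtain ⟨ι, _, Y, α, β, hY, e⟩ := h
  choose κ hκ Z γ δ hZ e' using fun i => h' (Y i) (hY i)
  refine ⟨Σ i, κ i, inferInstance, fun p => Z p.1 p.2, fun p => α p.1 ≫ γ p.1 p.2,
    fun p => δ p.1 p.2 ≫ β p.1, fun p => hZ p.1 p.2, ?_⟩
  rw [Fintype.sum_sigma, ← e]
  refine Finset.sum_congr rfl fun i _ => ?_
  have : ∀ j, (α i ≫ γ i j) ≫ δ i j ≫ β i = α i ≫ (γ i j ≫ δ i j) ≫ β i := fun j => by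
    simp only [Category.assoc]
  simp only [this]
  rw [← Preadditive.comp_sum, ← Preadditive.sum_comp, e', Category.id_comp]

lemma IsGenBy.map {S : C → Prop} {S' : D → Prop} {X : C} (h : IsGenBy S X) (F : C ⥤ D)
    [F.Additive] (h' : ∀ Y, S Y → IsGenBy S' (F.obj Y)) : IsGenBy S' (F.obj X) := by
  obtain ⟨ι, _, Y, α, β, hY, e⟩ := h
  refine IsGenBy.trans (S := fun Z => ∃ Y, S Y ∧ F.obj Y = Z) ?_ ?_
  · refine ⟨ι, inferInstance, fun i => F.obj (Y i), fun i => F.map (α i), fun i => F.map (β i),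
      fun i => ⟨Y i, hY i, rfl⟩, ?_⟩
    simp only [← F.map_comp]
    rw [← F.map_sum, e, F.map_id]
  · rintro _ ⟨Y, hY, rfl⟩
    exact h' Y hY

/-- A natural transformation that is bijective at some objects is so at the objects they generate. -/
lemma IsGenBy.bijective {K : Type u} [Field K] {S : C → Prop} {X : C} (h : IsGenBy S X)
    {f g : C ⥤ FGModuleCat.{u} K} [f.Additive] [g.Additive] (t : f ⟶ g)
    (ht : ∀ Y, S Y → Function.Bijective (ap t Y)) : Function.Bijective (ap t X) := by
  obtain ⟨ι, _, Y, α, β, hY, e⟩ := h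
  have ef : ∀ x : f.obj X, ∑ i, mp f (β i) (mp f (α i) x) = x := fun x => by
    simp only [← mp_comp]
    rw [← mp_sum, e, mp_id]
  have eg : ∀ x : g.obj X, ∑ i, mp g (β i) (mp g (α i) x) = x := fun x => by
    simp only [← mp_comp]
    rw [← mp_sum, e, mp_id]
  refine ⟨(injective_iff_map_eq_zero _).2 fun x hx => ?_, fun y => ?_⟩
  · rw [← ef x]
    refine Finset.sum_eq_zero fun i _ => ?_
    have : mp f (α i) x = 0 := (ht _ (hY i)).1 (by rw [ap_mp, hx, map_zero, map_zero])
    rw [this, map_zero]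
  · choose x hx using fun i => (ht _ (hY i)).2 (mp g (α i) y)
    refine ⟨∑ i, mp f (β i) (x i), ?_⟩
    rw [map_sum]
    conv_rhs => rw [← eg y]
    exact Finset.sum_congr rfl fun i _ => by rw [ap_mp, hx]

/-- A natural transformation of presented functors is bijective if it is so at the objects that
occur in the presentations. -/
lemma IsPres.bijective {K : Type u} [Field K] [CategoryTheory.Linear K C]
    {f g : C ⥤ FGModuleCat.{u} K} [f.Additive] [g.Additive] [f.Linear K] [g.Linear K]
    {M N M' N' : C} {a : M ⟶ N} {e : f.obj M} {a' : M' ⟶ N'} {e' : g.obj M'} (hf : IsPres f a e)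
    (hg : IsPres g a' e') (t : f ⟶ g) (hM : Function.Bijective (ap t M))
    (hM' : Function.Bijective (ap t M')) (hN' : Function.Bijective (ap t N')) (X : C) :
    Function.Bijective (ap t X) := by
  obtain ⟨y, hy⟩ := hM'.2 e'
  obtain ⟨r, hr⟩ := hg.exists_desc (k := f) (y := y) (hN'.1 (by
    rw [ap_mp, hy, hg.rel_self, map_zero]))
  have rt : r ≫ t = 𝟙 g := hg.hom_ext (by rw [ap_comp, hr, hy, ap_id])
  have rt' : ∀ Z x, ap t Z (ap r Z x) = x := fun Z x => by rw [← ap_comp, rt, ap_id]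
  have tr : t ≫ r = 𝟙 f := hf.hom_ext (hM.1 (by rw [ap_comp, rt', ap_id]))
  exact Function.bijective_iff_has_inverse.2 ⟨ap r X, fun x => by rw [← ap_comp, tr, ap_id], rt' X⟩

end IsGenBy

/-! ### The left adjoint of evaluation at tensor powers -/

section LeftAdjoint
variable {K : Type u} [Field K] {n : ℕ}

/-- A morphism `F ⟶ j^*(k)` at `V`, as a linear map `F(V) → k(V^{⊗ n})`. -/
def jAp {F : Pol K n} {k : LinFun K (SymGp n)} (θ : F ⟶ (jLin K n).obj k) (V : GamCat K n) :
    F.obj.obj V →ₗ[K] k.obj.obj ((iFun K n).obj V) :=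
  ap θ.hom V

lemma jAp_mp {F : Pol K n} {k : LinFun K (SymGp n)} (θ : F ⟶ (jLin K n).obj k) {V W : GamCat K n}
    (a : V ⟶ W) (x : F.obj.obj V) :
    jAp θ W (mp F.obj a x) = mp k.obj ((iFun K n).map a) (jAp θ V x) :=
  ap_mp θ.hom a x

/-- A morphism `F ⟶ j^*(k)` from a natural family of linear maps `F(V) → k(V^{⊗ n})`. -/
def mkJ {F : Pol K n} {k : LinFun K (SymGp n)}
    (l : ∀ V, F.obj.obj V →ₗ[K] k.obj.obj ((iFun K n).obj V))
    (h : ∀ {V W : GamCat K n} (a : V ⟶ W) (x : F.obj.obj V),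
      l W (mp F.obj a x) = mp k.obj ((iFun K n).map a) (l V x)) : F ⟶ (jLin K n).obj k :=
  ObjectProperty.homMk (mkNat l h)

lemma jAp_mkJ {F : Pol K n} {k : LinFun K (SymGp n)}
    (l : ∀ V, F.obj.obj V →ₗ[K] k.obj.obj ((iFun K n).obj V))
    (h : ∀ {V W : GamCat K n} (a : V ⟶ W) (x : F.obj.obj V),
      l W (mp F.obj a x) = mp k.obj ((iFun K n).map a) (l V x)) (V : GamCat K n) :
    jAp (mkJ l h) V = l V := rfl

lemma jAp_ext {F : Pol K n} {k : LinFun K (SymGp n)} {θ θ' : F ⟶ (jLin K n).obj k}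
    (h : ∀ V x, jAp θ V x = jAp θ' V x) : θ = θ' :=
  ObjectProperty.hom_ext _ (nat_ext h)

lemma jAp_comp_map {F : Pol K n} {k k' : LinFun K (SymGp n)} (θ : F ⟶ (jLin K n).obj k)
    (s : k ⟶ k') (V : GamCat K n) (x : F.obj.obj V) :
    jAp (θ ≫ (jLin K n).map s) V x = ap s.hom _ (jAp θ V x) := rfl

/-- The coherent functor `c` with the morphism `η : F ⟶ j^*(c)` is the value of the left adjoint
of `j^*` at `F`. -/
structure IsLeftJ (F : Pol K n) (c : Coh K (SymGp n)) (η : F ⟶ (jLin K n).obj c.obj) : Prop where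
  gen : ∀ (X : FDRep.{u} K (SymGp n)) (z : c.obj.obj.obj X),
    z ∈ Submodule.span K {z | ∃ (V : GamCat K n) (x : F.obj.obj V) (φ : (iFun K n).obj V ⟶ X),
      mp c.obj.obj φ (jAp η V x) = z}
  desc : ∀ (k : LinFun K (SymGp n)) (θ : F ⟶ (jLin K n).obj k),
    ∃ s : c.obj ⟶ k, η ≫ (jLin K n).map s = θ

/-- For a finite-dimensional space `E` of endomorphisms of `P` acting on a finite-dimensional space
`A` from the left, the coherent functor `A ⊗_E Hom(P, -)`. It is the cokernel of a map between
powers of `Hom(P, -)`. -/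
lemma exists_cotensor {G : Type} [Group G] {A E : Type u} [AddCommGroup A] [Module K A]
    [Module.Finite K A] [AddCommGroup E] [Module K E] [Module.Finite K E] (P : FDRep.{u} K G)
    (r : E →ₗ[K] (P ⟶ P)) (l : E →ₗ[K] A →ₗ[K] A) :
    ∃ (c : Coh K G) (q : A →ₗ[K] c.obj.obj.obj P),
      (∀ e x, q (l e x) = mp c.obj.obj (r e) (q x)) ∧
      (∀ (X : FDRep.{u} K G) (z : c.obj.obj.obj X),
        z ∈ Submodule.span K {z | ∃ (x : A) (φ : P ⟶ X), mp c.obj.obj φ (q x) = z}) ∧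
      (∀ (k : LinFun K G) (s : A →ₗ[K] k.obj.obj P), (∀ e x, s (l e x) = mp k.obj (r e) (s x)) →
        ∃ t : c.obj ⟶ k, ∀ x, ap t.hom P (q x) = s x) ∧
      ∃ (M N : FDRep.{u} K G) (a : M ⟶ N) (e : c.obj.obj.obj M), IsPres c.obj.obj a e ∧
        IsGenBy (· = P) M ∧ IsGenBy (· = P) N := by
  classical
  have : HasFiniteBiproducts (FDRep.{u} K G) := Abelian.hasFiniteBiproducts
  let b := Module.finBasis K A
  let b' := Module.finBasis K E
  let M := ⨁ fun _ : Fin (Module.finrank K A) => P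
  let N := ⨁ fun _ : Fin (Module.finrank K E) × Fin (Module.finrank K A) => P
  let pM : Fin (Module.finrank K A) → (M ⟶ P) := biproduct.π _
  let iM : Fin (Module.finrank K A) → (P ⟶ M) := biproduct.ι _
  let pN : Fin (Module.finrank K E) × Fin (Module.finrank K A) → (N ⟶ P) := biproduct.π _
  let iN : Fin (Module.finrank K E) × Fin (Module.finrank K A) → (P ⟶ N) := biproduct.ι _
  have tM : ∑ i, pM i ≫ iM i = 𝟙 M := biproduct.total
  have tN : ∑ i, pN i ≫ iN i = 𝟙 N := biproduct.total
  have ip : ∀ i, iM i ≫ pM i = 𝟙 P := fun i => biproduct.ι_π_self _ i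
  have ip' : ∀ i j, i ≠ j → iM i ≫ pM j = 0 := fun i j h => biproduct.ι_π_ne _ h
  let a' : ∀ p : Fin (Module.finrank K E) × Fin (Module.finrank K A), M ⟶ P := fun p =>
    ∑ i, b.coord i (l (b' p.1) (b p.2)) • pM i - pM p.2 ≫ r (b' p.1)
  let a : M ⟶ N := biproduct.lift a'
  have ha : ∀ p, a ≫ pN p = a' p := fun p => biproduct.lift_π _ _
  let e := cokerGen K a
  have he : IsPres (cokerLin K a).obj a e := isPres_cokerLin K a
  have hv : ∀ (k : LinFun K G) (s : A →ₗ[K] k.obj.obj P),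
      (∀ i j, s (l (b' i) (b j)) = mp k.obj (r (b' i)) (s (b j))) →
      ∀ e x, s (l e x) = mp k.obj (r e) (s x) := by
    intro k s hs e x
    rw [← b.sum_repr x, ← b'.sum_repr e]
    simp only [map_sum, LinearMap.sum_apply, map_smul, LinearMap.smul_apply, hs, mp_sum, mp_smul]
  let q : A →ₗ[K] (cokerLin K a).obj.obj P := b.constr K fun i => mp (cokerLin K a).obj (pM i) e
  have hq : ∀ i, q (b i) = mp (cokerLin K a).obj (pM i) e := b.constr_basis K _
  have sum : ∀ (k : LinFun K G) (s : A →ₗ[K] k.obj.obj P) x, ∑ i, b.coord i x • s (b i) = s x :=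
    fun k s x => by
      conv_rhs => rw [← b.sum_repr x, map_sum]
      exact Finset.sum_congr rfl fun i _ => by rw [map_smul]; rfl
  refine ⟨⟨cokerLin K a, isCoherent_cokerLin K a⟩, q, hv _ q fun i j => ?_, fun X z => ?_,
    fun k s hs => ?_, M, N, a, e, he, ⟨_, inferInstance, _, pM, iM, fun _ => rfl, tM⟩,
    ⟨_, inferInstance, _, pN, iN, fun _ => rfl, tN⟩⟩
  · have h0 : mp (cokerLin K a).obj (a' (i, j)) e = 0 := by
      rw [← ha, mp_comp, he.rel_self, map_zero]
    simp only [a', mp_sub, mp_sum, mp_smul, mp_comp, sub_eq_zero, ← hq] at h0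
    rw [← h0]
    exact (sum _ q _).symm
  · obtain ⟨φ, rfl⟩ := he.gen X z
    have : φ = ∑ i, pM i ≫ iM i ≫ φ := by
      simp only [← Category.assoc, ← Preadditive.sum_comp, tM, Category.id_comp]
    rw [this, mp_sum]
    refine Submodule.sum_mem _ fun i _ => Submodule.subset_span ⟨b i, iM i ≫ φ, ?_⟩
    rw [hq, ← mp_comp]
  · let y : k.obj.obj M := ∑ i, mp k.obj (iM i) (s (b i))
    have hy : ∀ i, mp k.obj (pM i) y = s (b i) := fun i => by
      simp only [y, map_sum, ← mp_comp]
      rw [Finset.sum_eq_single i]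
      · rw [ip, mp_id]
      · intro j _ hj
        rw [ip' j i hj, mp_zero]
      · simp
    have h0 : mp k.obj a y = 0 := by
      have : a = ∑ p, a' p ≫ iN p := by
        simp only [← ha, Category.assoc, ← Preadditive.comp_sum, tN, Category.comp_id]
      rw [this, mp_sum]
      refine Finset.sum_eq_zero fun p _ => ?_
      have : mp k.obj (a' p) y = 0 := by
        simp only [a', mp_sub, mp_sum, mp_smul, mp_comp, hy, sub_eq_zero]
        rw [← hs]
        exact sum k s _
      rw [mp_comp, this, map_zero]
    obtain ⟨t, ht⟩ := he.exists_desc h0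
    refine ⟨ObjectProperty.homMk t, LinearMap.congr_fun (f := ap t P ∘ₗ q) (b.ext fun i => ?_)⟩
    rw [LinearMap.comp_apply, hq, ap_mp, ht, hy]

variable (K n) in
/-- The tensor powers of finite-dimensional vector spaces, as representations. -/
def IsPower (X : FDRep.{u} K (SymGp n)) : Prop := ∃ V, X = (iFun K n).obj V

/-- A functor presented by direct summands of sums of tensor powers. -/
def IsPresPower (f : LinFun K (SymGp n)) : Prop :=
  ∃ (M N : FDRep.{u} K (SymGp n)) (a : M ⟶ N) (e : f.obj.obj M), IsPres f.obj a e ∧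
    IsGenBy (IsPower K n) M ∧ IsGenBy (IsPower K n) N

/-- The left adjoint of `j^*` at `F` is `F(K^n) ⊗ Hom((K^n)^{⊗ n}, -)`, where the tensor product is
over the endomorphisms of `K^n` in `Γ^n 𝒱`. -/
lemma exists_isLeftJ (F : Pol K n) : ∃ (c : Coh K (SymGp n)) (η : F ⟶ (jLin K n).obj c.obj),
    IsLeftJ F c η ∧ IsPresPower c.obj := by
  let V := stdObj K n
  have : Module.Finite K (V ⟶ V) :=
    Module.Finite.of_injective (Gam K (V.space →ₗ[K] V.space) n).subtype Subtype.val_injective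
  obtain ⟨c, q, hr, hg, hd, M, N, a, e, hp, hM, hN⟩ := exists_cotensor ((iFun K n).obj V) ((iFun K n).mapLinearMap K)
    (LinearMap.mk₂ K (fun (e : V ⟶ V) (x : F.obj.obj V) => mp F.obj e x)
      (fun e e' x => mp_add e e' x) (fun r e x => mp_smul r e x) (fun e x y => map_add _ x y)
      fun r e x => map_smul _ r x)
  have hr : ∀ (e : V ⟶ V) x, q (mp F.obj e x) = mp c.obj.obj ((iFun K n).map e) (q x) := hr
  choose ι hι α β h using exists_sum_eq_id (K := K) (n := n)
  let η₀ : ∀ W, F.obj.obj W →ₗ[K] c.obj.obj.obj ((iFun K n).obj W) := fun W =>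
    ∑ i, mp c.obj.obj ((iFun K n).map (β W i)) ∘ₗ q ∘ₗ mp F.obj (α W i)
  have hη₀ : ∀ W x, η₀ W x = ∑ i, mp c.obj.obj ((iFun K n).map (β W i)) (q (mp F.obj (α W i) x)) :=
    fun W x => LinearMap.sum_apply _ _ _
  have e1 : ∀ {W U} (b : V ⟶ U) (a : W ⟶ V) (x : F.obj.obj W),
      η₀ U (mp F.obj b (mp F.obj a x)) = mp c.obj.obj ((iFun K n).map b) (q (mp F.obj a x)) := by
    intro W U b a x
    rw [hη₀]
    have : ∀ i, mp c.obj.obj ((iFun K n).map (β U i))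
        (q (mp F.obj (α U i) (mp F.obj b (mp F.obj a x)))) =
          mp c.obj.obj ((iFun K n).map (b ≫ α U i ≫ β U i)) (q (mp F.obj a x)) := fun i => by
      rw [← mp_comp, hr, ← mp_comp, ← Functor.map_comp, Category.assoc]
    simp only [this]
    rw [← mp_sum, ← Functor.map_sum, ← Preadditive.comp_sum, h, Category.comp_id]
  have e2 : ∀ W (x : F.obj.obj W), ∑ i, mp F.obj (β W i) (mp F.obj (α W i) x) = x := fun W x => by
    simp only [← mp_comp]
    rw [← mp_sum, h, mp_id]
  have nat : ∀ {W U} (a : W ⟶ U) (x : F.obj.obj W),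
      η₀ U (mp F.obj a x) = mp c.obj.obj ((iFun K n).map a) (η₀ W x) := by
    intro W U a x
    conv_lhs => rw [← e2 W x, map_sum, map_sum]
    rw [hη₀ W, map_sum]
    refine Finset.sum_congr rfl fun i _ => ?_
    rw [← mp_comp (f := F.obj) (β W i) a, e1, Functor.map_comp, mp_comp]
  have hV : ∀ x, η₀ V x = q x := fun x => by
    have := e1 (𝟙 V) (𝟙 V) x
    rwa [mp_id, mp_id, CategoryTheory.Functor.map_id, mp_id] at this
  refine ⟨c, mkJ η₀ nat, ⟨fun X z => ?_, fun k θ => ?_⟩, M, N, a, e, hp,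
    hM.trans fun Y hY => .of ⟨V, hY⟩, hN.trans fun Y hY => .of ⟨V, hY⟩⟩
  · refine Submodule.span_mono ?_ (hg X z)
    rintro z ⟨x, φ, rfl⟩
    exact ⟨V, x, φ, congrArg _ (hV x)⟩
  · obtain ⟨s, hs⟩ := hd k (jAp θ V) fun e x => jAp_mp θ e x
    refine ⟨s, jAp_ext fun W x => ?_⟩
    rw [jAp_comp_map, jAp_mkJ, hη₀, map_sum]
    conv_rhs => rw [← e2 W x, map_sum]
    refine Finset.sum_congr rfl fun i _ => ?_
    rw [ap_mp, hs, jAp_mp, jAp_mp, jAp_mp]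

lemma IsLeftJ.hom_ext {F : Pol K n} {c : Coh K (SymGp n)} {η : F ⟶ (jLin K n).obj c.obj}
    (h : IsLeftJ F c η) {k : LinFun K (SymGp n)} {s s' : c.obj ⟶ k}
    (e : η ≫ (jLin K n).map s = η ≫ (jLin K n).map s') : s = s' := by
  refine ObjectProperty.hom_ext _ (nat_ext fun X z => ?_)
  change z ∈ LinearMap.eqLocus (ap s.hom X) (ap s'.hom X)
  refine Submodule.span_le.2 ?_ (h.gen X z)
  rintro z ⟨V, x, φ, rfl⟩
  change ap s.hom X (mp c.obj.obj φ (jAp η V x)) = ap s'.hom X (mp c.obj.obj φ (jAp η V x))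
  rw [ap_mp, ap_mp, ← jAp_comp_map, e, jAp_comp_map]

variable (K n) in
lemma exists_leftJ : ∃ (J : Pol K n ⥤ Coh K (SymGp n)) (η : 𝟭 (Pol K n) ⟶ J ⋙ jCoh K n),
    ∀ F, IsLeftJ F (J.obj F) (η.app F) ∧ IsPresPower (J.obj F).obj := by
  choose c η h₀ using exists_isLeftJ (K := K) (n := n)
  have h := fun F => (h₀ F).1
  choose m hm using fun {F F' : Pol K n} (t : F ⟶ F') => (h F).desc _ (t ≫ η F')
  refine ⟨{ obj := c
            map := fun t => ObjectProperty.homMk (m t)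
            map_id := fun F => ObjectProperty.hom_ext _ ((h F).hom_ext ?_)
            map_comp := fun s t => ObjectProperty.hom_ext _ ((h _).hom_ext ?_) },
    { app := η, naturality := fun F F' t => (hm t).symm }, h₀⟩
  · exact (hm _).trans ((Category.id_comp _).trans (Category.comp_id _).symm)
  · refine (hm _).trans (Eq.trans ?_ (congrArg (η _ ≫ ·) ((jLin K n).map_comp (m s) (m t)).symm))
    rw [← Category.assoc, hm, Category.assoc, Category.assoc, hm]

variable (K n) in
/-- The left adjoint `j_!` of `j^*`, with values in coherent functors. -/
def leftJ : Pol K n ⥤ Coh K (SymGp n) := (exists_leftJ K n).choose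

variable (K n) in
/-- The unit of the adjunction between `j_!` and `j^*`. -/
def leftJUnit : 𝟭 (Pol K n) ⟶ leftJ K n ⋙ jCoh K n := (exists_leftJ K n).choose_spec.choose

lemma leftJ_isLeftJ (F : Pol K n) : IsLeftJ F ((leftJ K n).obj F) ((leftJUnit K n).app F) :=
  ((exists_leftJ K n).choose_spec.choose_spec F).1

lemma leftJ_isPresPower (F : Pol K n) : IsPresPower ((leftJ K n).obj F).obj :=
  ((exists_leftJ K n).choose_spec.choose_spec F).2

/-- The functor `X ↦ Hom(Hom(X, P), A)`, without its linearity. -/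
def coHomFunctor {G : Type} [Group G] (P : FDRep.{u} K G) (A : FGModuleCat.{u} K) :
    FDRep.{u} K G ⥤ FGModuleCat.{u} K where
  obj X := FGModuleCat.of K ((X ⟶ P) →ₗ[K] A)
  map φ := FGModuleCat.ofHom (LinearMap.lcomp K A (CategoryTheory.Linear.leftComp K P φ))
  map_id X := by
    apply FGModuleCat.hom_ext
    refine LinearMap.ext fun (l : (X ⟶ P) →ₗ[K] A) => LinearMap.ext fun ψ => ?_
    exact congrArg l (Category.id_comp ψ)
  map_comp φ φ' := by
    apply FGModuleCat.hom_ext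
    refine LinearMap.ext fun l => LinearMap.ext fun ψ => ?_
    exact congrArg l (Category.assoc φ φ' ψ)

/-- The unit `F ⟶ j^* j_! F` is an isomorphism. It is surjective as `V ↦ V^{⊗ n}` is full, and
injective as `F` embeds into `j^*` of the functor `X ↦ Hom(Hom(X, (K^n)^{⊗ n}), F(K^n))`. -/
lemma leftJUnit_bijective (F : Pol K n) (W : GamCat K n) :
    Function.Bijective (jAp ((leftJUnit K n).app F) W) := by
  let η : F ⟶ (jLin K n).obj ((leftJ K n).obj F).obj := (leftJUnit K n).app F
  have hη : IsLeftJ F _ η := leftJ_isLeftJ F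
  change Function.Bijective (jAp η W)
  let V := stdObj K n
  let i : ∀ U, (U ⟶ V) ≃ₗ[K] ((iFun K n).obj U ⟶ (iFun K n).obj V) := fun U =>
    LinearEquiv.ofBijective ((iFun K n).mapLinearMap K) (iFun_map_bijective U V)
  constructor
  · let k : LinFun K (SymGp n) := ⟨coHomFunctor ((iFun K n).obj V) (F.obj.obj V), isLinear_of_mp _
      (fun φ ψ (l : (_ ⟶ (iFun K n).obj V) →ₗ[K] F.obj.obj V) => LinearMap.ext fun χ =>
        (congrArg l (Preadditive.add_comp _ _ _ φ ψ χ)).trans (map_add l _ _))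
      (fun r φ (l : (_ ⟶ (iFun K n).obj V) →ₗ[K] F.obj.obj V) => LinearMap.ext fun χ =>
        (congrArg l (CategoryTheory.Linear.smul_comp _ _ _ r φ χ)).trans (map_smul l _ _))⟩
    let l₀ : ∀ U, F.obj.obj U →ₗ[K] (U ⟶ V) →ₗ[K] F.obj.obj V := fun U =>
      LinearMap.mk₂ K (fun x a => mp F.obj a x) (fun x y a => map_add _ x y)
        (fun r x a => map_smul _ r x) (fun x a b => mp_add a b x)
        (fun r x a => mp_smul (f := F.obj) r a x)
    let l : ∀ U, F.obj.obj U →ₗ[K] ((iFun K n).obj U ⟶ (iFun K n).obj V) →ₗ[K] F.obj.obj V :=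
      fun U => LinearMap.lcomp K (F.obj.obj V) (i U).symm.toLinearMap ∘ₗ l₀ U
    have hl : ∀ U x (a : U ⟶ V), l U x ((iFun K n).map a) = mp F.obj a x := fun U x a =>
      congrArg (fun a => mp F.obj a x) ((i U).symm_apply_apply a)
    obtain ⟨s, hs⟩ := hη.desc k (mkJ (k := k) l fun {U U'} b x => LinearMap.ext fun χ => by
      obtain ⟨a, rfl⟩ := (i U').surjective χ
      refine (hl U' (mp F.obj b x) a).trans ((mp_comp b a x).symm.trans ((hl U x (b ≫ a)).symm.trans ?_))
      exact congrArg (l U x) ((iFun K n).map_comp b a))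
    refine (injective_iff_map_eq_zero _).2 fun x hx => ?_
    have h0 : l W x = 0 := by
      have h1 : ap s.hom _ (jAp η W x) = l W x := congrArg (fun θ => jAp θ W x) hs
      rw [← h1, hx, map_zero]
      rfl
    obtain ⟨ι, _, α, β, e⟩ := exists_sum_eq_id W
    have : ∑ i, mp F.obj (β i) (mp F.obj (α i) x) = x := by
      simp only [← mp_comp]
      rw [← mp_sum, e, mp_id]
    rw [← this]
    refine Finset.sum_eq_zero fun j _ => ?_
    have : mp F.obj (α j) x = 0 := by
      rw [← hl, h0]
      rfl
    rw [this, map_zero]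
  · intro y
    change y ∈ LinearMap.range (jAp η W)
    refine Submodule.span_le.2 ?_ (hη.gen _ y)
    rintro z ⟨U, x, φ, rfl⟩
    obtain ⟨a, rfl⟩ := (iFun_map_bijective U W).2 φ
    exact ⟨mp F.obj a x, jAp_mp η a x⟩

variable (K n) in
/-- The functor `j_!` is left adjoint to `j^*`. -/
def leftJAdj : leftJ K n ⋙ Coh.incl K (SymGp n) ⊣ jLin K n :=
  Adjunction.mkOfHomEquiv
    { homEquiv := fun F k => Equiv.ofBijective
        (fun (s : ((leftJ K n).obj F).obj ⟶ k) => (leftJUnit K n).app F ≫ (jLin K n).map s)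
        ⟨fun _ _ e => (leftJ_isLeftJ F).hom_ext e, (leftJ_isLeftJ F).desc k⟩
      homEquiv_naturality_left_symm := fun {F F' k} t θ => by
        obtain ⟨s, rfl⟩ := (leftJ_isLeftJ F').desc k θ
        rw [Equiv.symm_apply_eq]
        refine Eq.trans ?_ (congrArg ((leftJUnit K n).app F ≫ ·) ((jLin K n).map_comp _ _).symm)
        refine Eq.trans ?_ (congrArg (fun r => ((leftJUnit K n).app F ≫
          (jLin K n).map ((leftJ K n).map t).hom) ≫ (jLin K n).map r)
            (Equiv.ofBijective_symm_apply_apply _ _ s).symm)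
        exact (Category.assoc _ _ _).symm.trans
          (congrArg (· ≫ (jLin K n).map s) ((leftJUnit K n).naturality t))
      homEquiv_naturality_right := fun {F k k'} s r =>
        (congrArg ((leftJUnit K n).app F ≫ ·) ((jLin K n).map_comp _ _)).trans
          (Category.assoc _ _ _).symm }

end LeftAdjoint

end

end CoherentFunctors

namespace CoherentFunctors

noncomputable section

/-! ### Induced products of tensor powers -/

lemma IsGenBy.biprod {C : Type*} [Category C] [Preadditive C] [HasBinaryBiproducts C]
    {S : C → Prop} {X Y : C} (hX : IsGenBy S X) (hY : IsGenBy S Y) : IsGenBy S (X ⊞ Y) := by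
  refine IsGenBy.trans (S := IsGenBy S) ⟨Bool, inferInstance, fun b => cond b X Y,
    fun b => match b with
      | true => biprod.fst
      | false => biprod.snd,
    fun b => match b with
      | true => biprod.inl
      | false => biprod.inr, fun b => ?_, ?_⟩ fun _ h => h
  · cases b <;> assumption
  · rw [Fintype.sum_bool]
    exact biprod.total

section RelTrace
variable {K : Type u} [Field K] {G H : Type} [Group G] [Group H]

/-- The sum over the cosets of `H` in `G` of the conjugates of an `H`-equivariant map. On a vector
all of whose translates by elements outside `H` are annihilated by `t`, only one summand remains. -/
lemma exists_relTrace [Finite G] (φ : H →* G) {X Y : FDRep.{u} K G}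
    (t : (resRep K φ).obj Y ⟶ (resRep K φ).obj X) : ∃ r : Y ⟶ X, ∀ y : Y.V,
      (∀ g, g ∉ φ.range → lin (G := H) t (Y.ρ g y) = 0) → lin r y = lin (G := H) t y := by
  classical
  have := Fintype.ofFinite (G ⧸ φ.range)
  let t' : Y.V →ₗ[K] X.V := lin (G := H) t
  have ht : ∀ h y, t' (Y.ρ (φ h) y) = X.ρ (φ h) (t' y) := fun h y => lin_ρ (G := H) t h y
  let T : G → Y.V →ₗ[K] X.V := fun g => X.ρ g ∘ₗ t' ∘ₗ Y.ρ g⁻¹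
  have hT : ∀ g h, T (g * φ h) = T g := fun g h => LinearMap.ext fun y => by
    have : Y.ρ (g * φ h)⁻¹ y = Y.ρ (φ h⁻¹) (Y.ρ g⁻¹ y) := by
      rw [mul_inv_rev, map_mul, ← map_inv]; rfl
    change X.ρ (g * φ h) (t' (Y.ρ (g * φ h)⁻¹ y)) = X.ρ g (t' (Y.ρ g⁻¹ y))
    rw [this, ht, map_mul]
    change X.ρ g (X.ρ (φ h) (X.ρ (φ h⁻¹) _)) = _
    rw [map_inv φ, Representation.self_inv_apply]
  let T' : G ⧸ φ.range → Y.V →ₗ[K] X.V := Quotient.lift T fun a b hab => by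
    obtain ⟨h, hh⟩ := QuotientGroup.leftRel_apply.1 hab
    rw [← hT a h, hh, mul_inv_cancel_left]
  have hT' : ∀ (g : G) q y, X.ρ g (T' q y) = T' (g • q) (Y.ρ g y) := by
    intro g q y
    obtain ⟨a, rfl⟩ := QuotientGroup.mk_surjective q
    change X.ρ g (X.ρ a (t' (Y.ρ a⁻¹ y))) = X.ρ (g * a) (t' (Y.ρ (g * a)⁻¹ (Y.ρ g y)))
    have : Y.ρ (g * a)⁻¹ (Y.ρ g y) = Y.ρ a⁻¹ y := by
      rw [mul_inv_rev, map_mul]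
      exact congrArg (Y.ρ a⁻¹) (Representation.inv_self_apply _ _ _)
    rw [this, map_mul]
    rfl
  refine ⟨mkRep (∑ q, T' q) fun g y => ?_, fun y hy => ?_⟩
  · rw [LinearMap.sum_apply, LinearMap.sum_apply, map_sum]
    exact (Fintype.sum_equiv (MulAction.toPerm g) _ _ fun q => hT' g q y).symm
  · rw [lin_mkRep, LinearMap.sum_apply, Finset.sum_eq_single (QuotientGroup.mk 1)]
    · change X.ρ 1 (t' (Y.ρ 1⁻¹ y)) = t' y
      rw [inv_one, map_one, map_one]
      rfl
    · intro q _ hq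
      obtain ⟨a, rfl⟩ := QuotientGroup.mk_surjective q
      change X.ρ a (t' (Y.ρ a⁻¹ y)) = 0
      have : t' (Y.ρ a⁻¹ y) = 0 := hy a⁻¹ fun ha => hq (by
        rw [QuotientGroup.eq]
        simpa using ha)
      rw [this, map_zero]
    · simp

end RelTrace

section Retract
variable {K : Type u} [Field K] {m n : ℕ}

/-- The map `x₁ ⊗ ⋯ ⊗ xₙ ↦ a(x₁) ⊗ ⋯ ⊗ a(xₙ)` of tensor powers. -/
abbrev powMap (n : ℕ) {V W : FGModuleCat.{u} K} (a : V →ₗ[K] W) :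
    (iFun K n).obj ⟨V⟩ ⟶ (iFun K n).obj ⟨W⟩ :=
  (iFun K n).map (X := (⟨V⟩ : GamCat K n)) (Y := ⟨W⟩) (gam n a)

lemma powMap_tprod {V W : FGModuleCat.{u} K} (a : V →ₗ[K] W) (x : Fin n → V) :
    lin (powMap n a) (PiTensorProduct.tprod K x) = PiTensorProduct.tprod K fun i => a (x i) :=
  powBil_tprod K n _ _ _

lemma mem_range_young (σ : SymGp (m + n))
    (h : ∀ j : Fin m, ∃ i : Fin m, σ (Fin.castAdd n j) = Fin.castAdd n i) :
    σ ∈ (young m n).range := by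
  let τ : Equiv.Perm (Fin m ⊕ Fin n) := finSumFinEquiv.permCongr.symm σ
  have hτ : τ ∈ (Equiv.Perm.sumCongrHom (Fin m) (Fin n)).range := by
    refine Equiv.Perm.mem_sumCongrHom_range_of_perm_mapsTo_inl ?_
    rintro _ ⟨j, rfl⟩
    obtain ⟨i, hi⟩ := h j
    refine ⟨i, ?_⟩
    apply finSumFinEquiv.injective
    simp [τ, hi]
  obtain ⟨p, hp⟩ := hτ
  refine ⟨p, ?_⟩
  change finSumFinEquiv.permCongr (Equiv.Perm.sumCongrHom (Fin m) (Fin n) p) = σ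
  rw [hp]
  exact Equiv.apply_symm_apply _ _

lemma boxPow_ext {V W : FGModuleCat.{u} K} {Z : FDRep.{u} K (SymGp m × SymGp n)}
    {φ ψ : box K ((iFun K m).obj ⟨V⟩) ((iFun K n).obj ⟨W⟩) ⟶ Z}
    (h : ∀ (x : Fin m → V) (y : Fin n → W),
      lin φ (boxMk ((iFun K m).obj ⟨V⟩) ((iFun K n).obj ⟨W⟩)
        (PiTensorProduct.tprod K x) (PiTensorProduct.tprod K y)) =
      lin ψ (boxMk ((iFun K m).obj ⟨V⟩) ((iFun K n).obj ⟨W⟩)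
        (PiTensorProduct.tprod K x) (PiTensorProduct.tprod K y))) : φ = ψ := by
  have e : (boxMk ((iFun K m).obj ⟨V⟩) ((iFun K n).obj ⟨W⟩)).compr₂ (lin φ) =
      (boxMk ((iFun K m).obj ⟨V⟩) ((iFun K n).obj ⟨W⟩)).compr₂ (lin ψ) :=
    powExt K fun x => powExt K fun y => h x y
  exact box_ext fun x y => LinearMap.congr_fun₂ e x y

/-- Every equivariant map `V^{⊗ m} ⊠ W^{⊗ n} → Res X` extends to `U^{⊗ (m + n)}` if `V` and `W` are
complementary summands of `U`. The extension is a relative trace: no permutation outside the Young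
subgroup preserves the positions of the factors in `V` and in `W`. -/
lemma exists_extension {U V W : FGModuleCat.{u} K} (iV : V →ₗ[K] U) (iW : W →ₗ[K] U)
    (pV : U →ₗ[K] V) (pW : U →ₗ[K] W) (hV : pV ∘ₗ iV = LinearMap.id)
    (hW : pW ∘ₗ iW = LinearMap.id) (hVW : pV ∘ₗ iW = 0) (X : FDRep.{u} K (SymGp (m + n)))
    (φ : box K ((iFun K m).obj ⟨V⟩) ((iFun K n).obj ⟨W⟩) ⟶ (resRep K (young m n)).obj X) :
    ∃ r : (iFun K (m + n)).obj ⟨U⟩ ⟶ X,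
      boxHom (powMap m iV) (powMap n iW) ≫ mulRep K m n ⟨U⟩ ≫ (resRep K (young m n)).map r = φ := by
  let t : (resRep K (young m n)).obj ((iFun K (m + n)).obj ⟨U⟩) ⟶ (resRep K (young m n)).obj X :=
    mulRepInv K m n ⟨U⟩ ≫ boxHom (powMap m pV) (powMap n pW) ≫ φ
  have ht : ∀ (a : Fin m → U) (b : Fin n → U), lin t (PiTensorProduct.tprod K
      (fun i => Sum.elim a b (finSumFinEquiv.symm i))) =
        lin φ (boxMk ((iFun K m).obj ⟨V⟩) ((iFun K n).obj ⟨W⟩)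
          (PiTensorProduct.tprod K fun i => pV (a i)) (PiTensorProduct.tprod K fun i => pW (b i))) := by
    intro a b
    have h1 := (congrArg (lin (mulRepInv K m n ⟨U⟩)) (mulEquiv_tprod K a b).symm).trans
      ((lin_mulRepInv K m n ⟨U⟩ _).trans (boxPow_tmul K m n U _ _))
    refine (congrArg (lin (boxHom (powMap m pV) (powMap n pW) ≫ φ)) h1).trans ?_
    refine congrArg (lin φ) ?_
    exact congrArg₂ (fun x y => boxMk ((iFun K m).obj ⟨V⟩) ((iFun K n).obj ⟨W⟩) x y)
      (powMap_tprod pV a) (powMap_tprod pW b)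
  obtain ⟨r, hr⟩ := exists_relTrace (young m n) t
  refine ⟨r, boxPow_ext fun x y => ?_⟩
  let c : Fin (m + n) → U := fun i =>
    Sum.elim (fun j => iV (x j)) (fun j => iW (y j)) (finSumFinEquiv.symm i)
  have h0 : lin (boxHom (powMap m iV) (powMap n iW) ≫ mulRep K m n ⟨U⟩)
      (boxMk ((iFun K m).obj ⟨V⟩) ((iFun K n).obj ⟨W⟩) (PiTensorProduct.tprod K x)
        (PiTensorProduct.tprod K y)) = PiTensorProduct.tprod K c := by
    refine Eq.trans (congrArg₂ (fun x y => lin (mulRep K m n ⟨U⟩)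
      (boxMk ((iFun K m).obj ⟨U⟩) ((iFun K n).obj ⟨U⟩) x y)) (powMap_tprod iV x)
        (powMap_tprod iW y)) ?_
    exact (mulRep_mk K m n ⟨U⟩ _ _).trans (mulEquiv_tprod K _ _)
  refine (congrArg (lin r) h0).trans ((hr _ fun g hg => ?_).trans ?_)
  · have hg' : g⁻¹ ∉ (young m n).range := fun h => hg (inv_mem_iff.1 h)
    have hc : (fun i => c (g⁻¹ i)) = fun i => Sum.elim (fun j => c (g⁻¹ (Fin.castAdd n j)))
        (fun j => c (g⁻¹ (Fin.natAdd m j))) (finSumFinEquiv.symm i) := funext fun i => by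
      obtain ⟨i, rfl⟩ := finSumFinEquiv.surjective i
      rw [Equiv.symm_apply_apply]
      cases i <;> rfl
    have e1 : permAct K U (m + n) g (PiTensorProduct.tprod K c) = PiTensorProduct.tprod K _ :=
      (permAct_tprod K (m + n) g c).trans (congrArg (PiTensorProduct.tprod K) hc)
    refine (congrArg (lin t) e1).trans ((ht _ _).trans ?_)
    obtain ⟨j, hj⟩ : ∃ j : Fin m, ∀ i : Fin m, g⁻¹ (Fin.castAdd n j) ≠ Fin.castAdd n i := by
      by_contra hcon
      push Not at hcon
      exact hg' (mem_range_young _ hcon)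
    obtain ⟨i, hi⟩ : ∃ i : Fin n, g⁻¹ (Fin.castAdd n j) = Fin.natAdd m i := by
      obtain ⟨i, hi⟩ := finSumFinEquiv.surjective (g⁻¹ (Fin.castAdd n j))
      cases i with
      | inl i => exact absurd hi.symm (hj i)
      | inr i => exact ⟨i, hi.symm⟩
    have e2 : PiTensorProduct.tprod K (fun j => pV (c (g⁻¹ (Fin.castAdd n j)))) = 0 := by
      refine MultilinearMap.map_coord_zero _ j ?_
      have : c (Fin.natAdd m i) = iW (y i) := by
        have : finSumFinEquiv.symm (Fin.natAdd m i) = Sum.inr i := by simp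
        simp only [c, this, Sum.elim_inr]
      rw [hi, this]
      exact LinearMap.congr_fun hVW (y i)
    refine (congrArg (fun z => lin φ (boxMk ((iFun K m).obj ⟨V⟩) ((iFun K n).obj ⟨W⟩) z _)) e2).trans ?_
    exact (congrArg (lin φ) (LinearMap.map_zero₂ (boxMk ((iFun K m).obj ⟨V⟩)
      ((iFun K n).obj ⟨W⟩)) _)).trans (map_zero _)
  · refine (ht _ _).trans (congrArg (lin φ) ?_)
    exact congrArg₂ (fun x y => boxMk ((iFun K m).obj ⟨V⟩) ((iFun K n).obj ⟨W⟩)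
      (PiTensorProduct.tprod K x) (PiTensorProduct.tprod K y))
        (funext fun j => LinearMap.congr_fun hV (x j)) (funext fun j => LinearMap.congr_fun hW (y j))

/-- The induced product of tensor powers of `V` and `W` is a direct summand of a tensor power
of `V × W`. -/
lemma isGenBy_ind_box (V : GamCat K m) (W : GamCat K n) : IsGenBy (IsPower K (m + n))
    ((indRep K (young m n)).obj (box K ((iFun K m).obj V) ((iFun K n).obj W))) := by
  let U : FGModuleCat.{u} K := FGModuleCat.of K (V.space × W.space)
  let iV : V.space →ₗ[K] U := LinearMap.inl K _ _
  let iW : W.space →ₗ[K] U := LinearMap.inr K _ _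
  let B := box K ((iFun K m).obj V) ((iFun K n).obj W)
  let E := (indRep K (young m n)).obj B
  let l : B ⟶ (resRep K (young m n)).obj ((iFun K (m + n)).obj ⟨U⟩) :=
    boxHom (powMap m iV) (powMap n iW) ≫ mulRep K m n ⟨U⟩
  obtain ⟨r, hr⟩ := exists_extension (m := m) (n := n) iV iW (LinearMap.fst K _ _)
    (LinearMap.snd K _ _) rfl rfl rfl E (frobenius K (young m n) B E (𝟙 E))
  refine ⟨Unit, inferInstance, fun _ => _, fun _ => (frobenius K (young m n) B _).symm l,
    fun _ => r, fun _ => ⟨⟨U⟩, rfl⟩, ?_⟩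
  rw [Finset.univ_unique, Finset.sum_singleton]
  apply (frobenius K (young m n) B E).injective
  rw [frobenius_comp, LinearEquiv.apply_symm_apply, ← hr]
  rfl

instance (φ : SymGp m × SymGp n →* SymGp (m + n)) : (indRep.{u} K φ).Additive where
  map_add {N N' a b} := by
    apply (frobenius K φ N _).injective
    have e : ∀ a : N ⟶ N', frobenius K φ N _ ((indRep K φ).map a) = a ≫ frobenius K φ N' _ (𝟙 _) :=
      fun a => (congrArg _ (Category.comp_id _).symm).trans (indLinH_naturality K φ a _ (𝟙 _))
    rw [map_add, e, e, e, Preadditive.add_comp]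

lemma isGenBy_ind {M : FDRep.{u} K (SymGp m)} {N : FDRep.{u} K (SymGp n)}
    (hM : IsGenBy (IsPower K m) M) (hN : IsGenBy (IsPower K n) N) :
    IsGenBy (IsPower K (m + n)) ((indRep K (young m n)).obj (box K M N)) := by
  have : ((boxRep.{u} K (SymGp m) (SymGp n)).flip.obj N).Additive :=
    ⟨fun {X Y a b} => congrArg (fun t => t.app N) ((boxRep.{u} K (SymGp m) (SymGp n)).map_add
      (f := a) (g := b))⟩
  refine hM.map ((boxRep K _ _).flip.obj N ⋙ indRep K (young m n)) ?_
  rintro _ ⟨V, rfl⟩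
  refine hN.map ((boxRep K _ _).obj ((iFun K m).obj V) ⋙ indRep K (young m n)) ?_
  rintro _ ⟨W, rfl⟩
  exact isGenBy_ind_box V W

end Retract

/-! ### The left adjoint of evaluation at tensor powers is monoidal -/

section Monoidal
variable {K : Type u} [Field K] {m n : ℕ}

/-- Induction preserves presentations. -/
lemma IsPres.ind {G H : Type} [Group G] [Group H] [Finite G] (φ : H →* G) {f : LinFun K H}
    {M N : FDRep.{u} K H} {a : M ⟶ N} {e : f.obj.obj M} (h : IsPres f.obj a e) :
    IsPres ((indLin K φ).obj f).obj ((indRep K φ).map a)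
      (mp f.obj (frobenius K φ M _ (𝟙 _)) e) := by
  have key : ∀ (X : FDRep.{u} K G) (ψ : (indRep K φ).obj M ⟶ X),
      mp ((indLin K φ).obj f).obj ψ (mp f.obj (frobenius K φ M _ (𝟙 _)) e) =
        mp f.obj (frobenius K φ M X ψ) e := fun X ψ => by
    refine (mp_comp (f := f.obj) _ _ _).symm.trans ?_
    exact congrArg (fun t => mp f.obj t e)
      ((frobenius_comp K φ M (𝟙 _) ψ).symm.trans (congrArg _ (Category.id_comp ψ)))
  refine ⟨fun X x => ?_, fun X ψ => ?_⟩
  · obtain ⟨χ, hχ⟩ := h.gen ((resRep K φ).obj X) x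
    refine ⟨(frobenius K φ M X).symm χ, (key X _).trans ?_⟩
    rw [LinearEquiv.apply_symm_apply]
    exact hχ
  · rw [key]
    refine (h.rel ((resRep K φ).obj X) _).trans ⟨?_, ?_⟩
    · rintro ⟨χ, hχ⟩
      refine ⟨(frobenius K φ N X).symm χ, (frobenius K φ M X).injective ?_⟩
      rw [indLinH_naturality, LinearEquiv.apply_symm_apply, hχ]
    · rintro ⟨χ, rfl⟩
      exact ⟨frobenius K φ N X χ, (indLinH_naturality K φ a X χ).symm⟩

lemma Bil.IsPres₂.isPres_lift {A B C : Type*} [Category A] [Category B] [Category C] [Preadditive C]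
    [HasBinaryBiproducts C] {P : A ⥤ B ⥤ C} {t : C ⥤ FGModuleCat.{u} K} {M N : A} {M' N' : B}
    {a : M ⟶ N} {a' : M' ⟶ N'} {w : t.obj ((P.obj M).obj M')} (h : Bil.IsPres₂ P a a' t w) :
    IsPres t (biprod.lift ((P.map a).app M') ((P.obj M).map a')) w where
  gen := h.gen
  rel Z φ := by
    rw [h.rel]
    constructor
    · rintro ⟨ψ, ψ', rfl⟩
      exact ⟨biprod.desc ψ ψ', by rw [biprod.lift_desc]⟩
    · rintro ⟨ψ, rfl⟩
      refine ⟨biprod.inl ≫ ψ, biprod.inr ≫ ψ, ?_⟩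
      rw [← biprod.lift_desc]
      congr 1
      apply biprod.hom_ext' <;> simp

lemma IsPresPower.tensor {f : Coh K (SymGp m)} {g : Coh K (SymGp n)} (hf : IsPresPower f.obj)
    (hg : IsPresPower g.obj) : IsPresPower (((tensorL K m n).obj f).obj g).obj := by
  have : HasBinaryBiproducts (FDRep.{u} K (SymGp m × SymGp n)) := Abelian.hasBinaryBiproducts
  obtain ⟨M, N, a, e, p, hM, hN⟩ := hf
  obtain ⟨M', N', a', e', p', hM', hN'⟩ := hg
  have h := (((leftTensorIsTensor K (SymGp m) (SymGp n)).univ f g).isPres₂ p p' (cohι_isLinear f)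
    (cohι_isLinear g) (cohι_isLinear _)).isPres_lift
  refine ⟨_, _, _, _, IsPres.ind (young m n) h, isGenBy_ind hM hM', ?_⟩
  exact IsGenBy.map (IsGenBy.biprod (S := fun Z => IsGenBy (IsPower K (m + n))
    ((indRep K (young m n)).obj Z)) (.of (isGenBy_ind hN hM')) (.of (isGenBy_ind hM hN')))
      (indRep K (young m n)) fun _ h => h

lemma tensorMap_comp {F F' F'' : Pol K m} {G G' G'' : Pol K n} (s : F ⟶ F') (s' : F' ⟶ F'')
    (t : G ⟶ G') (t' : G' ⟶ G'') : Pol.tensorMap K s t ≫ Pol.tensorMap K s' t' =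
      Pol.tensorMap K (s ≫ s') (t ≫ t') := by
  ext V : 3
  apply FGModuleCat.hom_ext
  exact (TensorProduct.map_comp _ _ _ _).symm

/-- The unit of the adjunction, as a morphism of strict polynomial functors. -/
def leftEta (F : Pol K n) : F ⟶ (jLin K n).obj ((leftJ K n).obj F).obj := (leftJUnit K n).app F

lemma leftEta_naturality {F F' : Pol K n} (s : F ⟶ F') :
    s ≫ leftEta F' = leftEta F ≫ (jLin K n).map ((leftJ K n).map s).hom :=
  (leftJUnit K n).naturality s

/-- The morphism `j^*(f) ⊗ j^*(g) ⟶ j^*(f ⊗_ℓ g)`. -/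
def jMul (f : Coh K (SymGp m)) (g : Coh K (SymGp n)) :
    Pol.tensorObj K ((jLin K m).obj f.obj) ((jLin K n).obj g.obj) ⟶
      (jLin K (m + n)).obj (((tensorL K m n).obj f).obj g).obj :=
  jBil (f := f.obj) (g := g.obj) (k := (((leftTensor K _ _).obj f).obj g).obj)
    ((leftTensorIsTensor K (SymGp m) (SymGp n)).bil f g)

/-- The action of `⊗_ℓ` on morphisms. -/
def tensorLMap {f f' : Coh K (SymGp m)} {g g' : Coh K (SymGp n)} (s : f ⟶ f') (t : g ⟶ g') :
    ((tensorL K m n).obj f).obj g ⟶ ((tensorL K m n).obj f').obj g' :=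
  ((tensorL K m n).map s).app g ≫ ((tensorL K m n).obj f').map t

lemma jMul_naturality {f f' : Coh K (SymGp m)} {g g' : Coh K (SymGp n)} (s : f ⟶ f')
    (t : g ⟶ g') : Pol.tensorMap K ((jLin K m).map s.hom) ((jLin K n).map t.hom) ≫ jMul f' g' =
      jMul f g ≫ (jLin K (m + n)).map (tensorLMap s t).hom := by
  let h := leftTensorIsTensor K (SymGp m) (SymGp n)
  refine jBil_map (f := f.obj) (g := g.obj) (f' := f'.obj) (g' := g'.obj)
    (k := (((leftTensor K _ _).obj f).obj g).obj) (k' := (((leftTensor K _ _).obj f').obj g').obj)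
    (h.bil f g) (h.bil f' g') s.hom t.hom
    (((leftTensor K _ _).map s).app g ≫ ((leftTensor K _ _).obj f').map t).hom fun X Y x y => ?_
  refine Eq.trans (congrArg (ap (((leftTensor K _ _).obj f').map t).hom.hom _)
    (h.nat_left s g X Y x y)) ?_
  exact h.nat_right f' t X Y _ y

/-- The morphism `F ⊗ G ⟶ j^*(j_! F ⊗_ℓ j_! G)`. -/
def leftEtaTensor (F : Pol K m) (G : Pol K n) : Pol.tensorObj K F G ⟶
    (jLin K (m + n)).obj (((tensorL K m n).obj ((leftJ K m).obj F)).obj ((leftJ K n).obj G)).obj :=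
  Pol.tensorMap K (leftEta F) (leftEta G) ≫ jMul _ _

lemma leftEtaTensor_naturality {F F' : Pol K m} {G G' : Pol K n} (s : F ⟶ F') (t : G ⟶ G') :
    Pol.tensorMap K s t ≫ leftEtaTensor F' G' = leftEtaTensor F G ≫
      (jLin K (m + n)).map (tensorLMap ((leftJ K m).map s) ((leftJ K n).map t)).hom := by
  rw [leftEtaTensor, leftEtaTensor, ← Category.assoc, tensorMap_comp, leftEta_naturality,
    leftEta_naturality, ← tensorMap_comp, Category.assoc, Category.assoc, jMul_naturality]

lemma leftEtaTensor_bijective (F : Pol K m) (G : Pol K n) (V : GamCat K (m + n)) :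
    Function.Bijective (jAp (leftEtaTensor F G) V) := by
  let f := (leftJ K m).obj F
  let g := (leftJ K n).obj G
  have h1 : Function.Bijective (TensorProduct.map (jAp (leftEta F) ⟨V.space⟩)
      (jAp (leftEta G) ⟨V.space⟩)) :=
    (TensorProduct.congr (LinearEquiv.ofBijective _ (leftJUnit_bijective F ⟨V.space⟩))
      (LinearEquiv.ofBijective _ (leftJUnit_bijective G ⟨V.space⟩))).bijective
  exact ((mp_mulRep_bijective K m n _ V).comp (leftTensor_lift_bijective f g _ _)).comp h1

lemma exists_leftJ_tensor (F : Pol K m) (G : Pol K n) :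
    ∃ s : (leftJ K (m + n)).obj (Pol.tensorObj K F G) ⟶
        ((tensorL K m n).obj ((leftJ K m).obj F)).obj ((leftJ K n).obj G),
      leftEta (Pol.tensorObj K F G) ≫ (jLin K (m + n)).map s.hom = leftEtaTensor F G :=
  have ⟨s, hs⟩ := (leftJ_isLeftJ (Pol.tensorObj K F G)).desc _ (leftEtaTensor F G)
  ⟨ObjectProperty.homMk s, hs⟩

/-- The comparison `j_!(F ⊗ G) ⟶ j_! F ⊗_ℓ j_! G` is bijective at tensor powers, where both sides
are `F ⊗ G`; hence it is an isomorphism, as both sides are presented by tensor powers. -/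
lemma isIso_of_leftJ_tensor {F : Pol K m} {G : Pol K n}
    {s : (leftJ K (m + n)).obj (Pol.tensorObj K F G) ⟶
        ((tensorL K m n).obj ((leftJ K m).obj F)).obj ((leftJ K n).obj G)}
    (hs : leftEta (Pol.tensorObj K F G) ≫ (jLin K (m + n)).map s.hom = leftEtaTensor F G) :
    IsIso s := by
  obtain ⟨M, N, a, e, h, hM, hN⟩ := leftJ_isPresPower (Pol.tensorObj K F G)
  obtain ⟨M', N', a', e', h', hM', hN'⟩ := (leftJ_isPresPower F).tensor (leftJ_isPresPower G)
  have hp : ∀ Y, IsPower K (m + n) Y → Function.Bijective (ap s.hom.hom Y) := by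
    rintro _ ⟨V, rfl⟩
    refine (Function.Bijective.of_comp_iff _
      (leftJUnit_bijective (Pol.tensorObj K F G) V)).1 ?_
    have := leftEtaTensor_bijective F G V
    rw [← hs] at this
    exact this
  have := isIso_of_ap_bijective s.hom (h.bijective h' s.hom.hom (hM.bijective _ hp)
    (hM'.bijective _ hp) (hN'.bijective _ hp))
  have : IsIso ((Coh.incl K (SymGp (m + n))).map s) := this
  exact isIso_of_reflects_iso s (Coh.incl K (SymGp (m + n)))

variable (K m n) in
lemma leftJ_tensor : Nonempty (leftJ K m ⋙ tensorL K m n ⋙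
      (Functor.whiskeringLeft _ _ _).obj (leftJ K n) ≅
    Pol.tensor K m n ⋙ (Functor.whiskeringRight _ _ _).obj (leftJ K (m + n))) := by
  choose σ hσ using exists_leftJ_tensor (K := K) (m := m) (n := n)
  have nat : ∀ {F F' : Pol K m} {G G' : Pol K n} (s : F ⟶ F') (t : G ⟶ G'),
      (leftJ K (m + n)).map (Pol.tensorMap K s t) ≫ σ F' G' =
        σ F G ≫ tensorLMap ((leftJ K m).map s) ((leftJ K n).map t) := by
    intro F F' G G' s t
    refine ObjectProperty.hom_ext _ ((leftJ_isLeftJ (Pol.tensorObj K F G)).hom_ext ?_)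
    change leftEta (Pol.tensorObj K F G) ≫ (jLin K (m + n)).map
        (((leftJ K (m + n)).map (Pol.tensorMap K s t)).hom ≫ (σ F' G').hom) =
      leftEta (Pol.tensorObj K F G) ≫ (jLin K (m + n)).map ((σ F G).hom ≫
        (tensorLMap ((leftJ K m).map s) ((leftJ K n).map t)).hom)
    rw [Functor.map_comp, Functor.map_comp, ← Category.assoc, ← Category.assoc, hσ,
      ← leftEtaTensor_naturality, ← leftEta_naturality, Category.assoc, hσ]
  let τ : Pol.tensor K m n ⋙ (Functor.whiskeringRight _ _ _).obj (leftJ K (m + n)) ⟶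
      leftJ K m ⋙ tensorL K m n ⋙ (Functor.whiskeringLeft _ _ _).obj (leftJ K n) :=
    { app := fun F =>
        { app := fun G => σ F G
          naturality := fun G G' t => by
            refine (nat (𝟙 F) t).trans (congrArg (σ F G ≫ ·) ?_)
            rw [tensorLMap, CategoryTheory.Functor.map_id, CategoryTheory.Functor.map_id]
            exact Category.id_comp _ }
      naturality := fun F F' s => NatTrans.ext (funext fun G => by
        refine (nat s (𝟙 G)).trans (congrArg (σ F G ≫ ·) ?_)
        rw [tensorLMap, CategoryTheory.Functor.map_id, CategoryTheory.Functor.map_id]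
        exact Category.comp_id _) }
  have : ∀ F G, IsIso ((τ.app F).app G) := fun F G => isIso_of_leftJ_tensor (hσ F G)
  have : ∀ F, IsIso (τ.app F) := fun F => NatIso.isIso_of_isIso_app _
  have : IsIso τ := NatIso.isIso_of_isIso_app _
  exact ⟨(@asIso _ _ _ _ τ this).symm⟩

end Monoidal

end

end CoherentFunctors

namespace CoherentFunctors

noncomputable section

/-! ### Symmetric monoidal structures from universal bilinear maps -/

open MonoidalCategory

/-- The data from which universal bilinear maps make `D` a symmetric monoidal category. Objects
of `D` are regarded through `ι` as functors on a symmetric monoidal category `C`, the bifunctor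
`T` represents bilinear maps along the tensor product of `C`, and `U` represents the elements of
the value at the unit of `C`. -/
structure TensorSetup {K : Type u} [Field K] {C : Type*} [Category C] [MonoidalCategory C]
    {D : Type*} [Category D] (Q : ObjectProperty (C ⥤ FGModuleCat.{u} K))
    (ι : D ⥤ C ⥤ FGModuleCat.{u} K) (T : D ⥤ D ⥤ D) where
  /-- `D` is, through `ι`, a full category of functors on `C` -/
  ff : ι.FullyFaithful
  prop : ∀ d, Q (ι.obj d)
  prop_left : ∀ (X : C) (k : C ⥤ FGModuleCat.{u} K), Q k → Q (tensorLeft X ⋙ k)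
  prop_right : ∀ (X : C) (k : C ⥤ FGModuleCat.{u} K), Q k → Q (tensorRight X ⋙ k)
  /-- the universal bilinear maps -/
  tens : IsTensor (curriedTensor C) Q ι ι ι T
  /-- the unit object -/
  U : D
  /-- the universal element -/
  e : (ι.obj U).obj (𝟙_ C)
  unit : ∀ k, Q k → ∀ z : k.obj (𝟙_ C), ∃! s : ι.obj U ⟶ k, ap s _ e = z

namespace TensorSetup
variable {K : Type u} [Field K] {C : Type*} [Category C] [MonoidalCategory C]
    {D : Type*} [Category D] {Q : ObjectProperty (C ⥤ FGModuleCat.{u} K)}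
    {ι : D ⥤ C ⥤ FGModuleCat.{u} K} {T : D ⥤ D ⥤ D} (S : TensorSetup Q ι T)

variable (ι) in
/-- The action of a morphism of `D` on elements. -/
def act {a b : D} (s : a ⟶ b) (X : C) : (ι.obj a).obj X →ₗ[K] (ι.obj b).obj X := ap (ι.map s) X

/-- The product of two elements. -/
def el {a b : D} {X Y : C} (x : (ι.obj a).obj X) (y : (ι.obj b).obj Y) :
    (ι.obj ((T.obj a).obj b)).obj (X ⊗ Y) := (S.tens.bil a b).fn X Y x y

omit [MonoidalCategory C] in
@[simp] lemma act_id (a : D) (X : C) (x : (ι.obj a).obj X) : act ι (𝟙 a) X x = x := by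
  rw [act, ι.map_id, ap_id]

omit [MonoidalCategory C] in
lemma act_comp {a b c : D} (s : a ⟶ b) (t : b ⟶ c) (X : C) (x : (ι.obj a).obj X) :
    act ι (s ≫ t) X x = act ι t X (act ι s X x) := by
  rw [act, ι.map_comp, ap_comp]; rfl

omit [MonoidalCategory C] in
lemma act_mp {a b : D} (s : a ⟶ b) {X Y : C} (φ : X ⟶ Y) (x : (ι.obj a).obj X) :
    act ι s Y (mp (ι.obj a) φ x) = mp (ι.obj b) φ (act ι s X x) := ap_mp _ φ x

variable {a a' b b' c d d' : D} {X X' Y Y' Z W : C}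

lemma el_add_left (x x' : (ι.obj a).obj X) (y : (ι.obj b).obj Y) :
    S.el (x + x') y = S.el x y + S.el x' y := LinearMap.map_add₂ _ x x' y

lemma el_add_right (x : (ι.obj a).obj X) (y y' : (ι.obj b).obj Y) :
    S.el x (y + y') = S.el x y + S.el x y' := ((S.tens.bil a b).fn X Y x).map_add y y'

lemma el_smul_left (r : K) (x : (ι.obj a).obj X) (y : (ι.obj b).obj Y) :
    S.el (r • x) y = r • S.el x y := LinearMap.map_smul₂ _ r x y

lemma el_smul_right (r : K) (x : (ι.obj a).obj X) (y : (ι.obj b).obj Y) :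
    S.el x (r • y) = r • S.el x y := ((S.tens.bil a b).fn X Y x).map_smul r y

lemma el_mp_left (φ : X ⟶ X') (x : (ι.obj a).obj X) (y : (ι.obj b).obj Y) :
    S.el (mp (ι.obj a) φ x) y = mp (ι.obj _) (φ ▷ Y) (S.el x y) :=
  (S.tens.bil a b).nat_left φ Y x y

lemma el_mp_right (ψ : Y ⟶ Y') (x : (ι.obj a).obj X) (y : (ι.obj b).obj Y) :
    S.el x (mp (ι.obj b) ψ y) = mp (ι.obj _) (X ◁ ψ) (S.el x y) :=
  (S.tens.bil a b).nat_right X ψ x y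

lemma act_map_app (s : a ⟶ a') (x : (ι.obj a).obj X) (y : (ι.obj b).obj Y) :
    act ι ((T.map s).app b) _ (S.el x y) = S.el (act ι s X x) y := S.tens.nat_left s b X Y x y

lemma act_obj_map (t : b ⟶ b') (x : (ι.obj a).obj X) (y : (ι.obj b).obj Y) :
    act ι ((T.obj a).map t) _ (S.el x y) = S.el x (act ι t Y y) := S.tens.nat_right a t X Y x y

/-- A bilinear map from a family of bilinear maps. -/
def mkBil {k : C ⥤ FGModuleCat.{u} K}
    (β : ∀ X Y, (ι.obj a).obj X →ₗ[K] (ι.obj b).obj Y →ₗ[K] k.obj (X ⊗ Y))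
    (hl : ∀ {X X'} (φ : X ⟶ X') Y x y, β X' Y (mp (ι.obj a) φ x) y = mp k (φ ▷ Y) (β X Y x y))
    (hr : ∀ X {Y Y'} (ψ : Y ⟶ Y') x y, β X Y' x (mp (ι.obj b) ψ y) = mp k (X ◁ ψ) (β X Y x y)) :
    Bil (curriedTensor C) (ι.obj a) (ι.obj b) k := ⟨β, hl, hr⟩

lemma exists_desc {k : C ⥤ FGModuleCat.{u} K} (hk : Q k)
    (β : Bil (curriedTensor C) (ι.obj a) (ι.obj b) k) :
    ∃ s : ι.obj ((T.obj a).obj b) ⟶ k, ∀ X Y x y, ap s _ (S.el x y) = β.fn X Y x y :=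
  ⟨_, ((S.tens.univ a b) k hk β).choose_spec.1⟩

include S in
lemma exists_act {k : D} (s : ι.obj a ⟶ ι.obj k) : ∃ s' : a ⟶ k, ∀ X x, act ι s' X x = ap s X x :=
  ⟨S.ff.preimage s, fun X x => by rw [act, S.ff.map_preimage]⟩

/-- A set of elements that distinguishes the natural transformations from `a`. -/
def Det (Q : ObjectProperty (C ⥤ FGModuleCat.{u} K)) (ι : D ⥤ C ⥤ FGModuleCat.{u} K) (a : D)
    (A : ∀ X, (ι.obj a).obj X → Prop) : Prop :=
  ∀ k, Q k → ∀ s s' : ι.obj a ⟶ k, (∀ X x, A X x → ap s X x = ap s' X x) → s = s'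

/-- The products of elements of two given sets. -/
inductive Prods (A : ∀ X, (ι.obj a).obj X → Prop) (B : ∀ X, (ι.obj b).obj X → Prop) :
    ∀ X, (ι.obj ((T.obj a).obj b)).obj X → Prop
  | mk (X Y : C) (x : (ι.obj a).obj X) (y : (ι.obj b).obj Y) :
      A X x → B Y y → Prods A B (X ⊗ Y) (S.el x y)

/-- The set of all elements. -/
def all (ι : D ⥤ C ⥤ FGModuleCat.{u} K) (a : D) : ∀ X, (ι.obj a).obj X → Prop :=
  fun _ _ => True

/-- The set consisting of the universal element. -/
inductive IsE : ∀ X, (ι.obj S.U).obj X → Prop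
  | mk : IsE (𝟙_ C) S.e

omit [MonoidalCategory C] in
lemma det_all (a : D) : Det Q ι a (all ι a) := fun _ _ _ _ h => nat_ext fun X x => h X x trivial

lemma det_e : Det Q ι S.U S.IsE := fun k hk _ s' h =>
  (S.unit k hk (ap s' _ S.e)).unique (h _ _ ⟨⟩) rfl

/-- The natural transformation `x ↦ s(x y)`. -/
def mulRight {k : C ⥤ FGModuleCat.{u} K} (s : ι.obj ((T.obj a).obj b) ⟶ k)
    (y : (ι.obj b).obj Y) : ι.obj a ⟶ tensorRight Y ⋙ k :=
  mkNat (fun X => (ap s _).comp (((S.tens.bil a b).fn X Y).flip y)) fun φ x =>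
    (congrArg (ap s _) (S.el_mp_left φ x y)).trans (ap_mp s _ _)

/-- The natural transformation `y ↦ s(x y)`. -/
def mulLeft {k : C ⥤ FGModuleCat.{u} K} (s : ι.obj ((T.obj a).obj b) ⟶ k)
    (x : (ι.obj a).obj X) : ι.obj b ⟶ tensorLeft X ⋙ k :=
  mkNat (fun Y => (ap s _).comp ((S.tens.bil a b).fn X Y x)) fun ψ y =>
    (congrArg (ap s _) (S.el_mp_right ψ x y)).trans (ap_mp s _ _)

/-- Products of distinguishing elements distinguish: for fixed `y` the products `x y` form a natural
transformation in `x`, and for fixed `x` one in `y`, so that the hypotheses apply in turn. -/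
lemma Det.prods {A : ∀ X, (ι.obj a).obj X → Prop} {B : ∀ X, (ι.obj b).obj X → Prop}
    (hA : Det Q ι a A) (hB : Det Q ι b B) : Det Q ι ((T.obj a).obj b) (S.Prods A B) := by
  intro k hk s s' h
  refine (S.tens.univ a b).hom_ext hk fun X Y x y => ?_
  have h1 : ∀ Y (y : (ι.obj b).obj Y), B Y y → S.mulRight s y = S.mulRight s' y :=
    fun Y y hy => hA _ (S.prop_right Y k hk) _ _ fun X x hx => h _ _ ⟨X, Y, x, y, hx, hy⟩
  have h2 : S.mulLeft s x = S.mulLeft s' x :=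
    hB _ (S.prop_left X k hk) _ _ fun Y y hy => congrArg (fun t => ap t X x) (h1 Y y hy)
  exact congrArg (fun t => ap t Y y) h2

include S in
lemma Det.hom_ext {A : ∀ X, (ι.obj a).obj X → Prop} (hA : Det Q ι a A) {p q : a ⟶ b}
    (h : ∀ X x, A X x → act ι p X x = act ι q X x) : p = q :=
  S.ff.map_injective (hA _ (S.prop b) _ _ h)

lemma hom_ext₂ {p q : (T.obj a).obj b ⟶ d}
    (h : ∀ X Y (x : (ι.obj a).obj X) (y : (ι.obj b).obj Y),
      act ι p _ (S.el x y) = act ι q _ (S.el x y)) : p = q :=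
  (Det.prods S (det_all a) (det_all b)).hom_ext S fun _ _ ⟨X, Y, x, y, _, _⟩ => h X Y x y

lemma hom_ext₃ {p q : (T.obj ((T.obj a).obj b)).obj c ⟶ d}
    (h : ∀ X Y Z (x : (ι.obj a).obj X) (y : (ι.obj b).obj Y) (z : (ι.obj c).obj Z),
      act ι p _ (S.el (S.el x y) z) = act ι q _ (S.el (S.el x y) z)) : p = q :=
  (Det.prods S (Det.prods S (det_all a) (det_all b)) (det_all c)).hom_ext S
    fun _ _ ⟨_, Z, _, z, ⟨X, Y, x, y, _, _⟩, _⟩ => h X Y Z x y z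

lemma hom_ext₃' {p q : (T.obj a).obj ((T.obj b).obj c) ⟶ d}
    (h : ∀ X Y Z (x : (ι.obj a).obj X) (y : (ι.obj b).obj Y) (z : (ι.obj c).obj Z),
      act ι p _ (S.el x (S.el y z)) = act ι q _ (S.el x (S.el y z))) : p = q :=
  (Det.prods S (det_all a) (Det.prods S (det_all b) (det_all c))).hom_ext S
    fun _ _ ⟨X, _, x, _, _, ⟨Y, Z, y, z, _, _⟩⟩ => h X Y Z x y z

lemma hom_ext₄ {p q : (T.obj ((T.obj ((T.obj a).obj b)).obj c)).obj d ⟶ d'}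
    (h : ∀ X Y Z W (x : (ι.obj a).obj X) (y : (ι.obj b).obj Y) (z : (ι.obj c).obj Z)
      (w : (ι.obj d).obj W), act ι p _ (S.el (S.el (S.el x y) z) w) =
        act ι q _ (S.el (S.el (S.el x y) z) w)) : p = q :=
  (Det.prods S (Det.prods S (Det.prods S (det_all a) (det_all b)) (det_all c))
    (det_all d)).hom_ext S
    fun _ _ ⟨_, W, _, w, ⟨_, Z, _, z, ⟨X, Y, x, y, _, _⟩, _⟩, _⟩ => h X Y Z W x y z w

/-- A bilinear map, the first argument of which ranges over the values of a functor whose natural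
transformations are distinguished by a set `A` of elements, is obtained from a family of natural
transformations that is bilinear and natural on `A`. -/
lemma exists_desc_of_det {A : ∀ X, (ι.obj a).obj X → Prop} (hA : Det Q ι a A)
    {k : C ⥤ FGModuleCat.{u} K} (hk : Q k)
    (σ : ∀ Y, (ι.obj b).obj Y → (ι.obj a ⟶ tensorRight Y ⋙ k))
    (hadd : ∀ Y y y' X x, A X x → ap (σ Y (y + y')) X x = ap (σ Y y) X x + ap (σ Y y') X x)
    (hsmul : ∀ Y (r : K) y X x, A X x → ap (σ Y (r • y)) X x = r • ap (σ Y y) X x)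
    (hnat : ∀ {Y Y'} (ψ : Y ⟶ Y') y X x, A X x →
      ap (σ Y' (mp (ι.obj b) ψ y)) X x = mp k (X ◁ ψ) (ap (σ Y y) X x : k.obj (X ⊗ Y))) :
    ∃ s : ι.obj ((T.obj a).obj b) ⟶ k, ∀ X Y (x : (ι.obj a).obj X) (y : (ι.obj b).obj Y),
      ap s _ (S.el x y) = ap (σ Y y) X x := by
  have ext : ∀ {Y} {s s' : ι.obj a ⟶ tensorRight Y ⋙ k},
      (∀ X x, A X x → ap s X x = ap s' X x) → s = s' :=
    fun {Y s s'} h => hA _ (S.prop_right Y k hk) s s' h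
  have e1 : ∀ Y y y', σ Y (y + y') = mkNat (fun X => ap (σ Y y) X + ap (σ Y y') X)
      (fun φ x => by
        simp only [LinearMap.add_apply, ap_mp, map_add]) := fun Y y y' =>
    ext fun X x hx => hadd Y y y' X x hx
  have e2 : ∀ Y (r : K) y, σ Y (r • y) = mkNat (fun X => r • ap (σ Y y) X)
      (fun φ x => by
        simp only [LinearMap.smul_apply, ap_mp, map_smul]) := fun Y r y =>
    ext fun X x hx => hsmul Y r y X x hx
  have e3 : ∀ {Y Y'} (ψ : Y ⟶ Y') y, σ Y' (mp (ι.obj b) ψ y) =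
      σ Y y ≫ Functor.whiskerRight ((curriedTensor C).flip.map ψ) k := fun ψ y =>
    ext fun X x hx => hnat ψ y X x hx
  obtain ⟨s, hs⟩ := S.exists_desc hk (mkBil (a := a) (b := b) (k := k)
    (fun X Y => LinearMap.mk₂ K (fun x y => (ap (σ Y y) X x : k.obj (X ⊗ Y)))
      (fun x x' y => map_add _ x x') (fun r x y => map_smul _ r x)
      (fun x y y' => congrArg (fun t => ap t X x) (e1 Y y y'))
      (fun r x y => congrArg (fun t => ap t X x) (e2 Y r y)))
    (fun φ Y x y => ap_mp (σ Y y) φ x)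
    (fun X Y Y' ψ x y => congrArg (fun t => ap t X x) (e3 ψ y)))
  exact ⟨s, hs⟩

/-- Trilinear maps define maps from iterated tensor products. -/
lemma exists_desc₃ {k : C ⥤ FGModuleCat.{u} K} (hk : Q k)
    (t : ∀ X Y Z, (ι.obj a).obj X →ₗ[K] (ι.obj b).obj Y →ₗ[K] (ι.obj c).obj Z →ₗ[K]
      k.obj ((X ⊗ Y) ⊗ Z))
    (h1 : ∀ {X X'} (φ : X ⟶ X') Y Z x y z, t X' Y Z (mp (ι.obj a) φ x) y z =
      mp k ((φ ▷ Y) ▷ Z) (t X Y Z x y z))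
    (h2 : ∀ {Y Y'} (φ : Y ⟶ Y') X Z x y z, t X Y' Z x (mp (ι.obj b) φ y) z =
      mp k ((X ◁ φ) ▷ Z) (t X Y Z x y z))
    (h3 : ∀ {Z Z'} (φ : Z ⟶ Z') X Y x y z, t X Y Z' x y (mp (ι.obj c) φ z) =
      mp k ((X ⊗ Y) ◁ φ) (t X Y Z x y z)) :
    ∃ s : ι.obj ((T.obj ((T.obj a).obj b)).obj c) ⟶ k,
      ∀ X Y Z (x : (ι.obj a).obj X) (y : (ι.obj b).obj Y) (z : (ι.obj c).obj Z),
        ap s _ (S.el (S.el x y) z) = t X Y Z x y z := by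
  have ex : ∀ Z (z : (ι.obj c).obj Z), ∃ s : ι.obj ((T.obj a).obj b) ⟶ tensorRight Z ⋙ k,
      ∀ X Y (x : (ι.obj a).obj X) (y : (ι.obj b).obj Y), ap s _ (S.el x y) = t X Y Z x y z :=
    fun Z z => by
      obtain ⟨s, hs⟩ := S.exists_desc (S.prop_right Z k hk) (mkBil (a := a) (b := b)
        (k := tensorRight Z ⋙ k)
        (fun X Y => (LinearMap.mk₂ K (fun x y => t X Y Z x y z) (fun x x' y => by simp)
          (fun r x y => by simp) (fun x y y' => by simp) (fun r x y => by simp)))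
        (fun φ Y x y => h1 φ Y Z x y z) (fun X Y Y' φ x y => h2 φ X Z x y z))
      exact ⟨s, hs⟩
  choose σ hσ using ex
  obtain ⟨s, hs⟩ := S.exists_desc_of_det (Det.prods S (det_all a) (det_all b)) hk σ
    (by
      rintro Z z z' _ _ ⟨X, Y, x, y, _, _⟩
      rw [hσ, hσ, hσ]; exact map_add _ _ _)
    (by
      rintro Z r z _ _ ⟨X, Y, x, y, _, _⟩
      rw [hσ, hσ]; exact map_smul _ _ _)
    (by
      rintro Z Z' ψ z _ _ ⟨X, Y, x, y, _, _⟩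
      rw [hσ, hσ]; exact h3 ψ X Y x y z)
  exact ⟨s, fun X Y Z x y z => (hs _ _ _ _).trans (hσ _ _ _ _ _ _)⟩

section Braiding
variable [BraidedCategory C]

/-- The interchange of the factors. -/
lemma exists_swap (a b : D) : ∃ s : (T.obj a).obj b ⟶ (T.obj b).obj a,
    ∀ X Y (x : (ι.obj a).obj X) (y : (ι.obj b).obj Y),
      act ι s _ (S.el x y) = mp (ι.obj _) (β_ Y X).hom (S.el y x) := by
  obtain ⟨s, hs⟩ := S.exists_desc (S.prop ((T.obj b).obj a)) (mkBil (a := a) (b := b)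
    (k := ι.obj ((T.obj b).obj a))
    (fun X Y => ((S.tens.bil b a).fn Y X).flip.compr₂ (mp (ι.obj _) (β_ Y X).hom))
    (fun {X X'} φ Y x y => by
      change mp (ι.obj _) (β_ Y X').hom (S.el y (mp (ι.obj a) φ x)) =
        mp (ι.obj _) (φ ▷ Y) (mp (ι.obj _) (β_ Y X).hom (S.el y x))
      rw [el_mp_right, ← mp_comp, ← mp_comp, BraidedCategory.braiding_naturality_right])
    (fun X {Y Y'} φ x y => by
      change mp (ι.obj _) (β_ Y' X).hom (S.el (mp (ι.obj b) φ y) x) =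
        mp (ι.obj _) (X ◁ φ) (mp (ι.obj _) (β_ Y X).hom (S.el y x))
      rw [el_mp_left, ← mp_comp, ← mp_comp, BraidedCategory.braiding_naturality_left]))
  obtain ⟨s', hs'⟩ := S.exists_act s
  exact ⟨s', fun X Y x y => (hs' _ _).trans (hs X Y x y)⟩

/-- The natural transformation underlying the braiding. -/
def swap (a b : D) : (T.obj a).obj b ⟶ (T.obj b).obj a := (S.exists_swap a b).choose

lemma act_swap (x : (ι.obj a).obj X) (y : (ι.obj b).obj Y) :
    act ι (S.swap a b) _ (S.el x y) = mp (ι.obj _) (β_ Y X).hom (S.el y x) :=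
  (S.exists_swap a b).choose_spec X Y x y

end Braiding

section Symmetric
variable [SymmetricCategory C]

lemma swap_swap (a b : D) : S.swap a b ≫ S.swap b a = 𝟙 _ := S.hom_ext₂ fun X Y x y => by
  rw [act_comp, act_swap, act_mp, act_swap, ← mp_comp, SymmetricCategory.symmetry, mp_id, act_id]

/-- The braiding. -/
def braid (a b : D) : (T.obj a).obj b ≅ (T.obj b).obj a :=
  ⟨S.swap a b, S.swap b a, S.swap_swap a b, S.swap_swap b a⟩

/-- The version of `exists_desc₃` for the other bracketing. The braiding moves the factor `a` to the
right. -/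
lemma exists_desc₃' {k : C ⥤ FGModuleCat.{u} K} (hk : Q k)
    (t : ∀ X Y Z, (ι.obj a).obj X →ₗ[K] (ι.obj b).obj Y →ₗ[K] (ι.obj c).obj Z →ₗ[K]
      k.obj (X ⊗ Y ⊗ Z))
    (h1 : ∀ {X X'} (φ : X ⟶ X') Y Z x y z, t X' Y Z (mp (ι.obj a) φ x) y z =
      mp k (φ ▷ (Y ⊗ Z)) (t X Y Z x y z))
    (h2 : ∀ {Y Y'} (φ : Y ⟶ Y') X Z x y z, t X Y' Z x (mp (ι.obj b) φ y) z =
      mp k (X ◁ φ ▷ Z) (t X Y Z x y z))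
    (h3 : ∀ {Z Z'} (φ : Z ⟶ Z') X Y x y z, t X Y Z' x y (mp (ι.obj c) φ z) =
      mp k (X ◁ Y ◁ φ) (t X Y Z x y z)) :
    ∃ s : ι.obj ((T.obj a).obj ((T.obj b).obj c)) ⟶ k,
      ∀ X Y Z (x : (ι.obj a).obj X) (y : (ι.obj b).obj Y) (z : (ι.obj c).obj Z),
        ap s _ (S.el x (S.el y z)) = t X Y Z x y z := by
  obtain ⟨s, hs⟩ := S.exists_desc₃ (a := b) (b := c) (c := a) hk
    (fun Y Z X => LinearMap.mk₂ K
      (fun y z => (mp k (β_ X (Y ⊗ Z)).hom).comp (((t X Y Z).flip y).flip z))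
      (fun y y' z => by ext x; simp) (fun r y z => by ext x; simp)
      (fun y z z' => by ext x; simp) (fun r y z => by ext x; simp))
    (fun {Y Y'} φ Z X y z x => by
      change mp k (β_ X (Y' ⊗ Z)).hom (t X Y' Z x (mp (ι.obj b) φ y) z) =
        mp k _ (mp k (β_ X (Y ⊗ Z)).hom (t X Y Z x y z))
      rw [h2, ← mp_comp, ← mp_comp, BraidedCategory.braiding_naturality_right])
    (fun {Z Z'} φ Y X y z x => by
      change mp k (β_ X (Y ⊗ Z')).hom (t X Y Z' x y (mp (ι.obj c) φ z)) =
        mp k _ (mp k (β_ X (Y ⊗ Z)).hom (t X Y Z x y z))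
      rw [h3, ← mp_comp, ← mp_comp, BraidedCategory.braiding_naturality_right])
    (fun {X X'} φ Y Z y z x => by
      change mp k (β_ X' (Y ⊗ Z)).hom (t X' Y Z (mp (ι.obj a) φ x) y z) =
        mp k _ (mp k (β_ X (Y ⊗ Z)).hom (t X Y Z x y z))
      rw [h1, ← mp_comp, ← mp_comp, BraidedCategory.braiding_naturality_left])
  refine ⟨ι.map (S.swap _ _) ≫ s, fun X Y Z x y z => ?_⟩
  refine (congrArg (ap s _) (S.act_swap x (S.el y z))).trans ?_
  rw [ap_mp, hs]
  change mp k (β_ (Y ⊗ Z) X).hom (mp k (β_ X (Y ⊗ Z)).hom (t X Y Z x y z)) = _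
  rw [← mp_comp, SymmetricCategory.symmetry, mp_id]

/-- The associator of `C` exchanges the products `(x y) z` and `x (y z)`. -/
lemma exists_assoc (a b c : D) :
    ∃ i : (T.obj ((T.obj a).obj b)).obj c ≅ (T.obj a).obj ((T.obj b).obj c),
      ∀ X Y Z (x : (ι.obj a).obj X) (y : (ι.obj b).obj Y) (z : (ι.obj c).obj Z),
        act ι i.hom _ (S.el (S.el x y) z) = mp (ι.obj _) (α_ X Y Z).inv (S.el x (S.el y z)) := by
  obtain ⟨s, hs⟩ := S.exists_desc₃ (a := a) (b := b) (c := c)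
    (S.prop ((T.obj a).obj ((T.obj b).obj c)))
    (fun X Y Z => LinearMap.mk₂ K
      (fun x y => ((mp (ι.obj _) (α_ X Y Z).inv).comp ((S.tens.bil _ _).fn X (Y ⊗ Z) x)).comp
        ((S.tens.bil _ _).fn Y Z y))
      (fun x x' y => by ext z; simp) (fun r x y => by ext z; simp)
      (fun x y y' => by ext z; simp) (fun r x y => by ext z; simp))
    (fun {X X'} φ Y Z x y z => by
      change mp (ι.obj _) (α_ X' Y Z).inv (S.el (mp (ι.obj a) φ x) (S.el y z)) =
        mp (ι.obj _) _ (mp (ι.obj _) (α_ X Y Z).inv (S.el x (S.el y z)))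
      rw [el_mp_left, ← mp_comp, ← mp_comp, associator_inv_naturality_left])
    (fun {Y Y'} φ X Z x y z => by
      change mp (ι.obj _) (α_ X Y' Z).inv (S.el x (S.el (mp (ι.obj b) φ y) z)) =
        mp (ι.obj _) _ (mp (ι.obj _) (α_ X Y Z).inv (S.el x (S.el y z)))
      rw [el_mp_left, el_mp_right, ← mp_comp, ← mp_comp, associator_inv_naturality_middle])
    (fun {Z Z'} φ X Y x y z => by
      change mp (ι.obj _) (α_ X Y Z').inv (S.el x (S.el y (mp (ι.obj c) φ z))) =
        mp (ι.obj _) _ (mp (ι.obj _) (α_ X Y Z).inv (S.el x (S.el y z)))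
      rw [el_mp_right, el_mp_right, ← mp_comp, ← mp_comp, associator_inv_naturality_right])
  obtain ⟨t, ht⟩ := S.exists_desc₃' (a := a) (b := b) (c := c)
    (S.prop ((T.obj ((T.obj a).obj b)).obj c))
    (fun X Y Z => LinearMap.mk₂ K
      (fun x y => (mp (ι.obj _) (α_ X Y Z).hom).comp
        ((S.tens.bil _ _).fn (X ⊗ Y) Z ((S.tens.bil _ _).fn X Y x y)))
      (fun x x' y => by ext z; simp) (fun r x y => by ext z; simp)
      (fun x y y' => by ext z; simp) (fun r x y => by ext z; simp))
    (fun {X X'} φ Y Z x y z => by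
      change mp (ι.obj _) (α_ X' Y Z).hom (S.el (S.el (mp (ι.obj a) φ x) y) z) =
        mp (ι.obj _) _ (mp (ι.obj _) (α_ X Y Z).hom (S.el (S.el x y) z))
      rw [el_mp_left, el_mp_left, ← mp_comp, ← mp_comp, associator_naturality_left])
    (fun {Y Y'} φ X Z x y z => by
      change mp (ι.obj _) (α_ X Y' Z).hom (S.el (S.el x (mp (ι.obj b) φ y)) z) =
        mp (ι.obj _) _ (mp (ι.obj _) (α_ X Y Z).hom (S.el (S.el x y) z))
      rw [el_mp_right, el_mp_left, ← mp_comp, ← mp_comp, associator_naturality_middle])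
    (fun {Z Z'} φ X Y x y z => by
      change mp (ι.obj _) (α_ X Y Z').hom (S.el (S.el x y) (mp (ι.obj c) φ z)) =
        mp (ι.obj _) _ (mp (ι.obj _) (α_ X Y Z).hom (S.el (S.el x y) z))
      rw [el_mp_right, ← mp_comp, ← mp_comp, associator_naturality_right])
  obtain ⟨s', hs'⟩ := S.exists_act s
  obtain ⟨t', ht'⟩ := S.exists_act t
  have es : ∀ X Y Z (x : (ι.obj a).obj X) (y : (ι.obj b).obj Y) (z : (ι.obj c).obj Z),
      act ι s' _ (S.el (S.el x y) z) = mp (ι.obj _) (α_ X Y Z).inv (S.el x (S.el y z)) :=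
    fun X Y Z x y z => (hs' _ _).trans (hs X Y Z x y z)
  have et : ∀ X Y Z (x : (ι.obj a).obj X) (y : (ι.obj b).obj Y) (z : (ι.obj c).obj Z),
      act ι t' _ (S.el x (S.el y z)) = mp (ι.obj _) (α_ X Y Z).hom (S.el (S.el x y) z) :=
    fun X Y Z x y z => (ht' _ _).trans (ht X Y Z x y z)
  refine ⟨⟨s', t', S.hom_ext₃ fun X Y Z x y z => ?_, S.hom_ext₃' fun X Y Z x y z => ?_⟩, es⟩
  · rw [act_comp, es, act_mp, et, ← mp_comp, Iso.hom_inv_id, mp_id, act_id]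
  · rw [act_comp, et, act_mp, es, ← mp_comp, Iso.inv_hom_id, mp_id, act_id]

/-- The associativity constraint. -/
def assoc (a b c : D) : (T.obj ((T.obj a).obj b)).obj c ≅ (T.obj a).obj ((T.obj b).obj c) :=
  (S.exists_assoc a b c).choose

lemma act_assoc (x : (ι.obj a).obj X) (y : (ι.obj b).obj Y) (z : (ι.obj c).obj Z) :
    act ι (S.assoc a b c).hom _ (S.el (S.el x y) z) =
      mp (ι.obj _) (α_ X Y Z).inv (S.el x (S.el y z)) :=
  (S.exists_assoc a b c).choose_spec X Y Z x y z

lemma act_assoc_inv (x : (ι.obj a).obj X) (y : (ι.obj b).obj Y) (z : (ι.obj c).obj Z) :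
    act ι (S.assoc a b c).inv _ (S.el x (S.el y z)) =
      mp (ι.obj _) (α_ X Y Z).hom (S.el (S.el x y) z) := by
  have h := congrArg (mp (ι.obj _) (α_ X Y Z).hom) (S.act_assoc x y z)
  rw [← mp_comp, Iso.inv_hom_id, mp_id] at h
  rw [← h, act_mp, ← act_comp, Iso.hom_inv_id, act_id]

omit [SymmetricCategory C] in
/-- The unitor of `C` removes the distinguished element `e` of `U`; the products `e x` distinguish
morphisms, so this determines an isomorphism. -/
lemma exists_leftUnit (a : D) : ∃ i : (T.obj S.U).obj a ≅ a,
    ∀ X (x : (ι.obj a).obj X), act ι i.hom _ (S.el S.e x) = mp (ι.obj a) (λ_ X).inv x := by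
  have ex : ∀ X (x : (ι.obj a).obj X), ∃ s : ι.obj S.U ⟶ tensorRight X ⋙ ι.obj a,
      ap s _ S.e = mp (ι.obj a) (λ_ X).inv x :=
    fun X x => (S.unit _ (S.prop_right X _ (S.prop a)) (mp (ι.obj a) (λ_ X).inv x)).exists
  choose σ hσ using ex
  obtain ⟨s, hs⟩ := S.exists_desc_of_det (b := a) S.det_e (S.prop a) σ
    (by
      rintro X x x' _ _ ⟨⟩
      rw [hσ, hσ, hσ]; exact map_add _ _ _)
    (by
      rintro X r x _ _ ⟨⟩
      rw [hσ, hσ]; exact map_smul _ _ _)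
    (by
      rintro X X' ψ x _ _ ⟨⟩
      rw [hσ, hσ, ← mp_comp]
      rw [leftUnitor_inv_naturality]
      exact mp_comp (f := ι.obj a) _ _ _)
  obtain ⟨s', hs'⟩ := S.exists_act s
  have es : ∀ X (x : (ι.obj a).obj X), act ι s' _ (S.el S.e x) = mp (ι.obj a) (λ_ X).inv x :=
    fun X x => (hs' _ _).trans ((hs _ _ _ _).trans (hσ X x))
  obtain ⟨t', ht'⟩ := S.exists_act (a := a) (k := (T.obj S.U).obj a) (mkNat
    (fun X => (mp (ι.obj _) (λ_ X).hom).comp ((S.tens.bil S.U a).fn (𝟙_ C) X S.e))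
    (fun {X X'} φ x => by
      change mp (ι.obj _) (λ_ X').hom (S.el S.e (mp (ι.obj a) φ x)) =
        mp (ι.obj _) φ (mp (ι.obj _) (λ_ X).hom (S.el S.e x))
      rw [el_mp_right, ← mp_comp, ← mp_comp, leftUnitor_naturality]))
  have et : ∀ X (x : (ι.obj a).obj X), act ι t' _ x = mp (ι.obj _) (λ_ X).hom (S.el S.e x) := ht'
  refine ⟨⟨s', t', (Det.prods S S.det_e (det_all a)).hom_ext S ?_, ?_⟩, es⟩
  · rintro _ _ ⟨_, X, _, x, ⟨⟩, _⟩
    rw [act_comp, es, act_mp, et, ← mp_comp, Iso.hom_inv_id, mp_id, act_id]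
  · refine (det_all a).hom_ext S fun X x _ => ?_
    rw [act_comp, et, act_mp, es, ← mp_comp, Iso.inv_hom_id, mp_id, act_id]

/-- The left unit constraint. -/
def leftUnit (a : D) : (T.obj S.U).obj a ≅ a := (S.exists_leftUnit a).choose

omit [SymmetricCategory C] in
lemma act_leftUnit (x : (ι.obj a).obj X) :
    act ι (S.leftUnit a).hom _ (S.el S.e x) = mp (ι.obj a) (λ_ X).inv x :=
  (S.exists_leftUnit a).choose_spec X x

/-- The right unit constraint. -/
def rightUnit (a : D) : (T.obj a).obj S.U ≅ a := S.braid a S.U ≪≫ S.leftUnit a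

lemma act_rightUnit (x : (ι.obj a).obj X) :
    act ι (S.rightUnit a).hom _ (S.el x S.e) = mp (ι.obj a) (ρ_ X).inv x := by
  refine (act_comp _ _ _ _).trans ?_
  refine (congrArg _ (S.act_swap x S.e)).trans ?_
  rw [act_mp, act_leftUnit, ← mp_comp, leftUnitor_inv_braiding]

/-- The monoidal structure given by universal bilinear maps. -/
abbrev monoidal : MonoidalCategory D where
  tensorObj a b := (T.obj a).obj b
  whiskerLeft a _ _ s := (T.obj a).map s
  whiskerRight s b := (T.map s).app b
  tensorUnit := S.U
  associator := S.assoc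
  leftUnitor := S.leftUnit
  rightUnitor := S.rightUnit
  tensorHom_def _ _ := rfl
  id_tensorHom_id a b := by simp
  tensorHom_comp_tensorHom f₁ f₂ g₁ g₂ := by simp
  whiskerLeft_id a b := (T.obj a).map_id b
  id_whiskerRight a b := by simp
  associator_naturality {a₁ a₂ a₃ b₁ b₂ b₃} f₁ f₂ f₃ := S.hom_ext₃ fun X Y Z x y z => by
    simp only [act_comp, act_map_app, act_obj_map, act_assoc, act_mp]
  leftUnitor_naturality {a b} f := (Det.prods S S.det_e (det_all a)).hom_ext S fun _ _ h => by
    obtain ⟨_, X, _, x, ⟨⟩, _⟩ := h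
    simp only [act_comp, act_obj_map, act_leftUnit, act_mp]
  rightUnitor_naturality {a b} f := (Det.prods S (det_all a) S.det_e).hom_ext S fun _ _ h => by
    obtain ⟨X, _, x, _, _, ⟨⟩⟩ := h
    simp only [act_comp, act_map_app, act_rightUnit, act_mp]
  pentagon a b c d := S.hom_ext₄ fun X Y Z W x y z w => by
    simp only [act_comp, act_map_app, act_obj_map, act_assoc, act_mp, el_mp_left, el_mp_right,
      ← mp_comp]
    congr 2
    monoidal
  triangle a b := (Det.prods S (Det.prods S (det_all a) S.det_e) (det_all b)).hom_ext S
    fun _ _ h => by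
      obtain ⟨_, Y, _, y, ⟨X, _, x, _, _, ⟨⟩⟩, _⟩ := h
      simp only [act_comp, act_map_app, act_obj_map, act_assoc, act_mp, el_mp_left, el_mp_right,
        ← mp_comp, act_leftUnit, act_rightUnit]
      congr 2
      monoidal

/-- The monoidal structure given by universal bilinear maps is symmetric. -/
abbrev symmetric : @SymmetricCategory D _ S.monoidal :=
  letI := S.monoidal
  { braiding := S.braid
    braiding_naturality_right := fun a b c f => S.hom_ext₂ fun X Y x y => by
      change act ι ((T.obj a).map f ≫ S.swap a c) _ _ = act ι (S.swap a b ≫ (T.map f).app a) _ _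
      simp only [act_comp, act_map_app, act_obj_map, act_swap, act_mp]
    braiding_naturality_left := fun f c => S.hom_ext₂ fun X Y x y => by
      change act ι ((T.map f).app c ≫ S.swap _ c) _ _ = act ι (S.swap _ c ≫ (T.obj c).map f) _ _
      simp only [act_comp, act_map_app, act_obj_map, act_swap, act_mp]
    hexagon_forward := fun a b c => S.hom_ext₃ fun X Y Z x y z => by
      change act ι ((S.assoc a b c).hom ≫ S.swap a ((T.obj b).obj c) ≫ (S.assoc b c a).hom) _ _ =
        act ι ((T.map (S.swap a b)).app c ≫ (S.assoc b a c).hom ≫ (T.obj b).map (S.swap a c)) _ _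
      simp only [act_comp, act_map_app, act_obj_map, act_swap, act_assoc, act_mp, el_mp_left,
        el_mp_right, ← mp_comp]
      congr 2
      simp
    hexagon_reverse := fun a b c => S.hom_ext₃' fun X Y Z x y z => by
      change act ι ((S.assoc a b c).inv ≫ S.swap ((T.obj a).obj b) c ≫ (S.assoc c a b).inv) _ _ =
        act ι ((T.obj a).map (S.swap b c) ≫ (S.assoc a c b).inv ≫ (T.map (S.swap a c)).app b) _ _
      simp only [act_comp, act_map_app, act_obj_map, act_swap, act_assoc_inv, act_mp, el_mp_left,
        el_mp_right, ← mp_comp]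
      congr 2
      simp
    symmetry := fun a b => S.swap_swap a b }

section Additive
variable [Preadditive D] [ι.Additive]

omit [MonoidalCategory C] [SymmetricCategory C] in
lemma act_add (s t : a ⟶ b) (x : (ι.obj a).obj X) :
    act ι (s + t) X x = act ι s X x + act ι t X x := by
  rw [act, ι.map_add]; rfl

include S in
omit [SymmetricCategory C] in
lemma map_app_add (s t : a ⟶ a') : (T.map (s + t)).app b = (T.map s).app b + (T.map t).app b :=
  S.hom_ext₂ fun X Y x y => by
    rw [act_add, act_map_app, act_map_app, act_map_app, act_add, el_add_left]

include S in
omit [SymmetricCategory C] in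
lemma obj_map_add (s t : b ⟶ b') : (T.obj a).map (s + t) = (T.obj a).map s + (T.obj a).map t :=
  S.hom_ext₂ fun X Y x y => by
    rw [act_add, act_obj_map, act_obj_map, act_obj_map, act_add, el_add_right]

lemma monoidalPreadditive :
    letI := S.monoidal
    MonoidalPreadditive D :=
  letI := S.monoidal
  { whiskerLeft_zero := fun {a _ _} => (AddMonoidHom.mk' (T.obj a).map S.obj_map_add).map_zero
    zero_whiskerRight := fun {a b c} =>
      (AddMonoidHom.mk' (fun s : b ⟶ c => (T.map s).app a) S.map_app_add).map_zero
    whiskerLeft_add := S.obj_map_add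
    add_whiskerRight := S.map_app_add }

lemma monoidalLinear [CategoryTheory.Linear K D] [ι.Linear K] :
    letI := S.monoidal
    letI := S.monoidalPreadditive
    MonoidalLinear K D :=
  letI := S.monoidal
  letI := S.monoidalPreadditive
  have act_smul : ∀ {a b : D} {X : C} (r : K) (s : a ⟶ b) (x : (ι.obj a).obj X),
      act ι (r • s) X x = r • act ι s X x := fun r s x => by
    rw [act, ι.map_smul]; rfl
  { whiskerLeft_smul := fun a b c r s => S.hom_ext₂ fun X Y x y => by
      change act ι ((T.obj a).map (r • s)) _ _ = act ι (r • (T.obj a).map s) _ _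
      rw [act_smul, act_obj_map, act_obj_map, act_smul, el_smul_right]
    smul_whiskerRight := fun r {b c} s a => S.hom_ext₂ fun X Y x y => by
      change act ι ((T.map (r • s)).app a) _ _ = act ι (r • (T.map s).app a) _ _
      rw [act_smul, act_map_app, act_map_app, act_smul, el_smul_left] }

end Additive

end Symmetric

end TensorSetup
end
end CoherentFunctors

namespace CoherentFunctors

noncomputable section

/-! ### Linear species -/

open MonoidalCategory

/-- The groupoid with objects the natural numbers `n`, regarded as the sets `Fin n`, and with
morphisms the bijections. -/
structure FinBij : Type where
  /-- the number of elements -/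
  pts : ℕ

namespace FinBij

instance : Category FinBij where
  Hom X Y := Fin X.pts ≃ Fin Y.pts
  id X := Equiv.refl _
  comp f g := Equiv.trans f g

/-- The map underlying a morphism. -/
def fn {X Y : FinBij} (f : X ⟶ Y) : Fin X.pts → Fin Y.pts := (show Fin X.pts ≃ Fin Y.pts from f)

lemma hom_ext {X Y : FinBij} {f g : X ⟶ Y} (h : ∀ i, fn f i = fn g i) : f = g := Equiv.ext h

variable {X X' Y Y' Z : FinBij}

@[simp] lemma fn_id (i : Fin X.pts) : fn (𝟙 X) i = i := rfl

@[simp] lemma fn_comp (f : X ⟶ Y) (g : Y ⟶ Z) (i : Fin X.pts) : fn (f ≫ g) i = fn g (fn f i) := rfl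

/-- Morphisms from bijections. -/
abbrev ofEquiv (e : Fin X.pts ≃ Fin Y.pts) : X ⟶ Y := e

/-- Isomorphisms from bijections. -/
def isoOfEquiv (e : Fin X.pts ≃ Fin Y.pts) : X ≅ Y :=
  ⟨ofEquiv e, ofEquiv e.symm, Equiv.self_trans_symm e, Equiv.symm_trans_self e⟩

/-- The disjoint union. -/
def sum (X Y : FinBij) : FinBij := ⟨X.pts + Y.pts⟩

/-- The inclusion of the first summand. -/
def inl (X Y : FinBij) (i : Fin X.pts) : Fin (sum X Y).pts := Fin.castAdd Y.pts i

/-- The inclusion of the second summand. -/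
def inr (X Y : FinBij) (i : Fin Y.pts) : Fin (sum X Y).pts := Fin.natAdd X.pts i

lemma sum_cases {p : Fin (sum X Y).pts → Prop} (h : ∀ i, p (inl X Y i)) (h' : ∀ i, p (inr X Y i))
    (i : Fin (sum X Y).pts) : p i := Fin.addCases h h' i

/-- The disjoint union of bijections. -/
def sumMap (f : X ⟶ X') (g : Y ⟶ Y') : sum X Y ⟶ sum X' Y' :=
  ofEquiv (finSumFinEquiv.symm.trans ((Equiv.sumCongr f g).trans finSumFinEquiv))

@[simp] lemma sumMap_inl (f : X ⟶ X') (g : Y ⟶ Y') (i : Fin X.pts) :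
    fn (sumMap f g) (inl X Y i) = inl X' Y' (fn f i) := by
  change finSumFinEquiv (Equiv.sumCongr f g (finSumFinEquiv.symm (Fin.castAdd _ i))) = _
  rw [finSumFinEquiv_symm_apply_castAdd]; rfl

@[simp] lemma sumMap_inr (f : X ⟶ X') (g : Y ⟶ Y') (i : Fin Y.pts) :
    fn (sumMap f g) (inr X Y i) = inr X' Y' (fn g i) := by
  change finSumFinEquiv (Equiv.sumCongr f g (finSumFinEquiv.symm (Fin.natAdd _ i))) = _
  rw [finSumFinEquiv_symm_apply_natAdd]; rfl

/-- Associativity of the disjoint union. -/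
def sumAssoc (X Y Z : FinBij) : sum (sum X Y) Z ≅ sum X (sum Y Z) :=
  isoOfEquiv (finCongr (Nat.add_assoc X.pts Y.pts Z.pts))

@[simp] lemma sumAssoc_inl_inl (i : Fin X.pts) :
    fn (sumAssoc X Y Z).hom (inl (sum X Y) Z (inl X Y i)) = inl X (sum Y Z) i := rfl

@[simp] lemma sumAssoc_inl_inr (i : Fin Y.pts) :
    fn (sumAssoc X Y Z).hom (inl (sum X Y) Z (inr X Y i)) = inr X (sum Y Z) (inl Y Z i) := rfl

@[simp] lemma sumAssoc_inr (i : Fin Z.pts) :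
    fn (sumAssoc X Y Z).hom (inr (sum X Y) Z i) = inr X (sum Y Z) (inr Y Z i) :=
  Fin.ext (Nat.add_assoc _ _ _)

/-- The empty set is a left unit. -/
def sumLeft (X : FinBij) : sum ⟨0⟩ X ≅ X := isoOfEquiv (finCongr (Nat.zero_add X.pts))

@[simp] lemma sumLeft_inr (i : Fin X.pts) : fn (sumLeft X).hom (inr ⟨0⟩ X i) = i :=
  Fin.ext (Nat.zero_add _)

/-- The empty set is a right unit. -/
def sumRight (X : FinBij) : sum X ⟨0⟩ ≅ X := isoOfEquiv (Equiv.refl _)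

@[simp] lemma sumRight_inl (i : Fin X.pts) : fn (sumRight X).hom (inl X ⟨0⟩ i) = i := rfl

/-- The interchange of the summands. -/
def sumSwap (X Y : FinBij) : sum X Y ≅ sum Y X := isoOfEquiv finAddFlip

@[simp] lemma sumSwap_inl (i : Fin X.pts) : fn (sumSwap X Y).hom (inl X Y i) = inr Y X i :=
  finAddFlip_apply_castAdd i _

@[simp] lemma sumSwap_inr (i : Fin Y.pts) : fn (sumSwap X Y).hom (inr X Y i) = inl Y X i :=
  finAddFlip_apply_natAdd i _

lemma sum_hom_ext {f g : sum X Y ⟶ Z} (h : ∀ i, fn f (inl X Y i) = fn g (inl X Y i))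
    (h' : ∀ i, fn f (inr X Y i) = fn g (inr X Y i)) : f = g :=
  hom_ext (sum_cases h h')

lemma sum_hom_ext₃ {W : FinBij} {f g : sum (sum X Y) Z ⟶ W}
    (h : ∀ i, fn f (inl _ Z (inl X Y i)) = fn g (inl _ Z (inl X Y i)))
    (h' : ∀ i, fn f (inl _ Z (inr X Y i)) = fn g (inl _ Z (inr X Y i)))
    (h'' : ∀ i, fn f (inr _ Z i) = fn g (inr _ Z i)) : f = g :=
  sum_hom_ext (sum_cases h h') h''

instance : MonoidalCategory FinBij where
  tensorObj := sum
  tensorHom := sumMap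
  whiskerLeft X _ _ f := sumMap (𝟙 X) f
  whiskerRight f Y := sumMap f (𝟙 Y)
  tensorUnit := ⟨0⟩
  associator := sumAssoc
  leftUnitor := sumLeft
  rightUnitor := sumRight
  tensorHom_def f g := sum_hom_ext (fun i => by simp) (fun i => by simp)
  id_tensorHom_id X Y := sum_hom_ext (fun i => by simp) (fun i => by simp)
  tensorHom_comp_tensorHom f f' g g' := sum_hom_ext (fun i => by simp) (fun i => by simp)
  whiskerLeft_id X Y := sum_hom_ext (fun i => by simp) (fun i => by simp)
  id_whiskerRight X Y := sum_hom_ext (fun i => by simp) (fun i => by simp)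
  associator_naturality f g h := sum_hom_ext₃ (fun i => by simp) (fun i => by simp) (fun i => by simp)
  leftUnitor_naturality f := sum_hom_ext (fun i => i.elim0) (fun i => by simp)
  rightUnitor_naturality f := sum_hom_ext (fun i => by simp) (fun i => i.elim0)
  pentagon W X Y Z := sum_hom_ext (sum_cases (sum_cases (fun i => by simp) (fun i => by simp))
    (fun i => by simp)) (fun i => by simp)
  triangle X Y := sum_hom_ext₃ (fun i => by simp) (fun i => i.elim0) (fun i => by simp)

instance : SymmetricCategory FinBij where
  braiding := sumSwap
  braiding_naturality_right X Y Z f := sum_hom_ext (X := X) (Y := Y)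
    (fun i => by change fn (sumSwap X Z).hom (fn (sumMap (𝟙 X) f) _) = fn (sumMap f (𝟙 X)) (fn (sumSwap X Y).hom _); simp)
    (fun i => by change fn (sumSwap X Z).hom (fn (sumMap (𝟙 X) f) _) = fn (sumMap f (𝟙 X)) (fn (sumSwap X Y).hom _); simp)
  braiding_naturality_left {X Y} f Z := sum_hom_ext (X := X) (Y := Z)
    (fun i => by change fn (sumSwap Y Z).hom (fn (sumMap f (𝟙 Z)) _) = fn (sumMap (𝟙 Z) f) (fn (sumSwap X Z).hom _); simp)
    (fun i => by change fn (sumSwap Y Z).hom (fn (sumMap f (𝟙 Z)) _) = fn (sumMap (𝟙 Z) f) (fn (sumSwap X Z).hom _); simp)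
  hexagon_forward X Y Z := by
    change (sumAssoc X Y Z).hom ≫ (sumSwap X (sum Y Z)).hom ≫ (sumAssoc Y Z X).hom =
      sumMap (sumSwap X Y).hom (𝟙 Z) ≫ (sumAssoc Y X Z).hom ≫ sumMap (𝟙 Y) (sumSwap X Z).hom
    exact sum_hom_ext₃ (fun i => by simp) (fun i => by simp) (fun i => by simp)
  hexagon_reverse X Y Z := by
    change (sumAssoc X Y Z).inv ≫ (sumSwap (sum X Y) Z).hom ≫ (sumAssoc Z X Y).inv =
      sumMap (𝟙 X) (sumSwap Y Z).hom ≫ (sumAssoc X Z Y).inv ≫ sumMap (sumSwap X Z).hom (𝟙 Y)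
    rw [← cancel_epi (sumAssoc X Y Z).hom, Iso.hom_inv_id_assoc,
      ← cancel_mono (sumAssoc Z X Y).hom]
    simp only [Category.assoc, Iso.inv_hom_id, Category.comp_id]
    have e1 : ∀ i, fn (sumAssoc X Z Y).inv (inl X (sum Z Y) i) = inl _ Y (inl X Z i) := fun i => rfl
    have e2 : ∀ i, fn (sumAssoc X Z Y).inv (inr X (sum Z Y) (inl Z Y i)) = inl _ Y (inr X Z i) :=
      fun i => rfl
    have e3 : ∀ i, fn (sumAssoc X Z Y).inv (inr X (sum Z Y) (inr Z Y i)) = inr _ Y i :=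
      fun i => Fin.ext (Nat.add_assoc _ _ _).symm
    exact sum_hom_ext₃ (fun i => by simp [e1]) (fun i => by simp [e3]) (fun i => by simp [e2])
  symmetry X Y := by
    change (sumSwap X Y).hom ≫ (sumSwap Y X).hom = 𝟙 _
    exact sum_hom_ext (fun i => by simp) (fun i => by simp)

instance (X Y : FinBij) : Finite (X ⟶ Y) := inferInstanceAs (Finite (Fin X.pts ≃ Fin Y.pts))

lemma pts_eq (f : X ⟶ Y) : X.pts = Y.pts := by
  simpa using Fintype.card_congr (show Fin X.pts ≃ Fin Y.pts from f)

instance (n : FinBij) : Finite (CostructuredArrow (tensor FinBij) n) := by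
  let F : (Σ (a b : Fin (n.pts + 1)), ((⟨a⟩ ⊗ ⟨b⟩ : FinBij) ⟶ n)) →
      CostructuredArrow (tensor FinBij) n := fun x =>
    CostructuredArrow.mk (S := tensor FinBij)
      (Y := ((⟨x.1⟩ : FinBij), (⟨x.2.1⟩ : FinBij))) x.2.2
  refine Finite.of_surjective F fun y => ?_
  obtain ⟨⟨⟨a⟩, ⟨b⟩⟩, ⟨⟨⟩⟩, f⟩ := y
  have h : a + b = n.pts := pts_eq f
  exact ⟨⟨⟨a, by omega⟩, ⟨b, by omega⟩, f⟩, rfl⟩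

instance (n : FinBij) (x y : CostructuredArrow (tensor FinBij) n) : Finite (x ⟶ y) :=
  Finite.of_injective (fun f => (f.left.1, f.left.2)) fun f g h => by
    ext : 1
    exact Prod.ext (congrArg Prod.fst h) (congrArg Prod.snd h)

end FinBij

/-- Species of finite-dimensional vector spaces over `K`: functors on the groupoid `FinBij`, that
is, sequences of representations of the symmetric groups. -/
def Species (K : Type u) [Field K] := FinBij ⥤ FGModuleCat.{u} K

namespace Species
variable (K : Type u) [Field K]

instance : Category (Species K) := inferInstanceAs (Category (FinBij ⥤ FGModuleCat.{u} K))
instance : Preadditive (Species K) := inferInstanceAs (Preadditive (FinBij ⥤ FGModuleCat.{u} K))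
instance : CategoryTheory.Linear K (Species K) :=
  inferInstanceAs (CategoryTheory.Linear K (FinBij ⥤ FGModuleCat.{u} K))

/-- Species as functors. -/
def ι : Species K ⥤ FinBij ⥤ FGModuleCat.{u} K := 𝟭 (FinBij ⥤ FGModuleCat.{u} K)

instance : (ι K).Additive where
instance : (ι K).Linear K where

/-- The category of species is the category of functors. -/
def ιFF : (ι K).FullyFaithful := Functor.FullyFaithful.id (FinBij ⥤ FGModuleCat.{u} K)

/-- The functor `(a, b) ↦ X(a) ⊗ Y(b)`. -/
def ext (X Y : FinBij ⥤ FGModuleCat.{u} K) : FinBij × FinBij ⥤ FGModuleCat.{u} K where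
  obj p := FGModuleCat.of K (X.obj p.1 ⊗[K] Y.obj p.2)
  map f := FGModuleCat.ofHom (TensorProduct.map (mp X f.1) (mp Y f.2))
  map_id p := FGModuleCat.hom_ext (TensorProduct.ext' fun x y => by
    change mp X (𝟙 p.1) x ⊗ₜ mp Y (𝟙 p.2) y = x ⊗ₜ y
    rw [mp_id, mp_id])
  map_comp f g := FGModuleCat.hom_ext (TensorProduct.ext' fun x y => by
    change mp X (f.1 ≫ g.1) x ⊗ₜ mp Y (f.2 ≫ g.2) y = mp X g.1 (mp X f.1 x) ⊗ₜ mp Y g.2 (mp Y f.2 y)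
    rw [mp_comp, mp_comp])

/-- The products of species exist, as left Kan extensions along the disjoint union. -/
lemma exists_isUniv (X Y : FinBij ⥤ FGModuleCat.{u} K) :
    ∃ (t : FinBij ⥤ FGModuleCat.{u} K) (b : Bil (curriedTensor FinBij) X Y t), b.IsUniv ⊤ := by
  have : ∀ n, HasColimitsOfShape (CostructuredArrow (tensor FinBij) n) (FGModuleCat.{u} K) :=
    fun n => by
      have : Fintype (CostructuredArrow (tensor FinBij) n) := Fintype.ofFinite _
      let i : FinCategory (CostructuredArrow (tensor FinBij) n) :=
        { fintypeObj := this, fintypeHom := fun _ _ => Fintype.ofFinite _ }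
      infer_instance
  have : (tensor FinBij).HasPointwiseLeftKanExtension (ext K X Y) := fun n => inferInstance
  let t := (tensor FinBij).pointwiseLeftKanExtension (ext K X Y)
  let α : ext K X Y ⟶ tensor FinBij ⋙ t :=
    (tensor FinBij).pointwiseLeftKanExtensionUnit (ext K X Y)
  let toBil : ∀ {k : FinBij ⥤ FGModuleCat.{u} K}, (ext K X Y ⟶ tensor FinBij ⋙ k) →
      Bil (curriedTensor FinBij) X Y k := fun {k} s =>
    { fn := fun a b => TensorProduct.curry (ap s (a, b))
      nat_left := fun {a a'} φ b x y => by
        have := ap_mp s (X := (a, b)) (Y := (a', b)) (φ, 𝟙 b) (x ⊗ₜ y)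
        change ap s (a', b) (mp X φ x ⊗ₜ mp Y (𝟙 b) y) = mp k (φ ⊗ₘ 𝟙 b) _ at this
        rw [mp_id, tensorHom_id] at this
        exact this
      nat_right := fun a {b b'} φ x y => by
        have := ap_mp s (X := (a, b)) (Y := (a, b')) (𝟙 a, φ) (x ⊗ₜ y)
        change ap s (a, b') (mp X (𝟙 a) x ⊗ₜ mp Y φ y) = mp k (𝟙 a ⊗ₘ φ) _ at this
        rw [mp_id, id_tensorHom] at this
        exact this }
  refine ⟨t, toBil α, fun k _ β => ?_⟩
  let β' : ext K X Y ⟶ tensor FinBij ⋙ k := mkNat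
    (fun p => TensorProduct.lift (β.fn p.1 p.2)) fun {p q} f z => LinearMap.congr_fun
      (TensorProduct.ext' (g := TensorProduct.lift (β.fn q.1 q.2) ∘ₗ mp (ext K X Y) f)
        (h := mp (tensor FinBij ⋙ k) f ∘ₗ TensorProduct.lift (β.fn p.1 p.2)) fun x y => by
          change β.fn q.1 q.2 (mp X f.1 x) (mp Y f.2 y) = mp k (f.1 ⊗ₘ f.2) (β.fn p.1 p.2 x y)
          rw [β.nat_left, β.nat_right, MonoidalCategory.tensorHom_def', mp_comp]; rfl) z
  obtain ⟨s, hs, hs'⟩ := (t.homEquivOfIsLeftKanExtension α k).bijective.existsUnique β'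
  refine ⟨s, fun a b x y => congrArg (fun r => ap r (a, b) (x ⊗ₜ y)) hs, fun s' h => hs' s' ?_⟩
  refine nat_ext fun p z => LinearMap.congr_fun (TensorProduct.ext'
    (g := ap ((t.homEquivOfIsLeftKanExtension α k) s') p) (h := ap β' p) fun x y => ?_) z
  exact h p.1 p.2 x y

lemma exists_tensor : ∃ T : Species K ⥤ Species K ⥤ Species K,
    Nonempty (IsTensor (curriedTensor FinBij) ⊤ (ι K) (ι K) (ι K) T) :=
  exists_isTensor _ _ (ιFF K) (fun _ => trivial) fun X Y => exists_isUniv K X Y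

/-- The species `n ↦ K[Hom(∅, n)]`. -/
def unit : Species K where
  obj n := FGModuleCat.of K ((𝟙_ FinBij ⟶ n) →₀ K)
  map f := FGModuleCat.ofHom (Finsupp.lmapDomain K K (fun g => g ≫ f))
  map_id n := FGModuleCat.hom_ext (Finsupp.lhom_ext' fun g => LinearMap.ext_ring (by
    change Finsupp.mapDomain _ (Finsupp.single g 1) = Finsupp.single g 1
    rw [Finsupp.mapDomain_single, Category.comp_id]))
  map_comp f f' := FGModuleCat.hom_ext (Finsupp.lhom_ext' fun g => LinearMap.ext_ring (by
    change Finsupp.mapDomain _ (Finsupp.single g (1 : K)) =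
      Finsupp.mapDomain _ (Finsupp.mapDomain _ (Finsupp.single g 1))
    rw [Finsupp.mapDomain_single, Finsupp.mapDomain_single, Finsupp.mapDomain_single,
      Category.assoc]))

lemma unit_univ (k : FinBij ⥤ FGModuleCat.{u} K) (z : k.obj (𝟙_ FinBij)) :
    ∃! s : (ι K).obj (unit K) ⟶ k, ap s _ (Finsupp.single (𝟙 (𝟙_ FinBij)) (1 : K)) = z := by
  refine ⟨mkNat (fun n => Finsupp.linearCombination K fun g : 𝟙_ FinBij ⟶ n => mp k g z)
    fun {n n'} φ x => LinearMap.congr_fun (Finsupp.lhom_ext'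
      (φ := (Finsupp.linearCombination K fun g : 𝟙_ FinBij ⟶ n' => mp k g z) ∘ₗ
        Finsupp.lmapDomain K K (fun g => g ≫ φ))
      (ψ := mp k φ ∘ₗ Finsupp.linearCombination K fun g : 𝟙_ FinBij ⟶ n => mp k g z) fun g =>
        LinearMap.ext_ring (by simp [mp_comp])) x, ?_, fun s hs => ?_⟩
  · change Finsupp.linearCombination K _ (Finsupp.single _ _) = _
    simp
  · refine nat_ext fun n x => LinearMap.congr_fun (Finsupp.lhom_ext' (φ := ap s n)
      (ψ := Finsupp.linearCombination K fun g : 𝟙_ FinBij ⟶ n => mp k g z) fun g =>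
        LinearMap.ext_ring ?_) x
    change ap s n (Finsupp.single g 1) = Finsupp.linearCombination K _ (Finsupp.single g 1)
    have e : (Finsupp.single g (1 : K) : (𝟙_ FinBij ⟶ n) →₀ K) =
        mp ((ι K).obj (unit K)) g (Finsupp.single (𝟙 (𝟙_ FinBij)) (1 : K)) := by
      change _ = Finsupp.mapDomain _ _
      rw [Finsupp.mapDomain_single, Category.id_comp]
    rw [Finsupp.linearCombination_single, one_smul, ← hs]
    exact (congrArg (ap s n) e).trans (ap_mp s g _)

/-- The product of species `(X · Y)(n) = ⨁ X(a) ⊗ Y(b)`, the sum over the decompositions of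
`Fin n`, by its universal property. -/
def setup : TensorSetup ⊤ (ι K) (exists_tensor K).choose where
  ff := ιFF K
  prop _ := trivial
  prop_left _ _ _ := trivial
  prop_right _ _ _ := trivial
  tens := (exists_tensor K).choose_spec.some
  U := unit K
  e := Finsupp.single (𝟙 (𝟙_ FinBij)) (1 : K)
  unit k _ z := unit_univ K k z

instance : MonoidalCategory (Species K) := (setup K).monoidal
instance : SymmetricCategory (Species K) := (setup K).symmetric
instance : MonoidalPreadditive (Species K) := (setup K).monoidalPreadditive
instance : MonoidalLinear K (Species K) := (setup K).monoidalLinear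

end Species
end
end CoherentFunctors

namespace CoherentFunctors

noncomputable section

/-! ### The components of a species -/

open MonoidalCategory

namespace Species
variable (K : Type u) [Field K]

/-- The value of a species at `d`, as a representation of `S_d`. -/
def ev (d : ℕ) : Species K ⥤ FDRep.{u} K (SymGp d) where
  obj X :=
    { V := ((ι K).obj X).obj ⟨d⟩
      ρ :=
        { toFun σ := ((ι K).obj X).map (FinBij.ofEquiv (X := ⟨d⟩) (Y := ⟨d⟩) σ)
          map_one' := ((ι K).obj X).map_id ⟨d⟩
          map_mul' σ τ := ((ι K).obj X).map_comp (FinBij.ofEquiv (X := ⟨d⟩) (Y := ⟨d⟩) τ)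
            (FinBij.ofEquiv (X := ⟨d⟩) (Y := ⟨d⟩) σ) } }
  map f := { hom := ((ι K).map f).app ⟨d⟩, comm := fun σ => ((ι K).map f).naturality _ }

instance (d : ℕ) : (ev K d).Additive where
instance (d : ℕ) : (ev K d).Linear K where

variable {K}

lemma hom_ext {X Y : Species K} {s t : X ⟶ Y} (h : ∀ d, (ev K d).map s = (ev K d).map t) : s = t :=
  (ιFF K).map_injective (NatTrans.ext (funext fun n => congrArg (fun r => r.hom) (h n.pts)))

/-- A morphism of species from its components. -/
def glue {X Y : Species K} (φ : ∀ d, (ev K d).obj X ⟶ (ev K d).obj Y) : X ⟶ Y :=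
  (ιFF K).preimage
    { app n := (φ n.pts).hom
      naturality := by
        rintro ⟨m⟩ ⟨n⟩ σ
        have e : m = n := FinBij.pts_eq σ
        subst e
        exact (φ m).comm σ }

@[simp] lemma ev_glue {X Y : Species K} (φ : ∀ d, (ev K d).obj X ⟶ (ev K d).obj Y) (d : ℕ) :
    (ev K d).map (glue φ) = φ d := rfl

/-- The map induced by a bijection on a family of representations. -/
def famMap (M : ∀ d, FDRep.{u} K (SymGp d)) {m n : ℕ} (e : m = n) (σ : Fin m ≃ Fin n) :
    (M m).V ⟶ (M n).V := by
  subst e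
  exact Action.ρ (M m) σ

/-- The species with given components. -/
def ofFam (M : ∀ d, FDRep.{u} K (SymGp d)) : Species K :=
  (show FinBij ⥤ FGModuleCat.{u} K from
    { obj n := (M n.pts).V
      map σ := famMap M (FinBij.pts_eq σ) σ
      map_id n := (Action.ρ (M n.pts)).map_one
      map_comp := by
        rintro ⟨l⟩ ⟨m⟩ ⟨n⟩ σ τ
        have e : l = m := FinBij.pts_eq σ
        have e' : m = n := FinBij.pts_eq τ
        subst e e'
        exact (Action.ρ (M l)).map_mul τ σ })

/-- The components of the species with given components. -/
def evFam (M : ∀ d, FDRep.{u} K (SymGp d)) (d : ℕ) : (ev K d).obj (ofFam M) ≅ M d :=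
  Action.mkIso (Iso.refl _) (fun σ => by rfl)

/-- The projection of a species to its component of degree `m`. -/
def degProj (m : ℕ) (X : Species K) : X ⟶ X :=
  glue fun d => if d = m then 𝟙 _ else 0

lemma ev_degProj (m : ℕ) (X : Species K) (d : ℕ) :
    (ev K d).map (degProj m X) = if d = m then 𝟙 _ else 0 := rfl

lemma act_degProj_self {m : ℕ} {X : Species K} {A : FinBij} (h : A.pts = m)
    (x : ((ι K).obj X).obj A) : TensorSetup.act (ι K) (degProj m X) A x = x := by
  change lin ((ev K A.pts).map (degProj m X)) x = x
  rw [ev_degProj, if_pos h]; rfl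

lemma act_degProj_ne {m : ℕ} {X : Species K} {A : FinBij} (h : A.pts ≠ m)
    (x : ((ι K).obj X).obj A) : TensorSetup.act (ι K) (degProj m X) A x = 0 := by
  change lin ((ev K A.pts).map (degProj m X)) x = 0
  rw [ev_degProj, if_neg h]; rfl

/-- A product of elements. -/
abbrev mul {X Y : Species K} {A B : FinBij} (x : ((ι K).obj X).obj A) (y : ((ι K).obj Y).obj B) :
    ((ι K).obj (X ⊗ Y)).obj (A ⊗ B) := (setup K).el x y

lemma mul_zero {X Y : Species K} {A B : FinBij} (x : ((ι K).obj X).obj A) :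
    mul x (0 : ((ι K).obj Y).obj B) = 0 := map_zero _

lemma zero_mul {X Y : Species K} {A B : FinBij} (y : ((ι K).obj Y).obj B) :
    mul (0 : ((ι K).obj X).obj A) y = 0 := LinearMap.map_zero₂ _ y

lemma act_tensorHom {X X' Y Y' : Species K} (s : X ⟶ X') (t : Y ⟶ Y') {A B : FinBij}
    (x : ((ι K).obj X).obj A) (y : ((ι K).obj Y).obj B) :
    TensorSetup.act (ι K) (s ⊗ₘ t) _ (mul x y) =
      mul (TensorSetup.act (ι K) s _ x) (TensorSetup.act (ι K) t _ y) := by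
  refine (TensorSetup.act_comp _ _ _ _).trans ?_
  refine (congrArg _ ((setup K).act_map_app s x y)).trans ?_
  exact (setup K).act_obj_map t _ y

lemma tensor_hom_ext {X Y Z : Species K} {s t : X ⊗ Y ⟶ Z}
    (h : ∀ A B (x : ((ι K).obj X).obj A) (y : ((ι K).obj Y).obj B),
      TensorSetup.act (ι K) s _ (mul x y) = TensorSetup.act (ι K) t _ (mul x y)) : s = t :=
  (setup K).hom_ext₂ h

lemma degProj_tensor (m n : ℕ) (X Y : Species K) :
    (degProj m X ⊗ₘ degProj n Y) ≫ degProj (m + n) (X ⊗ Y) = degProj m X ⊗ₘ degProj n Y :=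
  tensor_hom_ext fun A B x y => by
    rw [TensorSetup.act_comp, act_tensorHom]
    by_cases hA : A.pts = m
    · by_cases hB : B.pts = n
      · exact act_degProj_self (congrArg₂ (· + ·) hA hB) _
      · rw [act_degProj_ne hB, mul_zero, map_zero]
    · rw [act_degProj_ne hA, zero_mul, map_zero]

lemma sum_degProj {X : Species K} {S : Finset ℕ} (hS : ∀ d ∉ S, IsZero ((ev K d).obj X)) :
    ∑ m ∈ S, degProj m X = 𝟙 X := hom_ext fun d => by
  rw [Functor.map_sum, CategoryTheory.Functor.map_id]
  simp only [ev_degProj]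
  by_cases hd : d ∈ S
  · rw [Finset.sum_ite_eq, if_pos hd]
  · exact (hS d hd).eq_of_src _ _

/-- The product of species with finitely many nonzero components has finitely many nonzero
components. -/
lemma isZero_ev_tensor {X Y : Species K} {S S' : Finset ℕ}
    (hS : ∀ d ∉ S, IsZero ((ev K d).obj X)) (hS' : ∀ d ∉ S', IsZero ((ev K d).obj Y)) (d : ℕ)
    (hd : ∀ m ∈ S, ∀ n ∈ S', d ≠ m + n) : IsZero ((ev K d).obj (X ⊗ Y)) := by
  rw [IsZero.iff_id_eq_zero, ← CategoryTheory.Functor.map_id, ← id_tensorHom_id,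
    ← sum_degProj hS, ← sum_degProj hS', sum_tensor, Functor.map_sum]
  refine Finset.sum_eq_zero fun m hm => ?_
  rw [tensor_sum, Functor.map_sum]
  refine Finset.sum_eq_zero fun n hn => ?_
  rw [← degProj_tensor, Functor.map_comp, ev_degProj, if_neg (hd m hm n hn), comp_zero]

end Species

/-! ### Families of coherent functors as functors on species -/

section CohSum
variable {K : Type u} [Field K]

open Species

/-- The value at a species `Z` of a family `F_d` of functors: the product of the spaces
`F_d(Z_d)`. -/
abbrev SumVal (F : ∀ d : ℕ, Coh K (SymGp d)) (Z : Species K) : Type u :=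
  ∀ d, ((cohι K (SymGp d)).obj (F d)).obj ((ev K d).obj Z)

lemma subsingleton_of_isZero {G : Type} [Group G] {f : Coh K G} (h : IsZero f)
    (X : FDRep.{u} K G) : Subsingleton (((cohι K G).obj f).obj X) :=
  subsingleton_of_forall_eq 0 fun x => by
    have : ap ((cohι K G).map (𝟙 f)) X x = ap ((cohι K G).map (0 : f ⟶ f)) X x := by
      rw [h.eq_of_src (𝟙 f) 0]
    exact this

lemma isZero_of_subsingleton {G : Type} [Group G] {f : Coh K G}
    (h : ∀ X, Subsingleton (((cohι K G).obj f).obj X)) : IsZero f := by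
  rw [IsZero.iff_id_eq_zero]
  exact coh_ext fun X x => (h X).elim _ _

lemma finite_sumVal (F : CohSum K) (Z : Species K) : Module.Finite K (SumVal F.obj Z) := by
  have hF : {d | ¬ IsZero (F.obj d)}.Finite := F.property
  have := hF.fintype
  let r : SumVal F.obj Z →ₗ[K] ∀ d : {d | ¬ IsZero (F.obj d)},
      ((cohι K (SymGp d)).obj (F.obj d)).obj ((ev K d).obj Z) :=
    LinearMap.pi fun d => LinearMap.proj (R := K) (d : ℕ)
  refine Module.Finite.of_injective r fun x y h => funext fun d => ?_
  by_cases hd : IsZero (F.obj d)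
  · exact (subsingleton_of_isZero hd _).elim _ _
  · exact congrFun h ⟨d, hd⟩

/-- The functor on species defined by a family of functors. -/
def sumFun (F : CohSum K) : Species K ⥤ FGModuleCat.{u} K where
  obj Z :=
    haveI := finite_sumVal F Z
    FGModuleCat.of K (SumVal F.obj Z)
  map {Z Z'} φ :=
    haveI := finite_sumVal F Z
    haveI := finite_sumVal F Z'
    FGModuleCat.ofHom (LinearMap.pi fun d =>
      (mp ((cohι K (SymGp d)).obj (F.obj d)) ((ev K d).map φ)).comp (LinearMap.proj (R := K) d))
  map_id Z := FGModuleCat.hom_ext (LinearMap.ext fun x => funext fun d =>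
    (congrArg (fun t => mp ((cohι K (SymGp d)).obj (F.obj d)) t (x d))
      ((ev K d).map_id Z)).trans (mp_id _ _))
  map_comp φ ψ := FGModuleCat.hom_ext (LinearMap.ext fun x => funext fun d =>
    (congrArg (fun t => mp ((cohι K (SymGp d)).obj (F.obj d)) t (x d))
      ((ev K d).map_comp φ ψ)).trans (mp_comp _ _ _))

/-- The components of an element. -/
def pr {F : CohSum K} {Z : Species K} (d : ℕ) :
    (sumFun F).obj Z →ₗ[K] ((cohι K (SymGp d)).obj (F.obj d)).obj ((ev K d).obj Z) :=
  LinearMap.proj (R := K) (φ := fun d => ((cohι K (SymGp d)).obj (F.obj d)).obj ((ev K d).obj Z)) d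

/-- The element with given components. -/
def mkEl {F : CohSum K} {Z : Species K} (x : SumVal F.obj Z) : (sumFun F).obj Z := x

lemma pr_ext {F : CohSum K} {Z : Species K} {x y : (sumFun F).obj Z} (h : ∀ d, pr d x = pr d y) :
    x = y := funext h

lemma isLinear_coh {G : Type} [Group G] (f : Coh K G) : IsLinear K ((cohι K G).obj f) :=
  f.obj.property

lemma isLinear_sumFun (F : CohSum K) : IsLinear K (sumFun F) := by
  refine ⟨⟨fun {X Y φ ψ} => ?_⟩, ⟨fun {X Y} φ r => ?_⟩⟩
  · refine FGModuleCat.hom_ext (LinearMap.ext fun x => pr_ext fun d => ?_)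
    have := (isLinear_coh (F.obj d)).1
    change mp _ ((ev K d).map (φ + ψ)) (pr d x) =
      mp _ ((ev K d).map φ) (pr d x) + mp _ ((ev K d).map ψ) (pr d x)
    rw [Functor.map_add, mp_add]
  · refine FGModuleCat.hom_ext (LinearMap.ext fun x => pr_ext fun d => ?_)
    have := (isLinear_coh (F.obj d)).1
    have := (isLinear_coh (F.obj d)).2
    change mp _ ((ev K d).map (r • φ)) (pr d x) = r • mp _ ((ev K d).map φ) (pr d x)
    rw [Functor.map_smul, mp_smul]

variable (K) in
/-- Families of functors as functors on species. -/
def sumι : CohSum K ⥤ Species K ⥤ FGModuleCat.{u} K where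
  obj := sumFun
  map {F F'} t := mkNat (f := sumFun F) (g := sumFun F') (fun Z => LinearMap.pi fun d =>
      (ap ((cohι K (SymGp d)).map (t.hom d)) ((ev K d).obj Z)).comp (pr d))
    fun φ x => pr_ext fun d => ap_mp ((cohι K (SymGp d)).map (t.hom d)) ((ev K d).map φ) (pr d x)
  map_id _ := rfl
  map_comp _ _ := rfl

instance : (sumι K).Additive where
  map_add := rfl

/-- Coherent functors have presentations such that the zero functor is presented by the zero module.
Thereby a family of functors with finite support has a family of generators with finite support. -/
lemma exists_pres {G : Type} [Group G] (f : Coh K G) : ∃ (M N : FDRep.{u} K G) (a : M ⟶ N)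
    (e : ((cohι K G).obj f).obj M), IsPres ((cohι K G).obj f) a e ∧ (IsZero f → IsZero M) := by
  by_cases h : IsZero f
  · have : HasZeroObject (FDRep.{u} K G) := hasZeroObject_of_hasTerminal_object
    obtain ⟨Z, hZ⟩ := this
    refine ⟨Z, Z, 𝟙 Z, 0, ⟨fun X x => ⟨0, ?_⟩, fun X φ => ⟨fun _ => ⟨φ, hZ.eq_of_src _ _⟩,
      fun _ => map_zero _⟩⟩, fun _ => hZ⟩
    exact (subsingleton_of_isZero h X).elim _ _
  · obtain ⟨M, N, a, e, he⟩ := (isCoherent_iff K f.obj).1 f.property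
    exact ⟨M, N, a, e, he, fun h' => (h h').elim⟩

/-- Presentations of the members of a family define a presentation of the functor on species. -/
lemma exists_sumPres (F : CohSum K) : ∃ (M N : Species K) (a : M ⟶ N) (e : (sumFun F).obj M),
    IsPres (sumFun F) a e ∧
    (∀ d, IsPres ((cohι K (SymGp d)).obj (F.obj d)) ((ev K d).map a) (pr d e)) ∧
    ∀ d, IsZero (F.obj d) → IsZero ((ev K d).obj M) := by
  choose M N a e he hM using fun d => exists_pres (F.obj d)
  let a' : ofFam M ⟶ ofFam N := glue fun d => (evFam M d).hom ≫ a d ≫ (evFam N d).inv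
  let e' : (sumFun F).obj (ofFam M) := mkEl fun d =>
    mp ((cohι K (SymGp d)).obj (F.obj d)) (evFam M d).inv (e d)
  have h : ∀ d, IsPres ((cohι K (SymGp d)).obj (F.obj d)) ((ev K d).map a') (pr d e') := by
    intro d
    have e1 : (ev K d).map a' = (evFam M d).hom ≫ a d ≫ (evFam N d).inv := rfl
    have e2 : pr d e' = mp ((cohι K (SymGp d)).obj (F.obj d)) (evFam M d).inv (e d) := rfl
    rw [e1, e2]
    refine ⟨fun X x => ?_, fun X φ => ?_⟩
    · obtain ⟨φ, rfl⟩ := (he d).gen X x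
      exact ⟨(evFam M d).hom ≫ φ, by rw [← mp_comp, Iso.inv_hom_id_assoc]⟩
    · rw [← mp_comp, (he d).rel]
      constructor
      · rintro ⟨ψ, hψ⟩
        exact ⟨(evFam N d).hom ≫ ψ, by
          rw [Category.assoc, Category.assoc, Iso.inv_hom_id_assoc, hψ, Iso.hom_inv_id_assoc]⟩
      · rintro ⟨ψ, rfl⟩
        exact ⟨(evFam N d).inv ≫ ψ, by simp⟩
  refine ⟨ofFam M, ofFam N, a', e', ⟨fun X x => ?_, fun X φ => ⟨fun hφ => ?_, ?_⟩⟩, h,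
    fun d hd => (hM d hd).of_iso (evFam M d)⟩
  · choose φ hφ using fun d => (h d).gen _ (pr d x)
    exact ⟨glue φ, pr_ext hφ⟩
  · choose ψ hψ using fun d => ((h d).rel _ ((ev K d).map φ)).1 (congrArg (pr d) hφ)
    exact ⟨glue ψ, Species.hom_ext fun d => ((ev K d).map_comp a' (glue ψ)).trans (hψ d)⟩
  · rintro ⟨ψ, rfl⟩
    exact pr_ext fun d => ((h d).rel _ _).2 ⟨(ev K d).map ψ, ((ev K d).map_comp a' ψ).symm⟩

/-- A natural transformation of the functors on species is determined by the image of the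
generator, whose coordinates define the components. -/
lemma exists_sumι_map {F F' : CohSum K} (θ : sumFun F ⟶ sumFun F') :
    ∃ t : F ⟶ F', (sumι K).map t = θ := by
  obtain ⟨M, N, a, e, he, h, -⟩ := exists_sumPres F
  have hy : mp (sumFun F') a (ap θ M e) = 0 := by rw [← ap_mp, he.rel_self, map_zero]
  have ex : ∀ d, ∃ s : (cohι K (SymGp d)).obj (F.obj d) ⟶ (cohι K (SymGp d)).obj (F'.obj d),
      ap s _ (pr d e) = pr d (ap θ M e) := fun d => by
    have := (isLinear_coh (F.obj d)).1
    have := (isLinear_coh (F.obj d)).2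
    have := (isLinear_coh (F'.obj d)).1
    have := (isLinear_coh (F'.obj d)).2
    exact (h d).exists_desc (congrArg (pr d) hy)
  choose s hs using ex
  refine ⟨ObjectProperty.homMk fun d => mkCoh (s d), he.hom_ext (pr_ext fun d => ?_)⟩
  exact hs d

variable (K) in
/-- The morphisms between families of coherent functors are the natural transformations between
the corresponding functors on species. -/
def sumιFF : (sumι K).FullyFaithful where
  preimage θ := (exists_sumι_map θ).choose
  map_preimage θ := (exists_sumι_map θ).choose_spec
  preimage_map {F F'} t := by
    have e := (exists_sumι_map ((sumι K).map t)).choose_spec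
    generalize (exists_sumι_map ((sumι K).map t)).choose = t' at e
    obtain ⟨M, N, a, x, -, h, -⟩ := exists_sumPres F
    ext d : 2
    refine (cohιFF K (SymGp d)).map_injective ((h d).hom_ext ?_)
    exact congrArg (fun θ => pr d (ap θ M x)) e

/-- Universal bilinear maps of families of coherent functors exist. -/
lemma exists_sumTensor (F F' : CohSum K) : ∃ (T : CohSum K)
    (b : Bil (curriedTensor (Species K)) (sumFun F) (sumFun F') (sumFun T)),
    b.IsUniv (IsLinear K) := by
  obtain ⟨M, N, a, e, he, -, hz⟩ := exists_sumPres F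
  obtain ⟨M', N', a', e', he', -, hz'⟩ := exists_sumPres F'
  have hb : ∀ d, HasBinaryBiproducts (FDRep.{u} K (SymGp d)) := fun d =>
    Abelian.hasBinaryBiproducts
  let c : ∀ d, (ev K d).obj (M ⊗ M') ⟶ (ev K d).obj (N ⊗ M') ⊞ (ev K d).obj (M ⊗ N') := fun d =>
    biprod.lift ((ev K d).map (a ▷ M')) ((ev K d).map (M ◁ a'))
  have hF : {d | ¬ IsZero (F.obj d)}.Finite := F.property
  have hF' : {d | ¬ IsZero (F'.obj d)}.Finite := F'.property
  have hT : IsFinSupp K fun d => ⟨cokerLin K (c d), isCoherent_cokerLin K (c d)⟩ := by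
    refine ((hF.toFinset ×ˢ hF'.toFinset).image fun p => p.1 + p.2).finite_toSet.subset
      fun d hd => ?_
    by_contra hne
    refine hd (isZero_of_subsingleton fun X => subsingleton_of_forall_eq 0 fun x => ?_)
    have z : IsZero ((ev K d).obj (M ⊗ M')) := isZero_ev_tensor (S := hF.toFinset)
      (S' := hF'.toFinset)
      (fun d hd => hz d (by simpa using hd)) (fun d hd => hz' d (by simpa using hd)) d
      fun m hm n hn hmn => hne (Finset.mem_coe.2 (Finset.mem_image.2
        ⟨(m, n), Finset.mem_product.2 ⟨hm, hn⟩, hmn.symm⟩))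
    obtain ⟨φ, rfl⟩ := (isPres_cokerLin K (c d)).gen X x
    have := (cokerLin K (c d)).property.1
    rw [z.eq_of_src φ 0, mp_zero]
  let T : CohSum K := ⟨_, hT⟩
  let w : (sumFun T).obj (M ⊗ M') := mkEl fun d => cokerGen K (c d)
  have hw : ∀ d, IsPres ((cohι K (SymGp d)).obj (T.obj d)) (c d) (pr d w) := fun d =>
    isPres_cokerLin K (c d)
  have h : Bil.IsPres₂ (curriedTensor (Species K)) a a' (sumFun T) w := by
    refine ⟨fun X x => ?_, fun X φ => ⟨fun hφ => ?_, ?_⟩⟩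
    · choose φ hφ using fun d => (hw d).gen _ (pr d x)
      exact ⟨glue φ, pr_ext hφ⟩
    · choose ψ hψ using fun d => ((hw d).rel _ ((ev K d).map φ)).1 (congrArg (pr d) hφ)
      refine ⟨glue fun d => biprod.inl ≫ ψ d, glue fun d => biprod.inr ≫ ψ d,
        Species.hom_ext fun d => ?_⟩
      refine (hψ d).symm.trans ?_
      refine Eq.trans ?_ ((ev K d).map_add (f := a ▷ M' ≫ glue fun d => biprod.inl ≫ ψ d)
        (g := M ◁ a' ≫ glue fun d => biprod.inr ≫ ψ d)).symm
      rw [Functor.map_comp, Functor.map_comp, ev_glue, ev_glue, ← biprod.lift_desc]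
      congr 1
      apply biprod.hom_ext' <;> simp
    · rintro ⟨ψ, ψ', rfl⟩
      refine pr_ext fun d => ((hw d).rel _ _).2 ⟨biprod.desc ((ev K d).map ψ) ((ev K d).map ψ'), ?_⟩
      refine biprod.lift_desc.trans ?_
      rw [← Functor.map_comp, ← Functor.map_comp, ← Functor.map_add]
      rfl
  have : (curriedTensor (Species K)).Additive :=
    ⟨fun {X Y φ ψ} => NatTrans.ext (funext fun Z => MonoidalPreadditive.add_whiskerRight φ ψ)⟩
  have : ∀ X, ((curriedTensor (Species K)).obj X).Additive := fun X =>
    ⟨fun {Y Z φ ψ} => MonoidalPreadditive.whiskerLeft_add φ ψ⟩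
  have := (isLinear_sumFun F).1
  have := (isLinear_sumFun F).2
  have := (isLinear_sumFun F').1
  have := (isLinear_sumFun F').2
  have := (isLinear_sumFun T).1
  have := (isLinear_sumFun T).2
  obtain ⟨b, hb⟩ := h.exists_bil (P := curriedTensor (Species K)) he he' (fun X Y ψ Z r => MonoidalLinear.whiskerLeft_smul Z r ψ)
    (fun X Y φ Z r => MonoidalLinear.smul_whiskerRight r φ Z)
  rw [← hb] at h
  exact ⟨T, b, h.isUniv he he' b⟩

variable (K)

lemma exists_sumTensorFunctor : ∃ T : CohSum K ⥤ CohSum K ⥤ CohSum K,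
    Nonempty (IsTensor (curriedTensor (Species K)) (IsLinear K) (sumι K) (sumι K) (sumι K) T) :=
  exists_isTensor _ _ (sumιFF K) isLinear_sumFun exists_sumTensor

/-- The unit: the functors represented by the components of the unit species. -/
def sumUnit : CohSum K where
  obj d := (hFun K (SymGp d)).obj (.op ((ev K d).obj (𝟙_ (Species K))))
  property := by
    refine (Set.finite_singleton 0).subset fun d hd => ?_
    by_contra hne
    refine hd (isZero_of_subsingleton fun X => ⟨fun x y => ?_⟩)
    refine rep_ext (X := (ev K d).obj (𝟙_ (Species K))) (Y := X) (φ := x) (ψ := y) fun v => ?_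
    have : IsEmpty (𝟙_ FinBij ⟶ (⟨d⟩ : FinBij)) := ⟨fun f => hne (FinBij.pts_eq f).symm⟩
    have : Subsingleton ((𝟙_ FinBij ⟶ (⟨d⟩ : FinBij)) →₀ K) := inferInstance
    have hv : v = 0 := this.elim _ _
    rw [hv, map_zero, map_zero]

/-- The universal element of the unit. -/
def sumUnitEl : (sumFun (sumUnit K)).obj (𝟙_ (Species K)) := mkEl fun d => 𝟙 ((ev K d).obj _)

lemma isPres_sumUnit :
    IsPres (sumFun (sumUnit K)) (0 : 𝟙_ (Species K) ⟶ 𝟙_ (Species K)) (sumUnitEl K) where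
  gen X x := ⟨glue fun d => pr d x, pr_ext fun d => Category.id_comp (X := (ev K d).obj (𝟙_ (Species K)))
    (Y := (ev K d).obj X) (pr d x)⟩
  rel X φ := by
    constructor
    · intro h
      refine ⟨0, Species.hom_ext fun d => ?_⟩
      rw [comp_zero, Functor.map_zero]
      exact (Category.id_comp (X := (ev K d).obj (𝟙_ (Species K))) (Y := (ev K d).obj X)
        ((ev K d).map φ)).symm.trans (congrArg (pr d) h) |>.symm
    · rintro ⟨ψ, rfl⟩
      have := (isLinear_sumFun (sumUnit K)).1
      rw [zero_comp, mp_zero]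

/-- The tensor product of families of coherent functors, by its universal property. -/
def sumSetup : TensorSetup (IsLinear K) (sumι K) (exists_sumTensorFunctor K).choose where
  ff := sumιFF K
  prop := isLinear_sumFun
  prop_left X k hk := by
    have := hk.1
    have := hk.2
    exact ⟨inferInstance, inferInstance⟩
  prop_right X k hk := by
    have := hk.1
    have := hk.2
    exact ⟨inferInstance, inferInstance⟩
  tens := (exists_sumTensorFunctor K).choose_spec.some
  U := sumUnit K
  e := sumUnitEl K
  unit k hk z := by
    have := (isLinear_sumFun (sumUnit K)).1
    have := (isLinear_sumFun (sumUnit K)).2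
    have := hk.1
    have := hk.2
    obtain ⟨s, hs⟩ := (isPres_sumUnit K).exists_desc (y := z) (mp_zero z)
    exact ⟨s, hs, fun s' hs' => (isPres_sumUnit K).hom_ext (hs'.trans hs.symm)⟩

end CohSum
end
end CoherentFunctors

namespace CoherentFunctors

noncomputable section

/-! ### The tensor product on the summands -/

open MonoidalCategory

section Congr
variable {K : Type u} [Field K] {A B C : Type*} [Category A] [Category B] [Category C]
  {D₁ D₂ D₃ : Type*} [Category D₁] [Category D₂] [Category D₃]
  {ι₁ ι₁' : D₁ ⥤ A ⥤ FGModuleCat.{u} K} {ι₂ ι₂' : D₂ ⥤ B ⥤ FGModuleCat.{u} K}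
  {ι₃ ι₃' : D₃ ⥤ C ⥤ FGModuleCat.{u} K} {P : A ⥤ B ⥤ C}
  {Q : ObjectProperty (C ⥤ FGModuleCat.{u} K)} {T : D₁ ⥤ D₂ ⥤ D₃}

lemma Bil.IsUniv.comp_iso {f f' : A ⥤ FGModuleCat.{u} K} {g g' : B ⥤ FGModuleCat.{u} K}
    {t t' : C ⥤ FGModuleCat.{u} K} {b : Bil P f g t} (hb : b.IsUniv Q) (r : f' ≅ f) (s : g' ≅ g)
    (w : t ≅ t') : (b.comp r.hom s.hom w.hom).IsUniv Q := by
  intro k hk β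
  obtain ⟨p, hp, hp'⟩ := hb k hk (β.comp r.inv s.inv (𝟙 k))
  refine ⟨w.inv ≫ p, fun X Y x y => ?_, fun q hq => ?_⟩
  · rw [ap_comp, Bil.comp_fn, ap_hom_inv, hp, Bil.comp_fn, ap_hom_inv, ap_hom_inv, ap_id]
  · rw [Iso.eq_inv_comp]
    refine hp' _ fun X Y x y => ?_
    have := hq X Y (ap r.inv X x) (ap s.inv Y y)
    rw [Bil.comp_fn, ap_inv_hom, ap_inv_hom] at this
    exact this

/-- Bifunctors given by universal bilinear maps, for isomorphic ways to regard the objects as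
functors. -/
def IsTensor.congr (h : IsTensor P Q ι₁ ι₂ ι₃ T) (r : ι₁' ≅ ι₁) (s : ι₂' ≅ ι₂) (w : ι₃ ≅ ι₃') :
    IsTensor P Q ι₁' ι₂' ι₃' T where
  bil d₁ d₂ := (h.bil d₁ d₂).comp (r.hom.app d₁) (s.hom.app d₂) (w.hom.app _)
  univ d₁ d₂ := (h.univ d₁ d₂).comp_iso (r.app d₁) (s.app d₂) (w.app _)
  nat_left {d₁ d₁'} p d₂ X Y x y := by
    rw [Bil.comp_fn, Bil.comp_fn, ← ap_comp, ← w.hom.naturality, ap_comp, h.nat_left, ← ap_comp,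
      ← r.hom.naturality, ap_comp]
  nat_right d₁ {d₂ d₂'} p X Y x y := by
    rw [Bil.comp_fn, Bil.comp_fn, ← ap_comp, ← w.hom.naturality, ap_comp, h.nat_right, ← ap_comp,
      ← s.hom.naturality, ap_comp]

end Congr

namespace Species
variable {K : Type u} [Field K]

/-- A species is concentrated in degree `m` if its other components are zero. -/
def IsConc (m : ℕ) (X : Species K) : Prop := ∀ d, d ≠ m → IsZero ((ev K d).obj X)

lemma IsConc.eq_zero {m : ℕ} {X : Species K} (hX : IsConc m X) {A : FinBij} (hA : A.pts ≠ m)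
    (x : ((ι K).obj X).obj A) : x = 0 := by
  have : lin (𝟙 ((ev K A.pts).obj X)) x = lin (0 : (ev K A.pts).obj X ⟶ (ev K A.pts).obj X) x := by
    rw [(hX _ hA).eq_of_src (𝟙 _) 0]
  exact this

lemma exists_isConc {m : ℕ} (M : FDRep.{u} K (SymGp m)) :
    ∃ X : Species K, IsConc m X ∧ Nonempty ((ev K m).obj X ≅ M) := by
  have (d : ℕ) : HasZeroObject (FDRep.{u} K (SymGp d)) := hasZeroObject_of_hasTerminal_object
  choose Z hZ using fun d => (this d).zero
  refine ⟨ofFam (Function.update Z m M), fun d hd => ?_, ⟨evFam _ m ≪≫ eqToIso (by simp)⟩⟩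
  refine IsZero.of_iso ?_ (evFam _ d)
  rw [Function.update_of_ne hd]
  exact hZ d

lemma exists_map_eq {m : ℕ} {X Y : Species K} (φ : (ev K m).obj X ⟶ (ev K m).obj Y) :
    ∃ s : X ⟶ Y, (ev K m).map s = φ :=
  ⟨glue (Function.update (fun _ => 0) m φ), by rw [ev_glue, Function.update_self]⟩

lemma IsConc.hom_ext {m : ℕ} {X Y : Species K} (hX : IsConc m X) {s t : X ⟶ Y}
    (h : (ev K m).map s = (ev K m).map t) : s = t := Species.hom_ext fun d => by
  by_cases hd : d = m
  · subst hd; exact h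
  · exact (hX d hd).eq_of_src _ _

lemma mul_mp {X Y : Species K} {A A' B B' : FinBij} (φ : A ⟶ A') (ψ : B ⟶ B')
    (x : ((ι K).obj X).obj A) (y : ((ι K).obj Y).obj B) :
    mul (mp ((ι K).obj X) φ x) (mp ((ι K).obj Y) ψ y) =
      mp ((ι K).obj (X ⊗ Y)) (φ ⊗ₘ ψ) (mul x y) := by
  rw [mul, TensorSetup.el_mp_left, TensorSetup.el_mp_right, MonoidalCategory.tensorHom_def',
    mp_comp]
  rfl

variable (m n : ℕ)

/-- The map `X_m ⊠ Y_n → Res (X · Y)_{m+n}`. -/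
def boxMul (X Y : Species K) :
    box K ((ev K m).obj X) ((ev K n).obj Y) ⟶ (resRep K (young m n)).obj ((ev K (m + n)).obj (X ⊗ Y)) :=
  boxDesc (M := (ev K m).obj X) (N := (ev K n).obj Y)
    (((setup K).tens.bil X Y).fn (⟨m⟩ : FinBij) (⟨n⟩ : FinBij)) fun g h x y => 
      mul_mp (FinBij.ofEquiv (X := ⟨m⟩) (Y := ⟨m⟩) g) (FinBij.ofEquiv (X := ⟨n⟩) (Y := ⟨n⟩) h) x y

lemma boxMul_mk {X Y : Species K} (x : ((ev K m).obj X).V) (y : ((ev K n).obj Y).V) :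
    lin (boxMul m n X Y) (boxMk _ _ x y) =
      mul (A := (⟨m⟩ : FinBij)) (B := (⟨n⟩ : FinBij)) (X := X) (Y := Y) x y :=
  boxDesc_mk _ _ x y

lemma boxMul_whiskerRight {X X' : Species K} (s : X ⟶ X') (Y : Species K) :
    boxMul m n X Y ≫ (resRep K (young m n)).map ((ev K (m + n)).map (s ▷ Y)) =
      ((boxRep K _ _).map ((ev K m).map s)).app ((ev K n).obj Y) ≫ boxMul m n X' Y :=
  box_ext fun x y => by
    rw [lin_comp, lin_comp, lin_boxRep_map, boxMul_mk, boxMul_mk]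
    exact (setup K).act_map_app (X := (⟨m⟩ : FinBij)) (Y := (⟨n⟩ : FinBij)) s x y

lemma boxMul_whiskerLeft (X : Species K) {Y Y' : Species K} (s : Y ⟶ Y') :
    boxMul m n X Y ≫ (resRep K (young m n)).map ((ev K (m + n)).map (X ◁ s)) =
      ((boxRep K _ _).obj ((ev K m).obj X)).map ((ev K n).map s) ≫ boxMul m n X Y' :=
  box_ext fun x y => by
    rw [lin_comp, lin_comp, lin_boxRep_obj_map, boxMul_mk, boxMul_mk]
    exact (setup K).act_obj_map (X := (⟨m⟩ : FinBij)) (Y := (⟨n⟩ : FinBij)) s x y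

variable {m n}

lemma boxMul_hom_ext {X Y Z : Species K} (hX : IsConc m X) (hY : IsConc n Y) {s t : X ⊗ Y ⟶ Z}
    (h : boxMul m n X Y ≫ (resRep K (young m n)).map ((ev K (m + n)).map s) =
      boxMul m n X Y ≫ (resRep K (young m n)).map ((ev K (m + n)).map t)) : s = t := by
  refine tensor_hom_ext fun A B x y => ?_
  by_cases hA : A.pts = m
  · by_cases hB : B.pts = n
    · obtain ⟨A⟩ := A
      obtain ⟨B⟩ := B
      subst hA hB
      have := congrArg (fun r => lin r (boxMk ((ev K _).obj X) ((ev K _).obj Y) x y)) h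
      simp only [lin_comp] at this
      exact this
    · rw [hY.eq_zero hB y, mul_zero, map_zero, map_zero]
  · rw [hX.eq_zero hA x, zero_mul, map_zero, map_zero]

/-- For species concentrated in degrees `m` and `n`, the morphisms `X · Y → Z` are the morphisms
`X_m ⊠ Y_n → Res Z_{m+n}`. -/
lemma exists_boxMul_comp {X Y Z : Species K} (hX : IsConc m X) (hY : IsConc n Y)
    (ψ : box K ((ev K m).obj X) ((ev K n).obj Y) ⟶
      (resRep K (young m n)).obj ((ev K (m + n)).obj Z)) :
    ∃ s : X ⊗ Y ⟶ Z, boxMul m n X Y ≫ (resRep K (young m n)).map ((ev K (m + n)).map s) = ψ := by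
  let b : ((ι K).obj X).obj ⟨m⟩ →ₗ[K] ((ι K).obj Y).obj ⟨n⟩ →ₗ[K]
      ((ι K).obj Z).obj ((⟨m⟩ : FinBij) ⊗ (⟨n⟩ : FinBij)) :=
    (boxMk ((ev K m).obj X) ((ev K n).obj Y)).compr₂ (lin ψ)
  have hb : ∀ (g : (⟨m⟩ : FinBij) ⟶ ⟨m⟩) (h : (⟨n⟩ : FinBij) ⟶ ⟨n⟩) x y,
      b (mp _ g x) (mp _ h y) = mp ((ι K).obj Z) (g ⊗ₘ h) (b x y) := fun g h x y =>
    lin_ρ (G := SymGp m × SymGp n) ψ (g, h)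
      (boxMk ((ev K m).obj X) ((ev K n).obj Y) x y)
  have ex : ∀ A B : FinBij, ∃ c : ((ι K).obj X).obj A →ₗ[K] ((ι K).obj Y).obj B →ₗ[K]
      ((ι K).obj Z).obj (A ⊗ B), ∀ (σ : (⟨m⟩ : FinBij) ⟶ A) (τ : (⟨n⟩ : FinBij) ⟶ B) x y,
        c (mp _ σ x) (mp _ τ y) = mp ((ι K).obj Z) (σ ⊗ₘ τ) (b x y) := by
    rintro ⟨A⟩ ⟨B⟩
    by_cases hA : A = m
    · by_cases hB : B = n
      · subst hA hB
        exact ⟨b, hb⟩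
      · exact ⟨0, fun σ τ => (hB (FinBij.pts_eq τ).symm).elim⟩
    · exact ⟨0, fun σ τ => (hA (FinBij.pts_eq σ).symm).elim⟩
  choose c hc using ex
  have c1 : c ⟨m⟩ ⟨n⟩ = b := LinearMap.ext₂ fun x y => by
    have := hc ⟨m⟩ ⟨n⟩ (𝟙 _) (𝟙 _) x y
    rwa [mp_id, mp_id, id_tensorHom_id, mp_id] at this
  have surj : ∀ {d : ℕ} {W : Species K}, IsConc d W → ∀ {A : FinBij} (x : ((ι K).obj W).obj A),
      x = 0 ∨ ∃ (σ : (⟨d⟩ : FinBij) ⟶ A) (x' : ((ι K).obj W).obj ⟨d⟩), x = mp _ σ x' := by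
    intro d W hW A x
    by_cases hA : A.pts = d
    · obtain ⟨A⟩ := A
      subst hA
      exact Or.inr ⟨𝟙 _, x, (mp_id _ _).symm⟩
    · exact Or.inl (hW.eq_zero hA x)
  obtain ⟨s, hs⟩ := (setup K).exists_desc (a := X) (b := Y) (k := (ι K).obj Z) trivial
    (TensorSetup.mkBil c
      (fun {A A'} φ B x y => by
        obtain rfl | ⟨σ, x, rfl⟩ := surj hX x
        · simp
        obtain rfl | ⟨τ, y, rfl⟩ := surj hY y
        · simp
        rw [← mp_comp, hc, hc, ← mp_comp, tensorHom_comp_whiskerRight])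
      (fun A {B B'} φ x y => by
        obtain rfl | ⟨σ, x, rfl⟩ := surj hX x
        · simp
        obtain rfl | ⟨τ, y, rfl⟩ := surj hY y
        · simp
        rw [← mp_comp, hc, hc, ← mp_comp, tensorHom_comp_whiskerLeft]))
  obtain ⟨s', hs'⟩ := (setup K).exists_act (a := X ⊗ Y) (k := Z) s
  refine ⟨s', box_ext fun x y => ?_⟩
  rw [lin_comp, boxMul_mk]
  refine (hs' _ _).trans ((hs _ _ _ _).trans ?_)
  exact LinearMap.congr_fun₂ c1 x y

end Species

section Summands
variable (K : Type u) [Field K]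

open Species

/-- Coherent functors on representations of `S_m`, as functors on species: `f` is regarded as
`Z ↦ f(Z_m)`. -/
def evι (m : ℕ) : Coh K (SymGp m) ⥤ Species K ⥤ FGModuleCat.{u} K :=
  cohι K (SymGp m) ⋙ (Functor.whiskeringLeft _ _ _).obj (ev K m)

variable {K}

lemma isLinear_evι {m : ℕ} (f : Coh K (SymGp m)) : IsLinear K ((evι K m).obj f) := by
  have := (isLinear_coh f).1
  have := (isLinear_coh f).2
  exact ⟨inferInstanceAs (ev K m ⋙ (cohι K (SymGp m)).obj f).Additive,
    inferInstanceAs ((ev K m ⋙ (cohι K (SymGp m)).obj f).Linear K)⟩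

lemma exists_evPres {m : ℕ} (f : Coh K (SymGp m)) : ∃ (X Y : Species K) (a : X ⟶ Y)
    (e : ((cohι K (SymGp m)).obj f).obj ((ev K m).obj X)), IsConc m X ∧ IsConc m Y ∧
      IsPres ((cohι K (SymGp m)).obj f) ((ev K m).map a) e ∧ IsPres ((evι K m).obj f) a e := by
  obtain ⟨M, N, a, e, he, -⟩ := exists_pres f
  obtain ⟨X, hX, ⟨i⟩⟩ := exists_isConc M
  obtain ⟨Y, hY, ⟨j⟩⟩ := exists_isConc N
  obtain ⟨a', ha'⟩ := exists_map_eq (i.hom ≫ a ≫ j.inv)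
  have h : IsPres ((cohι K (SymGp m)).obj f) ((ev K m).map a')
      (mp ((cohι K (SymGp m)).obj f) i.inv e) := by
    rw [ha']
    refine ⟨fun Z z => ?_, fun Z φ => ?_⟩
    · obtain ⟨φ, rfl⟩ := he.gen Z z
      exact ⟨i.hom ≫ φ, by rw [← mp_comp, Iso.inv_hom_id_assoc]⟩
    · rw [← mp_comp]
      refine (he.rel _ _).trans ⟨?_, ?_⟩
      · rintro ⟨ψ, hψ⟩
        exact ⟨j.hom ≫ ψ, by
          rw [Category.assoc, Category.assoc, Iso.inv_hom_id_assoc, hψ, Iso.hom_inv_id_assoc]⟩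
      · rintro ⟨ψ, rfl⟩
        exact ⟨j.inv ≫ ψ, by simp⟩
  refine ⟨X, Y, a', _, hX, hY, h, ⟨fun Z z => ?_, fun Z φ => ?_⟩⟩
  · obtain ⟨φ, hφ⟩ := h.gen _ z
    obtain ⟨s, rfl⟩ := exists_map_eq φ
    exact ⟨s, hφ⟩
  · refine (h.rel _ ((ev K m).map φ)).trans ⟨?_, ?_⟩
    · rintro ⟨ψ, hψ⟩
      obtain ⟨s, rfl⟩ := exists_map_eq ψ
      exact ⟨s, hX.hom_ext (((ev K m).map_comp _ _).trans hψ)⟩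
    · rintro ⟨ψ, rfl⟩
      exact ⟨(ev K m).map ψ, ((ev K m).map_comp _ _).symm⟩

variable (m n : ℕ)

/-- The bilinear map `f(X_m) × g(Y_n) → (f ⊠ g)(X_m ⊠ Y_n) → (f ⊗ g)((X · Y)_{m+n})`. -/
def spBil (f : Coh K (SymGp m)) (g : Coh K (SymGp n)) :
    Bil (curriedTensor (Species K)) ((evι K m).obj f) ((evι K n).obj g)
      ((evι K (m + n)).obj (((tensorL K m n).obj f).obj g)) where
  fn X Y := (((leftTensorIsTensor K (SymGp m) (SymGp n)).bil f g).fn ((ev K m).obj X)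
    ((ev K n).obj Y)).compr₂
      (mp ((cohι K _).obj (((leftTensor K (SymGp m) (SymGp n)).obj f).obj g)) (boxMul m n X Y))
  nat_left {X X'} φ Y x y := by
    let t := (cohι K _).obj (((leftTensor K (SymGp m) (SymGp n)).obj f).obj g)
    let b := (leftTensorIsTensor K (SymGp m) (SymGp n)).bil f g
    let z := b.fn ((ev K m).obj X) ((ev K n).obj Y) x y
    exact (congrArg (mp t (boxMul m n X' Y)) (b.nat_left ((ev K m).map φ) _ x y)).trans
      ((mp_comp (f := t) _ _ z).symm.trans ((congrArg (fun r => mp t r z)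
        (boxMul_whiskerRight m n φ Y).symm).trans (mp_comp (f := t) _ _ z)))
  nat_right X {Y Y'} φ x y := by
    let t := (cohι K _).obj (((leftTensor K (SymGp m) (SymGp n)).obj f).obj g)
    let b := (leftTensorIsTensor K (SymGp m) (SymGp n)).bil f g
    let z := b.fn ((ev K m).obj X) ((ev K n).obj Y) x y
    exact (congrArg (mp t (boxMul m n X Y')) (b.nat_right _ ((ev K n).map φ) x y)).trans
      ((mp_comp (f := t) _ _ z).symm.trans ((congrArg (fun r => mp t r z)
        (boxMul_whiskerLeft m n X φ).symm).trans (mp_comp (f := t) _ _ z)))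

/-- If `X` and `Y` are concentrated species whose components carry generators of `f` and `g`, then
the correspondence between morphisms out of `X · Y` and out of `X_m ⊠ Y_n` turns the presentation of
`f ⊠_ℓ g` into one by species. -/
lemma spBil_isUniv (f : Coh K (SymGp m)) (g : Coh K (SymGp n)) :
    (spBil m n f g).IsUniv (IsLinear K) := by
  obtain ⟨X, X₁, a, e, hX, hX₁, h, he⟩ := exists_evPres f
  obtain ⟨Y, Y₁, a', e', hY, hY₁, h', he'⟩ := exists_evPres g
  let t := (cohι K _).obj (((leftTensor K (SymGp m) (SymGp n)).obj f).obj g)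
  have lt : IsLinear K t := isLinear_coh _
  have hp := ((leftTensorIsTensor K (SymGp m) (SymGp n)).univ f g).isPres₂ h h'
    (isLinear_coh f) (isLinear_coh g) lt
  let w := ((leftTensorIsTensor K (SymGp m) (SymGp n)).bil f g).fn _ _ e e'
  have key : ∀ {Z : Species K} (s : X ⊗ Y ⟶ Z),
      mp ((evι K (m + n)).obj (((tensorL K m n).obj f).obj g)) s ((spBil m n f g).fn X Y e e') =
        mp t (boxMul m n X Y ≫ (resRep K (young m n)).map ((ev K (m + n)).map s)) w := fun s =>
    (mp_comp (f := t) _ _ _).symm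
  have l := isLinear_evι (((tensorL K m n).obj f).obj g)
  have := l.1
  have := l.2
  refine Bil.IsPres₂.isUniv he he' _ ⟨fun Z z => ?_, fun Z s => ?_⟩
  · obtain ⟨φ, hφ⟩ := hp.gen _ z
    obtain ⟨s, hs⟩ := exists_boxMul_comp hX hY φ
    exact ⟨s, (key s).trans ((congrArg (fun r => mp t r w) hs).trans hφ)⟩
  · rw [key]
    refine (hp.rel _ _).trans ⟨?_, ?_⟩
    · rintro ⟨ψ, ψ', hψ⟩
      obtain ⟨r, hr⟩ := exists_boxMul_comp hX₁ hY ψ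
      obtain ⟨r', hr'⟩ := exists_boxMul_comp hX hY₁ ψ'
      refine ⟨r, r', boxMul_hom_ext hX hY (hψ.trans ?_)⟩
      rw [← hr, ← hr', ← Category.assoc, ← Category.assoc, ← boxMul_whiskerRight,
        ← boxMul_whiskerLeft]
      refine box_ext fun x y => ?_
      rfl
    · rintro ⟨r, r', rfl⟩
      refine ⟨boxMul m n X₁ Y ≫ (resRep K (young m n)).map ((ev K (m + n)).map r),
        boxMul m n X Y₁ ≫ (resRep K (young m n)).map ((ev K (m + n)).map r'), ?_⟩
      rw [← Category.assoc, ← Category.assoc, ← boxMul_whiskerRight, ← boxMul_whiskerLeft]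
      refine box_ext fun x y => ?_
      rfl

variable (K) in
/-- On the summands, the tensor product of species represents the bilinear maps that define
`f ⊗ g`. -/
def spIsTensor : IsTensor (curriedTensor (Species K)) (IsLinear K) (evι K m) (evι K n)
    (evι K (m + n)) (tensorL K m n) where
  bil := spBil m n
  univ := spBil_isUniv m n
  nat_left s g X Y x y :=
    (ap_mp ((cohι K _).map (((leftTensor K (SymGp m) (SymGp n)).map s).app g))
      (boxMul m n X Y) _).trans (congrArg _
        ((leftTensorIsTensor K (SymGp m) (SymGp n)).nat_left s g _ _ x y))
  nat_right f _ _ s X Y x y :=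
    (ap_mp ((cohι K _).map (((leftTensor K (SymGp m) (SymGp n)).obj f).map s))
      (boxMul m n X Y) _).trans (congrArg _
        ((leftTensorIsTensor K (SymGp m) (SymGp n)).nat_right f s _ _ x y))

variable (K) in
/-- The family of functors concentrated in degree `m`, as a functor on species. -/
lemma exists_singleIso : Nonempty (single K m ⋙ sumι K ≅ evι K m) := by
  let j : singleFamily K m m ≅ 𝟭 _ := eqToIso (dif_pos rfl)
  have hz : ∀ d, d ≠ m → ∀ f, IsZero ((singleFamily K m d).obj f) := fun d hd f => by
    have e : singleFamily K m d = _ := dif_neg (fun e => hd e.symm)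
    rw [e]
    exact isZero_zero _
  let τ : single K m ⋙ sumι K ⟶ evι K m :=
    { app f := mkNat (f := sumFun ((single K m).obj f)) (g := (evι K m).obj f)
        (fun Z => (ap ((cohι K (SymGp m)).map (j.hom.app f)) ((ev K m).obj Z)).comp (pr m))
        fun φ x => ap_mp ((cohι K (SymGp m)).map (j.hom.app f)) ((ev K m).map φ) (pr m x)
      naturality f g s := nat_ext fun Z x =>
        congrArg (fun t => ap ((cohι K (SymGp m)).map t) ((ev K m).obj Z)
          (pr (F := (single K m).obj f) m x)) (j.hom.naturality s) }
  have : ∀ f, IsIso (τ.app f) := fun f => isIso_of_bijective _ fun Z => by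
    have hb := ap_bijective ((cohι K (SymGp m)).map (j.hom.app f)) ((ev K m).obj Z)
    refine hb.comp ⟨fun x y h => pr_ext fun d => ?_, fun y => ?_⟩
    · by_cases hd : d = m
      · subst hd; exact h
      · exact (subsingleton_of_isZero (hz d hd f) _).elim _ _
    · let z : SumVal ((single K m).obj f).obj Z := Function.update (fun _ => 0) m y
      have hz : z m = y := Function.update_self ..
      exact ⟨mkEl (F := (single K m).obj f) z, hz⟩
  have : IsIso τ := NatIso.isIso_of_isIso_app _
  exact ⟨asIso τ⟩

/-- Families of coherent functors form a symmetric monoidal category, in which the tensor product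
is given on the summands by `⊗_ℓ`. -/
theorem isSymmetricMonoidal_tensorL : IsSymmetricMonoidal K (fun m n => tensorL K m n) := by
  let _ : MonoidalCategory (CohSum K) := (sumSetup K).monoidal
  let _ : SymmetricCategory (CohSum K) := (sumSetup K).symmetric
  refine ⟨inferInstance, inferInstance, (sumSetup K).monoidalPreadditive, fun m n => ?_⟩
  have h1 : IsTensor (curriedTensor (Species K)) (IsLinear K) (single K m ⋙ sumι K)
      (single K n ⋙ sumι K) (sumι K) (single K m ⋙ curriedTensor (CohSum K) ⋙
        (Functor.whiskeringLeft _ _ _).obj (single K n)) :=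
    (show IsTensor (curriedTensor (Species K)) (IsLinear K) (sumι K) (sumι K) (sumι K)
        (curriedTensor (CohSum K)) from
      { bil := (sumSetup K).tens.bil
        univ := (sumSetup K).tens.univ
        nat_left := (sumSetup K).tens.nat_left
        nat_right := (sumSetup K).tens.nat_right }).precomp _ _
  have h2 := (spIsTensor K m n).congr (exists_singleIso K m).some (exists_singleIso K n).some
    (exists_singleIso K (m + n)).some.symm
  have h3 : IsTensor (curriedTensor (Species K)) (IsLinear K) (single K m ⋙ sumι K)
      (single K n ⋙ sumι K) (sumι K) (tensorL K m n ⋙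
        (Functor.whiskeringRight _ _ _).obj (single K (m + n))) :=
    { bil := h2.bil
      univ := h2.univ
      nat_left := h2.nat_left
      nat_right := h2.nat_right }
  obtain ⟨σ, -⟩ := h1.exists_iso (sumιFF K) isLinear_sumFun h3
  exact ⟨σ⟩

end Summands
end
end CoherentFunctors

open CoherentFunctors

theorem mainTheorem2 (K : Type u) [Field K] (p : ℕ) [Fact p.Prime] [CharP K p] :
    -- the external products `⊠_ℓ` and the products `⊗_ℓ = Ind (- ⊠_ℓ -)`
    ∃ (E : ∀ m n : ℕ, Coh K (SymGp m) ⥤ Coh K (SymGp n) ⥤ Coh K (SymGp m × SymGp n))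
      (T : ∀ m n : ℕ, Coh K (SymGp m) ⥤ Coh K (SymGp n) ⥤ Coh K (SymGp (m + n))),
      (∀ m n, IsLeftExternalTensor K (E m n)) ∧
      (∀ m n, T m n = indTensor K (E m n)) ∧
      -- (i) `h_M ⊗_ℓ h_N ≅ h_{M ⊗ N} ≅ h_M · h_N`
      (∀ m n,
        Nonempty (hFun K (SymGp m) ⋙ T m n ⋙ (Functor.whiskeringLeft _ _ _).obj (hFun K (SymGp n)) ≅
          hTens K m n) ∧
        Nonempty (hTens K m n ⋙ (Functor.whiskeringRight _ _ _).obj (Coh.incl K (SymGp (m + n))) ≅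
          hFun K (SymGp m) ⋙ dot K m n ⋙ (Functor.whiskeringLeft _ _ _).obj (hFun K (SymGp n)))) ∧
      -- (ii) `f · g` is coherent, and the comparison `f ⊗_ℓ g ⟶ f · g`
      (∀ m n, (∀ f g, IsCoherent K (((dot K m n).obj f).obj g)) ∧
        ∃ τ : T m n ⋙ (Functor.whiskeringRight _ _ _).obj (Coh.incl K (SymGp (m + n))) ⟶ dot K m n,
          ∀ f g, Projective g → IsIso ((τ.app f).app g)) ∧
      -- (iii) the symmetric monoidal structure
      IsSymmetricMonoidal K T ∧
      -- (iv) right exact and balanced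
      (∀ m n, IsRightExact₂ (T m n) ∧ IsBalanced (T m n)) ∧
      -- (v) `j^*(f) ⊗ j^*(g) ≅ j^*(f ⊗_ℓ g) ≅ j^*(f · g)`
      (∀ m n,
        Nonempty (jCoh K m ⋙ Pol.tensor K m n ⋙ (Functor.whiskeringLeft _ _ _).obj (jCoh K n) ≅
          T m n ⋙ (Functor.whiskeringRight _ _ _).obj (jCoh K (m + n))) ∧
        Nonempty (T m n ⋙ (Functor.whiskeringRight _ _ _).obj (jCoh K (m + n)) ≅
          dot K m n ⋙ (Functor.whiskeringRight _ _ _).obj (jLin K (m + n)))) ∧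
      -- (vi) the left adjoint `j_!` of `j^*` takes coherent values, and
      -- `j_!(F) ⊗_ℓ j_!(G) ≅ j_!(F ⊗ G)`
      ∃ J : ∀ n : ℕ, Pol K n ⥤ Coh K (SymGp n),
        (∀ n, Nonempty ((J n ⋙ Coh.incl K (SymGp n)) ⊣ jLin K n)) ∧
        ∀ m n, Nonempty (J m ⋙ T m n ⋙ (Functor.whiskeringLeft _ _ _).obj (J n) ≅
          Pol.tensor K m n ⋙ (Functor.whiskeringRight _ _ _).obj (J (m + n))) := by
  refine ⟨fun m n => leftTensor K (SymGp m) (SymGp n), fun m n => tensorL K m n,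
    fun m n => leftTensor_isLeftExternalTensor K _ _, fun _ _ => rfl,
    fun m n => ⟨tensorL_h K m n, hTens_dot K m n⟩,
    fun m n => ⟨isCoherent_dot K m n, comparisonL K m n, fun f g _ => isIso_comparisonL K f g⟩,
    isSymmetricMonoidal_tensorL, fun m n => ⟨tensorL_isRightExact₂ K m n, tensorL_isBalanced K m n⟩,
    fun m n => ⟨jCoh_tensor K m n, jCoh_dot K m n⟩, leftJ K, fun n => ⟨leftJAdj K n⟩,
    fun m n => leftJ_tensor K m n⟩
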